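/- Let $\mu\in(0,1)$, $E=(\mu,0,0)$, $M=(-1+\mu,0,0)\in\mathbb R^3$, and let $$H(q,p)=\tfrac12|p|^2-\frac{\mu}{|q-M|}-\frac{1-\mu}{|q-E|}+p_1q_2-p_2q_1$$ be the Hamiltonian of the spatial circular restricted three-body problem on $(\mathbb R^3\setminus\{E,M\})\times\mathbb R^3$, with the symplectic form $\omega=dp\wedge dq$. Let $L_1$ be the critical point of $H$ whose position lies on the open segment between $M$ and $E$. For $c\in\mathbb R$ let $\Sigma_c=H^{-1}(c)$ and let $\mathcal K_c$ be the projection of $\Sigma_c$ to $\mathbb R^3\setminus\{E,M\}$. For $c<H(L_1)$ let $\Sigma_c^E$ and $\Sigma_c^M$ be the parts of $\Sigma_c$ over the connected component of $\mathcal K_c$ whose closure in $\mathbb R^3$ contains $E$, respectively $M$; for $c$ slightly above $H(L_1)$ let $\Sigma_c^{E,M}$ be the part of $\Sigma_c$ over the component of $\mathcal K_c$ whose closure contains both $E$ and $M$. For a primary $b\in\{E,M\}$, Moser's transformation is the substitution $x=-p$, $y=q-b$ followed by the cotangent lift $(x,y)\mapsto(\xi,\eta)\in T^*S^3\subset\mathbb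 R^4\times\mathbb R^4$ of inverse stereographic projection, $$\xi_0=\frac{|x|^2-1}{|x|^2+1},\quad \vec\xi=\frac{2x}{|x|^2+1},\quad \eta_0=\langle x,y\rangle,\quad \vec\eta=\frac{|x|^2+1}{2}\,y-\langle x,y\rangle x .$$ It is symplectic and identifies $(\mathbb R^3\setminus\{b\})\times\mathbb R^3$ with $T^*S^3$ minus the zero section and minus the fibre over the north pole $(1;0)$. Let $(W,\omega)$ be the 6-dimensional symplectic manifold obtained from $(\mathbb R^3\setminus\{E,M\})\times\mathbb R^3$ by adding, for each of the two primaries, the nonzero covectors over the north pole by means of these two identifications. The regularized hypersurfaces $\overline\Sigma{}_c^{E}$, $\overline\Sigma{}_c^{M}$, $\overline\Sigma{}_c^{E,M}$ are the closures of $\Sigma_c^{E}$, $\Sigma_c^{M}$, $\Sigma_c^{E,M}$ in $W$. A smooth hypersurface $S\subset W$ is of contact type if on a neighbourhood of $S$ there is a smooth vector field $X$ with $\mathcal L_X\omega=\omega$ that is transverse to $S$. Write $ST^*S^3$ for the unit cotangent bundle of $S^3$. Theorem. (1) For every $c<H(L_1)$, both $\overline\Sigma{}_c^E$ and $\overline\Sigma{}_c^M$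 are smooth hypersurfaces of contact type, and each of them is diffeomorphic to $ST^*S^3$. (2) There is $\varepsilon>0$ (depending on $\mu$) such that for every $c$ with $H(L_1)<c<H(L_1)+\varepsilon$ the regularized hypersurface $\overline\Sigma{}_c^{E,M}$ is a smooth hypersurface of contact type, and it is diffeomorphic to the connected sum $ST^*S^3\# ST^*S^3$. -/

import Mathlib

open Set Topology
open scoped Manifold ContDiff RealInnerProductSpace

noncomputable section

namespace CRTBP

/-! ### The Hamiltonian of the spatial circular restricted three-body problem -/

/-- Euclidean three-space. -/
abbrev E3 : Type := EuclideanSpace ℝ (Fin 3)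

/-- The two massive bodies. -/
inductive Primary : Type
  | earth
  | moon

/-- The other one of the two massive bodies. -/
def Primary.other : Primary → Primary
  | .earth => .moon
  | .moon => .earth

/-- Positions of the primaries in the rotating frame: `E = (μ, 0, 0)`, `M = (-1 + μ, 0, 0)`. -/
def pos (μ : ℝ) : Primary → E3
  | .earth => !₂[μ, 0, 0]
  | .moon => !₂[-1 + μ, 0, 0]

/-- `(ℝ³ ∖ {E, M}) × ℝ³`, with points `z = (q, p)`. -/
def phaseSpace (μ : ℝ) : Set (E3 × E3) := {z | ∀ b, z.1 ≠ pos μ b}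

/-- The Hamiltonian in the rotating frame, for `z = (q, p)`. -/
def hamiltonian (μ : ℝ) (z : E3 × E3) : ℝ :=
  1 / 2 * ‖z.2‖ ^ 2 - μ / ‖z.1 - pos μ .moon‖ - (1 - μ) / ‖z.1 - pos μ .earth‖
    + z.2 0 * z.1 1 - z.2 1 * z.1 0

/-- The first Lagrange point `L₁`: the critical point of the Hamiltonian whose position lies on the
axis between the two primaries. -/
def IsFirstLagrangePoint (μ : ℝ) (z : E3 × E3) : Prop :=
  z.1 ∈ openSegment ℝ (pos μ .moon) (pos μ .earth) ∧ fderiv ℝ (hamiltonian μ) z = 0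

/-- The level set `Σ_c`. -/
def energyLevel (μ c : ℝ) : Set (E3 × E3) := {z ∈ phaseSpace μ | hamiltonian μ z = c}

/-- Hill's region, the projection of `Σ_c` to configuration space. -/
def hillRegion (μ c : ℝ) : Set E3 := Prod.fst '' energyLevel μ c

/-- The connected component of Hill's region whose closure in `ℝ³` contains all the points of `B`
(`B` is `{E}`, `{M}` or `{E, M}`). -/
def hillComponent (μ c : ℝ) (B : Set E3) : Set E3 :=
  {q ∈ hillRegion μ c | B ⊆ closure (connectedComponentIn (hillRegion μ c) q)}

/-- The part of `Σ_c` over the component `hillComponent μ c B`. -/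
def levelComponent (μ c : ℝ) (B : Set E3) : Set (E3 × E3) :=
  {z ∈ energyLevel μ c | z.1 ∈ hillComponent μ c B}

/-! ### The cotangent bundle of the three-sphere and stereographic projection -/

/-- Euclidean four-space, with points written `ξ = (ξ₀; ξ')`, `ξ₀ ∈ ℝ`, `ξ' ∈ ℝ³`. -/
abbrev R4 : Type := WithLp 2 (ℝ × E3)

/-- `T*S³` as a subset of `ℝ⁴ × ℝ⁴`. -/
def cotangentSphere : Set (R4 × R4) := {z | ‖z.1‖ = 1 ∧ ⟪z.1, z.2⟫ = 0}

/-- The unit cotangent bundle `ST*S³`. -/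
def unitCotangentSphere : Set (R4 × R4) := {z ∈ cotangentSphere | ‖z.2‖ = 1}

/-- The cotangent lift `T*ℝ³ → T*S³`, `(x, y) ↦ (ξ, η)`, of the inverse of stereographic
projection from the north pole `(1; 0)`. Its image is `T*S³` without the fibre over the pole. -/
def stereoLift (w : E3 × E3) : R4 × R4 :=
  (WithLp.toLp 2 ((‖w.1‖ ^ 2 - 1) / (‖w.1‖ ^ 2 + 1), (2 / (‖w.1‖ ^ 2 + 1)) • w.1),
    WithLp.toLp 2 (⟪w.1, w.2⟫, ((‖w.1‖ ^ 2 + 1) / 2) • w.2 - ⟪w.1, w.2⟫ • w.1))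

/-- The canonical coordinates on `T*S³` around the north pole: the cotangent lift of stereographic
projection from the south pole `(-1; 0)`. -/
def southCoord (z : R4 × R4) : E3 × E3 :=
  ((1 + z.1.fst)⁻¹ • z.1.snd, (1 + z.1.fst) • z.2.snd - z.2.fst • z.1.snd)

/-! ### The regularized phase space

At each primary `b`, the transformation `x = -p`, `y = q - b`, followed by the lift of inverse
stereographic projection, identifies `(ℝ³ ∖ {b}) × ℝ³` with `T*S³` minus the zero section and minus
the fibre over the north pole. The regularized phase space is the result of gluing `phaseSpace μ`
along these two symplectic maps to two copies of `T*S³` (without the zero section, and without the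
points that correspond to `q` = the other primary). Thus it arises from the phase space by adding,
for each primary, the nonzero covectors `(0; η)` over the north pole. -/

/-- The points of the regularized phase space. -/
inductive RegPhase (μ : ℝ) : Type
  | phase (z : E3 × E3) (hz : z ∈ phaseSpace μ)
  | collision (b : Primary) (η : E3) (hη : η ≠ 0)

/-- Moser's transformation at the primary `b`, with values in `T*S³ ⊆ ℝ⁴ × ℝ⁴`; only meaningful
on `phaseSpace μ` and at the collisions with `b`. -/
def RegPhase.moser {μ : ℝ} (b : Primary) : RegPhase μ → R4 × R4
  | .phase z _ => stereoLift (-z.2, z.1 - pos μ b)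
  | .collision _ η _ => (WithLp.toLp 2 (1, 0), WithLp.toLp 2 (0, η))

/-- The coordinates `(q, p)`; only meaningful on `phaseSpace μ`. -/
def RegPhase.qp {μ : ℝ} : RegPhase μ → E3 × E3
  | .phase z _ => z
  | .collision _ _ _ => 0

/-- The chart domain around the collisions with `b`: the points that correspond to covectors on the
sphere over points other than the south pole (the points with `p = 0` lie over the south pole). -/
def collisionSource (μ : ℝ) (b : Primary) : Set (RegPhase μ) :=
  {x | (∃ z hz, x = .phase z hz ∧ z.2 ≠ 0) ∨ ∃ η hη, x = .collision b η hη}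

/-- The position `q` as a function of the coordinates `(u, v)` around the collisions with `b`. -/
def collisionPos (μ : ℝ) (b : Primary) (w : E3 × E3) : E3 :=
  pos μ b + (‖w.1‖ ^ 2 • w.2 - (2 * ⟪w.1, w.2⟫) • w.1)

/-- The image of `collisionSource μ b` in the coordinates around the collisions with `b`. -/
def collisionTarget (μ : ℝ) (b : Primary) : Set (E3 × E3) :=
  {w | w.2 ≠ 0 ∧ collisionPos μ b w ≠ pos μ b.other}

/-- The map back to `(q, p)` from the coordinates `(u, v)`, away from collisions. -/
def toQP (μ : ℝ) (b : Primary) (w : E3 × E3) : E3 × E3 :=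
  (collisionPos μ b w, -((‖w.1‖ ^ 2)⁻¹ • w.1))

/-- The coordinates `(u, v)` in terms of `(q, p)`, away from collisions. -/
def ofQP (μ : ℝ) (b : Primary) (z : E3 × E3) : E3 × E3 :=
  (-((‖z.2‖ ^ 2)⁻¹ • z.2),
    ‖z.2‖ ^ 2 • (z.1 - pos μ b) - (2 * ⟪z.2, z.1 - pos μ b⟫) • z.2)

theorem pos_ne (μ : ℝ) (b : Primary) : pos μ b ≠ pos μ b.other := by
  intro h
  have h0 := congrArg (fun v : E3 => v 0) h
  cases b <;> simp [pos, Primary.other] at h0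

theorem southCoord_phase (μ : ℝ) (b : Primary) (z : E3 × E3) (hz : z ∈ phaseSpace μ)
    (hp : z.2 ≠ 0) : southCoord (RegPhase.moser b (.phase z hz)) = ofQP μ b z := by
  have hn : ‖z.2‖ ≠ 0 := norm_ne_zero_iff.2 hp
  have h1 : ‖z.2‖ ^ 2 + 1 ≠ 0 := by positivity
  have h2 : 1 + (‖z.2‖ ^ 2 - 1) / (‖z.2‖ ^ 2 + 1) = 2 * ‖z.2‖ ^ 2 / (‖z.2‖ ^ 2 + 1) := by
    field_simp; ring
  simp only [southCoord, RegPhase.moser, stereoLift, ofQP, norm_neg, WithLp.toLp_fst,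
    WithLp.toLp_snd, h2, inner_neg_left, Prod.mk.injEq]
  constructor
  · rw [smul_neg, smul_neg, smul_smul]
    congr 2
    field_simp
  · match_scalars
    · field_simp
    · field_simp
    · field_simp
      ring

theorem southCoord_collision (μ : ℝ) (b b' : Primary) (η : E3) (hη : η ≠ 0) :
    southCoord (RegPhase.moser (μ := μ) b (.collision b' η hη)) = (0, (2 : ℝ) • η) := by
  simp [southCoord, RegPhase.moser]
  norm_num

theorem toQP_ofQP (μ : ℝ) (b : Primary) (z : E3 × E3) (hp : z.2 ≠ 0) :
    toQP μ b (ofQP μ b z) = z := by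
  have hn : ‖z.2‖ ≠ 0 := norm_ne_zero_iff.2 hp
  obtain ⟨q, p⟩ := z
  simp only [toQP, ofQP, collisionPos, norm_neg, norm_smul, norm_inv, norm_pow, norm_norm,
    inner_sub_right, inner_neg_left, inner_smul_left, inner_smul_right,
    real_inner_self_eq_norm_sq, Prod.mk.injEq, RCLike.conj_to_real] at hn ⊢
  constructor
  · match_scalars <;> field_simp <;> ring
  · match_scalars; field_simp

theorem ofQP_toQP (μ : ℝ) (b : Primary) (w : E3 × E3) (hp : w.1 ≠ 0) :
    ofQP μ b (toQP μ b w) = w := by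
  have hn : ‖w.1‖ ≠ 0 := norm_ne_zero_iff.2 hp
  obtain ⟨u, v⟩ := w
  simp only [toQP, ofQP, collisionPos, norm_neg, norm_smul, norm_inv, norm_pow, norm_norm,
    inner_sub_right, inner_neg_left, inner_smul_left, inner_smul_right, add_sub_cancel_left,
    real_inner_self_eq_norm_sq, Prod.mk.injEq, RCLike.conj_to_real] at hn ⊢
  constructor
  · match_scalars; field_simp
  · match_scalars
    · field_simp
    · field_simp
      ring

theorem collisionTarget_of_toQP {μ : ℝ} {b : Primary} {w : E3 × E3} (h0 : w.1 ≠ 0) :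
    w ∈ collisionTarget μ b ↔ toQP μ b w ∈ phaseSpace μ := by
  have key : w.2 ≠ 0 ↔ collisionPos μ b w ≠ pos μ b := by
    have h1 := ofQP_toQP μ b w h0
    have hn : ‖w.1‖ ≠ 0 := norm_ne_zero_iff.2 h0
    rw [not_iff_not]
    constructor
    · intro h
      simp [collisionPos, h]
    · intro h
      have h2 := congrArg Prod.snd h1
      rw [← h2]
      simp [ofQP, toQP, h]
  simp only [collisionTarget, phaseSpace, mem_ofPred_eq, key, toQP]
  constructor
  · rintro ⟨h1, h2⟩ b'
    cases b <;> cases b' <;> simp_all [Primary.other]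
  · intro h
    exact ⟨h _, h _⟩

theorem ofQP_mem {μ : ℝ} {b : Primary} {z : E3 × E3} (hz : z ∈ phaseSpace μ) (hp : z.2 ≠ 0) :
    (ofQP μ b z).1 ≠ 0 ∧ ofQP μ b z ∈ collisionTarget μ b := by
  have h0 : (ofQP μ b z).1 ≠ 0 := by simpa [ofQP] using hp
  refine ⟨h0, ?_⟩
  rw [collisionTarget_of_toQP h0, toQP_ofQP μ b z hp]
  exact hz

theorem toQP_snd_ne {μ : ℝ} {b : Primary} {w : E3 × E3} (h0 : w.1 ≠ 0) : (toQP μ b w).2 ≠ 0 := by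
  simpa [toQP] using h0

theorem bijOn_collision (μ : ℝ) (b : Primary) :
    BijOn (fun x : RegPhase μ => southCoord (x.moser b)) (collisionSource μ b)
      (collisionTarget μ b) := by
  refine ⟨?_, ?_, ?_⟩
  · rintro x (⟨z, hz, rfl, hp⟩ | ⟨η, hη, rfl⟩)
    · simp only [southCoord_phase μ b z hz hp]
      exact (ofQP_mem hz hp).2
    · simp only [southCoord_collision]
      refine ⟨by simpa using hη, ?_⟩
      simpa [collisionPos] using pos_ne μ b
  · rintro x (⟨z, hz, rfl, hp⟩ | ⟨η, hη, rfl⟩) y (⟨z', hz', rfl, hp'⟩ | ⟨η', hη', rfl⟩) h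
    · simp only [southCoord_phase μ b z hz hp, southCoord_phase μ b z' hz' hp'] at h
      have := congrArg (toQP μ b) h
      rw [toQP_ofQP μ b z hp, toQP_ofQP μ b z' hp'] at this
      subst this
      rfl
    · simp only [southCoord_phase μ b z hz hp, southCoord_collision] at h
      exact absurd (congrArg Prod.fst h) (ofQP_mem hz hp).1
    · simp only [southCoord_phase μ b z' hz' hp', southCoord_collision] at h
      exact absurd (congrArg Prod.fst h).symm (ofQP_mem hz' hp').1
    · simp only [southCoord_collision] at h
      have : η = η' := smul_right_injective E3 (two_ne_zero (α := ℝ)) (congrArg Prod.snd h)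
      subst this
      rfl
  · intro w hw
    by_cases h0 : w.1 = 0
    · have hη : (2 : ℝ)⁻¹ • w.2 ≠ 0 := by simpa using hw.1
      refine ⟨.collision b ((2 : ℝ)⁻¹ • w.2) hη, Or.inr ⟨_, hη, rfl⟩, ?_⟩
      simp only [southCoord_collision]
      exact Prod.ext h0.symm (by simp)
    · have hz := (collisionTarget_of_toQP h0).1 hw
      refine ⟨.phase (toQP μ b w) hz, Or.inl ⟨_, hz, rfl, toQP_snd_ne h0⟩, ?_⟩
      simp only [southCoord_phase μ b _ hz (toQP_snd_ne h0)]
      exact ofQP_toQP μ b w h0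

theorem bijOn_phase (μ : ℝ) :
    BijOn (RegPhase.qp (μ := μ)) {x | ∃ z hz, x = .phase z hz} (phaseSpace μ) := by
  refine ⟨?_, ?_, ?_⟩
  · rintro x ⟨z, hz, rfl⟩
    exact hz
  · rintro x ⟨z, hz, rfl⟩ y ⟨z', hz', rfl⟩ h
    have : z = z' := h
    subst this
    rfl
  · intro z hz
    exact ⟨.phase z hz, ⟨z, hz, rfl⟩, rfl⟩

instance (μ : ℝ) : Nonempty (RegPhase μ) :=
  ⟨.collision .earth (!₂[1, 0, 0]) (fun h => by simpa using congrArg (fun v : E3 => v 0) h)⟩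

/-- The three charts of the regularized phase space: `none` stands for `(q, p)` on the phase space,
`some b` for canonical coordinates on `T*S³` around the collisions with `b`. -/
def regChart (μ : ℝ) : Option Primary → PartialEquiv (RegPhase μ) (E3 × E3)
  | none =>
    BijOn.toPartialEquiv RegPhase.qp {x | ∃ z hz, x = .phase z hz} (phaseSpace μ) (bijOn_phase μ)
  | some b =>
    BijOn.toPartialEquiv (fun x => southCoord (x.moser b)) (collisionSource μ b)
      (collisionTarget μ b) (bijOn_collision μ b)

/-- The index of the preferred chart at a point. -/
def RegPhase.chartIndex {μ : ℝ} : RegPhase μ → Option Primary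
  | .phase _ _ => none
  | .collision b _ _ => some b

theorem isOpen_phaseSpace (μ : ℝ) : IsOpen (phaseSpace μ) := by
  have : phaseSpace μ = {z | z.1 ≠ pos μ .earth} ∩ {z | z.1 ≠ pos μ .moon} := by
    ext z
    constructor
    · intro h
      exact ⟨h _, h _⟩
    · rintro ⟨h1, h2⟩ (_ | _)
      · exact h1
      · exact h2
  rw [this]
  exact (isOpen_ne_fun continuous_fst continuous_const).inter
    (isOpen_ne_fun continuous_fst continuous_const)

theorem contDiff_collisionPos (μ : ℝ) (b : Primary) : ContDiff ℝ ∞ (collisionPos μ b) := by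
  unfold collisionPos
  have h : ContDiff ℝ ∞ fun w : E3 × E3 => ‖w.1‖ ^ 2 := contDiff_fst.norm_sq ℝ
  have h' : ContDiff ℝ ∞ fun w : E3 × E3 => ⟪w.1, w.2⟫ := contDiff_fst.inner ℝ contDiff_snd
  exact contDiff_const.add ((h.smul contDiff_snd).sub ((contDiff_const.mul h').smul contDiff_fst))

theorem isOpen_collisionTarget (μ : ℝ) (b : Primary) : IsOpen (collisionTarget μ b) :=
  (isOpen_ne_fun continuous_snd continuous_const).inter
    (isOpen_ne_fun (contDiff_collisionPos μ b).continuous continuous_const)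

theorem contDiffOn_toQP (μ : ℝ) (b : Primary) :
    ContDiffOn ℝ ∞ (toQP μ b) {w | w.1 ≠ 0} := by
  unfold toQP
  have h : ContDiff ℝ ∞ fun w : E3 × E3 => ‖w.1‖ ^ 2 := contDiff_fst.norm_sq ℝ
  refine (contDiff_collisionPos μ b).contDiffOn.prodMk ?_
  refine ((h.contDiffOn.inv ?_).smul contDiff_fst.contDiffOn).neg
  intro w hw
  simpa using hw

theorem contDiffOn_ofQP (μ : ℝ) (b : Primary) :
    ContDiffOn ℝ ∞ (ofQP μ b) {z | z.2 ≠ 0} := by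
  unfold ofQP
  have h : ContDiff ℝ ∞ fun w : E3 × E3 => ‖w.2‖ ^ 2 := contDiff_snd.norm_sq ℝ
  have h1 : ContDiff ℝ ∞ fun w : E3 × E3 => w.1 - pos μ b := contDiff_fst.sub contDiff_const
  have h' : ContDiff ℝ ∞ fun w : E3 × E3 => ⟪w.2, w.1 - pos μ b⟫ := contDiff_snd.inner ℝ h1
  refine ContDiffOn.prodMk ?_
    ((h.smul h1).sub ((contDiff_const.mul h').smul contDiff_snd)).contDiffOn
  refine ((h.contDiffOn.inv ?_).smul contDiff_snd.contDiffOn).neg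
  intro w hw
  simpa using hw

theorem regChart_symm_none {μ : ℝ} {z : E3 × E3} (hz : z ∈ phaseSpace μ) :
    (regChart μ none).symm z = .phase z hz := by
  have h : (RegPhase.phase z hz) ∈ (regChart μ none).source := ⟨z, hz, rfl⟩
  exact (regChart μ none).left_inv h

theorem regChart_symm_some {μ : ℝ} {b : Primary} {w : E3 × E3} (h0 : w.1 ≠ 0)
    (hz : toQP μ b w ∈ phaseSpace μ) :
    (regChart μ (some b)).symm w = .phase (toQP μ b w) hz := by
  have h : (RegPhase.phase (toQP μ b w) hz) ∈ (regChart μ (some b)).source :=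
    Or.inl ⟨_, hz, rfl, toQP_snd_ne h0⟩
  have h1 := (regChart μ (some b)).left_inv h
  have h2 : regChart μ (some b) (.phase (toQP μ b w) hz) = w :=
    (southCoord_phase μ b _ hz (toQP_snd_ne h0)).trans (ofQP_toQP μ b w h0)
  rwa [h2] at h1

theorem regChart_symm_some_zero {μ : ℝ} {b : Primary} {w : E3 × E3} (h0 : w.1 = 0)
    (hw : w.2 ≠ 0) : ∃ η hη, (regChart μ (some b)).symm w = .collision b η hη := by
  have hη : (2 : ℝ)⁻¹ • w.2 ≠ 0 := by simpa using hw
  have h : (RegPhase.collision b _ hη) ∈ (regChart μ (some b)).source := Or.inr ⟨_, hη, rfl⟩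
  have h1 := (regChart μ (some b)).left_inv h
  have h2 : regChart μ (some b) (.collision b _ hη) = w :=
    (southCoord_collision μ b b _ hη).trans (Prod.ext h0.symm (by simp))
  rw [h2] at h1
  exact ⟨_, hη, h1⟩

theorem regChart_transition (μ : ℝ) (i j : Option Primary) :
    IsOpen ((regChart μ i).symm.trans (regChart μ j)).source ∧
      ContDiffOn ℝ ∞ ((regChart μ i).symm.trans (regChart μ j))
        ((regChart μ i).symm.trans (regChart μ j)).source := by
  have hopen : ∀ k, IsOpen (regChart μ k).target := by
    rintro (_ | b)
    · exact isOpen_phaseSpace μ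
    · exact isOpen_collisionTarget μ b
  have h0 : IsOpen {w : E3 × E3 | w.1 ≠ 0} := isOpen_ne_fun continuous_fst continuous_const
  have h0' : IsOpen {w : E3 × E3 | w.2 ≠ 0} := isOpen_ne_fun continuous_snd continuous_const
  by_cases hij : i = j
  · subst hij
    have hs : ((regChart μ i).symm.trans (regChart μ i)).source = (regChart μ i).target := by
      ext w
      simp only [PartialEquiv.trans_source, PartialEquiv.symm_source, mem_inter_iff, mem_preimage]
      exact ⟨fun h => h.1, fun h => ⟨h, (regChart μ i).map_target h⟩⟩
    rw [hs]
    exact ⟨hopen i, contDiffOn_id.congr fun w hw => (regChart μ i).right_inv hw⟩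
  rcases i with _ | b
  · rcases j with _ | b
    · exact absurd rfl hij
    have hs : ((regChart μ none).symm.trans (regChart μ (some b))).source =
        phaseSpace μ ∩ {z | z.2 ≠ 0} := by
      ext z
      simp only [PartialEquiv.trans_source, PartialEquiv.symm_source, mem_inter_iff, mem_preimage]
      refine and_congr_right fun (hz : z ∈ phaseSpace μ) => ?_
      rw [regChart_symm_none hz]
      constructor
      · rintro (⟨z', hz', h, hp⟩ | ⟨η, hη, h⟩)
        · cases h
          exact hp
        · cases h
      · intro hp
        exact Or.inl ⟨z, hz, rfl, hp⟩
    rw [hs]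
    refine ⟨(isOpen_phaseSpace μ).inter h0',
      ((contDiffOn_ofQP μ b).mono inter_subset_right).congr ?_⟩
    rintro z ⟨hz, hp⟩
    change regChart μ (some b) ((regChart μ none).symm z) = _
    rw [regChart_symm_none hz]
    exact southCoord_phase μ b z hz hp
  · have hs : ((regChart μ (some b)).symm.trans (regChart μ j)).source =
        collisionTarget μ b ∩ {w | w.1 ≠ 0} := by
      ext w
      simp only [PartialEquiv.trans_source, PartialEquiv.symm_source, mem_inter_iff, mem_preimage]
      refine and_congr_right fun (hw : w ∈ collisionTarget μ b) => ?_
      constructor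
      · intro h hw0
        obtain ⟨η, hη, he⟩ := regChart_symm_some_zero (μ := μ) (b := b) hw0 hw.1
        rw [he] at h
        rcases j with _ | b'
        · obtain ⟨z, hz, h⟩ := h
          cases h
        · rcases h with ⟨z, hz, h, -⟩ | ⟨η', hη', h⟩
          · cases h
          · cases h
            exact hij rfl
      · intro hw0
        have hz := (collisionTarget_of_toQP hw0).1 hw
        rw [regChart_symm_some hw0 hz]
        rcases j with _ | b'
        · exact ⟨_, hz, rfl⟩
        · exact Or.inl ⟨_, hz, rfl, toQP_snd_ne hw0⟩
    rw [hs]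
    refine ⟨(isOpen_collisionTarget μ b).inter h0, ?_⟩
    have hQ := (contDiffOn_toQP μ b).mono (inter_subset_right (s := collisionTarget μ b))
    rcases j with _ | b'
    · refine hQ.congr ?_
      rintro w ⟨hw, hw0⟩
      change regChart μ none ((regChart μ (some b)).symm w) = _
      rw [regChart_symm_some hw0 ((collisionTarget_of_toQP hw0).1 hw)]
      rfl
    · refine ((contDiffOn_ofQP μ b').comp hQ fun w hw => toQP_snd_ne hw.2).congr ?_
      rintro w ⟨hw, hw0⟩
      change regChart μ (some b') ((regChart μ (some b)).symm w) = _
      have hz := (collisionTarget_of_toQP hw0).1 hw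
      rw [regChart_symm_some hw0 hz]
      exact southCoord_phase μ b' _ hz (toQP_snd_ne hw0)

/-- The atlas of the regularized phase space. -/
def regCore (μ : ℝ) : ChartedSpaceCore (E3 × E3) (RegPhase μ) where
  atlas := range (regChart μ)
  chartAt x := regChart μ x.chartIndex
  mem_chart_source := by
    rintro (⟨z, hz⟩ | ⟨b, η, hη⟩)
    · exact ⟨z, hz, rfl⟩
    · exact Or.inr ⟨η, hη, rfl⟩
  chart_mem_atlas x := mem_range_self _
  open_source := by
    rintro _ _ ⟨i, rfl⟩ ⟨j, rfl⟩
    exact (regChart_transition μ i j).1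
  continuousOn_toFun := by
    rintro _ _ ⟨i, rfl⟩ ⟨j, rfl⟩
    exact (regChart_transition μ i j).2.continuousOn

instance (μ : ℝ) : TopologicalSpace (RegPhase μ) := (regCore μ).toTopologicalSpace

instance (μ : ℝ) : ChartedSpace (E3 × E3) (RegPhase μ) := (regCore μ).toChartedSpace

instance (μ : ℝ) : IsManifold 𝓘(ℝ, E3 × E3) ∞ (RegPhase μ) := by
  refine isManifold_of_contDiffOn _ _ _ ?_
  intro e e' he he'
  have key : ∀ e ∈ atlas (E3 × E3) (RegPhase μ), ∃ i, e.toPartialEquiv = regChart μ i := by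
    intro e he
    obtain ⟨f, hf⟩ := mem_iUnion.1 he
    obtain ⟨⟨i, rfl⟩, hf⟩ := mem_iUnion.1 hf
    exact ⟨i, by rw [mem_singleton_iff.1 hf]; rfl⟩
  obtain ⟨i, hi⟩ := key e he
  obtain ⟨j, hj⟩ := key e' he'
  have h := (regChart_transition μ i j).2
  rw [← hi, ← hj] at h
  simpa using h

/-- The regularized energy hypersurface: the closure in the regularized phase space of the part of
`Σ_c` over the component of Hill's region at the primaries in `B`. -/
def regularizedHypersurface (μ c : ℝ) (B : Set E3) : Set (RegPhase μ) :=
  closure {x | ∃ z hz, x = .phase z hz ∧ z ∈ levelComponent μ c B}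

/-! ### Hypersurfaces of contact type -/

/-- The canonical symplectic form `dp ∧ dq` on `ℝ³ × ℝ³ ∋ (q, p)`. All the coordinate changes of
the regularized phase space preserve it, so it defines there a symplectic form `ω`, which is given
by this formula in each of the three charts. -/
def canonicalForm (a b : E3 × E3) : ℝ := ⟪a.2, b.1⟫ - ⟪b.2, a.1⟫

/-- The representation of a vector field on the regularized phase space in a chart. -/
def chartField {μ : ℝ} (X : ∀ x : RegPhase μ, TangentSpace 𝓘(ℝ, E3 × E3) x)
    (e : OpenPartialHomeomorph (RegPhase μ) (E3 × E3)) (w : E3 × E3) : E3 × E3 :=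
  mfderiv 𝓘(ℝ, E3 × E3) 𝓘(ℝ, E3 × E3) e (e.symm w) (X (e.symm w))

/-- `X` is a Liouville vector field on the open set `U`: it is smooth and `L_X ω = ω`. For a constant
form, `(L_X ω)(a, b) = ω(DX a, b) + ω(a, DX b)`. -/
def IsLiouvilleOn {μ : ℝ} (X : ∀ x : RegPhase μ, TangentSpace 𝓘(ℝ, E3 × E3) x)
    (U : Set (RegPhase μ)) : Prop :=
  ContMDiffOn 𝓘(ℝ, E3 × E3) 𝓘(ℝ, E3 × E3).tangent ∞
      (fun x => (⟨x, X x⟩ : TangentBundle 𝓘(ℝ, E3 × E3) (RegPhase μ))) U ∧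
    ∀ e ∈ atlas (E3 × E3) (RegPhase μ), ∀ w ∈ e.target, e.symm w ∈ U → ∀ a b : E3 × E3,
      canonicalForm (fderiv ℝ (chartField X e) w a) b +
        canonicalForm a (fderiv ℝ (chartField X e) w b) = canonicalForm a b

/-- `S` is a smooth hypersurface of contact type: on a neighbourhood of `S` there is a Liouville
vector field transverse to `S`. Here `S` is locally the zero set of a smooth function `g`, and
transversality means `dg(X) ≠ 0` (so that `dg ≠ 0` on `S`, and `X` is not tangent to `S`). -/
def IsContactType {μ : ℝ} (S : Set (RegPhase μ)) : Prop :=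
  ∃ (U : Set (RegPhase μ)) (X : ∀ x : RegPhase μ, TangentSpace 𝓘(ℝ, E3 × E3) x),
    IsOpen U ∧ S ⊆ U ∧ IsLiouvilleOn X U ∧
    ∀ x ∈ S, ∃ (O : Set (RegPhase μ)) (g : RegPhase μ → ℝ), IsOpen O ∧ x ∈ O ∧
      ContMDiffOn 𝓘(ℝ, E3 × E3) 𝓘(ℝ, ℝ) ∞ g O ∧ S ∩ O = {y ∈ O | g y = 0} ∧
      (mfderiv 𝓘(ℝ, E3 × E3) 𝓘(ℝ, ℝ) g x (X x) : ℝ) ≠ 0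

/-! ### Diffeomorphisms and connected sums of subsets of manifolds -/

section Diffeo

variable {E H M : Type*} [NormedAddCommGroup E] [NormedSpace ℝ E] [TopologicalSpace H]
  (I : ModelWithCorners ℝ E H) [TopologicalSpace M] [ChartedSpace H M]
  {E' H' M' : Type*} [NormedAddCommGroup E'] [NormedSpace ℝ E'] [TopologicalSpace H']
  (I' : ModelWithCorners ℝ E' H') [TopologicalSpace M'] [ChartedSpace H' M']
  {E'' H'' M'' : Type*} [NormedAddCommGroup E''] [NormedSpace ℝ E''] [TopologicalSpace H'']
  (I'' : ModelWithCorners ℝ E'' H'') [TopologicalSpace M''] [ChartedSpace H'' M'']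

/-- `f` is smooth on the subset `S` of the manifold `M`: locally, `f` is on `S` the restriction of
a smooth map that is defined on an open subset of `M`. -/
def SmoothOnSubset (f : M → M') (S : Set M) : Prop :=
  ∀ x ∈ S, ∃ (U : Set M) (F : M → M'), IsOpen U ∧ x ∈ U ∧ ContMDiffOn I I' ∞ F U ∧ EqOn f F (S ∩ U)

/-- `f` restricts to a diffeomorphism from `S` onto `T`. -/
def IsDiffeoOn (f : M → M') (S : Set M) (T : Set M') : Prop :=
  BijOn f S T ∧ SmoothOnSubset I I' f S ∧
    ∃ g : M' → M, SmoothOnSubset I' I g T ∧ LeftInvOn g f S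

/-- The subsets `S` and `T` of manifolds are diffeomorphic. -/
def AreDiffeomorphic (S : Set M) (T : Set M') : Prop := ∃ f : M → M', IsDiffeoOn I I' f S T

/-- `f` restricts to a diffeomorphism from `S` onto a relatively open subset of `T`. -/
def IsOpenDiffeoInto (f : M → M') (S : Set M) (T : Set M') : Prop :=
  ∃ O : Set M', IsOpen O ∧ IsDiffeoOn I I' f S (T ∩ O)

/-- `N` is diffeomorphic to a connected sum of the `n`-dimensional submanifolds `A` and `B`: there
are embeddings `φ`, `ψ` of the open unit ball into `A` and `B` such that `N` arises from
`A ∖ {φ 0}` and `B ∖ {ψ 0}` (embedded into `N` by `i` and `j`) by identifying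
`φ (t • v)` with `ψ ((1 - t) • v)` for all unit vectors `v` and `0 < t < 1`. -/
def IsConnectedSum (n : ℕ) (A : Set M) (B : Set M') (N : Set M'') : Prop :=
  ∃ (φ : EuclideanSpace ℝ (Fin n) → M) (ψ : EuclideanSpace ℝ (Fin n) → M')
    (i : M → M'') (j : M' → M''),
    IsOpenDiffeoInto 𝓘(ℝ, EuclideanSpace ℝ (Fin n)) I φ (Metric.ball 0 1) A ∧
    IsOpenDiffeoInto 𝓘(ℝ, EuclideanSpace ℝ (Fin n)) I' ψ (Metric.ball 0 1) B ∧
    IsOpenDiffeoInto I I'' i (A \ {φ 0}) N ∧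
    IsOpenDiffeoInto I' I'' j (B \ {ψ 0}) N ∧
    i '' (A \ {φ 0}) ∪ j '' (B \ {ψ 0}) = N ∧
    i '' (A \ {φ 0}) ∩ j '' (B \ {ψ 0}) = i '' (φ '' (Metric.ball 0 1 \ {0})) ∧
    ∀ v, ‖v‖ = 1 → ∀ t ∈ Ioo (0 : ℝ) 1, i (φ (t • v)) = j (ψ ((1 - t) • v))

end Diffeo

end CRTBP

end

noncomputable section

namespace CRTBP


/-! ### Scalar inequalities along a ray issuing from a primary -/

/-! The Hamiltonian is half the squared velocity in the rotating frame plus the effective potential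
V = `potential`, so Hill's region is a sublevel set of V and the topology is decided by V. For a
primary b let r be its distance to the position of L₁ (`radius`). The radial field (q - b, 0) is
Liouville, and in Moser's coordinates it is the fibrewise radial field of T*S³, so it extends
smoothly over the collisions with b (`regField_isLiouvilleOn`). With y = q - b and y' the horizontal
part of y, Cauchy–Schwarz shows that the field is transverse to the level c as soon as dV(y) > 0 and
dV(y)² > 2|y'|²(c - V) (`hamDeriv_radial_pos`). Along a ray from b, after division by |y|², the
difference of the two sides of the second inequality has a derivative from which the centrifugal
terms cancel. What remains is twice the slope times the second derivative of the two gravitational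
terms, and it is negative up to the radius r (`ray_curvature_neg`, `rayEnergy_strictAntiOn`). Hence
only the sphere of radius r has to be inspected, and there V is minimal exactly at L₁
(`axisPot_lt_rayPot`).

Below the critical energy this sphere avoids Hill's region, while Hill's region inside it is
connected along rays; so the ball cuts out the component at b (`regularizedHypersurface_eq_surf`).
In T*S³, fixing the base point means fixing p, and scaling the covector means scaling q - b. Along
such a ray the energy starts at -∞, passes c, and increases wherever it is at most c. So the
regularized level meets every fibre ray exactly once, and projection to unit covectors is a
diffeomorphism (`IsStarLevel.isDiffeoOn`).

Slightly above the critical energy, the radial fields of the two primaries must be joined across the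
neck at L₁. `neckField` does this by adding to the radial field centred at L₁ a Hamiltonian field
with cutoffs. Where the cutoff is 1, it is half the Euler field at L₁ plus an axial term governed by
a profile g. The Euler part applied to H gives nearly the excess energy e, since H is nearly
quadratic there, and the axial term is coercive in the axial coordinate x. Once e is negligible
against x², the axial term also dominates the errors from the cutoff (`neck_center_pos`,
`neck_inner_ge`, `neck_outer_ge`, `neck_cutoff_le`). Away from L₁ the radial fields stay transverse
by compactness (`exists_radial_gap`).

For the connected sum, the transversal coordinates W = `neckTrans` in ℝ⁵ bring H near L₁ to the form
|W|²/2 plus a function of the axial coordinate, so the neck is a family of 4-spheres. Replacing the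
available energy on the side of b by `capEnergy`, which vanishes linearly at axial distance δ/4,
closes the neck with a 5-disk. The capped level is still star-shaped around b
(`IsCapData.isStarLevel`), hence a copy of ST*S³. Removing the tip of the cap and reparametrizing
the axial coordinate recovers the part of the true hypersurface beyond axial coordinate -δ
(`IsCapData.isDiffeoOn_uncap`). The two parts overlap in the neck, where the polar coordinates of
the two disks are matched by t ↦ 1 - t (`IsCapData.isConnectedSum`). -/

theorem sphere_potential_gt {a D : ℝ} (ha : 0 < a) (ha1 : a < 1) (hD : a < D) (hD2 : D ≤ 2 - a) :
    (1 - a) - 1 / a < (1 + (1 - a) ^ 2 - D ^ 2) / 2 - 1 / D := by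
  have hD0 : 0 < D := ha.trans hD
  -- Here 1 - a is the distance to the nearer centre and D the distance to the other primary; the
  -- point on the axis has D = a, which explains the factor D - a. The other factor is positive
  -- because a + D ≤ 2 and aD ≤ a(2 - a) < 1.
  have key : (1 + (1 - a) ^ 2 - D ^ 2) / 2 - 1 / D - ((1 - a) - 1 / a) =
      (D - a) * (2 - (a + D) * (a * D)) / (2 * (a * D)) := by
    field_simp
    ring
  have h1 : (a + D) * (a * D) < 2 := by
    have h2 : a * D ≤ a * (2 - a) := by gcongr
    have h3 : a * (2 - a) < 1 := by nlinarith [sq_pos_of_pos (sub_pos.2 ha1)]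
    have h4 : a * D < 1 := h2.trans_lt h3
    nlinarith [mul_pos ha hD0]
  have : 0 < (D - a) * (2 - (a + D) * (a * D)) / (2 * (a * D)) := by
    have := mul_pos ha hD0
    apply div_pos (mul_pos (by linarith) (by linarith)) (by linarith)
  linarith

/-- The analogue of `sphere_potential_gt` for the radial derivative (multiplied by the radius).
After splitting off D - a, the remaining factor decreases in D, so it suffices to evaluate it at the
far end D = 2 - a, where it is a rational function of a(2 - a) < 1. -/
theorem sphere_slope_gt {a D : ℝ} (ha : 0 < a) (ha1 : a < 1) (hD : a < D) (hD2 : D ≤ 2 - a) :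
    (1 - a) - (1 - a) / a ^ 2 <
      (1 + (1 - a) ^ 2 - D ^ 2) / 2 + ((1 - a) ^ 2 - 1 + D ^ 2) / (2 * D ^ 3) := by
  have hD0 : 0 < D := ha.trans hD
  have key : (1 + (1 - a) ^ 2 - D ^ 2) / 2 + ((1 - a) ^ 2 - 1 + D ^ 2) / (2 * D ^ 3) -
      ((1 - a) - (1 - a) / a ^ 2) =
      (D - a) * (-(a + D) + (2 - 2 * a) / (a ^ 2 * D) + (2 - a) / (a * D ^ 2) + (2 - a) / D ^ 3)
        / 2 := by
    field_simp
    ring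
  have h2a : 0 < 2 - a := by linarith
  have h1 : (2 - 2 * a) / (a ^ 2 * (2 - a)) ≤ (2 - 2 * a) / (a ^ 2 * D) := by
    apply div_le_div_of_nonneg_left (by linarith) (by positivity)
    gcongr
  have h2 : (2 - a) / (a * (2 - a) ^ 2) ≤ (2 - a) / (a * D ^ 2) := by
    apply div_le_div_of_nonneg_left (by linarith) (by positivity)
    gcongr
  have h3 : (2 - a) / (2 - a) ^ 3 ≤ (2 - a) / D ^ 3 := by
    apply div_le_div_of_nonneg_left (by linarith) (by positivity)
    gcongr
  have h4 : 0 < -(a + (2 - a)) + (2 - 2 * a) / (a ^ 2 * (2 - a)) + (2 - a) / (a * (2 - a) ^ 2) +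
      (2 - a) / (2 - a) ^ 3 := by
    have e : -(a + (2 - a)) + (2 - 2 * a) / (a ^ 2 * (2 - a)) + (2 - a) / (a * (2 - a) ^ 2) +
      (2 - a) / (2 - a) ^ 3 =
        2 * ((1 - a * (2 - a)) * (2 + a * (2 - a))) / (a ^ 2 * (2 - a) ^ 2) := by
      field_simp
      ring
    rw [e]
    have h3 : 0 < 1 - a * (2 - a) := by nlinarith [sq_pos_of_pos (sub_pos.2 ha1)]
    positivity
  have : 0 < (D - a) * (-(a + D) + (2 - 2 * a) / (a ^ 2 * D) + (2 - a) / (a * D ^ 2) +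
      (2 - a) / D ^ 3) / 2 := by
    apply div_pos (mul_pos (by linarith) (by linarith)) two_pos
  linarith

/-- Two regimes. If D³ is large compared with a³, the term -3e² can be dropped. Otherwise a < 1/5
and D ≤ 6a/5, so the point is so close to the axis that e ≤ -3a/4, and then D² - 3e² ≤ 0. -/
theorem ray_convexity {a D e : ℝ} (ha : 0 < a) (ha1 : a < 1) (hD : a ≤ D)
    (he : 2 * (1 - a) * e = D ^ 2 - a * (2 - a)) :
    a ^ 3 * (3 - 3 * a + a ^ 2) * (D ^ 2 - 3 * e ^ 2) < 2 * (1 + a + a ^ 2) * D ^ 5 := by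
  have hD0 : 0 < D := ha.trans_le hD
  have h3 : 0 < 3 - 3 * a + a ^ 2 := by nlinarith
  by_cases h : a ^ 3 * (3 - 3 * a + a ^ 2) < 2 * (1 + a + a ^ 2) * D ^ 3
  · calc a ^ 3 * (3 - 3 * a + a ^ 2) * (D ^ 2 - 3 * e ^ 2)
        ≤ a ^ 3 * (3 - 3 * a + a ^ 2) * D ^ 2 := by
          gcongr
          nlinarith [sq_nonneg e]
      _ < 2 * (1 + a + a ^ 2) * D ^ 3 * D ^ 2 := by gcongr
      _ = _ := by ring
  · push Not at h
    have hc : a ^ 3 ≤ D ^ 3 := by gcongr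
    have hapos : 0 < a ^ 3 := by positivity
    have h5 : a < 1 / 5 := by
      have : 2 * (1 + a + a ^ 2) * a ^ 3 ≤ (3 - 3 * a + a ^ 2) * a ^ 3 := by nlinarith
      have := le_of_mul_le_mul_right this hapos
      nlinarith
    have hDa : D ≤ 6 / 5 * a := by
      by_contra hh
      push Not at hh
      have : (6 / 5 * a) ^ 3 < D ^ 3 := by gcongr
      nlinarith
    have he1 : 3 / 4 * a ≤ -e := by
      have : D ^ 2 ≤ (6 / 5 * a) ^ 2 := by gcongr
      by_contra hh
      push Not at hh
      nlinarith
    have : D ^ 2 - 3 * e ^ 2 ≤ 0 := by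
      have h1 : D ^ 2 ≤ (6 / 5 * a) ^ 2 := by gcongr
      have h2 : (3 / 4 * a) ^ 2 ≤ (-e) ^ 2 := by gcongr
      nlinarith
    calc _ ≤ 0 := mul_nonpos_of_nonneg_of_nonpos (by positivity) this
      _ < _ := by positivity


/-! ### The effective potential along a ray

A primary of mass `m` sits at distance `1` from the other one, of mass `1 - m`. A ray issuing from it
is described by the squared length `k` of the horizontal part of its unit direction and by the cosine
`τ` of its angle with the direction of the other primary. -/

/-- The distance to the other primary along a ray. -/
def rayDist (τ ρ : ℝ) : ℝ := √(ρ ^ 2 - 2 * ρ * τ + 1)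

/-- The effective potential along a ray. -/
def rayPot (m k τ ρ : ℝ) : ℝ :=
  -(ρ ^ 2 * k - 2 * (1 - m) * ρ * τ + (1 - m) ^ 2) / 2 - m / ρ - (1 - m) / rayDist τ ρ

/-- The derivative of the effective potential along a ray. -/
def raySlope (m k τ ρ : ℝ) : ℝ :=
  -(ρ * k) + (1 - m) * τ + m / ρ ^ 2 + (1 - m) * (ρ - τ) / rayDist τ ρ ^ 3

/-- The effective potential on the axis, between the primaries. -/
def axisPot (m ρ : ℝ) : ℝ := -(ρ - (1 - m)) ^ 2 / 2 - m / ρ - (1 - m) / (1 - ρ)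

/-- The derivative of the effective potential on the axis. -/
def axisSlope (m ρ : ℝ) : ℝ := -ρ + (1 - m) + m / ρ ^ 2 - (1 - m) / (1 - ρ) ^ 2

/-- The quantity whose positivity makes the radial Liouville field transverse to the energy level. -/
def rayEnergy (m k τ c ρ : ℝ) : ℝ := raySlope m k τ ρ ^ 2 + 2 * k * (rayPot m k τ ρ - c)

section Ray

variable {m k τ ρ : ℝ}

theorem rayDist_radicand (h0 : 0 < ρ) (hτ : τ ≤ 1) : (1 - ρ) ^ 2 ≤ ρ ^ 2 - 2 * ρ * τ + 1 := by
  nlinarith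

theorem rayDist_sq (h0 : 0 < ρ) (hτ : τ ≤ 1) : rayDist τ ρ ^ 2 = ρ ^ 2 - 2 * ρ * τ + 1 :=
  Real.sq_sqrt ((sq_nonneg _).trans (rayDist_radicand h0 hτ))

theorem le_rayDist (h0 : 0 < ρ) (hτ : τ ≤ 1) : 1 - ρ ≤ rayDist τ ρ :=
  Real.le_sqrt_of_sq_le (rayDist_radicand h0 hτ)

theorem lt_rayDist (h0 : 0 < ρ) (hτ : τ < 1) : 1 - ρ < rayDist τ ρ :=
  Real.lt_sqrt_of_sq_lt (by nlinarith)

theorem rayDist_le (h0 : 0 < ρ) (hτ : -1 ≤ τ) : rayDist τ ρ ≤ 1 + ρ :=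
  Real.sqrt_le_iff.2 ⟨by linarith, by nlinarith⟩

theorem rayDist_pos (h0 : 0 < ρ) (h1 : ρ < 1) (hτ : τ ≤ 1) : 0 < rayDist τ ρ :=
  (sub_pos.2 h1).trans_le (le_rayDist h0 hτ)

theorem rayDist_one (h1 : ρ ≤ 1) : rayDist 1 ρ = 1 - ρ := by
  rw [rayDist, show ρ ^ 2 - 2 * ρ * 1 + 1 = (1 - ρ) ^ 2 by ring, Real.sqrt_sq (by linarith)]

theorem hasDerivAt_rayDist (h0 : 0 < ρ) (h1 : ρ < 1) (hτ : τ ≤ 1) :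
    HasDerivAt (rayDist τ) ((ρ - τ) / rayDist τ ρ) ρ := by
  have hD := rayDist_pos h0 h1 hτ
  have hne : ρ ^ 2 - 2 * ρ * τ + 1 ≠ 0 := by
    rw [← rayDist_sq h0 hτ]; positivity
  have h : HasDerivAt (fun ρ : ℝ => ρ ^ 2 - 2 * ρ * τ + 1) (2 * ρ - 2 * τ) ρ := by
    have := (((hasDerivAt_id ρ).pow 2).sub (((hasDerivAt_id ρ).const_mul 2).mul_const τ)).add_const 1
    refine this.congr_deriv ?_
    simp
  refine (h.sqrt hne).congr_deriv ?_
  change (2 * ρ - 2 * τ) / (2 * rayDist τ ρ) = _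
  field_simp

theorem hasDerivAt_rayPot (h0 : 0 < ρ) (h1 : ρ < 1) (hτ : τ ≤ 1) :
    HasDerivAt (rayPot m k τ) (raySlope m k τ ρ) ρ := by
  have hD := rayDist_pos h0 h1 hτ
  have h := (((((((hasDerivAt_id ρ).pow 2).mul_const k).sub
    (((hasDerivAt_id ρ).const_mul (2 * (1 - m))).mul_const τ)).add_const ((1 - m) ^ 2)).neg.div_const
    2).sub ((hasDerivAt_const ρ m).div (hasDerivAt_id ρ) h0.ne')).sub
    ((hasDerivAt_const ρ (1 - m)).div (hasDerivAt_rayDist h0 h1 hτ) hD.ne')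
  refine h.congr_deriv ?_
  simp only [raySlope, id]
  field_simp
  ring

theorem hasDerivAt_raySlope (h0 : 0 < ρ) (h1 : ρ < 1) (hτ : τ ≤ 1) :
    HasDerivAt (raySlope m k τ) (-k - 2 * m / ρ ^ 3 +
      (1 - m) * (rayDist τ ρ ^ 2 - 3 * (ρ - τ) ^ 2) / rayDist τ ρ ^ 5) ρ := by
  have hD := rayDist_pos h0 h1 hτ
  have h := ((((hasDerivAt_id ρ).mul_const k).neg.add_const ((1 - m) * τ)).add
    ((hasDerivAt_const ρ m).div ((hasDerivAt_id ρ).pow 2) (pow_ne_zero 2 h0.ne'))).add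
    ((((hasDerivAt_id ρ).sub_const τ).const_mul (1 - m)).div
      ((hasDerivAt_rayDist h0 h1 hτ).pow 3) (pow_ne_zero 3 hD.ne'))
  refine h.congr_deriv ?_
  simp only [id, Pi.pow_apply]
  field_simp
  ring

theorem hasDerivAt_axisPot (h0 : ρ ≠ 0) (h1 : ρ ≠ 1) :
    HasDerivAt (axisPot m) (axisSlope m ρ) ρ := by
  have h1' : 1 - ρ ≠ 0 := sub_ne_zero.2 h1.symm
  have h := ((((hasDerivAt_id ρ).sub_const (1 - m)).pow 2).neg.div_const 2).sub
    ((hasDerivAt_const ρ m).div (hasDerivAt_id ρ) h0) |>.sub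
    ((hasDerivAt_const ρ (1 - m)).div ((hasDerivAt_id ρ).const_sub 1) h1')
  refine h.congr_deriv ?_
  simp only [axisSlope, id]
  field_simp
  ring

/-- Every term of the slope is nonincreasing in ρ and the linear one strictly so; hence L₁ is the
only zero and the slope is positive before it. -/
theorem axisSlope_pos_of_lt (hm : m ∈ Ioo (0 : ℝ) 1) {r : ℝ} (hr : axisSlope m r = 0)
    (hr1 : r < 1) (h0 : 0 < ρ) (h1 : ρ < r) : 0 < axisSlope m ρ := by
  have hm1 : 0 < 1 - m := sub_pos.2 hm.2
  rw [← hr]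
  unfold axisSlope
  have h2 : m / r ^ 2 ≤ m / ρ ^ 2 := by
    apply div_le_div_of_nonneg_left hm.1.le (by positivity)
    gcongr
  have h3 : (1 - m) / (1 - ρ) ^ 2 ≤ (1 - m) / (1 - r) ^ 2 := by
    have : 0 < 1 - r := by linarith
    apply div_le_div_of_nonneg_left hm1.le (by positivity)
    gcongr
  linarith

theorem axisSlope_nonneg_of_le (hm : m ∈ Ioo (0 : ℝ) 1) {r : ℝ} (hr : axisSlope m r = 0)
    (hr1 : r < 1) (h0 : 0 < ρ) (h1 : ρ ≤ r) : 0 ≤ axisSlope m ρ := by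
  rcases h1.lt_or_eq with h | rfl
  · exact (axisSlope_pos_of_lt hm hr hr1 h0 h).le
  · exact hr.ge

/-- On a sphere around a primary the potential is least in the direction of the other primary. A
direction with k < 1 leaves the plane of rotation and only weakens the centrifugal term, so the
comparison may be made with k = 1. -/
theorem axisPot_lt_rayPot (hm : m ∈ Ioo (0 : ℝ) 1) (h0 : 0 < ρ) (h1 : ρ < 1) (hτ : -1 ≤ τ)
    (hτ1 : τ < 1) (hk : k ≤ 1) : axisPot m ρ < rayPot m k τ ρ := by
  have hm1 : 0 < 1 - m := sub_pos.2 hm.2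
  have h := sphere_potential_gt (sub_pos.2 h1) (by linarith) (lt_rayDist h0 hτ1)
    (by linarith [rayDist_le h0 hτ])
  rw [rayDist_sq h0 hτ1.le] at h
  have h2 := mul_lt_mul_of_pos_left h hm1
  have h3 : ρ ^ 2 * k ≤ ρ ^ 2 := by nlinarith [sq_nonneg ρ]
  have e1 : (1 - m) / rayDist τ ρ = (1 - m) * (1 / rayDist τ ρ) := by ring
  have e2 : (1 - m) / (1 - ρ) = (1 - m) * (1 / (1 - ρ)) := by ring
  unfold axisPot rayPot
  rw [e1, e2]
  nlinarith

theorem rayPot_axis (h1 : ρ ≤ 1) : rayPot m 1 1 ρ = axisPot m ρ := by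
  rw [rayPot, axisPot, rayDist_one h1]
  ring

theorem axisSlope_lt_raySlope (hm : m ∈ Ioo (0 : ℝ) 1) (h0 : 0 < ρ) (h1 : ρ < 1) (hτ : -1 ≤ τ)
    (hτ1 : τ < 1) (hk : k ≤ 1) : axisSlope m ρ < raySlope m k τ ρ := by
  have hm1 : 0 < 1 - m := sub_pos.2 hm.2
  have hD := rayDist_pos h0 h1 hτ1.le
  have h := sphere_slope_gt (sub_pos.2 h1) (by linarith) (lt_rayDist h0 hτ1)
    (by linarith [rayDist_le h0 hτ])
  have ha : 0 < 1 - ρ := sub_pos.2 h1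
  have h2 := rayDist_sq h0 hτ1.le
  have e1 : (1 + (1 - (1 - ρ)) ^ 2 - rayDist τ ρ ^ 2) / 2 +
      ((1 - (1 - ρ)) ^ 2 - 1 + rayDist τ ρ ^ 2) / (2 * rayDist τ ρ ^ 3) =
      ρ * (τ + (ρ - τ) / rayDist τ ρ ^ 3) := by
    rw [h2]
    field_simp
    ring
  have e2 : (1 - (1 - ρ)) - (1 - (1 - ρ)) / (1 - ρ) ^ 2 = ρ * (1 - 1 / (1 - ρ) ^ 2) := by
    field_simp
    ring
  rw [e1, e2] at h
  have h3 := mul_lt_mul_of_pos_left (lt_of_mul_lt_mul_left h h0.le) hm1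
  have h4 : ρ * k ≤ ρ := by nlinarith
  unfold axisSlope raySlope
  have e3 : (1 - m) * (ρ - τ) / rayDist τ ρ ^ 3 = (1 - m) * ((ρ - τ) / rayDist τ ρ ^ 3) := by ring
  have e4 : (1 - m) / (1 - ρ) ^ 2 = (1 - m) * (1 / (1 - ρ) ^ 2) := by ring
  rw [e3, e4]
  nlinarith

theorem raySlope_axis_ge (h1 : ρ < 1) (hk : k ≤ 1) (h0 : 0 < ρ) :
    axisSlope m ρ ≤ raySlope m k 1 ρ := by
  have ha : 0 < 1 - ρ := sub_pos.2 h1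
  rw [raySlope, axisSlope, rayDist_one h1.le]
  have e : (1 - m) * (ρ - 1) / (1 - ρ) ^ 3 = -((1 - m) / (1 - ρ) ^ 2) := by
    field_simp
    ring
  rw [e]
  nlinarith

/-- Before L₁ the near mass is large enough relative to the far one; this is what `0 ≤ axisSlope m
ρ` says once denominators are cleared. Inserted into `ray_convexity`, it shows that the concavity of
-m/ρ beats the possible convexity of the far mass's potential. -/
theorem ray_curvature_neg (hm : m ∈ Ioo (0 : ℝ) 1) (h0 : 0 < ρ) (h1 : ρ < 1) (hτ : τ ≤ 1)
    (hs : 0 ≤ axisSlope m ρ) :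
    - 2 * m / ρ ^ 3 + (1 - m) * (rayDist τ ρ ^ 2 - 3 * (ρ - τ) ^ 2) / rayDist τ ρ ^ 5 < 0 := by
  have hm1 : 0 < 1 - m := sub_pos.2 hm.2
  have hD := rayDist_pos h0 h1 hτ
  have ha : 0 < 1 - ρ := sub_pos.2 h1
  have hsq := rayDist_sq h0 hτ
  have h := ray_convexity ha (by linarith) (le_rayDist h0 hτ) (e := ρ - τ) (by rw [hsq]; ring)
  have hq : (0 : ℝ) < 1 + ρ + ρ ^ 2 := by positivity
  have e1 : 3 - 3 * (1 - ρ) + (1 - ρ) ^ 2 = 1 + ρ + ρ ^ 2 := by ring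
  rw [e1] at h
  set D := rayDist τ ρ
  -- The quintic equation for L₁ as an inequality, in the form that is symmetric under exchange of
  -- the two masses and of ρ with 1 - ρ.
  have hs' : (1 - m) * (1 + (1 - ρ) + (1 - ρ) ^ 2) * ρ ^ 3 ≤
      m * ((1 - ρ) ^ 3 * (1 + ρ + ρ ^ 2)) := by
    have e : axisSlope m ρ * (ρ ^ 2 * (1 - ρ) ^ 2) * ((1 - ρ) * ρ) =
        ((1 - ρ) * ρ) * (m * ((1 - ρ) ^ 3 * (1 + ρ + ρ ^ 2)) -
          (1 - m) * (1 + (1 - ρ) + (1 - ρ) ^ 2) * ρ ^ 3) := by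
      unfold axisSlope
      field_simp
      ring
    have : 0 ≤ ((1 - ρ) * ρ) * (m * ((1 - ρ) ^ 3 * (1 + ρ + ρ ^ 2)) -
          (1 - m) * (1 + (1 - ρ) + (1 - ρ) ^ 2) * ρ ^ 3) := by
      rw [← e]; positivity
    have := nonneg_of_mul_nonneg_right this (by positivity)
    linarith
  rw [show - 2 * m / ρ ^ 3 + (1 - m) * (D ^ 2 - 3 * (ρ - τ) ^ 2) / D ^ 5 =
    ((1 - m) * (D ^ 2 - 3 * (ρ - τ) ^ 2) * ρ ^ 3 - 2 * m * D ^ 5) / (ρ ^ 3 * D ^ 5) by field_simp; ring]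
  apply div_neg_of_neg_of_pos _ (by positivity)
  have hb : 0 < (1 - ρ) ^ 3 * (1 + ρ + ρ ^ 2) := by positivity
  refine neg_of_mul_neg_right (a := (1 - ρ) ^ 3 * (1 + ρ + ρ ^ 2)) ?_ hb.le
  have h2 := mul_lt_mul_of_pos_left h (show 0 < (1 - m) * ρ ^ 3 by positivity)
  have h3 := mul_le_mul_of_nonneg_right hs' (show 0 ≤ 2 * D ^ 5 by positivity)
  linarith

variable {r c : ℝ}

theorem raySlope_pos (hm : m ∈ Ioo (0 : ℝ) 1) (hr : axisSlope m r = 0) (hr1 : r < 1)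
    (h0 : 0 < ρ) (h1 : ρ ≤ r) (hτ : -1 ≤ τ) (hτ1 : τ ≤ 1) (hk : k ≤ 1)
    (hne : ¬ (ρ = r ∧ τ = 1)) : 0 < raySlope m k τ ρ := by
  rcases hτ1.lt_or_eq with h | rfl
  · exact (axisSlope_nonneg_of_le hm hr hr1 h0 h1).trans_lt
      (axisSlope_lt_raySlope hm h0 (h1.trans_lt hr1) hτ h hk)
  · have : ρ < r := lt_of_le_of_ne h1 fun h => hne ⟨h, rfl⟩
    exact (axisSlope_pos_of_lt hm hr hr1 h0 this).trans_le
      (raySlope_axis_ge (this.trans hr1) hk h0)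

/-- The term -k in the derivative of the slope cancels against the derivative of 2k times the
potential. What remains is twice the slope, which is positive, times the gravitational curvature,
which is negative. -/
theorem rayEnergy_strictAntiOn (hm : m ∈ Ioo (0 : ℝ) 1) (hr : axisSlope m r = 0) (hr1 : r < 1)
    (hτ : -1 ≤ τ) (hτ1 : τ ≤ 1) (hk : k ≤ 1) :
    StrictAntiOn (rayEnergy m k τ c) (Ioc 0 r) := by
  have hder : ∀ ρ ∈ Ioc 0 r, HasDerivAt (rayEnergy m k τ c) (2 * raySlope m k τ ρ *
      (- 2 * m / ρ ^ 3 + (1 - m) * (rayDist τ ρ ^ 2 - 3 * (ρ - τ) ^ 2) / rayDist τ ρ ^ 5)) ρ := by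
    intro ρ hρ
    have h1 := hρ.2.trans_lt hr1
    have := ((hasDerivAt_raySlope (m := m) (k := k) hρ.1 h1 hτ1).pow 2).add
      (((hasDerivAt_rayPot (m := m) (k := k) hρ.1 h1 hτ1).sub_const c).const_mul (2 * k))
    refine this.congr_deriv ?_
    simp only [Nat.cast_ofNat, Nat.add_one_sub_one, pow_one]
    ring
  apply strictAntiOn_of_deriv_neg (convex_Ioc 0 r)
  · exact fun ρ hρ => (hder ρ hρ).continuousAt.continuousWithinAt
  · intro ρ hρ
    rw [interior_Ioc] at hρ
    have hρ' : ρ ∈ Ioc 0 r := ⟨hρ.1, hρ.2.le⟩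
    rw [(hder ρ hρ').deriv]
    have h1 := raySlope_pos (k := k) hm hr hr1 hρ.1 hρ.2.le hτ hτ1 hk fun h => hρ.2.ne h.1
    have h2 := ray_curvature_neg hm hρ.1 (hρ.2.trans hr1) hτ1
      (axisSlope_nonneg_of_le hm hr hr1 hρ.1 hρ.2.le)
    nlinarith

/-- By monotonicity only the endpoint r matters, where both summands are nonnegative because the
potential there is at least its value at L₁. The condition `τ = 1 → k = 1` makes this true on the
axis itself. -/
theorem rayEnergy_pos (hm : m ∈ Ioo (0 : ℝ) 1) (hr : axisSlope m r = 0) (hr1 : r < 1)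
    (h0 : 0 < ρ) (h1 : ρ ≤ r) (hτ : -1 ≤ τ) (hτ1 : τ ≤ 1) (hk0 : 0 ≤ k) (hk : k ≤ 1)
    (hk1 : τ = 1 → k = 1) (hne : ¬ (ρ = r ∧ τ = 1)) :
    0 < rayEnergy m k τ (axisPot m r) ρ := by
  have hr0 : 0 < r := h0.trans_le h1
  have hend : 0 ≤ rayEnergy m k τ (axisPot m r) r := by
    have : axisPot m r ≤ rayPot m k τ r := by
      rcases hτ1.lt_or_eq with h | rfl
      · exact (axisPot_lt_rayPot hm hr0 hr1 hτ h hk).le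
      · rw [hk1 rfl, rayPot_axis hr1.le]
    unfold rayEnergy
    have : 0 ≤ 2 * k * (rayPot m k τ r - axisPot m r) := mul_nonneg (by linarith) (by linarith)
    positivity
  rcases h1.lt_or_eq with h | rfl
  · exact hend.trans_lt (rayEnergy_strictAntiOn hm hr hr1 hτ hτ1 hk ⟨h0, h1⟩ ⟨hr0, le_rfl⟩ h)
  · have hτ2 : τ < 1 := lt_of_le_of_ne hτ1 fun h => hne ⟨rfl, h⟩
    have h2 := raySlope_pos (k := k) hm hr hr1 h0 le_rfl hτ hτ1 hk hne
    have h3 := axisPot_lt_rayPot (k := k) hm h0 hr1 hτ hτ2 hk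
    unfold rayEnergy
    have : 0 ≤ 2 * k * (rayPot m k τ ρ - axisPot m ρ) := mul_nonneg (by linarith) (by linarith)
    positivity

end Ray


/-! ### The effective potential -/

theorem norm_sq_three (x : E3) : ‖x‖ ^ 2 = x 0 ^ 2 + x 1 ^ 2 + x 2 ^ 2 := by
  simp [EuclideanSpace.real_norm_sq_eq, Fin.sum_univ_three]

theorem inner_three (x y : E3) : ⟪x, y⟫ = x 0 * y 0 + x 1 * y 1 + x 2 * y 2 := by
  simp [PiLp.inner_apply, Fin.sum_univ_three, mul_comm]

/-- The masses of the primaries. -/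
def mass (μ : ℝ) : Primary → ℝ
  | .earth => 1 - μ
  | .moon => μ

/-- The sign of the direction, on the first axis, from a primary to the other one. -/
def sgn : Primary → ℝ
  | .earth => -1
  | .moon => 1

@[simp] theorem Primary.other_other (b : Primary) : b.other.other = b := by cases b <;> rfl

theorem Primary.eq_or_eq_other (b b' : Primary) : b' = b ∨ b' = b.other := by
  cases b <;> cases b' <;> simp [Primary.other]

theorem sgn_mul_self (b : Primary) : sgn b * sgn b = 1 := by cases b <;> simp [sgn]

@[simp] theorem sgn_other (b : Primary) : sgn b.other = -sgn b := by
  cases b <;> simp [sgn, Primary.other]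

theorem mass_other (μ : ℝ) (b : Primary) : mass μ b.other = 1 - mass μ b := by
  cases b <;> simp [mass, Primary.other]

theorem mass_mem {μ : ℝ} (hμ : μ ∈ Ioo (0 : ℝ) 1) (b : Primary) : mass μ b ∈ Ioo (0 : ℝ) 1 := by
  cases b <;> simp only [mass, mem_Ioo] at * <;> constructor <;> linarith [hμ.1, hμ.2]

theorem pos_zero (μ : ℝ) (b : Primary) : pos μ b 0 = -(sgn b * (1 - mass μ b)) := by
  cases b <;> simp [pos, sgn, mass] <;> ring

@[simp] theorem pos_one (μ : ℝ) (b : Primary) : pos μ b 1 = 0 := by cases b <;> simp [pos]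

@[simp] theorem pos_two (μ : ℝ) (b : Primary) : pos μ b 2 = 0 := by cases b <;> simp [pos]

theorem pos_other_zero (μ : ℝ) (b : Primary) : pos μ b.other 0 = pos μ b 0 + sgn b := by
  rw [pos_zero, pos_zero, mass_other, sgn_other]
  ring

/-- The effective potential. -/
def potential (μ : ℝ) (q : E3) : ℝ :=
  -(q 0 ^ 2 + q 1 ^ 2) / 2 - μ / ‖q - pos μ .moon‖ - (1 - μ) / ‖q - pos μ .earth‖

theorem potential_eq (μ : ℝ) (b : Primary) (q : E3) :
    potential μ q = -(q 0 ^ 2 + q 1 ^ 2) / 2 - mass μ b / ‖q - pos μ b‖ -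
      (1 - mass μ b) / ‖q - pos μ b.other‖ := by
  cases b <;> simp only [potential, mass, Primary.other] <;> ring

theorem hamiltonian_eq (μ : ℝ) (z : E3 × E3) :
    hamiltonian μ z = ((z.2 0 + z.1 1) ^ 2 + (z.2 1 - z.1 0) ^ 2 + z.2 2 ^ 2) / 2 +
      potential μ z.1 := by
  rw [hamiltonian, potential, norm_sq_three]
  ring

/-- The derivative of the effective potential at `q` in the direction `a`. -/
def potentialDeriv (μ : ℝ) (q a : E3) : ℝ :=
  -(q 0 * a 0 + q 1 * a 1) + μ * ⟪q - pos μ .moon, a⟫ / ‖q - pos μ .moon‖ ^ 3 +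
    (1 - μ) * ⟪q - pos μ .earth, a⟫ / ‖q - pos μ .earth‖ ^ 3

theorem potentialDeriv_eq (μ : ℝ) (b : Primary) (q a : E3) :
    potentialDeriv μ q a = -(q 0 * a 0 + q 1 * a 1) +
      mass μ b * ⟪q - pos μ b, a⟫ / ‖q - pos μ b‖ ^ 3 +
      (1 - mass μ b) * ⟪q - pos μ b.other, a⟫ / ‖q - pos μ b.other‖ ^ 3 := by
  cases b <;> simp only [potentialDeriv, mass, Primary.other] <;> ring

/-- Configuration space without the primaries. -/
def offPrimaries (μ : ℝ) : Set E3 := {q | ∀ b, q ≠ pos μ b}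

theorem mem_phaseSpace_iff {μ : ℝ} {z : E3 × E3} : z ∈ phaseSpace μ ↔ z.1 ∈ offPrimaries μ :=
  Iff.rfl

theorem offPrimaries_iff {μ : ℝ} (b : Primary) {q : E3} :
    q ∈ offPrimaries μ ↔ q ≠ pos μ b ∧ q ≠ pos μ b.other := by
  refine ⟨fun h => ⟨h _, h _⟩, fun h b' => ?_⟩
  rcases b.eq_or_eq_other b' with rfl | rfl
  exacts [h.1, h.2]

theorem hasFDerivAt_inv_norm {x : E3} (hx : x ≠ 0) :
    HasFDerivAt (fun x : E3 => ‖x‖⁻¹) (-(‖x‖ ^ 3)⁻¹ • innerSL ℝ x) x := by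
  have hn : ‖x‖ ≠ 0 := norm_ne_zero_iff.2 hx
  have h1 := (hasStrictFDerivAt_norm_sq x).hasFDerivAt.sqrt (pow_ne_zero 2 hn)
  simp only [Real.sqrt_sq (norm_nonneg _)] at h1
  have h2 := (hasDerivAt_inv hn).comp_hasFDerivAt x h1
  refine h2.congr_fderiv ?_
  ext a
  simp only [_root_.smul_apply, smul_eq_mul, innerSL_apply_apply, nsmul_eq_mul]
  field_simp
  simp

theorem hasFDerivAt_potential {μ : ℝ} {q : E3} (hq : q ∈ offPrimaries μ) :
    ∃ L : E3 →L[ℝ] ℝ, HasFDerivAt (potential μ) L q ∧ ∀ a, L a = potentialDeriv μ q a := by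
  have hp : ∀ i : Fin 3, HasFDerivAt (fun q : E3 => q i) (EuclideanSpace.proj i : E3 →L[ℝ] ℝ) q :=
    fun i => (EuclideanSpace.proj i : E3 →L[ℝ] ℝ).hasFDerivAt
  have hb : ∀ b, HasFDerivAt (fun q : E3 => ‖q - pos μ b‖⁻¹)
      (-(‖q - pos μ b‖ ^ 3)⁻¹ • innerSL ℝ (q - pos μ b)) q := fun b =>
    ((hasFDerivAt_inv_norm (sub_ne_zero.2 (hq b))).comp (f := fun q => q - pos μ b) q
      ((hasFDerivAt_id q).sub_const (pos μ b))).congr_fderiv (ContinuousLinearMap.comp_id _)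
  have h := (((((hp 0).pow 2).add ((hp 1).pow 2)).neg.mul_const (1 / 2)).sub
    ((hb .moon).const_mul μ)).sub ((hb .earth).const_mul (1 - μ))
  refine ⟨_, h.congr_of_eventuallyEq (Filter.Eventually.of_forall fun x => ?_), fun a => ?_⟩
  · simp only [potential, div_eq_mul_inv, one_mul]
    rfl
  · simp only [potentialDeriv, _root_.sub_apply, _root_.smul_apply,
      _root_.neg_apply, _root_.add_apply, smul_eq_mul, nsmul_eq_mul,
      innerSL_apply_apply]
    have e : ∀ i : Fin 3, (EuclideanSpace.proj i : E3 →L[ℝ] ℝ) a = a i := fun i => rfl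
    simp only [Nat.add_one_sub_one, pow_one, Nat.cast_ofNat, e]
    ring

/-- The derivative of the Hamiltonian at `z` in the direction `v`. -/
def hamDeriv (μ : ℝ) (z v : E3 × E3) : ℝ :=
  (z.2 0 + z.1 1) * (v.2 0 + v.1 1) + (z.2 1 - z.1 0) * (v.2 1 - v.1 0) + z.2 2 * v.2 2 +
    potentialDeriv μ z.1 v.1

theorem hasFDerivAt_hamiltonian {μ : ℝ} {z : E3 × E3} (hz : z ∈ phaseSpace μ) :
    ∃ L : E3 × E3 →L[ℝ] ℝ, HasFDerivAt (hamiltonian μ) L z ∧ ∀ v, L v = hamDeriv μ z v := by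
  obtain ⟨L, hL, hL'⟩ := hasFDerivAt_potential (μ := μ) (q := z.1) hz
  have hq : ∀ i : Fin 3, HasFDerivAt (fun z : E3 × E3 => z.1 i)
      ((EuclideanSpace.proj i : E3 →L[ℝ] ℝ).comp (ContinuousLinearMap.fst ℝ E3 E3)) z :=
    fun i => ((EuclideanSpace.proj i : E3 →L[ℝ] ℝ).comp
      (ContinuousLinearMap.fst ℝ E3 E3)).hasFDerivAt
  have hp : ∀ i : Fin 3, HasFDerivAt (fun z : E3 × E3 => z.2 i)
      ((EuclideanSpace.proj i : E3 →L[ℝ] ℝ).comp (ContinuousLinearMap.snd ℝ E3 E3)) z :=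
    fun i => ((EuclideanSpace.proj i : E3 →L[ℝ] ℝ).comp
      (ContinuousLinearMap.snd ℝ E3 E3)).hasFDerivAt
  have h := ((((((hp 0).add (hq 1)).pow 2).add (((hp 1).sub (hq 0)).pow 2)).add
    ((hp 2).pow 2)).mul_const (1 / 2)).add (hL.comp z hasFDerivAt_fst)
  refine ⟨_, h.congr_of_eventuallyEq (Filter.Eventually.of_forall fun x => ?_), fun a => ?_⟩
  · rw [hamiltonian_eq]
    simp only [div_eq_mul_inv, one_mul]
    rfl
  · have e : ∀ (i : Fin 3) (a : E3), (EuclideanSpace.proj i : E3 →L[ℝ] ℝ) a = a i :=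
      fun i a => rfl
    simp only [hamDeriv, _root_.sub_apply, _root_.smul_apply,
      _root_.add_apply, smul_eq_mul, nsmul_eq_mul, ContinuousLinearMap.comp_apply,
      e, ContinuousLinearMap.coe_fst', ContinuousLinearMap.coe_snd', hL',
      Pi.add_apply, Pi.sub_apply, Nat.add_one_sub_one, pow_one, Nat.cast_ofNat]
    ring

theorem fderiv_hamiltonian {μ : ℝ} {z : E3 × E3} (hz : z ∈ phaseSpace μ) (v : E3 × E3) :
    fderiv ℝ (hamiltonian μ) z v = hamDeriv μ z v := by
  obtain ⟨L, hL, hL'⟩ := hasFDerivAt_hamiltonian hz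
  rw [hL.fderiv, hL']

theorem contDiffAt_coord (i : Fin 3) (q : E3) : ContDiffAt ℝ ∞ (fun q : E3 => q i) q :=
  (EuclideanSpace.proj i : E3 →L[ℝ] ℝ).contDiff.contDiffAt

theorem contDiffAt_potential {μ : ℝ} {q : E3} (hq : q ∈ offPrimaries μ) :
    ContDiffAt ℝ ∞ (potential μ) q := by
  have hb : ∀ b, ContDiffAt ℝ ∞ (fun q : E3 => ‖q - pos μ b‖) q := fun b =>
    (contDiffAt_id.sub contDiffAt_const).norm ℝ (sub_ne_zero.2 (hq b))
  have hn : ∀ b, ‖q - pos μ b‖ ≠ 0 := fun b => norm_ne_zero_iff.2 (sub_ne_zero.2 (hq b))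
  unfold potential
  exact (((((contDiffAt_coord 0 q).pow 2).add ((contDiffAt_coord 1 q).pow 2)).neg.div_const 2).sub
    (contDiffAt_const.div (hb _) (hn _))).sub (contDiffAt_const.div (hb _) (hn _))

theorem contDiffAt_hamiltonian {μ : ℝ} {z : E3 × E3} (hz : z ∈ phaseSpace μ) :
    ContDiffAt ℝ ∞ (hamiltonian μ) z := by
  have hq : ∀ i : Fin 3, ContDiffAt ℝ ∞ (fun z : E3 × E3 => z.1 i) z :=
    fun i => (contDiffAt_coord i z.1).comp z contDiffAt_fst
  have hp : ∀ i : Fin 3, ContDiffAt ℝ ∞ (fun z : E3 × E3 => z.2 i) z :=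
    fun i => (contDiffAt_coord i z.2).comp z contDiffAt_snd
  have hV : ContDiffAt ℝ ∞ (fun z : E3 × E3 => potential μ z.1) z :=
    (contDiffAt_potential (q := z.1) hz).comp z contDiffAt_fst
  have : hamiltonian μ = fun z => ((z.2 0 + z.1 1) ^ 2 + (z.2 1 - z.1 0) ^ 2 + z.2 2 ^ 2) / 2 +
      potential μ z.1 := funext (hamiltonian_eq μ)
  rw [this]
  exact ((((hp 0).add (hq 1)).pow 2 |>.add (((hp 1).sub (hq 0)).pow 2)).add
    ((hp 2).pow 2) |>.div_const 2).add hV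

/-! ### Polar coordinates around a primary -/

theorem norm_sub_other_sq (μ : ℝ) (b : Primary) (q : E3) :
    ‖q - pos μ b.other‖ ^ 2 = ‖q - pos μ b‖ ^ 2 - 2 * (sgn b * (q - pos μ b) 0) + 1 := by
  rw [norm_sq_three, norm_sq_three]
  simp only [PiLp.sub_apply, pos_other_zero, pos_one, pos_two]
  linear_combination sgn_mul_self b

theorem norm_pos_sub_other (μ : ℝ) (b : Primary) : ‖pos μ b - pos μ b.other‖ = 1 := by
  have h := norm_sub_other_sq μ b (pos μ b)
  simp only [sub_self, norm_zero, PiLp.zero_apply] at h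
  have : ‖pos μ b - pos μ b.other‖ ^ 2 = 1 := by rw [h]; ring
  exact (pow_eq_one_iff_of_nonneg (norm_nonneg _) two_ne_zero).1 this

/-- The squared length of the horizontal part of the direction of `y`. -/
def horiz (y : E3) : ℝ := (y 0 ^ 2 + y 1 ^ 2) / ‖y‖ ^ 2

/-- The cosine of the angle between `y` and the direction from `b` to the other primary. -/
def cosOther (b : Primary) (y : E3) : ℝ := sgn b * y 0 / ‖y‖

theorem horiz_nonneg (y : E3) : 0 ≤ horiz y := by unfold horiz; positivity

theorem horiz_le_one (y : E3) : horiz y ≤ 1 := by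
  unfold horiz
  apply div_le_one_of_le₀ _ (by positivity)
  rw [norm_sq_three]
  nlinarith [sq_nonneg (y 2)]

theorem cosOther_sq_le (b : Primary) (y : E3) : cosOther b y ^ 2 ≤ horiz y := by
  unfold horiz cosOther
  rw [div_pow, mul_pow]
  gcongr
  have : sgn b ^ 2 = 1 := by rw [sq, sgn_mul_self]
  nlinarith [sq_nonneg (y 1)]

theorem cosOther_mem (b : Primary) (y : E3) : cosOther b y ∈ Icc (-1 : ℝ) 1 :=
  abs_le.1 ((sq_le_one_iff_abs_le_one _).1 ((cosOther_sq_le b y).trans (horiz_le_one y)))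

theorem horiz_eq_one_of_cosOther {b : Primary} {y : E3} (h : cosOther b y = 1) : horiz y = 1 :=
  le_antisymm (horiz_le_one y) (by simpa [h] using cosOther_sq_le b y)

section Polar

variable {μ : ℝ} {b : Primary} {q : E3}

theorem norm_mul_cosOther (hq : q ≠ pos μ b) :
    ‖q - pos μ b‖ * cosOther b (q - pos μ b) = sgn b * (q - pos μ b) 0 := by
  have : ‖q - pos μ b‖ ≠ 0 := norm_ne_zero_iff.2 (sub_ne_zero.2 hq)
  unfold cosOther
  field_simp

theorem rayDist_eq (hq : q ≠ pos μ b) :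
    rayDist (cosOther b (q - pos μ b)) ‖q - pos μ b‖ = ‖q - pos μ b.other‖ := by
  rw [rayDist, mul_assoc, norm_mul_cosOther hq, ← norm_sub_other_sq, Real.sqrt_sq (norm_nonneg _)]

theorem potential_eq_rayPot (hq : q ≠ pos μ b) :
    potential μ q = rayPot (mass μ b) (horiz (q - pos μ b)) (cosOther b (q - pos μ b))
      ‖q - pos μ b‖ := by
  have hn : ‖q - pos μ b‖ ≠ 0 := norm_ne_zero_iff.2 (sub_ne_zero.2 hq)
  rw [potential_eq μ b, rayPot, rayDist_eq hq]
  congr 3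
  have e := norm_mul_cosOther hq
  rw [mul_assoc (2 * (1 - mass μ b)), e, horiz, mul_div_cancel₀ _ (pow_ne_zero 2 hn)]
  have h0 : q 0 = (q - pos μ b) 0 - sgn b * (1 - mass μ b) := by
    rw [PiLp.sub_apply, pos_zero]; ring
  have h1 : q 1 = (q - pos μ b) 1 := by simp
  rw [h0, h1]
  linear_combination (-(1 - mass μ b) ^ 2) * sgn_mul_self b

theorem potentialDeriv_eq_raySlope (hq : q ≠ pos μ b) :
    potentialDeriv μ q (q - pos μ b) = ‖q - pos μ b‖ * raySlope (mass μ b) (horiz (q - pos μ b))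
      (cosOther b (q - pos μ b)) ‖q - pos μ b‖ := by
  have hn : ‖q - pos μ b‖ ≠ 0 := norm_ne_zero_iff.2 (sub_ne_zero.2 hq)
  rw [potentialDeriv_eq μ b, raySlope, rayDist_eq hq, real_inner_self_eq_norm_sq]
  have e := norm_mul_cosOther hq
  have eh : horiz (q - pos μ b) * ‖q - pos μ b‖ ^ 2 = (q - pos μ b) 0 ^ 2 + (q - pos μ b) 1 ^ 2 := by
    unfold horiz; field_simp
  have h0 : q 0 = (q - pos μ b) 0 - sgn b * (1 - mass μ b) := by
    rw [PiLp.sub_apply, pos_zero]; ring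
  have h1 : q 1 = (q - pos μ b) 1 := by simp
  have hin : ⟪q - pos μ b.other, q - pos μ b⟫ =
      ‖q - pos μ b‖ ^ 2 - ‖q - pos μ b‖ * cosOther b (q - pos μ b) := by
    rw [e, inner_three, norm_sq_three]
    simp only [PiLp.sub_apply, pos_other_zero, pos_one, pos_two]
    ring
  rw [hin, h0, h1]
  generalize (q - pos μ b) = y at *
  have e2 : mass μ b * ‖y‖ ^ 2 / ‖y‖ ^ 3 = ‖y‖ * (mass μ b / ‖y‖ ^ 2) := by field_simp
  rw [e2]
  rw [show ‖y‖ * (-(‖y‖ * horiz y) + (1 - mass μ b) * cosOther b y + mass μ b / ‖y‖ ^ 2 +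
    (1 - mass μ b) * (‖y‖ - cosOther b y) / ‖q - pos μ b.other‖ ^ 3) =
    -(horiz y * ‖y‖ ^ 2) + (1 - mass μ b) * (‖y‖ * cosOther b y) + ‖y‖ * (mass μ b / ‖y‖ ^ 2) +
    (1 - mass μ b) * (‖y‖ ^ 2 - ‖y‖ * cosOther b y) / ‖q - pos μ b.other‖ ^ 3 by ring, e, eh]
  ring

end Polar

/-- The quantity whose positivity makes the radial Liouville field at `b` transverse to the energy
level `c` over `q`. -/
def radialEnergy (μ : ℝ) (b : Primary) (c : ℝ) (q : E3) : ℝ :=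
  potentialDeriv μ q (q - pos μ b) ^ 2 +
    2 * ((q - pos μ b) 0 ^ 2 + (q - pos μ b) 1 ^ 2) * (potential μ q - c)

theorem radialEnergy_eq {μ : ℝ} {b : Primary} {q : E3} (hq : q ≠ pos μ b) (c : ℝ) :
    radialEnergy μ b c q = ‖q - pos μ b‖ ^ 2 * rayEnergy (mass μ b) (horiz (q - pos μ b))
      (cosOther b (q - pos μ b)) c ‖q - pos μ b‖ := by
  have hn : ‖q - pos μ b‖ ≠ 0 := norm_ne_zero_iff.2 (sub_ne_zero.2 hq)
  have eh : (q - pos μ b) 0 ^ 2 + (q - pos μ b) 1 ^ 2 = horiz (q - pos μ b) * ‖q - pos μ b‖ ^ 2 := by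
    unfold horiz; field_simp
  rw [radialEnergy, rayEnergy, potentialDeriv_eq_raySlope hq, eh, ← potential_eq_rayPot hq]
  ring

/-- The momentum enters the derivative only through αy₁ - βy₀, with (α, β) the horizontal velocity.
Cauchy–Schwarz and the energy bound α² + β² ≤ 2(c - V) keep the square of this below the square of
the radial derivative of V. -/
theorem hamDeriv_radial_pos {μ : ℝ} {b : Primary} {c : ℝ} {z : E3 × E3}
    (hs : 0 < potentialDeriv μ z.1 (z.1 - pos μ b)) (hE : 0 < radialEnergy μ b c z.1)
    (hH : hamiltonian μ z ≤ c) : 0 < hamDeriv μ z (z.1 - pos μ b, 0) := by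
  rw [hamiltonian_eq] at hH
  unfold radialEnergy at hE
  simp only [hamDeriv, PiLp.zero_apply]
  generalize z.1 - pos μ b = y at *
  generalize potentialDeriv μ z.1 y = f at *
  generalize potential μ z.1 = V at *
  generalize z.2 0 + z.1 1 = α at *
  generalize z.2 1 - z.1 0 = β at *
  have h1 : (α * y 1 - β * y 0) ^ 2 ≤ (α ^ 2 + β ^ 2) * (y 0 ^ 2 + y 1 ^ 2) := by
    nlinarith [sq_nonneg (α * y 0 + β * y 1)]
  have h2 : (α ^ 2 + β ^ 2) * (y 0 ^ 2 + y 1 ^ 2) ≤ 2 * (c - V) * (y 0 ^ 2 + y 1 ^ 2) := by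
    gcongr
    nlinarith [sq_nonneg (z.2 2)]
  have h3 : (α * y 1 - β * y 0) ^ 2 < f ^ 2 := by linarith
  have h4 := abs_lt.1 (abs_lt_of_sq_lt_sq h3 hs.le)
  linarith [h4.1]

/-! ### The first Lagrange point -/

/-- `(l, 0, 0)` is the position of the first Lagrange point. -/
structure IsLagrangePos (μ l : ℝ) : Prop where
  mem : μ ∈ Ioo (0 : ℝ) 1
  left : -1 + μ < l
  right : l < μ
  slope : axisSlope μ (l + 1 - μ) = 0

/-- The distance from the primary `b` to `(l, 0, 0)`. -/
def radius (μ l : ℝ) : Primary → ℝ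
  | .earth => μ - l
  | .moon => l + 1 - μ

theorem radius_other (μ l : ℝ) (b : Primary) : radius μ l b.other = 1 - radius μ l b := by
  cases b <;> simp [radius, Primary.other] <;> ring

theorem radius_eq (μ l : ℝ) (b : Primary) : radius μ l b = sgn b * (l - pos μ b 0) := by
  cases b <;> simp [radius, sgn, pos] <;> ring

/-- The axis potential is the same function seen from either end, so both primaries assign L₁ the
same energy. This lets every later estimate be stated for an arbitrary primary b. -/
theorem axisPot_radius (μ l : ℝ) (b : Primary) :
    axisPot (mass μ b) (radius μ l b) = axisPot μ (l + 1 - μ) := by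
  cases b
  · simp only [radius, mass, axisPot]
    rw [show (1 - (μ - l)) = l + 1 - μ by ring, show 1 - (l + 1 - μ) = μ - l by ring]
    ring
  · rfl

namespace IsLagrangePos

variable {μ l : ℝ}

theorem radius_mem (h : IsLagrangePos μ l) (b : Primary) : radius μ l b ∈ Ioo (0 : ℝ) 1 := by
  cases b <;> simp only [radius, mem_Ioo] <;> constructor <;> linarith [h.left, h.right]

theorem axisSlope_radius (h : IsLagrangePos μ l) (b : Primary) :
    axisSlope (mass μ b) (radius μ l b) = 0 := by
  cases b
  · have h1 := h.slope
    unfold axisSlope at *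
    simp only [radius, mass]
    rw [show (1 - (μ - l)) = l + 1 - μ by ring]
    rw [show 1 - (l + 1 - μ) = μ - l by ring] at h1
    linear_combination -h1
  · exact h.slope

end IsLagrangePos

/-- The energy of the first Lagrange point at `(l, 0, 0)`. -/
def critEnergy (μ l : ℝ) : ℝ := axisPot μ (l + 1 - μ)

/-- The momentum derivatives force the velocity to vanish, so the energy equals the effective
potential; the derivative in the direction of the axis is then the slope of the axis potential. -/
theorem IsFirstLagrangePoint.isLagrangePos {μ : ℝ} (hμ : μ ∈ Ioo (0 : ℝ) 1) {L₁ : E3 × E3}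
    (h : IsFirstLagrangePoint μ L₁) :
    IsLagrangePos μ (L₁.1 0) ∧ hamiltonian μ L₁ = critEnergy μ (L₁.1 0) := by
  obtain ⟨hseg, hd⟩ := h
  obtain ⟨q, p⟩ := L₁
  obtain ⟨a, a', ha, ha', hab, hq⟩ := hseg
  simp only at hq ⊢
  have hq1 : q 1 = 0 := by rw [← hq]; simp
  have hq2 : q 2 = 0 := by rw [← hq]; simp
  have hq0 : q 0 = a * (-1 + μ) + a' * μ := by rw [← hq]; simp [pos]
  have hl : -1 + μ < q 0 := by rw [hq0, eq_sub_of_add_eq hab]; nlinarith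
  have hr : q 0 < μ := by rw [hq0, eq_sub_of_add_eq hab]; nlinarith
  have hz : (q, p) ∈ phaseSpace μ := by
    rintro (_ | _) he
    · exact hr.ne (by simpa [pos] using congrArg (fun v : E3 => v 0) he)
    · exact hl.ne' (by simpa [pos] using congrArg (fun v : E3 => v 0) he)
  have hder : ∀ v, hamDeriv μ (q, p) v = 0 := fun v => by rw [← fderiv_hamiltonian hz, hd]; rfl
  have hα : p 0 + q 1 = 0 := by
    simpa [hamDeriv, potentialDeriv] using hder (0, EuclideanSpace.single 0 1)
  have hβ : p 1 - q 0 = 0 := by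
    simpa [hamDeriv, potentialDeriv] using hder (0, EuclideanSpace.single 1 1)
  have hγ : p 2 = 0 := by
    simpa [hamDeriv, potentialDeriv] using hder (0, EuclideanSpace.single 2 1)
  have hM : ‖q - pos μ .moon‖ = q 0 + 1 - μ := by
    have : ‖q - pos μ .moon‖ ^ 2 = (q 0 + 1 - μ) ^ 2 := by
      rw [norm_sq_three]; simp [hq1, hq2, pos]; ring
    exact (pow_left_inj₀ (norm_nonneg _) (by linarith) two_ne_zero).1 this
  have hE : ‖q - pos μ .earth‖ = μ - q 0 := by
    have : ‖q - pos μ .earth‖ ^ 2 = (μ - q 0) ^ 2 := by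
      rw [norm_sq_three]; simp [hq1, hq2, pos]; ring
    exact (pow_left_inj₀ (norm_nonneg _) (by linarith) two_ne_zero).1 this
  have hM0 : q 0 + 1 - μ ≠ 0 := by linarith
  have hE0 : μ - q 0 ≠ 0 := by linarith
  refine ⟨⟨hμ, hl, hr, ?_⟩, ?_⟩
  · have := hder (EuclideanSpace.single 0 1, 0)
    simp only [hamDeriv, potentialDeriv, hM, hE, inner_three, hα, hβ] at this
    simp [pos] at this
    rw [axisSlope, show 1 - (q 0 + 1 - μ) = μ - q 0 by ring]
    have e1 : μ / (q 0 + 1 - μ) ^ 2 = μ * (q 0 - (-1 + μ)) / (q 0 + 1 - μ) ^ 3 := by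
      field_simp
      ring
    have e2 : (1 - μ) / (μ - q 0) ^ 2 = -((1 - μ) * (q 0 - μ) / (μ - q 0) ^ 3) := by
      field_simp
      ring
    rw [e1, e2]
    linear_combination this
  · rw [hamiltonian_eq]
    rw [hα]
    simp only [hβ, hγ, potential, hM, hE, critEnergy, axisPot, hq1]
    rw [show 1 - (q 0 + 1 - μ) = μ - q 0 by ring]
    ring


/-! ### The charts of the regularized phase space -/

/-- The charts of the regularized phase space, as open partial homeomorphisms. -/
def chart (μ : ℝ) (i : Option Primary) : OpenPartialHomeomorph (RegPhase μ) (E3 × E3) :=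
  (regCore μ).openPartialHomeomorph (regChart μ i) (mem_range_self i)

section Charts

variable {μ : ℝ}

theorem chart_mem_atlas (i : Option Primary) : chart μ i ∈ atlas (E3 × E3) (RegPhase μ) :=
  mem_iUnion.2 ⟨regChart μ i, mem_iUnion.2 ⟨mem_range_self i, rfl⟩⟩

theorem exists_eq_chart {e : OpenPartialHomeomorph (RegPhase μ) (E3 × E3)}
    (he : e ∈ atlas (E3 × E3) (RegPhase μ)) : ∃ i, e = chart μ i := by
  obtain ⟨f, hf⟩ := mem_iUnion.1 he
  obtain ⟨⟨i, rfl⟩, hf⟩ := mem_iUnion.1 hf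
  exact ⟨i, mem_singleton_iff.1 hf⟩

theorem chart_mem_maximalAtlas (i : Option Primary) :
    chart μ i ∈ IsManifold.maximalAtlas 𝓘(ℝ, E3 × E3) ∞ (RegPhase μ) :=
  IsManifold.subset_maximalAtlas (chart_mem_atlas i)

theorem chartAt_eq (x : RegPhase μ) : chartAt (E3 × E3) x = chart μ x.chartIndex := rfl

theorem phase_mem {z : E3 × E3} (hz : z ∈ phaseSpace μ) :
    RegPhase.phase z hz ∈ (chart μ none).source := ⟨z, hz, rfl⟩

theorem collision_mem {b : Primary} {η : E3} (hη : η ≠ 0) :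
    (RegPhase.collision b η hη : RegPhase μ) ∈ (chart μ (some b)).source := Or.inr ⟨η, hη, rfl⟩

@[simp] theorem chart_none_phase {z : E3 × E3} (hz : z ∈ phaseSpace μ) :
    chart μ none (.phase z hz) = z := rfl

theorem chart_some_phase {z : E3 × E3} (hz : z ∈ phaseSpace μ) (hp : z.2 ≠ 0) (b : Primary) :
    chart μ (some b) (.phase z hz) = ofQP μ b z := southCoord_phase μ b z hz hp

theorem chart_some_collision (b : Primary) {η : E3} (hη : η ≠ 0) :
    chart μ (some b) (.collision b η hη) = (0, (2 : ℝ) • η) := southCoord_collision μ b b η hη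

theorem chart_none_symm {z : E3 × E3} (hz : z ∈ phaseSpace μ) :
    (chart μ none).symm z = .phase z hz := regChart_symm_none hz

theorem chart_some_symm {b : Primary} {w : E3 × E3} (h0 : w.1 ≠ 0)
    (hz : toQP μ b w ∈ phaseSpace μ) :
    (chart μ (some b)).symm w = .phase (toQP μ b w) hz := regChart_symm_some h0 hz

theorem chart_some_symm_zero {b : Primary} {v : E3} (hv : v ≠ 0) :
    (chart μ (some b)).symm (0, v) = .collision b ((2 : ℝ)⁻¹ • v) (by simpa using hv) := by
  have hη : (2 : ℝ)⁻¹ • v ≠ 0 := by simpa using hv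
  have h := (chart μ (some b)).left_inv (collision_mem hη)
  rw [chart_some_collision] at h
  simpa using h

theorem contMDiffOn_chart' (i : Option Primary) :
    ContMDiffOn 𝓘(ℝ, E3 × E3) 𝓘(ℝ, E3 × E3) ∞ (chart μ i) (chart μ i).source :=
  contMDiffOn_of_mem_maximalAtlas (chart_mem_maximalAtlas i)

theorem contMDiffOn_chart_symm' (i : Option Primary) :
    ContMDiffOn 𝓘(ℝ, E3 × E3) 𝓘(ℝ, E3 × E3) ∞ (chart μ i).symm (chart μ i).target :=
  contMDiffOn_symm_of_mem_maximalAtlas (chart_mem_maximalAtlas i)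

theorem contMDiffAt_of_chart {F : Type*} [NormedAddCommGroup F] [NormedSpace ℝ F]
    {f : RegPhase μ → F} {g : E3 × E3 → F} {i : Option Primary} {x : RegPhase μ}
    (hx : x ∈ (chart μ i).source) (hg : ContDiffAt ℝ ∞ g (chart μ i x))
    (hfg : ∀ᶠ y in 𝓝 x, f y = g (chart μ i y)) :
    ContMDiffAt 𝓘(ℝ, E3 × E3) 𝓘(ℝ, F) ∞ f x := by
  have h1 : ContMDiffAt 𝓘(ℝ, E3 × E3) 𝓘(ℝ, E3 × E3) ∞ (chart μ i) x :=
    (contMDiffOn_chart' i).contMDiffAt ((chart μ i).open_source.mem_nhds hx)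
  exact (ContMDiffAt.comp x hg.contMDiffAt h1).congr_of_eventuallyEq hfg

theorem mfderiv_apply_chartAt {F : Type*} [NormedAddCommGroup F] [NormedSpace ℝ F]
    {f : RegPhase μ → F} {x : RegPhase μ}
    (hf : MDifferentiableAt 𝓘(ℝ, E3 × E3) 𝓘(ℝ, F) f x) (v : E3 × E3) :
    (mfderiv 𝓘(ℝ, E3 × E3) 𝓘(ℝ, F) f x v : F) =
      fderiv ℝ (f ∘ (chart μ x.chartIndex).symm) (chart μ x.chartIndex x) v := by
  rw [hf.mfderiv]
  simp only [writtenInExtChartAt, extChartAt, mfld_simps, fderivWithin_univ]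
  rfl

theorem isOpen_setOf_qp {W : Set (E3 × E3)} (hW : IsOpen W) :
    IsOpen {x : RegPhase μ | ∃ z hz, x = .phase z hz ∧ z ∈ W} := by
  have := (chart μ none).isOpen_inter_preimage hW
  convert this using 1
  ext x
  constructor
  · rintro ⟨z, hz, rfl, h⟩
    exact ⟨phase_mem hz, h⟩
  · rintro ⟨⟨z, hz, rfl⟩, h⟩
    exact ⟨z, hz, rfl, h⟩

/-- The set of the points of the regularized phase space that lie over an open set `N` of positions;
the collisions with `b` lie over the position of `b`. -/
def overPos (μ : ℝ) (N : Set E3) : Set (RegPhase μ) :=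
  {x | (∃ z hz, x = .phase z hz ∧ z.1 ∈ N) ∨ ∃ b η hη, x = .collision b η hη ∧ pos μ b ∈ N}

theorem phase_mem_over {z : E3 × E3} {hz : z ∈ phaseSpace μ} {N : Set E3} :
    RegPhase.phase z hz ∈ overPos μ N ↔ z.1 ∈ N := by
  constructor
  · rintro (⟨z', hz', h, h'⟩ | ⟨b, η, hη, h, -⟩) <;> cases h
    exact h'
  · exact fun h => Or.inl ⟨z, hz, rfl, h⟩

theorem collision_mem_over {b : Primary} {η : E3} {hη : η ≠ 0} {N : Set E3} :
    (RegPhase.collision b η hη : RegPhase μ) ∈ overPos μ N ↔ pos μ b ∈ N := by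
  constructor
  · rintro (⟨z', hz', h, h'⟩ | ⟨b, η, hη, h, h'⟩) <;> cases h
    exact h'
  · exact fun h => Or.inr ⟨b, η, hη, rfl, h⟩

theorem collisionPos_ofQP {b : Primary} {z : E3 × E3} (hp : z.2 ≠ 0) :
    collisionPos μ b (ofQP μ b z) = z.1 := congrArg Prod.fst (toQP_ofQP μ b z hp)

theorem mem_over_iff_collisionPos {b : Primary} {N : Set E3} {x : RegPhase μ}
    (hx : x ∈ (chart μ (some b)).source) :
    x ∈ overPos μ N ↔ collisionPos μ b (chart μ (some b) x) ∈ N := by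
  rcases hx with ⟨z, hz, rfl, hp⟩ | ⟨η, hη, rfl⟩
  · rw [phase_mem_over, chart_some_phase hz hp, collisionPos_ofQP hp]
  · rw [collision_mem_over, chart_some_collision]
    simp [collisionPos]

theorem isOpen_over {N : Set E3} (hN : IsOpen N) : IsOpen (overPos μ N) := by
  rw [isOpen_iff_mem_nhds]
  rintro x (⟨z, hz, rfl, h⟩ | ⟨b, η, hη, rfl, h⟩)
  · refine Filter.mem_of_superset ((isOpen_setOf_qp (μ := μ)
      (hN.preimage continuous_fst)).mem_nhds ⟨z, hz, rfl, h⟩) ?_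
    rintro x ⟨z, hz, rfl, h⟩
    exact Or.inl ⟨z, hz, rfl, h⟩
  · have ho := (chart μ (some b)).isOpen_inter_preimage
      (hN.preimage (contDiff_collisionPos μ b).continuous)
    refine Filter.mem_of_superset (ho.mem_nhds ⟨collision_mem hη, ?_⟩) ?_
    · exact (mem_over_iff_collisionPos (collision_mem hη)).1 (collision_mem_over.2 h)
    · exact fun x hx => (mem_over_iff_collisionPos hx.1).2 hx.2

end Charts

/-! ### Liouville fields -/

theorem canonicalForm_add_left (a a' b : E3 × E3) :
    canonicalForm (a + a') b = canonicalForm a b + canonicalForm a' b := by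
  simp only [canonicalForm, Prod.fst_add, Prod.snd_add, inner_add_left, inner_add_right]
  ring

theorem canonicalForm_add_right (a b b' : E3 × E3) :
    canonicalForm a (b + b') = canonicalForm a b + canonicalForm a b' := by
  simp only [canonicalForm, Prod.fst_add, Prod.snd_add, inner_add_left, inner_add_right]
  ring

/-- The field `Y` satisfies `L_Y ω = ω` at `z`. -/
def LiouvilleAt (Y : E3 × E3 → E3 × E3) (z : E3 × E3) : Prop :=
  ∀ a b, canonicalForm (fderiv ℝ Y z a) b + canonicalForm a (fderiv ℝ Y z b) = canonicalForm a b

theorem LiouvilleAt.congr {Y Y' : E3 × E3 → E3 × E3} {z : E3 × E3} (h : LiouvilleAt Y z)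
    (hY : Y' =ᶠ[𝓝 z] Y) : LiouvilleAt Y' z := by
  unfold LiouvilleAt at *
  rwa [hY.fderiv_eq]

/-- A symplectic coordinate change carries Liouville fields to Liouville fields. -/
theorem LiouvilleAt.pushforward {T Y Z : E3 × E3 → E3 × E3} {z : E3 × E3}
    (hT : ContDiffAt ℝ ∞ T z)
    (hsym : ∀ᶠ z' in 𝓝 z, ∀ a b,
      canonicalForm (fderiv ℝ T z' a) (fderiv ℝ T z' b) = canonicalForm a b)
    (hsurj : Function.Surjective (fderiv ℝ T z)) (hY : DifferentiableAt ℝ Y z)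
    (hYL : LiouvilleAt Y z) (hZ : DifferentiableAt ℝ Z (T z))
    (hZT : ∀ᶠ z' in 𝓝 z, Z (T z') = fderiv ℝ T z' (Y z')) : LiouvilleAt Z (T z) := by
  have hT1 : DifferentiableAt ℝ T z := hT.differentiableAt (by simp)
  have hdT : DifferentiableAt ℝ (fderiv ℝ T) z :=
    (hT.fderiv_right (m := 1) (by norm_cast)).differentiableAt (by simp)
  have hsymm : ∀ v w, fderiv ℝ (fderiv ℝ T) z v w = fderiv ℝ (fderiv ℝ T) z w v :=
    hT.isSymmSndFDerivAt (by simp; norm_cast)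
  -- Differentiate the identity Z ∘ T = DT·Y.
  have hD : ∀ a, fderiv ℝ Z (T z) (fderiv ℝ T z a) =
      fderiv ℝ (fderiv ℝ T) z a (Y z) + fderiv ℝ T z (fderiv ℝ Y z a) := by
    intro a
    have h1 : HasFDerivAt (fun z' => Z (T z')) ((fderiv ℝ Z (T z)).comp (fderiv ℝ T z)) z :=
      hZ.hasFDerivAt.comp z hT1.hasFDerivAt
    have h2 := (hdT.hasFDerivAt.clm_apply hY.hasFDerivAt).congr_of_eventuallyEq hZT
    have := congrArg (fun L => L a) (h1.unique h2)
    simpa [add_comm] using this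
  -- Differentiate the invariance of the form under DT in the direction Y z.
  have hω : ∀ a b, canonicalForm (fderiv ℝ (fderiv ℝ T) z (Y z) a) (fderiv ℝ T z b) +
      canonicalForm (fderiv ℝ T z a) (fderiv ℝ (fderiv ℝ T) z (Y z) b) = 0 := by
    intro a b
    have hap : ∀ a, HasFDerivAt (fun z' => fderiv ℝ T z' a)
        ((fderiv ℝ (fderiv ℝ T) z).flip a) z := fun a => by
      have := hdT.hasFDerivAt.clm_apply (hasFDerivAt_const a z)
      refine this.congr_fderiv ?_
      ext v <;> simp
    have h1 := ((hap a).snd.inner ℝ (hap b).fst).sub ((hap b).snd.inner ℝ (hap a).fst)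
    have h2 : HasFDerivAt (fun _ : E3 × E3 => canonicalForm a b) (0 : E3 × E3 →L[ℝ] ℝ) z :=
      hasFDerivAt_const _ _
    have h3 := h2.congr_of_eventuallyEq (hsym.mono fun z' hz' => hz' a b)
    have h4 := congrArg (fun L => L (Y z)) (h1.unique h3)
    simp at h4
    unfold canonicalForm
    linarith
  intro a' b'
  obtain ⟨a, rfl⟩ := hsurj a'
  obtain ⟨b, rfl⟩ := hsurj b'
  -- Symmetry of D²T moves Y z into the first slot, where `hω` makes the second-order terms cancel.
  -- What remains is the Liouville identity for Y pulled through the symplectic map DT.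
  rw [hD, hD, canonicalForm_add_left, canonicalForm_add_right, hsymm a, hsymm b]
  have h1 := hω a b
  have h2 := hsym.self_of_nhds (fderiv ℝ Y z a) b
  have h3 := hsym.self_of_nhds a (fderiv ℝ Y z b)
  have h4 := hsym.self_of_nhds a b
  have h5 := hYL a b
  linarith

theorem hasFDerivAt_ofQP (μ : ℝ) (b : Primary) {z : E3 × E3} (hp : z.2 ≠ 0) :
    ∃ L : E3 × E3 →L[ℝ] E3 × E3, HasFDerivAt (ofQP μ b) L z ∧ ∀ a, L a =
      ((2 * ⟪z.2, a.2⟫ * ((‖z.2‖ ^ 2)⁻¹) ^ 2) • z.2 - (‖z.2‖ ^ 2)⁻¹ • a.2,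
        (2 * ⟪z.2, a.2⟫) • (z.1 - pos μ b) + ‖z.2‖ ^ 2 • a.1 -
          (2 * (⟪a.2, z.1 - pos μ b⟫ + ⟪z.2, a.1⟫)) • z.2 -
          (2 * ⟪z.2, z.1 - pos μ b⟫) • a.2) := by
  have hn : ‖z.2‖ ^ 2 ≠ 0 := pow_ne_zero 2 (norm_ne_zero_iff.2 hp)
  have h1 : HasFDerivAt (fun z : E3 × E3 => z.1 - pos μ b) (ContinuousLinearMap.fst ℝ E3 E3) z :=
    hasFDerivAt_fst.sub_const _
  have h2 : HasFDerivAt (fun z : E3 × E3 => z.2) (ContinuousLinearMap.snd ℝ E3 E3) z :=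
    hasFDerivAt_snd
  have hN := (hasStrictFDerivAt_norm_sq z.2).hasFDerivAt.comp z h2
  have hN' := (hasDerivAt_inv hn).comp_hasFDerivAt z hN
  have h := (hN'.smul h2).neg.prodMk ((hN.smul h1).sub (((h2.inner ℝ h1).const_mul 2).smul h2))
  refine ⟨_, h, fun a => ?_⟩
  simp only [ContinuousLinearMap.prod_apply]
  refine Prod.ext ?_ ?_
  · simp
    module
  · simp
    rw [real_inner_comm a.1 z.2, real_inner_comm (z.1 - pos μ b) a.2]
    module

/-- With x = -p and y = q - b, the map is the cotangent lift of the inversion x ↦ x/|x|², the change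
between the two stereographic projections. -/
theorem ofQP_symplectic (μ : ℝ) (b : Primary) {z : E3 × E3} (hp : z.2 ≠ 0) (a a' : E3 × E3) :
    canonicalForm (fderiv ℝ (ofQP μ b) z a) (fderiv ℝ (ofQP μ b) z a') = canonicalForm a a' := by
  obtain ⟨L, hL, hL'⟩ := hasFDerivAt_ofQP μ b hp
  have hn : ‖z.2‖ ≠ 0 := norm_ne_zero_iff.2 hp
  rw [hL.fderiv, hL', hL']
  unfold canonicalForm
  generalize z.1 - pos μ b = y
  simp only [inner_add_left, inner_sub_left, inner_sub_right, inner_smul_left,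
    inner_smul_right, RCLike.conj_to_real, real_inner_self_eq_norm_sq]
  rw [real_inner_comm z.2 a.2, real_inner_comm z.2 a'.2, real_inner_comm a.2 a'.2,
    real_inner_comm z.2 a.1, real_inner_comm z.2 a'.1]
  rw [real_inner_comm a'.2 y, real_inner_comm a.2 y, real_inner_comm z.2 y,
    real_inner_comm a.2 a'.1, real_inner_comm a'.2 a.1]
  field_simp
  ring

/-- For fixed p the coordinate u is constant and v is linear in q - b, so the radial field becomes
(0, v). In this form it has no singularity at u = 0. -/
theorem fderiv_ofQP_radial (μ : ℝ) (b : Primary) {z : E3 × E3} (hp : z.2 ≠ 0) :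
    fderiv ℝ (ofQP μ b) z (z.1 - pos μ b, 0) = (0, (ofQP μ b z).2) := by
  obtain ⟨L, hL, hL'⟩ := hasFDerivAt_ofQP μ b hp
  rw [hL.fderiv, hL']
  simp [ofQP]

theorem fderiv_ofQP_surjective (μ : ℝ) (b : Primary) {z : E3 × E3} (hp : z.2 ≠ 0) :
    Function.Surjective (fderiv ℝ (ofQP μ b) z) := by
  have h0 : (ofQP μ b z).1 ≠ 0 := by simpa [ofQP] using hp
  have hT : DifferentiableAt ℝ (ofQP μ b) z :=
    ((contDiffOn_ofQP μ b).contDiffAt ((isOpen_ne_fun continuous_snd continuous_const).mem_nhds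
      hp)).differentiableAt (by simp)
  have hS : DifferentiableAt ℝ (toQP μ b) (ofQP μ b z) :=
    ((contDiffOn_toQP μ b).contDiffAt ((isOpen_ne_fun continuous_fst continuous_const).mem_nhds
      h0)).differentiableAt (by simp)
  have hT' : DifferentiableAt ℝ (ofQP μ b) (toQP μ b (ofQP μ b z)) := by rwa [toQP_ofQP μ b z hp]
  have h1 := hT'.hasFDerivAt.comp _ hS.hasFDerivAt
  have h2 : HasFDerivAt (ofQP μ b ∘ toQP μ b) (ContinuousLinearMap.id ℝ (E3 × E3)) (ofQP μ b z) := by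
    refine (hasFDerivAt_id _).congr_of_eventuallyEq ?_
    filter_upwards [(isOpen_ne_fun continuous_fst continuous_const).mem_nhds h0] with w hw
    exact ofQP_toQP μ b w hw
  have h3 := h1.unique h2
  rw [toQP_ofQP μ b z hp] at h3
  intro v
  exact ⟨_, congrArg (fun L => L v) h3⟩

/-- The field on the regularized phase space that is `Y` on the phase space and the fibrewise radial
field at the collisions. -/
def regField (μ : ℝ) (Y : E3 × E3 → E3 × E3) : ∀ x : RegPhase μ, TangentSpace 𝓘(ℝ, E3 × E3) x
  | .phase z _ => Y z
  -- The collision with covector η has chart coordinates (0, 2η), so this is the value there of the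
  -- field (0, v).
  | .collision _ η _ => ((0, (2 : ℝ) • η) : E3 × E3)

section RegField

variable {μ : ℝ} {Y : E3 × E3 → E3 × E3}

theorem mfderiv_chart {i : Option Primary} {x : RegPhase μ} (hx : x ∈ (chart μ i).source)
    (v : E3 × E3) : (mfderiv 𝓘(ℝ, E3 × E3) 𝓘(ℝ, E3 × E3) (chart μ i) x v : E3 × E3) =
      fderiv ℝ (chart μ i ∘ (chart μ x.chartIndex).symm) (chart μ x.chartIndex x) v :=
  mfderiv_apply_chartAt (((contMDiffOn_chart' i).contMDiffAt
    ((chart μ i).open_source.mem_nhds hx)).mdifferentiableAt (by simp)) v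

theorem fderiv_chart_self {i : Option Primary} {w : E3 × E3} (hw : w ∈ (chart μ i).target)
    (v : E3 × E3) : fderiv ℝ (chart μ i ∘ (chart μ i).symm) w v = v := by
  have : (chart μ i ∘ (chart μ i).symm) =ᶠ[𝓝 w] id := by
    filter_upwards [(chart μ i).open_target.mem_nhds hw] with w' hw'
    exact (chart μ i).right_inv hw'
  rw [this.fderiv_eq]
  simp

theorem chartField_eq {X : ∀ x : RegPhase μ, TangentSpace 𝓘(ℝ, E3 × E3) x} {i : Option Primary}
    {w : E3 × E3} {x : RegPhase μ} (hw : w ∈ (chart μ i).target) (hx : (chart μ i).symm w = x) :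
    chartField X (chart μ i) w =
      fderiv ℝ (chart μ i ∘ (chart μ x.chartIndex).symm) (chart μ x.chartIndex x) (X x) := by
  subst hx
  exact mfderiv_chart ((chart μ i).map_target hw) _

theorem chartField_none {w : E3 × E3} (hw : w ∈ phaseSpace μ) :
    chartField (regField μ Y) (chart μ none) w = Y w := by
  rw [chartField_eq (i := none) hw (chart_none_symm hw)]
  exact fderiv_chart_self (i := none) hw _

theorem chartField_some_zero {b : Primary} {w : E3 × E3} (hw : w ∈ collisionTarget μ b)
    (h0 : w.1 = 0) : chartField (regField μ Y) (chart μ (some b)) w = (0, w.2) := by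
  obtain ⟨u, v⟩ := w
  obtain rfl : u = 0 := h0
  have hv : v ≠ 0 := hw.1
  rw [chartField_eq (i := some b) hw (chart_some_symm_zero hv)]
  refine (fderiv_chart_self (i := some b) ?_ _).trans ?_
  · exact (chart μ (some b)).map_source (collision_mem _)
  · simp [regField]

theorem chartField_some {b : Primary} {w : E3 × E3} (hw : w ∈ collisionTarget μ b)
    (h0 : w.1 ≠ 0) : chartField (regField μ Y) (chart μ (some b)) w =
      fderiv ℝ (ofQP μ b) (toQP μ b w) (Y (toQP μ b w)) := by
  have hz := (collisionTarget_of_toQP h0).1 hw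
  rw [chartField_eq (i := some b) hw (chart_some_symm h0 hz)]
  change fderiv ℝ (chart μ (some b) ∘ (chart μ none).symm) (toQP μ b w) (Y (toQP μ b w)) = _
  have : (chart μ (some b) ∘ (chart μ none).symm) =ᶠ[𝓝 (toQP μ b w)] ofQP μ b := by
    filter_upwards [(isOpen_phaseSpace μ).mem_nhds hz,
      (isOpen_ne_fun continuous_snd continuous_const).mem_nhds (toQP_snd_ne h0)] with z hz hp
    simp only [Function.comp_apply, chart_none_symm hz, chart_some_phase hz hp]
  rw [this.fderiv_eq]

theorem chartField_some_radial {b : Primary} {w : E3 × E3} (hw : w ∈ collisionTarget μ b)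
    (hY : w.1 ≠ 0 → Y (toQP μ b w) = (collisionPos μ b w - pos μ b, 0)) :
    chartField (regField μ Y) (chart μ (some b)) w = (0, w.2) := by
  by_cases h0 : w.1 = 0
  · exact chartField_some_zero hw h0
  · rw [chartField_some hw h0, hY h0]
    have := fderiv_ofQP_radial μ b (z := toQP μ b w) (toQP_snd_ne h0)
    rwa [ofQP_toQP μ b w h0] at this

theorem regField_contMDiffAt {x : RegPhase μ}
    (h : ContDiffAt ℝ ∞ (chartField (regField μ Y) (chart μ x.chartIndex))
      (chart μ x.chartIndex x)) :
    ContMDiffAt 𝓘(ℝ, E3 × E3) 𝓘(ℝ, E3 × E3).tangent ∞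
      (fun x => (⟨x, regField μ Y x⟩ : TangentBundle 𝓘(ℝ, E3 × E3) (RegPhase μ))) x := by
  rw [Bundle.contMDiffAt_section]
  have hx : x ∈ (chart μ x.chartIndex).source := mem_chart_source (E3 × E3) x
  refine contMDiffAt_of_chart hx h ?_
  filter_upwards [(chart μ x.chartIndex).open_source.mem_nhds hx] with y hy
  rw [chartField_eq ((chart μ x.chartIndex).map_source hy) ((chart μ x.chartIndex).left_inv hy),
    TangentBundle.trivializationAt_apply]
  simp only [chartAt_eq, mfld_simps, fderivWithin_univ]

/-- A Liouville field on the phase space that is the radial field near some primaries is a Liouville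
field on the regularized phase space, away from the collisions with the other primaries. -/
theorem regField_isLiouvilleOn {Bs : Set Primary} (hsm : ContDiffOn ℝ ∞ Y (phaseSpace μ))
    (hL : ∀ z ∈ phaseSpace μ, LiouvilleAt Y z)
    (hrad : ∀ b ∈ Bs, ∀ᶠ q in 𝓝 (pos μ b), ∀ p, Y (q, p) = (q - pos μ b, 0)) :
    IsLiouvilleOn (regField μ Y)
      {x | (∃ z hz, x = .phase z hz) ∨ ∃ b η hη, x = .collision b η hη ∧ b ∈ Bs} := by
  -- Chart points close to (0, v) have positions close to b, where Y is radial. Hence in the chart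
  -- the field equals (0, v) on a whole neighbourhood, including the points with u = 0; smoothness
  -- and the Liouville identity at collisions follow.
  have hnear : ∀ b ∈ Bs, ∀ v : E3, v ≠ 0 →
      chartField (regField μ Y) (chart μ (some b)) =ᶠ[𝓝 (0, v)] fun w => (0, w.2) := by
    intro b hb v hv
    have hmem : ((0, v) : E3 × E3) ∈ collisionTarget μ b :=
      ⟨hv, by simpa [collisionPos] using pos_ne μ b⟩
    have hc : Filter.Tendsto (collisionPos μ b) (𝓝 (0, v)) (𝓝 (pos μ b)) := by
      have := (contDiff_collisionPos μ b).continuous.tendsto ((0, v) : E3 × E3)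
      simpa [collisionPos] using this
    filter_upwards [(isOpen_collisionTarget μ b).mem_nhds hmem, hc.eventually (hrad b hb)]
      with w hw hw'
    exact chartField_some_radial hw fun _ => hw' _
  constructor
  · rintro x (⟨z, hz, rfl⟩ | ⟨b, η, hη, rfl, hb⟩)
    · refine (regField_contMDiffAt ?_).contMDiffWithinAt
      refine (hsm.contDiffAt ((isOpen_phaseSpace μ).mem_nhds hz)).congr_of_eventuallyEq ?_
      filter_upwards [(isOpen_phaseSpace μ).mem_nhds hz] with w hw
      exact chartField_none hw
    · refine (regField_contMDiffAt ?_).contMDiffWithinAt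
      change ContDiffAt ℝ ∞ _ (chart μ (some b) (.collision b η hη))
      rw [chart_some_collision]
      refine ContDiffAt.congr_of_eventuallyEq ?_ (hnear b hb _ (by simpa using hη))
      exact contDiffAt_const.prodMk contDiffAt_snd
  · intro e he w hw hU
    obtain ⟨i, rfl⟩ := exists_eq_chart he
    change LiouvilleAt _ w
    rcases i with _ | b
    · have hw : w ∈ phaseSpace μ := hw
      refine (hL w hw).congr ?_
      filter_upwards [(isOpen_phaseSpace μ).mem_nhds hw] with w hw
      exact chartField_none hw
    · have hw : w ∈ collisionTarget μ b := hw
      by_cases h0 : w.1 = 0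
      · obtain ⟨u, v⟩ := w
        obtain rfl : u = 0 := h0
        rw [chart_some_symm_zero hw.1] at hU
        have hb : b ∈ Bs := by
          rcases hU with ⟨z, hz, h⟩ | ⟨b', η, hη, h, hb⟩ <;> cases h
          exact hb
        refine LiouvilleAt.congr ?_ (hnear b hb v hw.1)
        have hd : HasFDerivAt (fun w : E3 × E3 => ((0, w.2) : E3 × E3))
            ((0 : E3 × E3 →L[ℝ] E3).prod (ContinuousLinearMap.snd ℝ E3 E3)) (0, v) :=
          (hasFDerivAt_const _ _).prodMk hasFDerivAt_snd
        intro a a'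
        rw [hd.fderiv]
        simp [canonicalForm, sub_eq_add_neg]
      · have hz := (collisionTarget_of_toQP h0).1 hw
        have hp := toQP_snd_ne (μ := μ) (b := b) h0
        have hT := (contDiffOn_ofQP μ b).contDiffAt
          ((isOpen_ne_fun continuous_snd continuous_const).mem_nhds hp)
        have hS := (contDiffOn_toQP μ b).contDiffAt
          ((isOpen_ne_fun continuous_fst continuous_const).mem_nhds h0)
        have hYd := hsm.contDiffAt ((isOpen_phaseSpace μ).mem_nhds hz)
        have hZ : chartField (regField μ Y) (chart μ (some b)) =ᶠ[𝓝 w]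
            fun w => fderiv ℝ (ofQP μ b) (toQP μ b w) (Y (toQP μ b w)) := by
          filter_upwards [(isOpen_collisionTarget μ b).mem_nhds hw,
            (isOpen_ne_fun continuous_fst continuous_const).mem_nhds h0] with w hw h0
          exact chartField_some hw h0
        refine LiouvilleAt.congr ?_ hZ
        have key := LiouvilleAt.pushforward (Y := Y) (z := toQP μ b w)
          (Z := fun w => fderiv ℝ (ofQP μ b) (toQP μ b w) (Y (toQP μ b w))) hT ?_
          (fderiv_ofQP_surjective μ b hp) (hYd.differentiableAt (by simp)) (hL _ hz) ?_ ?_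
        · rwa [ofQP_toQP μ b w h0] at key
        · filter_upwards [(isOpen_ne_fun continuous_snd continuous_const).mem_nhds hp] with z hz
          exact ofQP_symplectic μ b hz
        · rw [ofQP_toQP μ b w h0]
          have hdT : DifferentiableAt ℝ (fderiv ℝ (ofQP μ b)) (toQP μ b w) :=
            (hT.fderiv_right (m := 1) (by norm_cast)).differentiableAt (by simp)
          have hSd := hS.differentiableAt (by simp)
          exact (hdT.comp w hSd).clm_apply ((hYd.differentiableAt (by simp)).comp w hSd)
        · filter_upwards [(isOpen_ne_fun continuous_snd continuous_const).mem_nhds hp] with z hz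
          rw [toQP_ofQP μ b z hz]

end RegField


/-! ### Regularized level sets -/

/-- The Hamiltonian with an additional potential `χ`. -/
def modHam (μ : ℝ) (χ : E3 → ℝ) (z : E3 × E3) : ℝ := hamiltonian μ z + χ z.1

/-- The regularized level set of the Hamiltonian over the set `Ω` of positions. -/
def surf (μ : ℝ) (χ : E3 → ℝ) (c : ℝ) (Ω : Set E3) : Set (RegPhase μ) :=
  {x | (∃ z hz, x = .phase z hz ∧ z.1 ∈ Ω ∧ modHam μ χ z = c) ∨
    ∃ b η hη, x = .collision b η hη ∧ pos μ b ∈ Ω ∧ ‖η‖ = mass μ b}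

/-- The regularized Hamiltonian in the coordinates `(u, v)` around the collisions with `b`: the
energy, multiplied by `‖u‖ ^ 2`. -/
def colFun (μ : ℝ) (b : Primary) (χ : E3 → ℝ) (c : ℝ) (w : E3 × E3) : ℝ :=
  1 / 2 - mass μ b / ‖w.2‖ - ‖w.1‖ ^ 2 * ((1 - mass μ b) / ‖collisionPos μ b w - pos μ b.other‖) +
    (w.1 1 * collisionPos μ b w 0 - w.1 0 * collisionPos μ b w 1) +
    ‖w.1‖ ^ 2 * (χ (collisionPos μ b w) - c)

section Surf

variable {μ : ℝ} {b : Primary} {χ : E3 → ℝ} {c : ℝ} {Ω : Set E3}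

theorem phase_mem_surf {z : E3 × E3} {hz : z ∈ phaseSpace μ} :
    RegPhase.phase z hz ∈ surf μ χ c Ω ↔ z.1 ∈ Ω ∧ modHam μ χ z = c := by
  constructor
  · rintro (⟨z', hz', h, h'⟩ | ⟨b, η, hη, h, -⟩) <;> cases h
    exact h'
  · exact fun h => Or.inl ⟨z, hz, rfl, h⟩

theorem collision_mem_surf {η : E3} {hη : η ≠ 0} :
    (RegPhase.collision b η hη : RegPhase μ) ∈ surf μ χ c Ω ↔ pos μ b ∈ Ω ∧ ‖η‖ = mass μ b := by
  constructor
  · rintro (⟨z', hz', h, h'⟩ | ⟨b, η, hη, h, h'⟩) <;> cases h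
    exact h'
  · exact fun h => Or.inr ⟨b, η, hη, rfl, h⟩

/-- The vector is |u|² times the reflection of v in the plane orthogonal to u. -/
theorem norm_reflect (u v : E3) : ‖‖u‖ ^ 2 • v - (2 * ⟪u, v⟫) • u‖ = ‖u‖ ^ 2 * ‖v‖ := by
  refine (pow_left_inj₀ (norm_nonneg _) (by positivity) two_ne_zero).1 ?_
  rw [← real_inner_self_eq_norm_sq]
  simp only [inner_sub_left, inner_sub_right, inner_smul_left, inner_smul_right,
    RCLike.conj_to_real, real_inner_self_eq_norm_sq]
  rw [real_inner_comm u v]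
  ring

/-- In these coordinates |q - b| = |u|²|v| and |p||u| = 1. So the factor |u|² turns the kinetic
energy into a constant and the collision singularity into the smooth term m/|v|. -/
theorem colFun_eq {w : E3 × E3} (h0 : w.1 ≠ 0) :
    colFun μ b χ c w = ‖w.1‖ ^ 2 * (modHam μ χ (toQP μ b w) - c) := by
  have hn : ‖w.1‖ ≠ 0 := norm_ne_zero_iff.2 h0
  rw [modHam, hamiltonian_eq, potential_eq μ b]
  have e1 : ‖collisionPos μ b w - pos μ b‖ = ‖w.1‖ ^ 2 * ‖w.2‖ := by
    rw [collisionPos, add_sub_cancel_left, norm_reflect]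
  simp only [toQP, colFun, e1]
  generalize collisionPos μ b w = q
  have e2 : mass μ b / (‖w.1‖ ^ 2 * ‖w.2‖) = (‖w.1‖ ^ 2)⁻¹ * (mass μ b / ‖w.2‖) := by
    rw [div_mul_eq_div_div, div_right_comm, div_eq_inv_mul _ (‖w.1‖ ^ 2)]
  rw [e2]
  simp only [PiLp.neg_apply, PiLp.smul_apply, smul_eq_mul]
  have e3 := norm_sq_three w.1
  field_simp
  linear_combination e3

theorem colFun_zero (v : E3) : colFun μ b χ c (0, v) = 1 / 2 - mass μ b / ‖v‖ := by
  simp [colFun]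

theorem contDiffAt_colFun {w : E3 × E3} (hw : w ∈ collisionTarget μ b)
    (hχ : ContDiffAt ℝ ∞ χ (collisionPos μ b w)) : ContDiffAt ℝ ∞ (colFun μ b χ c) w := by
  have hq := (contDiff_collisionPos μ b).contDiffAt (x := w)
  have hc : ∀ i : Fin 3, ContDiffAt ℝ ∞ (fun w => collisionPos μ b w i) w := fun i =>
    (contDiffAt_coord i _).comp w hq
  have hu : ∀ i : Fin 3, ContDiffAt ℝ ∞ (fun w : E3 × E3 => w.1 i) w := fun i =>
    (contDiffAt_coord i _).comp w contDiffAt_fst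
  have hN : ContDiffAt ℝ ∞ (fun w : E3 × E3 => ‖w.1‖ ^ 2) w := contDiffAt_fst.norm_sq ℝ
  unfold colFun
  refine ((((contDiffAt_const.sub (contDiffAt_const.div (contDiffAt_snd.norm ℝ hw.1)
    (norm_ne_zero_iff.2 hw.1))).sub (hN.mul (contDiffAt_const.div
      ((hq.sub contDiffAt_const).norm ℝ (sub_ne_zero.2 hw.2))
      (norm_ne_zero_iff.2 (sub_ne_zero.2 hw.2))))).add
    (((hu 1).mul (hc 0)).sub ((hu 0).mul (hc 1)))).add
    (hN.mul ((hχ.comp w hq).sub contDiffAt_const)))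

theorem mem_surf_iff_colFun {x : RegPhase μ}
    (hx : x ∈ (chart μ (some b)).source) (hxΩ : x ∈ overPos μ Ω) :
    x ∈ surf μ χ c Ω ↔ colFun μ b χ c (chart μ (some b) x) = 0 := by
  rcases hx with ⟨z, hz, rfl, hp⟩ | ⟨η, hη, rfl⟩
  · rw [phase_mem_over] at hxΩ
    rw [phase_mem_surf, chart_some_phase hz hp, colFun_eq (ofQP_mem hz hp).1, toQP_ofQP μ b z hp]
    have : ‖(ofQP μ b z).1‖ ^ 2 ≠ 0 :=
      pow_ne_zero 2 (norm_ne_zero_iff.2 (ofQP_mem (b := b) hz hp).1)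
    rw [mul_eq_zero, or_iff_right this, sub_eq_zero]
    exact and_iff_right hxΩ
  · rw [collision_mem_over] at hxΩ
    rw [collision_mem_surf, chart_some_collision, colFun_zero, norm_smul]
    have : ‖η‖ ≠ 0 := norm_ne_zero_iff.2 hη
    rw [and_iff_right hxΩ]
    simp only [Real.norm_ofNat]
    field_simp
    constructor <;> intro h <;> linarith

/-- At u = 0 the regularized Hamiltonian changes sign when v is scaled through the collision point.
By continuity it still does so for small u ≠ 0, and the intermediate value theorem gives
noncollision points of the level nearby. -/
theorem collision_mem_closure (hm : μ ∈ Ioo (0 : ℝ) 1) (hΩ : IsOpen Ω)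
    (hχ : ∀ᶠ q in 𝓝 (pos μ b), ContDiffAt ℝ ∞ χ q) (hb : pos μ b ∈ Ω) {η : E3} (hη : η ≠ 0)
    (hn : ‖η‖ = mass μ b) :
    (RegPhase.collision b η hη : RegPhase μ) ∈
      closure {x | ∃ z hz, x = .phase z hz ∧ z.1 ∈ Ω ∧ modHam μ χ z = c} := by
  set v : E3 := (2 : ℝ) • η with hv
  have hv0 : v ≠ 0 := by simpa [hv] using hη
  have hvn : ‖v‖ = 2 * mass μ b := by rw [hv, norm_smul, hn]; simp
  have hmp := (mass_mem hm b).1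
  have hmem : ((0, v) : E3 × E3) ∈ collisionTarget μ b :=
    ⟨hv0, by simpa [collisionPos] using pos_ne μ b⟩
  rw [mem_closure_iff_nhds]
  intro O hO
  have hO' : (chart μ (some b)).symm ⁻¹' O ∈ 𝓝 ((0, v) : E3 × E3) := by
    refine ((chart μ (some b)).continuousAt_symm hmem).preimage_mem_nhds ?_
    rw [chart_some_symm_zero hv0]
    simpa [hv] using hO
  have hcont : Continuous (fun s : E3 × ℝ => (s.1, s.2 • v)) := by fun_prop
  have hev : ∀ᶠ s : E3 × ℝ in 𝓝 (0, 1), (s.1, s.2 • v) ∈ (chart μ (some b)).symm ⁻¹' O ∧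
      (s.1, s.2 • v) ∈ collisionTarget μ b ∧ collisionPos μ b (s.1, s.2 • v) ∈ Ω ∧
      ContDiffAt ℝ ∞ (colFun μ b χ c) (s.1, s.2 • v) := by
    have h1 : Filter.Tendsto (fun s : E3 × ℝ => (s.1, s.2 • v)) (𝓝 (0, 1)) (𝓝 (0, v)) := by
      have := hcont.tendsto ((0, 1) : E3 × ℝ)
      simpa using this
    have h2 : Filter.Tendsto (collisionPos μ b) (𝓝 (0, v)) (𝓝 (pos μ b)) := by
      have := (contDiff_collisionPos μ b).continuous.tendsto ((0, v) : E3 × E3)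
      simpa [collisionPos] using this
    have h3 : ∀ᶠ w in 𝓝 ((0, v) : E3 × E3), ContDiffAt ℝ ∞ (colFun μ b χ c) w := by
      filter_upwards [h2.eventually hχ, (isOpen_collisionTarget μ b).mem_nhds hmem] with w h h'
      exact contDiffAt_colFun h' h
    exact h1.eventually (Filter.eventually_and.2 ⟨hO', Filter.eventually_and.2
      ⟨(isOpen_collisionTarget μ b).mem_nhds hmem, Filter.eventually_and.2
        ⟨h2.eventually (hΩ.mem_nhds hb), h3⟩⟩⟩)
  obtain ⟨r, hr, hball⟩ := Metric.eventually_nhds_iff_ball.1 hev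
  set τ := min (r / 2) (1 / 2) with hτ
  have hτ0 : 0 < τ := by positivity
  have hτ1 : τ ≤ 1 / 2 := min_le_right _ _
  have hτr : τ < r := (min_le_left _ _).trans_lt (by linarith)
  have hin : ∀ u : E3, ‖u‖ < r → ∀ t ∈ Icc (1 - τ) (1 + τ), ((u, t) : E3 × ℝ) ∈
      Metric.ball ((0, 1) : E3 × ℝ) r := by
    intro u hu t ht
    rw [Metric.mem_ball, Prod.dist_eq, max_lt_iff]
    refine ⟨by simpa using hu, ?_⟩
    rw [Real.dist_eq, abs_lt]
    constructor <;> linarith [ht.1, ht.2]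
  have hsign : ∀ t : ℝ, 0 < t → colFun μ b χ c (0, t • v) = 1 / 2 * (1 - t⁻¹) := by
    intro t ht
    rw [colFun_zero, norm_smul, hvn, Real.norm_of_nonneg ht.le]
    field_simp
  have hcu : ∀ t ∈ Icc (1 - τ) (1 + τ),
      ContinuousAt (fun u : E3 => colFun μ b χ c (u, t • v)) 0 := by
    intro t ht
    have := (hball _ (hin 0 (by simpa using hr) t ht)).2.2.2.continuousAt
    exact ContinuousAt.comp (f := fun u : E3 => (u, t • v)) this (by fun_prop)
  have hneg : ∀ᶠ u : E3 in 𝓝 0, colFun μ b χ c (u, (1 - τ) • v) < 0 := by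
    refine (hcu (1 - τ) ⟨le_rfl, by linarith⟩).eventually_lt_const ?_
    beta_reduce
    rw [hsign _ (by linarith)]
    have : 1 < (1 - τ)⁻¹ := (one_lt_inv₀ (by linarith)).2 (by linarith)
    linarith
  have hpos : ∀ᶠ u : E3 in 𝓝 0, 0 < colFun μ b χ c (u, (1 + τ) • v) := by
    refine (hcu (1 + τ) ⟨by linarith, le_rfl⟩).eventually_const_lt ?_
    beta_reduce
    rw [hsign _ (by linarith)]
    have : (1 + τ)⁻¹ < 1 := inv_lt_one_of_one_lt₀ (by linarith)
    linarith
  have hlt : ∀ᶠ u : E3 in 𝓝 0, ‖u‖ < r := by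
    filter_upwards [Metric.ball_mem_nhds (0 : E3) hr] with u hu
    simpa using hu
  obtain ⟨u, ⟨⟨hu1, hu2⟩, hu3⟩, hu0⟩ :=
    ((hneg.and hpos).and hlt |>.filter_mono nhdsWithin_le_nhds |>.and
      (self_mem_nhdsWithin (s := {(0 : E3)}ᶜ))).exists
  have hu0 : u ≠ 0 := hu0
  have hIVT : ContinuousOn (fun t : ℝ => colFun μ b χ c (u, t • v)) (Icc (1 - τ) (1 + τ)) := by
    intro t ht
    have := (hball _ (hin u hu3 t ht)).2.2.2.continuousAt
    exact (ContinuousAt.comp (f := fun t : ℝ => (u, t • v)) this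
      (by fun_prop)).continuousWithinAt
  obtain ⟨t, ht, ht0⟩ := intermediate_value_Icc (by linarith) hIVT ⟨hu1.le, hu2.le⟩
  obtain ⟨h1, h2, h3, -⟩ := hball _ (hin u hu3 t ht)
  have hz := (collisionTarget_of_toQP (w := (u, t • v)) hu0).1 h2
  refine ⟨_, h1, toQP μ b (u, t • v), hz, chart_some_symm hu0 hz, h3, ?_⟩
  have ht0 : colFun μ b χ c (u, t • v) = 0 := ht0
  rw [colFun_eq hu0, mul_eq_zero] at ht0
  exact sub_eq_zero.1 (ht0.resolve_left (pow_ne_zero 2 (norm_ne_zero_iff.2 hu0)))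

theorem potential_le_hamiltonian (μ : ℝ) (z : E3 × E3) : potential μ z.1 ≤ hamiltonian μ z := by
  rw [hamiltonian_eq]
  have : 0 ≤ ((z.2 0 + z.1 1) ^ 2 + (z.2 1 - z.1 0) ^ 2 + z.2 2 ^ 2) / 2 := by positivity
  linarith

/-- The closure of the part of an energy level over a set of positions. -/
theorem closure_level_eq_surf (hm : μ ∈ Ioo (0 : ℝ) 1) (hΩ : IsOpen Ω)
    (hbd : ∀ q ∈ closure Ω, q ∉ Ω → q ∈ offPrimaries μ ∧ c < potential μ q) :
    closure {x : RegPhase μ | ∃ z hz, x = .phase z hz ∧ z.1 ∈ Ω ∧ hamiltonian μ z = c} =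
      surf μ 0 c Ω := by
  have hsub : {x : RegPhase μ | ∃ z hz, x = .phase z hz ∧ z.1 ∈ Ω ∧ hamiltonian μ z = c} =
      {x : RegPhase μ | ∃ z hz, x = .phase z hz ∧ z.1 ∈ Ω ∧ modHam μ 0 z = c} := by
    simp [modHam]
  apply subset_antisymm
  · apply closure_minimal
    · rintro x ⟨z, hz, rfl, h, h'⟩
      exact Or.inl ⟨z, hz, rfl, h, by simpa [modHam] using h'⟩
    · rw [← isOpen_compl_iff, isOpen_iff_mem_nhds]
      -- Frontier positions carry no points of energy c by `hbd`. So a point outside the surface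
      -- either lies over the exterior of Ω, or it is separated from the surface by its defining
      -- function.
      have hout : ∀ x ∈ overPos μ (closure Ω)ᶜ, (surf μ 0 c Ω)ᶜ ∈ 𝓝 x := by
        intro x hx
        refine Filter.mem_of_superset ((isOpen_over isClosed_closure.isOpen_compl).mem_nhds hx) ?_
        intro y hy hyS
        rcases hyS with (⟨z, hz, rfl, h, -⟩ | ⟨b, η, hη, rfl, h, -⟩)
        · exact phase_mem_over.1 hy (subset_closure h)
        · exact collision_mem_over.1 hy (subset_closure h)
      rintro (⟨z, hz⟩ | ⟨b, η, hη⟩) hx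
      · by_cases hH : hamiltonian μ z = c
        · have hzΩ : z.1 ∉ Ω := fun h => hx (phase_mem_surf.2 ⟨h, by simpa [modHam] using hH⟩)
          refine hout _ (phase_mem_over.2 fun hcl => ?_)
          have := (hbd _ hcl hzΩ).2
          linarith [potential_le_hamiltonian μ z]
        · have hev : ∀ᶠ z' in 𝓝 z, hamiltonian μ z' ≠ c :=
            (contDiffAt_hamiltonian hz).continuousAt.eventually_ne hH
          obtain ⟨W, hW, hWo, hzW⟩ := eventually_nhds_iff.1 hev
          refine Filter.mem_of_superset ((isOpen_setOf_qp hWo).mem_nhds ⟨z, hz, rfl, hzW⟩) ?_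
          rintro y ⟨z', hz', rfl, hz'W⟩ hy
          exact hW z' hz'W (by simpa [modHam] using (phase_mem_surf.1 hy).2)
      · by_cases hb : pos μ b ∈ Ω
        · have hcol := collision_mem (μ := μ) (b := b) hη
          have h0 : colFun μ b 0 c (chart μ (some b) (.collision b η hη)) ≠ 0 := fun h =>
            hx ((mem_surf_iff_colFun hcol (collision_mem_over.2 hb)).2 h)
          have hc : ContinuousAt (fun y => colFun μ b 0 c (chart μ (some b) y))
              (.collision b η hη) :=
            ContinuousAt.comp (contDiffAt_colFun ((chart μ (some b)).map_source hcol)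
              contDiffAt_const).continuousAt ((chart μ (some b)).continuousAt hcol)
          filter_upwards [hc.eventually_ne h0, (chart μ (some b)).open_source.mem_nhds hcol,
            (isOpen_over hΩ).mem_nhds (collision_mem_over.2 hb)] with y h1 h2 h3 h4
          exact h1 ((mem_surf_iff_colFun h2 h3).1 h4)
        · exact hout _ (collision_mem_over.2 fun hcl => (hbd _ hcl hb).1 b rfl)
  · rw [hsub]
    rintro x (⟨z, hz, rfl, h⟩ | ⟨b, η, hη, rfl, hb, hn⟩)
    · exact subset_closure ⟨z, hz, rfl, h⟩
    · exact collision_mem_closure hm hΩ (Filter.Eventually.of_forall fun _ => contDiffAt_const) hb hη hn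

/-- A Liouville field that is radial near the primaries in `Ω` and transverse to the energy level
makes the regularized level a hypersurface of contact type. -/
theorem surf_isContactType (hm : μ ∈ Ioo (0 : ℝ) 1) (hΩ : IsOpen Ω) {Y : E3 × E3 → E3 × E3}
    (hsm : ContDiffOn ℝ ∞ Y (phaseSpace μ)) (hL : ∀ z ∈ phaseSpace μ, LiouvilleAt Y z)
    (hrad : ∀ b, pos μ b ∈ Ω → ∀ᶠ q in 𝓝 (pos μ b), ∀ p, Y (q, p) = (q - pos μ b, 0))
    (htr : ∀ z ∈ phaseSpace μ, z.1 ∈ Ω → hamiltonian μ z = c → hamDeriv μ z (Y z) ≠ 0) :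
    IsContactType (surf μ 0 c Ω) := by
  refine ⟨_, regField μ Y, ?_, ?_, regField_isLiouvilleOn (Bs := {b | pos μ b ∈ Ω}) hsm hL hrad, ?_⟩
  · rw [isOpen_iff_mem_nhds]
    rintro x (⟨z, hz, rfl⟩ | ⟨b, η, hη, rfl, hb⟩)
    · filter_upwards [(chart μ none).open_source.mem_nhds (phase_mem hz)] with x hx
      exact Or.inl hx
    · filter_upwards [(chart μ (some b)).open_source.mem_nhds (collision_mem hη)] with x hx
      rcases hx with ⟨z, hz, rfl, -⟩ | ⟨η, hη, rfl⟩
      exacts [Or.inl ⟨z, hz, rfl⟩, Or.inr ⟨b, η, hη, rfl, hb⟩]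
  · rintro x (⟨z, hz, rfl, -⟩ | ⟨b, η, hη, rfl, hb, -⟩)
    exacts [Or.inl ⟨z, hz, rfl⟩, Or.inr ⟨b, η, hη, rfl, hb⟩]
  · rintro x (⟨z, hz, rfl, hzΩ, hH⟩ | ⟨b, η, hη, rfl, hb, hn⟩)
    · have hsmg : ∀ x ∈ (chart μ none).source, ContMDiffAt 𝓘(ℝ, E3 × E3) 𝓘(ℝ, ℝ) ∞
          (fun x => hamiltonian μ (chart μ none x) - c) x := by
        intro x hx
        refine contMDiffAt_of_chart (g := fun z => hamiltonian μ z - c) hx ?_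
          (Filter.Eventually.of_forall fun _ => rfl)
        exact (contDiffAt_hamiltonian ((chart μ none).map_source hx)).sub contDiffAt_const
      refine ⟨overPos μ Ω ∩ (chart μ none).source, fun x => hamiltonian μ (chart μ none x) - c,
        (isOpen_over hΩ).inter (chart μ none).open_source, ⟨phase_mem_over.2 hzΩ, phase_mem hz⟩,
        fun x hx => (hsmg x hx.2).contMDiffWithinAt, ?_, ?_⟩
      · ext x
        constructor
        · rintro ⟨hS, hO, z, hz, rfl⟩
          have := (phase_mem_surf.1 hS).2
          exact ⟨⟨hO, phase_mem hz⟩, by simpa [modHam, sub_eq_zero] using this⟩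
        · rintro ⟨⟨hO, z, hz, rfl⟩, h⟩
          exact ⟨phase_mem_surf.2 ⟨phase_mem_over.1 hO, by simpa [modHam, sub_eq_zero] using h⟩,
            hO, phase_mem hz⟩
      · have h1 := mfderiv_apply_chartAt
          ((hsmg _ (phase_mem hz)).mdifferentiableAt (by simp)) (Y z)
        refine ne_of_eq_of_ne h1 ?_
        change fderiv ℝ ((fun x => hamiltonian μ (chart μ none x) - c) ∘ (chart μ none).symm) z
          (Y z) ≠ 0
        have h2 : ((fun x => hamiltonian μ (chart μ none x) - c) ∘ (chart μ none).symm) =ᶠ[𝓝 z]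
            fun z => hamiltonian μ z - c := by
          filter_upwards [(isOpen_phaseSpace μ).mem_nhds hz] with z' hz'
          simp [chart_none_symm hz']
        rw [h2.fderiv_eq, fderiv_sub_const, fderiv_hamiltonian hz]
        exact htr z hz hzΩ (by simpa [modHam] using hH)
    · have hsmg : ∀ x ∈ (chart μ (some b)).source, ContMDiffAt 𝓘(ℝ, E3 × E3) 𝓘(ℝ, ℝ) ∞
          (fun x => colFun μ b 0 c (chart μ (some b) x)) x := by
        intro x hx
        exact contMDiffAt_of_chart (g := colFun μ b 0 c) hx (contDiffAt_colFun
          ((chart μ (some b)).map_source hx) contDiffAt_const)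
          (Filter.Eventually.of_forall fun _ => rfl)
      have hcol := collision_mem (μ := μ) (b := b) hη
      refine ⟨overPos μ Ω ∩ (chart μ (some b)).source,
        fun x => colFun μ b 0 c (chart μ (some b) x),
        (isOpen_over hΩ).inter (chart μ (some b)).open_source,
        ⟨collision_mem_over.2 hb, hcol⟩,
        fun x hx => (hsmg x hx.2).contMDiffWithinAt, ?_, ?_⟩
      · ext x
        constructor
        · rintro ⟨hS, hO, hx⟩
          exact ⟨⟨hO, hx⟩, (mem_surf_iff_colFun hx hO).1 hS⟩
        · rintro ⟨⟨hO, hx⟩, h⟩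
          exact ⟨(mem_surf_iff_colFun hx hO).2 h, hO, hx⟩
      · set v : E3 := (2 : ℝ) • η with hv
        have hv0 : v ≠ 0 := by simpa [hv] using hη
        have hmem : ((0, v) : E3 × E3) ∈ collisionTarget μ b :=
          ⟨hv0, by simpa [collisionPos] using pos_ne μ b⟩
        have h1 := mfderiv_apply_chartAt
          ((hsmg _ hcol).mdifferentiableAt (by simp)) (0, v)
        refine ne_of_eq_of_ne h1 ?_
        change fderiv ℝ ((fun x => colFun μ b 0 c (chart μ (some b) x)) ∘ (chart μ (some b)).symm)
          (chart μ (some b) (.collision b η hη)) (0, v) ≠ 0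
        rw [chart_some_collision]
        have h2 : ((fun x => colFun μ b 0 c (chart μ (some b) x)) ∘ (chart μ (some b)).symm)
            =ᶠ[𝓝 (0, v)] colFun μ b 0 c := by
          filter_upwards [(chart μ (some b)).open_target.mem_nhds hmem] with w hw
          simp [(chart μ (some b)).right_inv hw]
        rw [h2.fderiv_eq]
        have h3 := ((contDiffAt_colFun (χ := 0) (c := c) hmem contDiffAt_const).differentiableAt
          (by simp)).hasFDerivAt
        -- The field at the collision is (0, v), so transversality is tested along t ↦ (0, tv).
        -- There the regularized Hamiltonian is 1/2 - m/(t|v|), with derivative m/|v| at t = 1.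
        have hcurve : HasDerivAt (fun t : ℝ => ((0, t • v) : E3 × E3)) (0, v) 1 := by
          have h4 : HasDerivAt (fun t : ℝ => t • v) v 1 := by
            simpa using (hasDerivAt_id (1 : ℝ)).smul_const v
          exact (hasDerivAt_const (1 : ℝ) (0 : E3)).prodMk h4
        have h4 : HasDerivAt (fun t : ℝ => colFun μ b 0 c (0, t • v))
            (fderiv ℝ (colFun μ b 0 c) (0, v) (0, v)) 1 := by
          have h3' : HasFDerivAt (colFun μ b 0 c) (fderiv ℝ (colFun μ b 0 c) (0, v))
              (0, (1 : ℝ) • v) := by rwa [one_smul]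
          exact h3'.comp_hasDerivAt (f := fun t : ℝ => ((0, t • v) : E3 × E3)) 1 hcurve
        have hvn : ‖v‖ ≠ 0 := norm_ne_zero_iff.2 hv0
        have h5 : HasDerivAt (fun t : ℝ => 1 / 2 - mass μ b / ‖v‖ * t⁻¹)
            (mass μ b / ‖v‖) 1 := by
          have := ((hasDerivAt_inv (one_ne_zero (α := ℝ))).const_mul (mass μ b / ‖v‖)).const_sub (1 / 2)
          simpa using this
        have h6 : (fun t : ℝ => colFun μ b 0 c (0, t • v)) =ᶠ[𝓝 1]
            fun t : ℝ => 1 / 2 - mass μ b / ‖v‖ * t⁻¹ := by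
          filter_upwards [lt_mem_nhds (zero_lt_one (α := ℝ))] with t ht
          rw [colFun_zero, norm_smul, Real.norm_of_nonneg ht.le]
          field_simp
        rw [h4.unique (h5.congr_of_eventuallyEq h6)]
        exact div_ne_zero (mass_mem hm b).1.ne' hvn

end Surf


/-! ### Smooth roots -/

section Root

variable {E : Type*} [NormedAddCommGroup E] [NormedSpace ℝ E] [CompleteSpace E]

theorem isInvertible_of_apply_one_ne_zero {L : ℝ →L[ℝ] ℝ} (h : L 1 ≠ 0) : L.IsInvertible := by
  refine ⟨ContinuousLinearEquiv.unitsEquivAut ℝ (Units.mk0 (L 1) h), ?_⟩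
  ext
  simp

/-- A simple root of a scalar equation depends smoothly on the parameters. -/
theorem exists_smooth_root {F : E × ℝ → ℝ} {a : E} {t₀ D : ℝ}
    (hF : ∀ᶠ v in 𝓝 (a, t₀), ContDiffAt ℝ ∞ F v) (h0 : F (a, t₀) = 0)
    (hD : HasDerivAt (fun t => F (a, t)) D t₀) (hD0 : D ≠ 0) :
    ∃ τ : E → ℝ, τ a = t₀ ∧ ∀ᶠ x in 𝓝 a, ContDiffAt ℝ ∞ τ x ∧ F (x, τ x) = 0 := by
  have hF0 := hF.self_of_nhds
  have hder : (fderiv ℝ F (a, t₀) ∘L .inr ℝ E ℝ) 1 ≠ 0 := by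
    have h1 : HasDerivAt (fun t : ℝ => ((a, t) : E × ℝ)) (0, 1) t₀ :=
      (hasDerivAt_const t₀ a).prodMk (hasDerivAt_id t₀)
    have h2 := (hF0.differentiableAt (by simp)).hasFDerivAt.comp_hasDerivAt t₀ h1
    have h3 := h2.unique hD
    simpa [h3] using hD0
  have hcont : ContinuousAt (fun v => (fderiv ℝ F v ∘L .inr ℝ E ℝ) 1) (a, t₀) := by
    have h1 : ContinuousAt (fderiv ℝ F) (a, t₀) :=
      (hF0.fderiv_right (m := 1) (by norm_cast)).continuousAt
    exact h1.clm_apply continuousAt_const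
  have hinv : ∀ᶠ v in 𝓝 (a, t₀), (fderiv ℝ F v ∘L .inr ℝ E ℝ).IsInvertible :=
    (hcont.eventually_ne hder).mono fun v hv => isInvertible_of_apply_one_ne_zero hv
  set τ := hF0.implicitFunction (by simp) hinv.self_of_nhds with hτ
  have hτa : τ a = t₀ := hF0.implicitFunction_apply_self (by simp) hinv.self_of_nhds
  have hτs : ContDiffAt ℝ ∞ τ a := hF0.contDiffAt_implicitFunction (by simp) hinv.self_of_nhds
  have hroot : ∀ᶠ x in 𝓝 a, F (x, τ x) = 0 := by
    have := hF0.eventually_apply_implicitFunction (by simp) hinv.self_of_nhds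
    simpa only [h0] using this
  have hτc : ∀ᶠ x in 𝓝 a, ContinuousAt τ x :=
    ((hτs.of_le (m := 1) (by norm_cast)).eventually (by simp)).mono fun x hx => hx.continuousAt
  have htend : Filter.Tendsto (fun x => (x, τ x)) (𝓝 a) (𝓝 (a, t₀)) := by
    have : ContinuousAt (fun x => (x, τ x)) a := continuousAt_id.prodMk hτs.continuousAt
    simpa [ContinuousAt, hτa] using this
  refine ⟨τ, hτa, ?_⟩
  filter_upwards [hroot, hroot.eventually_nhds, hτc, htend.eventually hF, htend.eventually hinv]
    with x h1 h2 h3 h4 h5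
  refine ⟨?_, h1⟩
  -- `ContDiffAt` of order ∞ at a point does not spread to a neighbourhood. The implicit function
  -- theorem is therefore applied again at each nearby x, and local uniqueness of the root
  -- identifies the two implicit functions.
  have hx := h4.contDiffAt_implicitFunction (by simp) h5
  refine hx.congr_of_eventuallyEq ?_
  have hev := h4.eventually_apply_eq_iff_implicitFunction (by simp) h5
  have htx : Filter.Tendsto (fun y => (y, τ y)) (𝓝 x) (𝓝 (x, τ x)) :=
    continuousAt_id.prodMk h3
  filter_upwards [htx.eventually hev, h2] with y h6 h7
  exact (h6.1 (by simpa [h1] using h7)).symm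

end Root

/-! ### Smooth maps and diffeomorphisms between subsets -/

section Subset

variable {E H M : Type*} [NormedAddCommGroup E] [NormedSpace ℝ E] [TopologicalSpace H]
  {I : ModelWithCorners ℝ E H} [TopologicalSpace M] [ChartedSpace H M]
  {E' H' M' : Type*} [NormedAddCommGroup E'] [NormedSpace ℝ E'] [TopologicalSpace H']
  {I' : ModelWithCorners ℝ E' H'} [TopologicalSpace M'] [ChartedSpace H' M']
  {E'' H'' M'' : Type*} [NormedAddCommGroup E''] [NormedSpace ℝ E''] [TopologicalSpace H'']
  {I'' : ModelWithCorners ℝ E'' H''} [TopologicalSpace M''] [ChartedSpace H'' M'']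

theorem SmoothOnSubset.of_eventually {f : M → M'} {S : Set M}
    (h : ∀ x ∈ S, ∃ F : M → M', (∀ᶠ y in 𝓝 x, ContMDiffAt I I' ∞ F y) ∧
      ∀ᶠ y in 𝓝 x, y ∈ S → f y = F y) : SmoothOnSubset I I' f S := by
  intro x hx
  obtain ⟨F, h1, h2⟩ := h x hx
  obtain ⟨U, hU, hUo, hxU⟩ := eventually_nhds_iff.1 (h1.and h2)
  exact ⟨U, F, hUo, hxU, fun y hy => (hU y hy).1.contMDiffWithinAt, fun y hy => (hU y hy.2).2 hy.1⟩

theorem SmoothOnSubset.comp {f : M → M'} {g : M' → M''} {S : Set M} {T : Set M'}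
    (hg : SmoothOnSubset I' I'' g T) (hf : SmoothOnSubset I I' f S) (hST : MapsTo f S T) :
    SmoothOnSubset I I'' (g ∘ f) S := by
  intro x hx
  obtain ⟨U, F, hU, hxU, hF, hfF⟩ := hf x hx
  obtain ⟨V, G, hV, hxV, hG, hgG⟩ := hg (f x) (hST hx)
  refine ⟨U ∩ F ⁻¹' V, G ∘ F, hF.continuousOn.isOpen_inter_preimage hU hV, ⟨hxU, ?_⟩, ?_, ?_⟩
  · change F x ∈ V
    rwa [← hfF ⟨hx, hxU⟩]
  · exact hG.comp (hF.mono inter_subset_left) fun y hy => hy.2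
  · rintro y ⟨hy, hyU, hyV⟩
    have h1 := hfF ⟨hy, hyU⟩
    change g (f y) = G (F y)
    have hyV : F y ∈ V := hyV
    rw [← h1] at hyV ⊢
    exact hgG ⟨hST hy, hyV⟩

theorem SmoothOnSubset.mono {f : M → M'} {S S' : Set M} (hf : SmoothOnSubset I I' f S)
    (h : S' ⊆ S) : SmoothOnSubset I I' f S' := by
  intro x hx
  obtain ⟨U, F, hU, hxU, hF, hfF⟩ := hf x (h hx)
  exact ⟨U, F, hU, hxU, hF, fun y hy => hfF ⟨h hy.1, hy.2⟩⟩

theorem IsDiffeoOn.of_leftInvOn {f : M → M'} {g : M' → M} {S : Set M} {T : Set M'}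
    (hf : SmoothOnSubset I I' f S) (hg : SmoothOnSubset I' I g T) (h1 : MapsTo f S T)
    (h2 : MapsTo g T S) (h3 : LeftInvOn g f S) (h4 : LeftInvOn f g T) :
    IsDiffeoOn I I' f S T :=
  ⟨⟨h1, h3.injOn, fun y hy => ⟨g y, h2 hy, h4 hy⟩⟩, hf, g, hg, h3⟩

theorem IsDiffeoOn.exists_inverse {f : M → M'} {S : Set M} {T : Set M'}
    (h : IsDiffeoOn I I' f S T) :
    ∃ g : M' → M, IsDiffeoOn I' I g T S ∧ LeftInvOn g f S ∧ LeftInvOn f g T := by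
  obtain ⟨hb, hf, g, hg, hl⟩ := h
  have hr : LeftInvOn f g T := by
    intro y hy
    obtain ⟨x, hx, rfl⟩ := hb.surjOn hy
    rw [hl hx]
  have hm : MapsTo g T S := by
    intro y hy
    obtain ⟨x, hx, rfl⟩ := hb.surjOn hy
    rwa [hl hx]
  exact ⟨g, .of_leftInvOn hg hf hm hb.mapsTo hr hl, hl, hr⟩

theorem IsDiffeoOn.comp {f : M → M'} {g : M' → M''} {S : Set M} {T : Set M'} {R : Set M''}
    (hg : IsDiffeoOn I' I'' g T R) (hf : IsDiffeoOn I I' f S T) :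
    IsDiffeoOn I I'' (g ∘ f) S R := by
  obtain ⟨f', hf', hf1, hf2⟩ := hf.exists_inverse
  obtain ⟨g', hg', hg1, hg2⟩ := hg.exists_inverse
  refine ⟨hg.1.comp hf.1, hg.2.1.comp hf.2.1 hf.1.mapsTo, f' ∘ g',
    hf'.2.1.comp hg'.2.1 hg'.1.mapsTo, ?_⟩
  intro x hx
  simp only [Function.comp_apply]
  rw [hg1 (hf.1.mapsTo hx), hf1 hx]

theorem IsDiffeoOn.restrict {f : M → M'} {S S' : Set M} {T : Set M'}
    (h : IsDiffeoOn I I' f S T) (hS : S' ⊆ S) : IsDiffeoOn I I' f S' (f '' S') := by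
  obtain ⟨hb, hf, g, hg, hl⟩ := h
  refine ⟨(hb.injOn.mono hS).bijOn_image, hf.mono hS, g, hg.mono ?_, fun x hx => hl (hS hx)⟩
  rintro _ ⟨x, hx, rfl⟩
  exact hb.mapsTo (hS hx)

/-- A diffeomorphism between subsets maps relatively open subsets onto relatively open subsets. -/
theorem IsDiffeoOn.exists_isOpen_image {f : M → M'} {S : Set M} {T : Set M'}
    (h : IsDiffeoOn I I' f S T) {O : Set M} (hO : IsOpen O) :
    ∃ O' : Set M', IsOpen O' ∧ f '' (S ∩ O) = T ∩ O' := by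
  obtain ⟨g, hg, hl, hr⟩ := h.exists_inverse
  have hloc : ∀ y ∈ T, g y ∈ O → ∃ V : Set M', IsOpen V ∧ y ∈ V ∧ ∀ y' ∈ T ∩ V, g y' ∈ O := by
    intro y hy hyO
    obtain ⟨U, F, hU, hyU, hF, hgF⟩ := hg.2.1 y hy
    refine ⟨U ∩ F ⁻¹' O, hF.continuousOn.isOpen_inter_preimage hU hO, ⟨hyU, ?_⟩, ?_⟩
    · change F y ∈ O
      rwa [← hgF ⟨hy, hyU⟩]
    · rintro y' ⟨hy', hyU', hyO'⟩
      rw [hgF ⟨hy', hyU'⟩]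
      exact hyO'
  refine ⟨⋃₀ {V | IsOpen V ∧ ∀ y ∈ T ∩ V, g y ∈ O}, isOpen_sUnion fun V hV => hV.1, ?_⟩
  ext y
  constructor
  · rintro ⟨x, ⟨hx, hxO⟩, rfl⟩
    have hy := h.1.mapsTo hx
    obtain ⟨V, hV, hyV, hV'⟩ := hloc (f x) hy (by rwa [hl hx])
    exact ⟨hy, V, ⟨hV, hV'⟩, hyV⟩
  · rintro ⟨hy, V, ⟨hV, hV'⟩, hyV⟩
    exact ⟨g y, ⟨hg.1.mapsTo hy, hV' y ⟨hy, hyV⟩⟩, hr hy⟩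

theorem IsOpenDiffeoInto.comp {f : M → M'} {g : M' → M''} {S : Set M} {T : Set M'} {R : Set M''}
    (hg : IsDiffeoOn I' I'' g T R) (hf : IsOpenDiffeoInto I I' f S T) :
    IsOpenDiffeoInto I I'' (g ∘ f) S R := by
  obtain ⟨O, hO, hf⟩ := hf
  obtain ⟨O', hO', he⟩ := hg.exists_isOpen_image hO
  refine ⟨O', hO', ?_⟩
  rw [← he]
  exact (hg.restrict inter_subset_left).comp hf

end Subset

/-! ### One-dimensional lemmas -/

/-- A function that is increasing wherever it is at most `c` takes the value `c` at most once. -/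
theorem eq_of_deriv_pos_of_le {φ φ' : ℝ → ℝ} {a b c : ℝ} (hab : a ≤ b)
    (hd : ∀ t ∈ Icc a b, HasDerivAt φ (φ' t) t) (hpos : ∀ t ∈ Icc a b, φ t ≤ c → 0 < φ' t)
    (ha : φ a = c) (hb : φ b = c) : a = b := by
  by_contra hne
  have hlt : a < b := lt_of_le_of_ne hab hne
  have hc : ContinuousOn φ (Icc a b) := fun t ht => (hd t ht).continuousAt.continuousWithinAt
  -- The derivative at b is positive, so values below c occur and the minimum is interior. Being a
  -- critical point with value below c, it contradicts `hpos`.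
  obtain ⟨t, ht, hmin⟩ := isCompact_Icc.exists_isMinOn (nonempty_Icc.2 hab) hc
  have htc : φ t ≤ c := by rw [← ha]; exact hmin (left_mem_Icc.2 hab)
  have hbpos := hpos b (right_mem_Icc.2 hab) hb.le
  have hbl : ∃ s ∈ Ioo a b, φ s < c := by
    have h1 := (hasDerivAt_iff_tendsto_slope_left_right.1 (hd b (right_mem_Icc.2 hab))).1
    have h2 := h1.eventually (lt_mem_nhds hbpos)
    obtain ⟨s, hs1, hs2⟩ := (h2.and (Ioo_mem_nhdsLT hlt)).exists
    refine ⟨s, hs2, ?_⟩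
    rw [slope_def_field, div_pos_iff] at hs1
    rcases hs1 with ⟨h3, h4⟩ | ⟨h3, h4⟩
    · linarith [hs2.2]
    · linarith
  obtain ⟨s, hs, hsc⟩ := hbl
  have hts : φ t < c := (hmin (Ioo_subset_Icc_self hs)).trans_lt hsc
  have hta : t ≠ a := fun h => by rw [h, ha] at hts; exact lt_irrefl _ hts
  have htb : t ≠ b := fun h => by rw [h, hb] at hts; exact lt_irrefl _ hts
  have hti : t ∈ Ioo a b := ⟨lt_of_le_of_ne ht.1 hta.symm, lt_of_le_of_ne ht.2 htb⟩
  have hloc : IsLocalMin φ t := hmin.isLocalMin (Icc_mem_nhds hti.1 hti.2)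
  have := hloc.hasDerivAt_eq_zero (hd t ht)
  linarith [hpos t ht hts.le]


/-! ### Stereographic coordinates on the cotangent bundle of the sphere -/

theorem R4.ext' {z w : R4} (h : z.fst = w.fst) (h' : z.snd = w.snd) : z = w :=
  WithLp.ofLp_injective _ (Prod.ext h h')

theorem R4.inner_eq (z w : R4) : ⟪z, w⟫ = z.fst * w.fst + ⟪z.snd, w.snd⟫ := by
  rw [WithLp.prod_inner_apply]
  simp [mul_comm]

theorem R4.norm_sq_eq (z : R4) : ‖z‖ ^ 2 = z.fst ^ 2 + ‖z.snd‖ ^ 2 := by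
  rw [WithLp.prod_norm_sq_eq_of_L2]
  simp

theorem R4.contDiff_fst : ContDiff ℝ ∞ fun z : R4 => z.fst :=
  (ContinuousLinearMap.fst ℝ ℝ E3 ∘L
    (WithLp.prodContinuousLinearEquiv 2 ℝ ℝ E3).toContinuousLinearMap).contDiff

theorem R4.contDiff_snd : ContDiff ℝ ∞ fun z : R4 => z.snd :=
  (ContinuousLinearMap.snd ℝ ℝ E3 ∘L
    (WithLp.prodContinuousLinearEquiv 2 ℝ ℝ E3).toContinuousLinearMap).contDiff

theorem R4.contDiff_toLp : ContDiff ℝ ∞ fun z : ℝ × E3 => (WithLp.toLp 2 z : R4) :=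
  (WithLp.prodContinuousLinearEquiv 2 ℝ ℝ E3).symm.contDiff

/-- The inverse of `stereoLift`. -/
def northCoord (z : R4 × R4) : E3 × E3 :=
  ((1 - z.1.fst)⁻¹ • z.1.snd, (1 - z.1.fst) • z.2.snd + z.2.fst • z.1.snd)

/-- The cotangent lift of the inverse of stereographic projection from the south pole. -/
def southLift (w : E3 × E3) : R4 × R4 :=
  (WithLp.toLp 2 ((1 - ‖w.1‖ ^ 2) / (‖w.1‖ ^ 2 + 1), (2 / (‖w.1‖ ^ 2 + 1)) • w.1),
    WithLp.toLp 2 (-⟪w.1, w.2⟫, ((‖w.1‖ ^ 2 + 1) / 2) • w.2 - ⟪w.1, w.2⟫ • w.1))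

theorem northCoord_stereoLift (w : E3 × E3) : northCoord (stereoLift w) = w := by
  have h1 : ‖w.1‖ ^ 2 + 1 ≠ 0 := by positivity
  have h2 : 1 - (‖w.1‖ ^ 2 - 1) / (‖w.1‖ ^ 2 + 1) = 2 / (‖w.1‖ ^ 2 + 1) := by
    field_simp; ring
  simp only [northCoord, stereoLift, WithLp.toLp_fst, WithLp.toLp_snd, h2]
  refine Prod.ext ?_ ?_
  · simp only
    match_scalars
    field_simp
  · simp only
    match_scalars
    · field_simp
    · field_simp
      ring

theorem snd_norm_sq_of_mem {z : R4 × R4} (hz : z ∈ cotangentSphere) :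
    ‖z.1.snd‖ ^ 2 = 1 - z.1.fst ^ 2 := by
  have := R4.norm_sq_eq z.1
  rw [hz.1] at this
  linarith

theorem inner_snd_of_mem {z : R4 × R4} (hz : z ∈ cotangentSphere) :
    ⟪z.1.snd, z.2.snd⟫ = -(z.1.fst * z.2.fst) := by
  have := R4.inner_eq z.1 z.2
  rw [hz.2] at this
  linarith

theorem stereoLift_northCoord {z : R4 × R4} (hz : z ∈ cotangentSphere) (h : z.1.fst ≠ 1) :
    stereoLift (northCoord z) = z := by
  have h1 : 1 - z.1.fst ≠ 0 := sub_ne_zero.2 h.symm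
  have hn := snd_norm_sq_of_mem hz
  have hi := inner_snd_of_mem hz
  have e1 : ‖(northCoord z).1‖ ^ 2 = (1 + z.1.fst) / (1 - z.1.fst) := by
    rw [northCoord, norm_smul, mul_pow, hn, norm_inv, inv_pow, Real.norm_eq_abs, sq_abs]
    field_simp
    ring
  have e2 : ⟪(northCoord z).1, (northCoord z).2⟫ = z.2.fst := by
    simp only [northCoord, inner_add_right, inner_smul_left, inner_smul_right, hi,
      real_inner_self_eq_norm_sq, hn, RCLike.conj_to_real]
    field_simp
    ring
  have e3 : ‖(northCoord z).1‖ ^ 2 + 1 = 2 / (1 - z.1.fst) := by rw [e1]; field_simp; ring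
  have e4 : ‖(northCoord z).1‖ ^ 2 - 1 = 2 * z.1.fst / (1 - z.1.fst) := by
    rw [e1]; field_simp; ring
  unfold stereoLift
  rw [e2, e3, e4]
  refine Prod.ext (R4.ext' ?_ ?_) (R4.ext' ?_ ?_)
  · simp only [WithLp.toLp_fst]
    field_simp
  · simp only [WithLp.toLp_snd, northCoord]
    match_scalars
    field_simp
  · simp only [WithLp.toLp_fst]
  · simp only [WithLp.toLp_snd, northCoord]
    match_scalars
    · field_simp
    · field_simp
      ring

theorem southLift_southCoord {z : R4 × R4} (hz : z ∈ cotangentSphere) (h : z.1.fst ≠ -1) :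
    southLift (southCoord z) = z := by
  have h1 : 1 + z.1.fst ≠ 0 := fun h' => h (by linarith)
  have hn := snd_norm_sq_of_mem hz
  have hi := inner_snd_of_mem hz
  have e1 : ‖(southCoord z).1‖ ^ 2 = (1 - z.1.fst) / (1 + z.1.fst) := by
    rw [southCoord, norm_smul, mul_pow, hn, norm_inv, inv_pow, Real.norm_eq_abs, sq_abs]
    field_simp
    ring
  have e2 : ⟪(southCoord z).1, (southCoord z).2⟫ = -z.2.fst := by
    simp only [southCoord, inner_sub_right, inner_smul_left, inner_smul_right, hi,
      real_inner_self_eq_norm_sq, hn, RCLike.conj_to_real]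
    field_simp
    ring
  have e3 : ‖(southCoord z).1‖ ^ 2 + 1 = 2 / (1 + z.1.fst) := by rw [e1]; field_simp; ring
  have e4 : 1 - ‖(southCoord z).1‖ ^ 2 = 2 * z.1.fst / (1 + z.1.fst) := by
    rw [e1]; field_simp; ring
  unfold southLift
  rw [e2, e3, e4]
  refine Prod.ext (R4.ext' ?_ ?_) (R4.ext' ?_ ?_)
  · simp only [WithLp.toLp_fst]
    field_simp
  · simp only [WithLp.toLp_snd, southCoord]
    match_scalars
    field_simp
  · simp only [WithLp.toLp_fst, neg_neg]
  · simp only [WithLp.toLp_snd, southCoord]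
    match_scalars
    · field_simp
    · field_simp
      ring

theorem stereoLift_mem (w : E3 × E3) : stereoLift w ∈ cotangentSphere := by
  have h1 : ‖w.1‖ ^ 2 + 1 ≠ 0 := by positivity
  constructor
  · refine (pow_left_inj₀ (norm_nonneg _) zero_le_one two_ne_zero).1 ?_
    rw [R4.norm_sq_eq]
    simp only [stereoLift, WithLp.toLp_fst, WithLp.toLp_snd, norm_smul, mul_pow, Real.norm_eq_abs,
      sq_abs]
    field_simp
    ring
  · rw [R4.inner_eq]
    simp only [stereoLift, WithLp.toLp_fst, WithLp.toLp_snd, inner_smul_left, inner_sub_right,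
      inner_smul_right, real_inner_self_eq_norm_sq, RCLike.conj_to_real]
    field_simp
    ring

theorem stereoLift_snd_norm (w : E3 × E3) :
    ‖(stereoLift w).2‖ = (‖w.1‖ ^ 2 + 1) / 2 * ‖w.2‖ := by
  refine (pow_left_inj₀ (norm_nonneg _) (by positivity) two_ne_zero).1 ?_
  rw [R4.norm_sq_eq]
  simp only [stereoLift, WithLp.toLp_fst, WithLp.toLp_snd]
  rw [← real_inner_self_eq_norm_sq (((‖w.1‖ ^ 2 + 1) / 2) • w.2 - ⟪w.1, w.2⟫ • w.1)]
  simp only [inner_sub_left, inner_sub_right, inner_smul_left, inner_smul_right,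
    RCLike.conj_to_real, real_inner_self_eq_norm_sq]
  rw [real_inner_comm w.1 w.2]
  ring

theorem stereoLift_fst_ne (w : E3 × E3) : (stereoLift w).1.fst ≠ 1 := by
  have h1 : ‖w.1‖ ^ 2 + 1 ≠ 0 := by positivity
  simp only [stereoLift, WithLp.toLp_fst, ne_eq, div_eq_one_iff_eq h1]
  intro h
  linarith

theorem southLift_contDiff : ContDiff ℝ ∞ southLift := by
  have hN : ContDiff ℝ ∞ fun w : E3 × E3 => ‖w.1‖ ^ 2 := contDiff_fst.norm_sq ℝ
  have hI : ContDiff ℝ ∞ fun w : E3 × E3 => ⟪w.1, w.2⟫ := contDiff_fst.inner ℝ contDiff_snd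
  have hN1 := hN.add (contDiff_const (c := (1 : ℝ)))
  have h0 : ∀ w : E3 × E3, ‖w.1‖ ^ 2 + 1 ≠ 0 := fun w => by positivity
  unfold southLift
  exact (R4.contDiff_toLp.comp (((contDiff_const.sub hN).div hN1 h0).prodMk
    ((contDiff_const.div hN1 h0).smul contDiff_fst))).prodMk (R4.contDiff_toLp.comp
    (hI.neg.prodMk (((hN1.div_const 2).smul contDiff_snd).sub (hI.smul contDiff_fst))))

theorem stereoLift_contDiff : ContDiff ℝ ∞ stereoLift := by
  have hN : ContDiff ℝ ∞ fun w : E3 × E3 => ‖w.1‖ ^ 2 := contDiff_fst.norm_sq ℝ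
  have hI : ContDiff ℝ ∞ fun w : E3 × E3 => ⟪w.1, w.2⟫ := contDiff_fst.inner ℝ contDiff_snd
  have hN1 := hN.add (contDiff_const (c := (1 : ℝ)))
  have h0 : ∀ w : E3 × E3, ‖w.1‖ ^ 2 + 1 ≠ 0 := fun w => by positivity
  unfold stereoLift
  exact (R4.contDiff_toLp.comp (((hN.sub contDiff_const).div hN1 h0).prodMk
    ((contDiff_const.div hN1 h0).smul contDiff_fst))).prodMk (R4.contDiff_toLp.comp
    (hI.prodMk (((hN1.div_const 2).smul contDiff_snd).sub (hI.smul contDiff_fst))))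

theorem northCoord_contDiffAt {z : R4 × R4} (h : z.1.fst ≠ 1) : ContDiffAt ℝ ∞ northCoord z := by
  have h1 : ContDiffAt ℝ ∞ (fun z : R4 × R4 => 1 - z.1.fst) z :=
    contDiffAt_const.sub (R4.contDiff_fst.comp contDiff_fst).contDiffAt
  have hs : ContDiffAt ℝ ∞ (fun z : R4 × R4 => z.1.snd) z :=
    (R4.contDiff_snd.comp contDiff_fst).contDiffAt
  exact ((h1.inv (sub_ne_zero.2 h.symm)).smul hs).prodMk
    ((h1.smul (R4.contDiff_snd.comp contDiff_snd).contDiffAt).add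
      ((R4.contDiff_fst.comp contDiff_snd).contDiffAt.smul hs))

theorem southCoord_contDiffAt {z : R4 × R4} (h : z.1.fst ≠ -1) : ContDiffAt ℝ ∞ southCoord z := by
  have h1 : ContDiffAt ℝ ∞ (fun z : R4 × R4 => 1 + z.1.fst) z :=
    contDiffAt_const.add (R4.contDiff_fst.comp contDiff_fst).contDiffAt
  have hs : ContDiffAt ℝ ∞ (fun z : R4 × R4 => z.1.snd) z :=
    (R4.contDiff_snd.comp contDiff_fst).contDiffAt
  exact ((h1.inv fun h' => h (by linarith)).smul hs).prodMk
    ((h1.smul (R4.contDiff_snd.comp contDiff_snd).contDiffAt).sub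
      ((R4.contDiff_fst.comp contDiff_snd).contDiffAt.smul hs))

theorem northCoord_smul (z : R4 × R4) (t : ℝ) :
    northCoord (z.1, t • z.2) = ((northCoord z).1, t • (northCoord z).2) := by
  simp only [northCoord, WithLp.smul_fst, WithLp.smul_snd, Prod.mk.injEq, true_and]
  module

theorem southCoord_smul (z : R4 × R4) (t : ℝ) :
    southCoord (z.1, t • z.2) = ((southCoord z).1, t • (southCoord z).2) := by
  simp only [southCoord, WithLp.smul_fst, WithLp.smul_snd, Prod.mk.injEq, true_and]
  module

theorem smul_mem_cotangentSphere {z : R4 × R4} (hz : z ∈ cotangentSphere) (t : ℝ) :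
    (z.1, t • z.2) ∈ cotangentSphere :=
  ⟨hz.1, by simp [inner_smul_right, hz.2]⟩

/-! ### Moser's transformation -/

section Moser

variable {μ : ℝ} {b : Primary}

theorem moser_mem {x : RegPhase μ} : x.moser b ∈ cotangentSphere := by
  rcases x with ⟨z, hz⟩ | ⟨b', η, hη⟩
  · exact stereoLift_mem _
  · constructor
    · refine (pow_left_inj₀ (norm_nonneg _) zero_le_one two_ne_zero).1 ?_
      rw [R4.norm_sq_eq]
      simp [RegPhase.moser]
    · rw [R4.inner_eq]
      simp [RegPhase.moser]

theorem moser_snd_ne_zero (x : RegPhase μ) : (x.moser b).2 ≠ 0 := by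
  rw [← norm_ne_zero_iff]
  rcases x with ⟨z, hz⟩ | ⟨b', η, hη⟩
  · rw [RegPhase.moser, stereoLift_snd_norm]
    have h1 : ‖z.1 - pos μ b‖ ≠ 0 := norm_ne_zero_iff.2 (sub_ne_zero.2 (hz b))
    exact mul_ne_zero (by positivity) h1
  · rw [norm_ne_zero_iff]
    intro h
    exact hη (by simpa [RegPhase.moser] using congrArg WithLp.snd h)

theorem moser_fst_collision {b' : Primary} {η : E3} {hη : η ≠ 0} :
    (RegPhase.moser (μ := μ) b (.collision b' η hη)).1.fst = 1 := rfl

theorem moser_eq_southLift {x : RegPhase μ} (hx : x ∈ (chart μ (some b)).source) :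
    x.moser b = southLift (chart μ (some b) x) := by
  refine (southLift_southCoord moser_mem ?_).symm
  rcases hx with ⟨z, hz, rfl, hp⟩ | ⟨η, hη, rfl⟩
  · have hn : ‖z.2‖ ≠ 0 := norm_ne_zero_iff.2 hp
    have h1 : ‖z.2‖ ^ 2 + 1 ≠ 0 := by positivity
    simp only [RegPhase.moser, stereoLift, norm_neg, WithLp.toLp_fst]
    rw [ne_eq, div_eq_iff h1]
    intro h
    have : ‖z.2‖ ^ 2 = 0 := by linarith
    exact hn (pow_eq_zero_iff two_ne_zero |>.1 this)
  · rw [moser_fst_collision]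
    norm_num

/-- The phase space coordinates in terms of Moser's coordinates at `b`. -/
def moserQP (μ : ℝ) (b : Primary) (z : R4 × R4) : E3 × E3 :=
  (pos μ b + (northCoord z).2, -(northCoord z).1)

theorem moserQP_moser {z : E3 × E3} (hz : z ∈ phaseSpace μ) :
    moserQP μ b (RegPhase.moser b (.phase z hz)) = z := by
  simp [moserQP, RegPhase.moser, northCoord_stereoLift]

theorem moser_moserQP {z : R4 × R4} (hz : z ∈ cotangentSphere) (h : z.1.fst ≠ 1)
    (hq : moserQP μ b z ∈ phaseSpace μ) : RegPhase.moser b (.phase (moserQP μ b z) hq) = z := by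
  simp only [moserQP, RegPhase.moser, neg_neg, add_sub_cancel_left]
  exact stereoLift_northCoord hz h

theorem moserQP_contDiffAt {z : R4 × R4} (h : z.1.fst ≠ 1) : ContDiffAt ℝ ∞ (moserQP μ b) z :=
  (contDiffAt_const.add (northCoord_contDiffAt h).snd).prodMk (northCoord_contDiffAt h).fst.neg

theorem moser_symm_southCoord {z : R4 × R4} (hz : z ∈ cotangentSphere) (h : z.1.fst ≠ -1)
    (hw : southCoord z ∈ collisionTarget μ b) :
    ((chart μ (some b)).symm (southCoord z)).moser b = z := by
  rw [moser_eq_southLift ((chart μ (some b)).map_target hw), (chart μ (some b)).right_inv hw,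
    southLift_southCoord hz h]

/-- Moser's transformation followed by the projection to the unit cotangent bundle. -/
def starMap (b : Primary) (x : RegPhase μ) : R4 × R4 :=
  ((x.moser b).1, ‖(x.moser b).2‖⁻¹ • (x.moser b).2)

theorem starMap_mem (x : RegPhase μ) : starMap b x ∈ unitCotangentSphere := by
  refine ⟨smul_mem_cotangentSphere moser_mem _, ?_⟩
  simp only [starMap]
  rw [norm_smul, norm_inv, norm_norm, inv_mul_cancel₀ (norm_ne_zero_iff.2 (moser_snd_ne_zero x))]

theorem starMap_eq_of_moser {x : RegPhase μ} {z : R4 × R4} (hz : z ∈ unitCotangentSphere) {t : ℝ}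
    (ht : 0 < t) (h : x.moser b = (z.1, t • z.2)) : starMap b x = z := by
  rw [starMap, h]
  refine Prod.ext rfl ?_
  simp only
  rw [norm_smul, hz.2, Real.norm_of_nonneg ht.le, mul_one, smul_smul, inv_mul_cancel₀ ht.ne',
    one_smul]

theorem moser_eq_starMap (x : RegPhase μ) :
    x.moser b = ((starMap b x).1, ‖(x.moser b).2‖ • (starMap b x).2) := by
  refine Prod.ext rfl ?_
  simp only [starMap]
  rw [smul_smul, mul_inv_cancel₀ (norm_ne_zero_iff.2 (moser_snd_ne_zero x)), one_smul]

theorem moser_contMDiffAt {x : RegPhase μ}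
    (hx : x ∈ (chart μ none).source ∪ (chart μ (some b)).source) :
    ContMDiffAt 𝓘(ℝ, E3 × E3) 𝓘(ℝ, R4 × R4) ∞ (RegPhase.moser b) x := by
  rcases hx with hx | hx
  · refine contMDiffAt_of_chart (g := fun z => stereoLift (-z.2, z.1 - pos μ b)) hx ?_ ?_
    · exact (stereoLift_contDiff.comp (contDiff_snd.neg.prodMk
        (contDiff_fst.sub contDiff_const))).contDiffAt
    · filter_upwards [(chart μ none).open_source.mem_nhds hx] with y hy
      obtain ⟨z, hz, rfl⟩ := hy
      rfl
  · refine contMDiffAt_of_chart (g := southLift) hx southLift_contDiff.contDiffAt ?_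
    filter_upwards [(chart μ (some b)).open_source.mem_nhds hx] with y hy
    exact moser_eq_southLift hy

theorem starMap_contMDiffAt {x : RegPhase μ}
    (hx : x ∈ (chart μ none).source ∪ (chart μ (some b)).source) :
    ContMDiffAt 𝓘(ℝ, E3 × E3) 𝓘(ℝ, R4 × R4) ∞ (starMap (μ := μ) b) x := by
  have h1 := moser_contMDiffAt hx
  have h2 : ContDiffAt ℝ ∞ (fun z : R4 × R4 => (z.1, ‖z.2‖⁻¹ • z.2)) (x.moser b) :=
    contDiffAt_fst.prodMk (((contDiffAt_snd.norm ℝ (moser_snd_ne_zero x)).inv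
      (norm_ne_zero_iff.2 (moser_snd_ne_zero x))).smul contDiffAt_snd)
  exact ContMDiffAt.comp x h2.contMDiffAt h1

end Moser


/-! ### Star-shaped levels around a primary are unit cotangent bundles -/

/-- The level `c` of the Hamiltonian with the additional potential `χ` is, over the ball of radius
`r` around `b`, transverse to the rays from `b`, and it meets all of them. -/
structure IsStarLevel (μ : ℝ) (b : Primary) (χ : E3 → ℝ) (c r : ℝ) : Prop where
  lt_one : r < 1
  eq_zero : ∀ᶠ q in 𝓝 (pos μ b), χ q = 0
  smooth : ∀ q ∈ Metric.ball (pos μ b) r, ContDiffAt ℝ ∞ χ q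
  deriv_pos : ∀ z ∈ phaseSpace μ, z.1 ∈ Metric.ball (pos μ b) r → modHam μ χ z ≤ c →
    0 < hamDeriv μ z (z.1 - pos μ b, 0) + fderiv ℝ χ z.1 (z.1 - pos μ b)
  le_potential : ∀ θ : E3, ‖θ‖ = 1 → ∃ ρ ∈ Ioo 0 r,
    c ≤ potential μ (pos μ b + ρ • θ) + χ (pos μ b + ρ • θ)

theorem hamDeriv_smul (μ : ℝ) (z v : E3 × E3) (s : ℝ) :
    hamDeriv μ z (s • v) = s * hamDeriv μ z v := by
  simp only [hamDeriv, potentialDeriv, Prod.smul_fst, Prod.smul_snd, PiLp.smul_apply, smul_eq_mul,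
    inner_smul_right]
  ring

theorem ball_mem_offPrimaries {μ : ℝ} {b : Primary} {r : ℝ} (hr : r ≤ 1) {q : E3}
    (hq : q ∈ Metric.ball (pos μ b) r) (hqb : q ≠ pos μ b) : q ∈ offPrimaries μ := by
  refine (offPrimaries_iff b).2 ⟨hqb, ?_⟩
  rintro rfl
  rw [Metric.mem_ball, dist_comm, dist_eq_norm, norm_pos_sub_other] at hq
  linarith

namespace IsStarLevel

variable {μ : ℝ} {b : Primary} {χ : E3 → ℝ} {c r : ℝ}

theorem mem_phaseSpace (h : IsStarLevel μ b χ c r) {y p : E3} (hy : y ≠ 0) (hyr : ‖y‖ < r) :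
    ((pos μ b + y, p) : E3 × E3) ∈ phaseSpace μ :=
  mem_phaseSpace_iff.2 (ball_mem_offPrimaries (q := pos μ b + y) h.lt_one.le
    (mem_ball_iff_norm.2 (by rwa [add_sub_cancel_left])) (by rwa [ne_eq, add_eq_left]))

theorem eq_of_pos_mem (h : IsStarLevel μ b χ c r) {b' : Primary}
    (hb : pos μ b' ∈ Metric.ball (pos μ b) r) : b' = b := by
  rcases b.eq_or_eq_other b' with rfl | rfl
  · rfl
  · rw [Metric.mem_ball, dist_comm, dist_eq_norm, norm_pos_sub_other] at hb
    linarith [h.lt_one]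

/-- Scaling q - b at fixed p is the flow direction of the radial field; `deriv_pos` is t times the
derivative along the ray. -/
theorem hasDerivAt_ray (h : IsStarLevel μ b χ c r) {y p : E3} {t : ℝ} (hy : y ≠ 0) (ht : 0 < t)
    (htr : t * ‖y‖ < r) :
    ∃ D, HasDerivAt (fun t : ℝ => modHam μ χ (pos μ b + t • y, p)) D t ∧
      (modHam μ χ (pos μ b + t • y, p) ≤ c → 0 < D) := by
  have hty : t • y ≠ 0 := smul_ne_zero ht.ne' hy
  have hn : ‖t • y‖ < r := by rwa [norm_smul, Real.norm_of_nonneg ht.le]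
  have hz := h.mem_phaseSpace (p := p) hty hn
  have hball : pos μ b + t • y ∈ Metric.ball (pos μ b) r := by simpa using hn
  obtain ⟨L, hL, hL'⟩ := hasFDerivAt_hamiltonian hz
  have hc : HasFDerivAt χ (fderiv ℝ χ (pos μ b + t • y)) (pos μ b + t • y) :=
    ((h.smooth _ hball).differentiableAt (by simp)).hasFDerivAt
  have hq : HasDerivAt (fun t : ℝ => pos μ b + t • y) y t := by
    simpa using ((hasDerivAt_id t).smul_const y).const_add (pos μ b)
  have hqp : HasDerivAt (fun t : ℝ => ((pos μ b + t • y, p) : E3 × E3)) (y, 0) t :=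
    hq.prodMk (hasDerivAt_const t p)
  refine ⟨_, (hL.comp_hasDerivAt t hqp).add (hc.comp_hasDerivAt t hq), fun hle => ?_⟩
  have h1 := h.deriv_pos _ hz hball hle
  simp only [add_sub_cancel_left, map_smul, smul_eq_mul] at h1
  have h2 : ((t • y, 0) : E3 × E3) = t • (y, 0) := by simp
  rw [h2, hamDeriv_smul, ← mul_add] at h1
  rw [hL']
  exact pos_of_mul_pos_right h1 ht.le

/-- The attraction of b drives the energy to -∞ at the start of the ray, while `le_potential` brings
it up to c before radius r. -/
theorem exists_root (h : IsStarLevel μ b χ c r) (hm : μ ∈ Ioo (0 : ℝ) 1) {y p : E3} (hy : y ≠ 0) :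
    ∃ t > 0, t * ‖y‖ < r ∧ modHam μ χ (pos μ b + t • y, p) = c := by
  have hn : 0 < ‖y‖ := norm_pos_iff.2 hy
  obtain ⟨ρ, hρ, hle⟩ := h.le_potential (‖y‖⁻¹ • y) (by
    rw [norm_smul, norm_inv, norm_norm, inv_mul_cancel₀ hn.ne'])
  set t₁ := ρ / ‖y‖ with ht₁
  have ht₁0 : 0 < t₁ := div_pos hρ.1 hn
  have ht₁r : t₁ * ‖y‖ < r := by rw [ht₁, div_mul_cancel₀ _ hn.ne']; exact hρ.2
  have hle' : c ≤ modHam μ χ (pos μ b + t₁ • y, p) := by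
    rw [smul_smul, ← div_eq_mul_inv, ← ht₁] at hle
    exact hle.trans
      (add_le_add_left (potential_le_hamiltonian μ (pos μ b + t₁ • y, p)) (χ (pos μ b + t₁ • y)))
  have htend : Filter.Tendsto (fun t : ℝ => modHam μ χ (pos μ b + t • y, p)) (𝓝[>] 0)
      Filter.atBot := by
    -- Everything in the energy except the attraction of b; it is continuous at t = 0 because χ
    -- vanishes near b and the other primary is at distance 1.
    set g : ℝ → ℝ := fun t => ((p 0 + (pos μ b + t • y) 1) ^ 2 + (p 1 - (pos μ b + t • y) 0) ^ 2 +
      p 2 ^ 2) / 2 + (-((pos μ b + t • y) 0 ^ 2 + (pos μ b + t • y) 1 ^ 2) / 2 -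
      (1 - mass μ b) / ‖pos μ b + t • y - pos μ b.other‖) + χ (pos μ b + t • y) with hg
    have hcont : ContinuousAt g 0 := by
      have hq : Continuous fun t : ℝ => pos μ b + t • y := by fun_prop
      have hq' : ∀ i : Fin 3, Continuous fun t : ℝ => (pos μ b + t • y) i := fun i =>
        ((EuclideanSpace.proj i : E3 →L[ℝ] ℝ).continuous).comp hq
      have hχ : ContinuousAt (fun t : ℝ => χ (pos μ b + t • y)) 0 := by
        have h1 : ContinuousAt χ (pos μ b + (0 : ℝ) • y) := by
          rw [zero_smul, add_zero]
          exact (continuousAt_const (y := (0 : ℝ))).congr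
            (h.eq_zero.mono fun q hq => hq.symm)
        exact ContinuousAt.comp (f := fun t : ℝ => pos μ b + t • y) h1 hq.continuousAt
      have hd : ContinuousAt (fun t : ℝ => (1 - mass μ b) / ‖pos μ b + t • y - pos μ b.other‖) 0 := by
        refine ContinuousAt.div continuousAt_const (by fun_prop) ?_
        rw [zero_smul, add_zero, norm_pos_sub_other]
        exact one_ne_zero
      have h0 := (hq' 0).continuousAt (x := 0)
      have h1 := (hq' 1).continuousAt (x := 0)
      exact ((((((continuousAt_const.add h1).pow 2).add ((continuousAt_const.sub h0).pow 2)).add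
        continuousAt_const).div_const 2).add ((((h0.pow 2).add (h1.pow 2)).neg.div_const 2).sub
          hd)).add hχ
    have hinv : Filter.Tendsto (fun t : ℝ => -(mass μ b / ‖y‖) * t⁻¹) (𝓝[>] 0) Filter.atBot :=
      tendsto_inv_nhdsGT_zero.const_mul_atTop_of_neg
        (neg_neg_of_pos (div_pos (mass_mem hm b).1 hn))
    have hsum := Filter.Tendsto.add_atBot (hcont.tendsto.mono_left nhdsWithin_le_nhds) hinv
    refine hsum.congr' ?_
    filter_upwards [self_mem_nhdsWithin] with t ht
    have ht : 0 < t := ht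
    rw [modHam, hamiltonian_eq, potential_eq μ b]
    simp only [hg, add_sub_cancel_left]
    rw [norm_smul, Real.norm_of_nonneg ht.le]
    field_simp
    ring
  obtain ⟨t₀, ht₀, ht₀'⟩ := ((htend.eventually (Filter.eventually_le_atBot c)).and
    (Ioo_mem_nhdsGT ht₁0)).exists
  have hcont : ContinuousOn (fun t : ℝ => modHam μ χ (pos μ b + t • y, p)) (Icc t₀ t₁) := by
    intro t ht
    obtain ⟨D, hD, -⟩ := h.hasDerivAt_ray (p := p) hy (ht₀'.1.trans_le ht.1)
      ((mul_le_mul_of_nonneg_right ht.2 hn.le).trans_lt ht₁r)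
    exact hD.continuousAt.continuousWithinAt
  obtain ⟨t, ht, hroot⟩ := intermediate_value_Icc ht₀'.2.le hcont ⟨ht₀, hle'⟩
  exact ⟨t, ht₀'.1.trans_le ht.1, (mul_le_mul_of_nonneg_right ht.2 hn.le).trans_lt ht₁r, hroot⟩

theorem root_unique (h : IsStarLevel μ b χ c r) {y p : E3} {t t' : ℝ} (hy : y ≠ 0) (ht : 0 < t)
    (htt : t ≤ t') (htr : t' * ‖y‖ < r) (h1 : modHam μ χ (pos μ b + t • y, p) = c)
    (h2 : modHam μ χ (pos μ b + t' • y, p) = c) : t = t' := by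
  have hD : ∀ s : ℝ, ∃ D, s ∈ Icc t t' →
      HasDerivAt (fun t : ℝ => modHam μ χ (pos μ b + t • y, p)) D s ∧
        (modHam μ χ (pos μ b + s • y, p) ≤ c → 0 < D) := by
    intro s
    by_cases hs : s ∈ Icc t t'
    · obtain ⟨D, hD⟩ := h.hasDerivAt_ray (p := p) hy (ht.trans_le hs.1)
        ((mul_le_mul_of_nonneg_right hs.2 (norm_nonneg y)).trans_lt htr)
      exact ⟨D, fun _ => hD⟩
    · exact ⟨0, fun h => absurd h hs⟩
  choose D hD using hD
  exact eq_of_deriv_pos_of_le htt (fun s hs => (hD s hs).1) (fun s hs => (hD s hs).2) h1 h2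

theorem northCoord_snd_ne_zero {z : R4 × R4} (hz : z ∈ unitCotangentSphere) (h1 : z.1.fst ≠ 1) :
    (northCoord z).2 ≠ 0 := by
  intro h0
  have := stereoLift_snd_norm (northCoord z)
  rw [stereoLift_northCoord hz.1 h1, h0, hz.2] at this
  simp at this

theorem moserQP_smul (z : R4 × R4) (t : ℝ) :
    moserQP μ b (z.1, t • z.2) = (pos μ b + t • (northCoord z).2, -(northCoord z).1) := by
  rw [moserQP, northCoord_smul]

theorem eq_of_fst_eq_one {z : R4 × R4} (hz : z ∈ unitCotangentSphere) (h1 : z.1.fst = 1) :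
    z.1.snd = 0 ∧ z.2.fst = 0 := by
  have h2 := snd_norm_sq_of_mem hz.1
  rw [h1] at h2
  have h3 : z.1.snd = 0 := by
    rw [← norm_eq_zero]
    nlinarith [norm_nonneg z.1.snd]
  have h4 := inner_snd_of_mem hz.1
  rw [h3, h1, inner_zero_left] at h4
  exact ⟨h3, by linarith⟩

/-- A base point other than the north pole fixes p, and the fibre ray over it is a ray of positions,
so `exists_root` applies. Over the pole the level consists of the collisions with covectors of
length equal to the mass. -/
theorem surjOn (h : IsStarLevel μ b χ c r) (hm : μ ∈ Ioo (0 : ℝ) 1) (hr : 0 < r) :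
    SurjOn (starMap (μ := μ) b) (surf μ χ c (Metric.ball (pos μ b) r)) unitCotangentSphere := by
  intro z hz
  by_cases h1 : z.1.fst = 1
  · obtain ⟨h3, h4⟩ := eq_of_fst_eq_one hz h1
    have hmp := (mass_mem hm b).1
    have hz2 : ‖z.2.snd‖ = 1 := by
      have := R4.norm_sq_eq z.2
      rw [hz.2, h4] at this
      nlinarith [norm_nonneg z.2.snd]
    have hn : ‖mass μ b • z.2.snd‖ = mass μ b := by
      rw [norm_smul, hz2, Real.norm_of_nonneg hmp.le, mul_one]
    have hη : mass μ b • z.2.snd ≠ 0 := by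
      rw [← norm_pos_iff, hn]; exact hmp
    refine ⟨.collision b _ hη, collision_mem_surf.2 ⟨Metric.mem_ball_self hr, hn⟩, ?_⟩
    refine starMap_eq_of_moser hz hmp ?_
    refine Prod.ext (R4.ext' h1.symm h3.symm) (R4.ext' ?_ ?_)
    · simp [RegPhase.moser, h4]
    · simp [RegPhase.moser]
  · have hy := northCoord_snd_ne_zero hz h1
    obtain ⟨t, ht, htr, hroot⟩ := h.exists_root hm (p := -(northCoord z).1) hy
    have hn : ‖t • (northCoord z).2‖ < r := by rwa [norm_smul, Real.norm_of_nonneg ht.le]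
    have hz' := h.mem_phaseSpace (p := -(northCoord z).1) (smul_ne_zero ht.ne' hy) hn
    refine ⟨.phase _ hz', phase_mem_surf.2 ⟨by simpa using hn, hroot⟩, ?_⟩
    refine starMap_eq_of_moser hz ht ?_
    have h2 := moser_moserQP (μ := μ) (b := b) (z := (z.1, t • z.2))
      (smul_mem_cotangentSphere hz.1 t) h1 (by rwa [moserQP_smul])
    convert h2 using 2
    simp only [moserQP_smul]

theorem injOn (h : IsStarLevel μ b χ c r) :
    InjOn (starMap (μ := μ) b) (surf μ χ c (Metric.ball (pos μ b) r)) := by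
  -- `root_unique` needs the two parameters on the ray in order; by symmetry the covector lengths
  -- may be assumed ordered.
  have key : ∀ x x' : RegPhase μ, x ∈ surf μ χ c (Metric.ball (pos μ b) r) →
      x' ∈ surf μ χ c (Metric.ball (pos μ b) r) → starMap b x = starMap b x' →
      ‖(x.moser b).2‖ ≤ ‖(x'.moser b).2‖ → x = x' := by
    intro x x' hx hx' he hle
    have h1 : (x.moser b).1 = (x'.moser b).1 :=
      show (starMap b x).1 = (starMap b x').1 from congrArg Prod.fst he
    rcases hx with ⟨z, hz, rfl, hzb, hH⟩ | ⟨b', η, hη, rfl, hb, hn⟩ <;>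
      rcases hx' with ⟨z', hz', rfl, hzb', hH'⟩ | ⟨b'', η', hη', rfl, hb', hn'⟩
    · have hu := starMap_mem (b := b) (RegPhase.phase z hz)
      have e1 := moser_eq_starMap (b := b) (RegPhase.phase z hz)
      have e2 := moser_eq_starMap (b := b) (RegPhase.phase z' hz')
      rw [← he] at e2
      generalize starMap b (RegPhase.phase z hz) = ζ at hu e1 e2
      have hζ : ζ.1.fst ≠ 1 := by
        have := stereoLift_fst_ne (-z.2, z.1 - pos μ b)
        change (RegPhase.moser b (RegPhase.phase z hz)).1.fst ≠ 1 at this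
        rwa [e1] at this
      have q1 := moserQP_moser (b := b) hz
      have q2 := moserQP_moser (b := b) hz'
      have hpos := norm_pos_iff.2 (moser_snd_ne_zero (b := b) (RegPhase.phase z hz))
      rw [e1, moserQP_smul] at q1
      rw [e2, moserQP_smul] at q2
      have hy := northCoord_snd_ne_zero hu hζ
      have hzz : z = z' := by
        rw [← q1] at hH
        rw [← q2] at hH' hzb'
        have hpos' := hpos.trans_le hle
        have hr' : ‖(RegPhase.moser b (RegPhase.phase z' hz')).2‖ * ‖(northCoord ζ).2‖ < r := by
          simpa [norm_smul] using hzb'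
        have := h.root_unique hy hpos hle hr' hH hH'
        rw [← q1, ← q2, this]
      subst hzz
      rfl
    · exact absurd (congrArg WithLp.fst h1) (stereoLift_fst_ne _)
    · exact absurd (congrArg WithLp.fst h1).symm (stereoLift_fst_ne _)
    · obtain rfl := h.eq_of_pos_mem hb
      obtain rfl := h.eq_of_pos_mem hb'
      have e1 := moser_eq_starMap (b := b'') (RegPhase.collision b'' η hη : RegPhase μ)
      have e2 := moser_eq_starMap (b := b'') (RegPhase.collision b'' η' hη' : RegPhase μ)
      have hnorm : ∀ (η : E3) (hη : η ≠ 0),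
          ‖((RegPhase.collision b'' η hη : RegPhase μ).moser b'').2‖ = ‖η‖ := by
        intro η hη
        refine (pow_left_inj₀ (norm_nonneg _) (norm_nonneg _) two_ne_zero).1 ?_
        rw [R4.norm_sq_eq]
        simp [RegPhase.moser]
      rw [hnorm, hn] at e1
      rw [hnorm, hn', ← he, ← e1] at e2
      have : η' = η := congrArg (fun w : R4 × R4 => w.2.snd) e2
      subst this
      rfl
  intro x hx x' hx' he
  rcases le_total ‖(x.moser b).2‖ ‖(x'.moser b).2‖ with hle | hle
  · exact key x x' hx hx' he hle
  · exact (key x' x hx' hx he.symm hle).symm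

/-- A smooth coordinate system in which the level is given by an equation with a simple root along
the fibre yields a local inverse of `starMap`. -/
theorem exists_local_inverse_of_coord {x : RegPhase μ} (i : Option Primary)
    (co : R4 × R4 → E3 × E3) (F : E3 × E3 → ℝ) (D : ℝ)
    (hco : co (x.moser b) = chart μ i x)
    (hev : ∀ᶠ w in 𝓝 (x.moser b), ContDiffAt ℝ ∞ co w ∧ ContDiffAt ℝ ∞ F (co w) ∧
      co w ∈ (chart μ i).target ∧
      (w ∈ cotangentSphere → (F (co w) = 0 →
        (chart μ i).symm (co w) ∈ surf μ χ c (Metric.ball (pos μ b) r)) ∧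
        ((chart μ i).symm (co w)).moser b = w))
    (hF0 : F (chart μ i x) = 0)
    (hD : HasDerivAt (fun t : ℝ => F (co ((starMap b x).1, t • (starMap b x).2))) D
      ‖(x.moser b).2‖) (hD0 : D ≠ 0) :
    ∃ G : R4 × R4 → RegPhase μ,
      (∀ᶠ ζ in 𝓝 (starMap b x), ContMDiffAt 𝓘(ℝ, R4 × R4) 𝓘(ℝ, E3 × E3) ∞ G ζ) ∧
      ∀ᶠ ζ in 𝓝 (starMap b x), ζ ∈ unitCotangentSphere →
        G ζ ∈ surf μ χ c (Metric.ball (pos μ b) r) ∧ starMap b (G ζ) = ζ := by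
  set ζ₀ := starMap b x with hζ₀
  set t₀ := ‖(x.moser b).2‖ with ht₀
  have ht₀pos : 0 < t₀ := norm_pos_iff.2 (moser_snd_ne_zero x)
  have e0 : x.moser b = (ζ₀.1, t₀ • ζ₀.2) := moser_eq_starMap x
  have hu : ζ₀ ∈ unitCotangentSphere := starMap_mem x
  have hΦs : ContDiff ℝ ∞ fun v : (R4 × R4) × ℝ => ((v.1.1, v.2 • v.1.2) : R4 × R4) :=
    (contDiff_fst.comp contDiff_fst).prodMk (contDiff_snd.smul (contDiff_snd.comp contDiff_fst))
  have hΦ : Filter.Tendsto (fun v : (R4 × R4) × ℝ => ((v.1.1, v.2 • v.1.2) : R4 × R4))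
      (𝓝 (ζ₀, t₀)) (𝓝 (x.moser b)) := by
    have := hΦs.continuous.tendsto (ζ₀, t₀)
    rwa [e0]
  -- The unknown is the length τ of the covector in the fibre direction ζ; the local inverse
  -- attaches to ζ the point of the level with covector τ(ζ)·ζ.
  obtain ⟨τ, hτ0, hτ⟩ := exists_smooth_root (E := R4 × R4)
    (F := fun v => F (co (v.1.1, v.2 • v.1.2))) (a := ζ₀) (t₀ := t₀)
    (by
      filter_upwards [hΦ.eventually hev] with v hv
      exact hv.2.1.comp v (hv.1.comp v hΦs.contDiffAt))
    (by simpa only [← e0, hco] using hF0) hD hD0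
  have hτc : ContinuousAt τ ζ₀ := hτ.self_of_nhds.1.continuousAt
  have hten : Filter.Tendsto (fun ζ : R4 × R4 => (ζ, τ ζ)) (𝓝 ζ₀) (𝓝 (ζ₀, t₀)) := by
    have : ContinuousAt (fun ζ : R4 × R4 => (ζ, τ ζ)) ζ₀ := continuousAt_id.prodMk hτc
    simpa [ContinuousAt, hτ0] using this
  refine ⟨fun ζ => (chart μ i).symm (co (ζ.1, τ ζ • ζ.2)), ?_, ?_⟩
  · filter_upwards [hτ, hten.eventually (hΦ.eventually hev)] with ζ h1 h2
    have h3 : ContDiffAt ℝ ∞ (fun ζ : R4 × R4 => co (ζ.1, τ ζ • ζ.2)) ζ :=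
      ContDiffAt.comp (f := fun ζ : R4 × R4 => (ζ.1, τ ζ • ζ.2)) ζ h2.1
        (contDiffAt_fst.prodMk (h1.1.smul contDiffAt_snd))
    exact ContMDiffAt.comp ζ ((contMDiffOn_chart_symm' i).contMDiffAt
      ((chart μ i).open_target.mem_nhds h2.2.2.1)) h3.contMDiffAt
  · have hτpos : ∀ᶠ ζ in 𝓝 ζ₀, 0 < τ ζ :=
      hτc.eventually_const_lt (by rw [hτ0]; exact ht₀pos)
    filter_upwards [hτ, hten.eventually (hΦ.eventually hev), hτpos] with ζ h1 h2 h3 h4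
    have h5 := h2.2.2.2 (smul_mem_cotangentSphere h4.1 _)
    exact ⟨h5.1 h1.2, starMap_eq_of_moser h4 h3 h5.2⟩

/-- Away from collisions the coordinates are (q, p), the equation is H + χ = c, and the fibre
derivative is positive by `hasDerivAt_ray`. At a collision the coordinates are (u, v), the equation
is `colFun` = 0, and along the fibre this reads 1/2 - m/|v|, whose derivative is explicit. -/
theorem exists_local_inverse (h : IsStarLevel μ b χ c r) (hm : μ ∈ Ioo (0 : ℝ) 1)
    {x : RegPhase μ} (hx : x ∈ surf μ χ c (Metric.ball (pos μ b) r)) :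
    ∃ G : R4 × R4 → RegPhase μ,
      (∀ᶠ ζ in 𝓝 (starMap b x), ContMDiffAt 𝓘(ℝ, R4 × R4) 𝓘(ℝ, E3 × E3) ∞ G ζ) ∧
      ∀ᶠ ζ in 𝓝 (starMap b x), ζ ∈ unitCotangentSphere →
        G ζ ∈ surf μ χ c (Metric.ball (pos μ b) r) ∧ starMap b (G ζ) = ζ := by
  set ζ₀ := starMap b x with hζ₀
  set t₀ := ‖(x.moser b).2‖ with ht₀
  have ht₀pos : 0 < t₀ := norm_pos_iff.2 (moser_snd_ne_zero x)
  have e0 : x.moser b = (ζ₀.1, t₀ • ζ₀.2) := moser_eq_starMap x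
  have hu : ζ₀ ∈ unitCotangentSphere := starMap_mem x
  have main := exists_local_inverse_of_coord (b := b) (c := c) (χ := χ) (r := r) (x := x)
  rcases hx with ⟨z, hz, rfl, hzb, hH⟩ | ⟨b', η, hη, rfl, hb, hn⟩
  · have hne : ((RegPhase.phase z hz).moser b).1.fst ≠ 1 := stereoLift_fst_ne _
    have hζ1 : ζ₀.1.fst ≠ 1 := by rwa [e0] at hne
    have hco := moserQP_moser (b := b) hz
    have hy := northCoord_snd_ne_zero hu hζ1
    have hq := hco
    rw [e0, moserQP_smul] at hq
    have hzb1 := hzb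
    have hH1 := hH
    rw [← hq] at hzb1 hH1
    have htr : t₀ * ‖(northCoord ζ₀).2‖ < r := by
      simpa [norm_smul, abs_of_pos ht₀pos] using hzb1
    obtain ⟨D, hD, hDpos⟩ := h.hasDerivAt_ray (p := -(northCoord ζ₀).1) hy ht₀pos htr
    refine main none (moserQP μ b) (fun z => modHam μ χ z - c) D hco ?_
      (by simpa [sub_eq_zero] using hH) ?_ (hDpos hH1.le).ne'
    · have hcont : ContinuousAt (moserQP μ b) ((RegPhase.phase z hz).moser b) :=
        (moserQP_contDiffAt hne).continuousAt
      have hA : phaseSpace μ ∈ 𝓝 (moserQP μ b ((RegPhase.phase z hz).moser b)) := by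
        rw [hco]; exact (isOpen_phaseSpace μ).mem_nhds hz
      have hB : {w : E3 × E3 | w.1 ∈ Metric.ball (pos μ b) r} ∈
          𝓝 (moserQP μ b ((RegPhase.phase z hz).moser b)) := by
        rw [hco]; exact (Metric.isOpen_ball.preimage continuous_fst).mem_nhds hzb
      have h2 : ∀ᶠ w in 𝓝 ((RegPhase.phase z hz).moser b), w.1.fst ≠ 1 :=
        ((R4.contDiff_fst.comp contDiff_fst).continuous.continuousAt).eventually_ne hne
      filter_upwards [hcont.preimage_mem_nhds hA, hcont.preimage_mem_nhds hB, h2] with w hwA hwB hw1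
      have hw : moserQP μ b w ∈ phaseSpace μ ∧ (moserQP μ b w).1 ∈ Metric.ball (pos μ b) r :=
        ⟨hwA, hwB⟩
      refine ⟨moserQP_contDiffAt hw1, ?_, hw.1, fun hwS => ⟨fun h0 => ?_, ?_⟩⟩
      · exact ((contDiffAt_hamiltonian hw.1).add
          ((h.smooth _ hw.2).comp _ contDiffAt_fst)).sub contDiffAt_const
      · rw [chart_none_symm hw.1]
        exact phase_mem_surf.2 ⟨hw.2, sub_eq_zero.1 h0⟩
      · rw [chart_none_symm hw.1]
        exact moser_moserQP hwS hw1 hw.1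
    · simp only [moserQP_smul]
      exact hD.sub_const c
  · obtain rfl := h.eq_of_pos_mem hb
    have hmp := (mass_mem hm b').1
    have hcol := collision_mem (μ := μ) (b := b') hη
    have hfst : ((RegPhase.collision b' η hη : RegPhase μ).moser b').1.fst = 1 := rfl
    have hv : southCoord ((RegPhase.collision b' η hη : RegPhase μ).moser b') =
        (0, (2 : ℝ) • η) := southCoord_collision μ b' b' η hη
    have hv' := hv
    rw [e0, southCoord_smul] at hv'
    have hu0 : (southCoord ζ₀).1 = 0 := congrArg Prod.fst hv'
    have hv0 : t₀ • (southCoord ζ₀).2 = (2 : ℝ) • η := congrArg Prod.snd hv'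
    have hvn : t₀ * ‖(southCoord ζ₀).2‖ = 2 * mass μ b' := by
      have := congrArg norm hv0
      simpa [norm_smul, hn, ht₀pos.le, abs_of_pos ht₀pos] using this
    have hvpos : 0 < ‖(southCoord ζ₀).2‖ := by
      by_contra hneg
      have : ‖(southCoord ζ₀).2‖ = 0 := le_antisymm (not_lt.1 hneg) (norm_nonneg _)
      rw [this] at hvn
      linarith
    have hcol0 : colFun μ b' χ c (chart μ (some b') (.collision b' η hη)) = 0 :=
      (mem_surf_iff_colFun hcol (collision_mem_over.2 hb)).1
        (collision_mem_surf.2 ⟨hb, hn⟩)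
    refine main (some b') southCoord (colFun μ b' χ c)
      (mass μ b' / ‖(southCoord ζ₀).2‖ / t₀ ^ 2) rfl ?_ hcol0 ?_ (by positivity)
    · have hne1 : ((RegPhase.collision b' η hη : RegPhase μ).moser b').1.fst ≠ -1 := by
        rw [hfst]; norm_num
      have h2 : ∀ᶠ w in 𝓝 ((RegPhase.collision b' η hη : RegPhase μ).moser b'), w.1.fst ≠ -1 :=
        ((R4.contDiff_fst.comp contDiff_fst).continuous.continuousAt).eventually_ne hne1
      have hcont := (southCoord_contDiffAt hne1).continuousAt
      have htar : southCoord ((RegPhase.collision b' η hη : RegPhase μ).moser b') ∈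
        collisionTarget μ b' := (chart μ (some b')).map_source hcol
      have h1 : ∀ᶠ w in 𝓝 ((RegPhase.collision b' η hη : RegPhase μ).moser b'),
          southCoord w ∈ collisionTarget μ b' ∧
          collisionPos μ b' (southCoord w) ∈ Metric.ball (pos μ b') r := by
        refine (hcont.eventually (p := fun w => w ∈ collisionTarget μ b')
          ((isOpen_collisionTarget μ b').mem_nhds htar)).and (hcont.eventually
          (p := fun w => collisionPos μ b' w ∈ Metric.ball (pos μ b') r) ?_)
        refine (contDiff_collisionPos μ b').continuous.continuousAt.eventually
          (Metric.isOpen_ball.mem_nhds ?_)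
        rw [hv]
        simpa [collisionPos] using Metric.nonempty_ball.1 ⟨_, hb⟩
      filter_upwards [h1, h2] with w hw hw1
      refine ⟨southCoord_contDiffAt hw1, contDiffAt_colFun hw.1 (h.smooth _ hw.2), hw.1,
        fun hwS => ⟨fun h0 => ?_, moser_symm_southCoord hwS hw1 hw.1⟩⟩
      have hsrc := (chart μ (some b')).map_target hw.1
      have hri := (chart μ (some b')).right_inv hw.1
      refine (mem_surf_iff_colFun hsrc ((mem_over_iff_collisionPos hsrc).2 ?_)).2 ?_
      · rw [hri]; exact hw.2
      · rw [hri]; exact h0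
    · simp only [← hζ₀, southCoord_smul, hu0]
      have h3 : HasDerivAt (fun t : ℝ => 1 / 2 - mass μ b' / ‖(southCoord ζ₀).2‖ * t⁻¹)
          (-(mass μ b' / ‖(southCoord ζ₀).2‖ * -(t₀ ^ 2)⁻¹)) t₀ :=
        ((hasDerivAt_inv ht₀pos.ne').const_mul _).const_sub _
      refine (h3.congr_of_eventuallyEq ?_).congr_deriv (by field_simp)
      filter_upwards [lt_mem_nhds ht₀pos] with t ht
      rw [colFun_zero, norm_smul, Real.norm_of_nonneg ht.le]
      field_simp

/-- A regularized star-shaped level is the unit cotangent bundle of the three-sphere. -/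
theorem isDiffeoOn (h : IsStarLevel μ b χ c r) (hm : μ ∈ Ioo (0 : ℝ) 1) (hr : 0 < r) :
    IsDiffeoOn 𝓘(ℝ, E3 × E3) 𝓘(ℝ, R4 × R4) (starMap b)
      (surf μ χ c (Metric.ball (pos μ b) r)) unitCotangentSphere := by
  set S := surf μ χ c (Metric.ball (pos μ b) r) with hS
  have hinj : InjOn (starMap b) S := h.injOn
  refine ⟨⟨fun x _ => starMap_mem x, hinj, h.surjOn hm hr⟩, ?_, Function.invFunOn (starMap b) S,
    ?_, hinj.leftInvOn_invFunOn⟩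
  · refine .of_eventually fun x hx => ⟨starMap b, ?_, Filter.Eventually.of_forall fun _ _ => rfl⟩
    have hx' : x ∈ (chart μ none).source ∪ (chart μ (some b)).source := by
      rcases hx with ⟨z, hz, rfl, -⟩ | ⟨b', η, hη, rfl, hb, -⟩
      · exact Or.inl (phase_mem hz)
      · obtain rfl := h.eq_of_pos_mem hb
        exact Or.inr (collision_mem hη)
    filter_upwards [((chart μ none).open_source.union (chart μ (some b)).open_source).mem_nhds hx']
      with y hy
    exact starMap_contMDiffAt hy
  · refine .of_eventually fun ζ hζ => ?_
    obtain ⟨x, hx, rfl⟩ := h.surjOn hm hr hζ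
    obtain ⟨G, hG, hG'⟩ := h.exists_local_inverse hm hx
    refine ⟨G, hG, hG'.mono fun ζ h1 h2 => ?_⟩
    obtain ⟨h3, h4⟩ := h1 h2
    have := hinj.leftInvOn_invFunOn h3
    rwa [h4] at this

end IsStarLevel


/-! ### Hill's region and its components -/

theorem hillRegion_eq (μ c : ℝ) : hillRegion μ c = {q ∈ offPrimaries μ | potential μ q ≤ c} := by
  ext q
  constructor
  · rintro ⟨z, ⟨hz, hH⟩, rfl⟩
    exact ⟨hz, hH ▸ potential_le_hamiltonian μ z⟩
  · rintro ⟨hq, hV⟩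
    -- The momentum for which the velocity points along the first axis and has exactly the kinetic
    -- energy c - V.
    refine ⟨(q, !₂[-q 1 + √(2 * (c - potential μ q)), q 0, 0]), ⟨hq, ?_⟩, rfl⟩
    rw [hamiltonian_eq]
    simp only [Matrix.cons_val]
    have := Real.sq_sqrt (show 0 ≤ 2 * (c - potential μ q) by linarith)
    linear_combination this / 2

theorem potential_le_neg_div {μ : ℝ} (hm : μ ∈ Ioo (0 : ℝ) 1) (b : Primary) (q : E3) :
    potential μ q ≤ -(mass μ b / ‖q - pos μ b‖) := by
  rw [potential_eq μ b]
  have h1 : 0 ≤ (q 0 ^ 2 + q 1 ^ 2) / 2 := by positivity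
  have h2 : 0 ≤ (1 - mass μ b) / ‖q - pos μ b.other‖ :=
    div_nonneg (by linarith [(mass_mem hm b).2]) (norm_nonneg _)
  linarith

theorem exists_ball_subset_hillRegion {μ : ℝ} (hm : μ ∈ Ioo (0 : ℝ) 1) (c : ℝ) (b : Primary) :
    ∃ δ > 0, Metric.ball (pos μ b) δ \ {pos μ b} ⊆ hillRegion μ c := by
  have hmp := (mass_mem hm b).1
  refine ⟨min 1 (mass μ b / (|c| + 1)), by positivity, ?_⟩
  rintro q ⟨hq, hqb⟩
  rw [mem_singleton_iff] at hqb
  rw [hillRegion_eq]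
  refine ⟨ball_mem_offPrimaries (min_le_left _ _) hq hqb, ?_⟩
  have hn : 0 < ‖q - pos μ b‖ := norm_pos_iff.2 (sub_ne_zero.2 hqb)
  have h1 : ‖q - pos μ b‖ < mass μ b / (|c| + 1) :=
    (mem_ball_iff_norm.1 hq).trans_le (min_le_right _ _)
  have h2 : |c| + 1 ≤ mass μ b / ‖q - pos μ b‖ := by
    rw [le_div_iff₀ hn]
    rw [lt_div_iff₀ (by positivity)] at h1
    linarith
  linarith [potential_le_neg_div hm b q, neg_abs_le c]

theorem pos_mem_closure_hillRegion {μ : ℝ} (hm : μ ∈ Ioo (0 : ℝ) 1) (c : ℝ) {b : Primary}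
    {Ω : Set E3} (hΩ : IsOpen Ω) (hb : pos μ b ∈ Ω) : pos μ b ∈ closure (hillRegion μ c ∩ Ω) := by
  obtain ⟨δ, hδ, hsub⟩ := exists_ball_subset_hillRegion hm c b
  have h : (Metric.ball (pos μ b) δ ∩ Ω) ∩ {pos μ b}ᶜ ⊆ hillRegion μ c ∩ Ω :=
    fun q hq => ⟨hsub ⟨hq.1.1, hq.2⟩, hq.1.2⟩
  refine closure_mono h ?_
  rw [mem_closure_iff_nhds]
  intro t ht
  have h1 : t ∩ (Metric.ball (pos μ b) δ ∩ Ω) ∈ 𝓝 (pos μ b) :=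
    Filter.inter_mem ht (Filter.inter_mem (Metric.ball_mem_nhds _ hδ) (hΩ.mem_nhds hb))
  obtain ⟨q, hq, hq'⟩ := ((Filter.Eventually.filter_mono nhdsWithin_le_nhds h1).and
    (self_mem_nhdsWithin (s := {pos μ b}ᶜ))).exists
  exact ⟨q, hq.1, hq.2, hq'⟩

/-- Hill's region avoids the frontier of Ω, so it is separated by Ω and the complement of its
closure. A component that accumulates at a point of B enters Ω and therefore stays in it; conversely
the part in Ω is connected and accumulates at all of B. -/
theorem hillComponent_eq {μ c : ℝ} {Ω B : Set E3} (hΩ : IsOpen Ω)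
    (hbd : ∀ q ∈ closure Ω, q ∉ Ω → q ∉ hillRegion μ c)
    (hconn : IsPreconnected (hillRegion μ c ∩ Ω)) (hBΩ : B ⊆ Ω) (hB : B.Nonempty)
    (hcl : B ⊆ closure (hillRegion μ c ∩ Ω)) : hillComponent μ c B = hillRegion μ c ∩ Ω := by
  have hsub : ∀ q ∈ hillRegion μ c, (connectedComponentIn (hillRegion μ c) q ∩ Ω).Nonempty →
      connectedComponentIn (hillRegion μ c) q ⊆ Ω := by
    intro q hq hne
    refine isPreconnected_connectedComponentIn.subset_left_of_subset_union hΩ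
      (isClosed_closure (s := Ω)).isOpen_compl ?_ ?_ hne
    · exact disjoint_compl_right.mono_left subset_closure
    · intro q' hq'
      by_contra hcon
      rw [mem_union, not_or, notMem_compl_iff] at hcon
      exact hbd q' hcon.2 hcon.1 (connectedComponentIn_subset _ _ hq')
  ext q
  constructor
  · rintro ⟨hq, hqB⟩
    refine ⟨hq, ?_⟩
    obtain ⟨p, hp⟩ := hB
    obtain ⟨q', hq'⟩ := mem_closure_iff_nhds.1 (hqB hp) Ω (hΩ.mem_nhds (hBΩ hp))
    exact hsub q hq ⟨q', hq'.2, hq'.1⟩ (mem_connectedComponentIn hq)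
  · rintro ⟨hq, hqΩ⟩
    refine ⟨hq, hcl.trans (closure_mono ?_)⟩
    exact hconn.subset_connectedComponentIn ⟨hq, hqΩ⟩ inter_subset_left

/-- The regularized hypersurface over an open set that cuts out a component of Hill's region. -/
theorem regularizedHypersurface_eq_surf {μ c : ℝ} (hm : μ ∈ Ioo (0 : ℝ) 1) {Ω : Set E3}
    {Bs : Set Primary} (hΩ : IsOpen Ω)
    (hbd : ∀ q ∈ closure Ω, q ∉ Ω → q ∈ offPrimaries μ ∧ c < potential μ q)
    (hconn : IsPreconnected (hillRegion μ c ∩ Ω)) (hBΩ : ∀ b ∈ Bs, pos μ b ∈ Ω)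
    (hB : Bs.Nonempty) : regularizedHypersurface μ c (pos μ '' Bs) = surf μ 0 c Ω := by
  rw [← closure_level_eq_surf hm hΩ hbd, regularizedHypersurface]
  congr 1
  ext x
  have h := hillComponent_eq (μ := μ) (c := c) (B := pos μ '' Bs) hΩ
    (fun q h1 h2 h3 => by
      rw [hillRegion_eq] at h3
      exact absurd (hbd q h1 h2).2 (not_lt.2 h3.2)) hconn
    (by rintro _ ⟨b, hb, rfl⟩; exact hBΩ b hb) (hB.image _)
    (by rintro _ ⟨b, hb, rfl⟩; exact pos_mem_closure_hillRegion hm c hΩ (hBΩ b hb))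
  constructor
  · rintro ⟨z, hz, rfl, hH, hc⟩
    rw [h] at hc
    exact ⟨z, hz, rfl, hc.2, hH.2⟩
  · rintro ⟨z, hz, rfl, hzΩ, hH⟩
    refine ⟨z, hz, rfl, ⟨hz, hH⟩, ?_⟩
    rw [h]
    exact ⟨⟨z, ⟨hz, hH⟩, rfl⟩, hzΩ⟩

/-! ### The potential along rays -/

theorem rayPot_strictMonoOn {m k τ r : ℝ} (hm : m ∈ Ioo (0 : ℝ) 1) (hr : axisSlope m r = 0)
    (hr1 : r < 1) (hτ : -1 ≤ τ) (hτ1 : τ ≤ 1) (hk : k ≤ 1) :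
    StrictMonoOn (rayPot m k τ) (Ioc 0 r) := by
  refine strictMonoOn_of_hasDerivWithinAt_pos (f' := raySlope m k τ) (convex_Ioc 0 r) ?_ ?_ ?_
  · exact fun ρ hρ => (hasDerivAt_rayPot hρ.1 (hρ.2.trans_lt hr1)
      hτ1).continuousAt.continuousWithinAt
  · intro ρ hρ
    rw [interior_Ioc] at hρ
    exact (hasDerivAt_rayPot hρ.1 (hρ.2.trans hr1) hτ1).hasDerivWithinAt
  · intro ρ hρ
    rw [interior_Ioc] at hρ
    exact raySlope_pos hm hr hr1 hρ.1 hρ.2.le hτ hτ1 hk fun h => hρ.2.ne h.1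

theorem axisPot_le_rayPot {m k τ ρ : ℝ} (hm : m ∈ Ioo (0 : ℝ) 1) (h0 : 0 < ρ) (h1 : ρ < 1)
    (hτ : -1 ≤ τ) (hτ1 : τ ≤ 1) (hk : k ≤ 1) (hk1 : τ = 1 → k = 1) :
    axisPot m ρ ≤ rayPot m k τ ρ := by
  rcases hτ1.lt_or_eq with h | rfl
  · exact (axisPot_lt_rayPot hm h0 h1 hτ h hk).le
  · rw [hk1 rfl, rayPot_axis h1.le]

theorem horiz_smul {y : E3} {t : ℝ} (ht : t ≠ 0) : horiz (t • y) = horiz y := by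
  simp only [horiz, PiLp.smul_apply, smul_eq_mul, norm_smul, mul_pow, Real.norm_eq_abs, sq_abs]
  rw [← mul_add, mul_div_mul_left _ _ (pow_ne_zero 2 ht)]

theorem cosOther_smul {b : Primary} {y : E3} {t : ℝ} (ht : 0 < t) :
    cosOther b (t • y) = cosOther b y := by
  simp only [cosOther, PiLp.smul_apply, smul_eq_mul, norm_smul, Real.norm_of_nonneg ht.le]
  rw [mul_left_comm, mul_div_mul_left _ _ ht.ne']

theorem potential_ray {μ : ℝ} {b : Primary} {y : E3} (hy : y ≠ 0) {t : ℝ} (ht : 0 < t) :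
    potential μ (pos μ b + t • y) = rayPot (mass μ b) (horiz y) (cosOther b y) (t * ‖y‖) := by
  have hq : pos μ b + t • y ≠ pos μ b := by
    rw [ne_eq, add_eq_left]; exact smul_ne_zero ht.ne' hy
  rw [potential_eq_rayPot hq, add_sub_cancel_left, horiz_smul ht.ne', cosOther_smul ht, norm_smul,
    Real.norm_of_nonneg ht.le]

/-- The point `(l, 0, 0)`. -/
def axisPoint (l : ℝ) : E3 := !₂[l, 0, 0]

theorem isConnected_ball_diff_center (x : E3) {δ : ℝ} (hδ : 0 < δ) :
    IsConnected (Metric.ball x δ \ {x}) := by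
  have h1 : IsConnected (Metric.sphere (0 : E3) 1) :=
    isConnected_sphere (Module.lt_rank_of_lt_finrank (by simp)) 0 zero_le_one
  have h2 := ((isConnected_Ioo hδ).prod h1).image (fun v : ℝ × E3 => x + v.1 • v.2)
    (by fun_prop)
  convert h2 using 1
  ext q
  constructor
  · rintro ⟨hq, hqx⟩
    have hn : 0 < ‖q - x‖ := norm_pos_iff.2 (sub_ne_zero.2 hqx)
    refine ⟨(‖q - x‖, ‖q - x‖⁻¹ • (q - x)), ⟨⟨hn, mem_ball_iff_norm.1 hq⟩, ?_⟩, ?_⟩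
    · rw [mem_sphere_zero_iff_norm, norm_smul, norm_inv, norm_norm, inv_mul_cancel₀ hn.ne']
    · simp only [smul_smul, mul_inv_cancel₀ hn.ne', one_smul, add_sub_cancel]
  · rintro ⟨⟨t, θ⟩, ⟨ht, hθ⟩, rfl⟩
    rw [mem_sphere_zero_iff_norm] at hθ
    simp only at hθ ht ⊢
    refine ⟨?_, ?_⟩
    · rw [mem_ball_iff_norm, add_sub_cancel_left, norm_smul, hθ, Real.norm_of_nonneg ht.1.le,
        mul_one]
      exact ht.2
    · rw [mem_singleton_iff, add_eq_left]
      refine smul_ne_zero ht.1.ne' fun h0 => ?_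
      rw [h0, norm_zero] at hθ
      exact zero_ne_one hθ

namespace IsLagrangePos

variable {μ l : ℝ}

theorem eq_axisPoint (h : IsLagrangePos μ l) {b : Primary} {q : E3}
    (hq : ‖q - pos μ b‖ = radius μ l b) (hc : cosOther b (q - pos μ b) = 1) :
    q = axisPoint l := by
  have hr := (h.radius_mem b).1
  have h1 : sgn b * (q - pos μ b) 0 = radius μ l b := by
    rw [cosOther, hq, div_eq_one_iff_eq hr.ne'] at hc
    exact hc
  have h2 := norm_sq_three (q - pos μ b)
  have h3 := sgn_mul_self b
  have h4 : ‖q - pos μ b‖ ^ 2 = (q - pos μ b) 0 ^ 2 := by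
    rw [hq, ← h1]
    linear_combination (q - pos μ b) 0 ^ 2 * h3
  simp only [PiLp.sub_apply, pos_one, pos_two, sub_zero] at h1 h2 h4
  have h5 : q 1 = 0 := by nlinarith [sq_nonneg (q 1), sq_nonneg (q 2)]
  have h6 : q 2 = 0 := by nlinarith [sq_nonneg (q 1), sq_nonneg (q 2)]
  rw [radius_eq] at h1
  have h7 : q 0 = l := by linear_combination sgn b * h1 - (q 0 - l) * h3
  ext i
  fin_cases i <;> simp [axisPoint, h5, h6, h7]

theorem critEnergy_le_potential (h : IsLagrangePos μ l) {b : Primary} {q : E3}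
    (hq : ‖q - pos μ b‖ = radius μ l b) : critEnergy μ l ≤ potential μ q := by
  have hr := h.radius_mem b
  have hqb : q ≠ pos μ b := fun he => by simp [he] at hq; linarith [hr.1]
  rw [potential_eq_rayPot hqb, critEnergy, ← axisPot_radius μ l b, hq]
  have hc := cosOther_mem b (q - pos μ b)
  exact axisPot_le_rayPot (mass_mem h.mem b) hr.1 hr.2 hc.1 hc.2 (horiz_le_one _)
    horiz_eq_one_of_cosOther

theorem critEnergy_lt_potential (h : IsLagrangePos μ l) {b : Primary} {q : E3}
    (hq : ‖q - pos μ b‖ = radius μ l b) (hne : q ≠ axisPoint l) :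
    critEnergy μ l < potential μ q := by
  have hr := h.radius_mem b
  have hqb : q ≠ pos μ b := fun he => by simp [he] at hq; linarith [hr.1]
  rw [potential_eq_rayPot hqb, critEnergy, ← axisPot_radius μ l b, hq]
  have hc := cosOther_mem b (q - pos μ b)
  exact axisPot_lt_rayPot (mass_mem h.mem b) hr.1 hr.2 hc.1
    (lt_of_le_of_ne hc.2 fun he => hne (h.eq_axisPoint hq he)) (horiz_le_one _)

theorem potentialDeriv_pos (h : IsLagrangePos μ l) {b : Primary} {q : E3} (hqb : q ≠ pos μ b)
    (hq : ‖q - pos μ b‖ ≤ radius μ l b) (hne : q ≠ axisPoint l) :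
    0 < potentialDeriv μ q (q - pos μ b) := by
  have hn : 0 < ‖q - pos μ b‖ := norm_pos_iff.2 (sub_ne_zero.2 hqb)
  have hc := cosOther_mem b (q - pos μ b)
  rw [potentialDeriv_eq_raySlope hqb]
  exact mul_pos hn (raySlope_pos (mass_mem h.mem b) (h.axisSlope_radius b) (h.radius_mem b).2 hn hq
    hc.1 hc.2 (horiz_le_one _) fun he => hne (h.eq_axisPoint he.1 he.2))

theorem radialEnergy_pos (h : IsLagrangePos μ l) {b : Primary} {q : E3} (hqb : q ≠ pos μ b)
    (hq : ‖q - pos μ b‖ ≤ radius μ l b) (hne : q ≠ axisPoint l) :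
    0 < radialEnergy μ b (critEnergy μ l) q := by
  have hn : 0 < ‖q - pos μ b‖ := norm_pos_iff.2 (sub_ne_zero.2 hqb)
  have hc := cosOther_mem b (q - pos μ b)
  rw [radialEnergy_eq hqb, critEnergy, ← axisPot_radius μ l b]
  exact mul_pos (by positivity) (rayEnergy_pos (mass_mem h.mem b) (h.axisSlope_radius b)
    (h.radius_mem b).2 hn hq hc.1 hc.2 (horiz_nonneg _) (horiz_le_one _)
    horiz_eq_one_of_cosOther fun he => hne (h.eq_axisPoint he.1 he.2))

theorem axisPoint_notMem_ball (μ l : ℝ) (b : Primary) :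
    axisPoint l ∉ Metric.ball (pos μ b) (radius μ l b) := by
  rw [mem_ball_iff_norm, not_lt]
  refine abs_le_of_sq_le_sq' ?_ (norm_nonneg _) |>.2
  rw [norm_sq_three, radius_eq]
  simp only [PiLp.sub_apply, pos_one, pos_two, axisPoint, Matrix.cons_val]
  have := sgn_mul_self b
  apply le_of_eq
  linear_combination (l - pos μ b 0) ^ 2 * this

/-- Hill's region is star-shaped in the ball up to the Lagrange point. -/
theorem ray_mem_hillRegion (h : IsLagrangePos μ l) {c : ℝ} {b : Primary} {q : E3}
    (hq : q ∈ hillRegion μ c ∩ Metric.ball (pos μ b) (radius μ l b)) {t : ℝ} (ht : t ∈ Ioc 0 1) :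
    pos μ b + t • (q - pos μ b) ∈ hillRegion μ c ∩ Metric.ball (pos μ b) (radius μ l b) := by
  rw [hillRegion_eq] at hq ⊢
  obtain ⟨⟨hqo, hV⟩, hqr⟩ := hq
  have hy : q - pos μ b ≠ 0 := sub_ne_zero.2 (hqo b)
  have hn : 0 < ‖q - pos μ b‖ := norm_pos_iff.2 hy
  rw [mem_ball_iff_norm] at hqr
  have htn : t * ‖q - pos μ b‖ ≤ ‖q - pos μ b‖ := by nlinarith [ht.2]
  have hball : pos μ b + t • (q - pos μ b) ∈ Metric.ball (pos μ b) (radius μ l b) := by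
    rw [mem_ball_iff_norm, add_sub_cancel_left, norm_smul, Real.norm_of_nonneg ht.1.le]
    linarith
  refine ⟨⟨ball_mem_offPrimaries (h.radius_mem b).2.le hball ?_, ?_⟩, hball⟩
  · rw [ne_eq, add_eq_left]; exact smul_ne_zero ht.1.ne' hy
  · refine le_trans ?_ hV
    rw [potential_ray hy ht.1, potential_eq_rayPot (hqo b)]
    have hc := cosOther_mem b (q - pos μ b)
    exact (rayPot_strictMonoOn (mass_mem h.mem b) (h.axisSlope_radius b) (h.radius_mem b).2 hc.1
      hc.2 (horiz_le_one _)).monotoneOn ⟨mul_pos ht.1 hn, by linarith⟩ ⟨hn, hqr.le⟩ htn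

/-- The potential increases along rays up to radius r, so every point can be pushed towards b inside
the region until it reaches a punctured ball around b that lies in Hill's region. -/
theorem isPreconnected_hillRegion_inter_ball (h : IsLagrangePos μ l) (c : ℝ) (b : Primary) :
    IsPreconnected (hillRegion μ c ∩ Metric.ball (pos μ b) (radius μ l b)) := by
  obtain ⟨δ', hδ', hsub'⟩ := exists_ball_subset_hillRegion h.mem c b
  set δ := min δ' (radius μ l b) with hδdef
  have hδ : 0 < δ := lt_min hδ' (h.radius_mem b).1
  have hsub : Metric.ball (pos μ b) δ \ {pos μ b} ⊆
      hillRegion μ c ∩ Metric.ball (pos μ b) (radius μ l b) := fun q hq =>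
    ⟨hsub' ⟨Metric.ball_subset_ball (min_le_left _ _) hq.1, hq.2⟩,
      Metric.ball_subset_ball (min_le_right _ _) hq.1⟩
  have hpun := isConnected_ball_diff_center (pos μ b) hδ
  obtain ⟨x₀, hx₀⟩ := hpun.nonempty
  refine isPreconnected_of_forall x₀ fun q hq => ?_
  have hcont : Continuous fun t : ℝ => pos μ b + t • (q - pos μ b) := by fun_prop
  have hseg : IsPreconnected ((fun t : ℝ => pos μ b + t • (q - pos μ b)) '' Ioc 0 1) :=
    isPreconnected_Ioc.image _ hcont.continuousOn
  have hqb : q ≠ pos μ b := by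
    have := hq.1
    rw [hillRegion_eq] at this
    exact this.1 b
  have hn : 0 < ‖q - pos μ b‖ := norm_pos_iff.2 (sub_ne_zero.2 hqb)
  refine ⟨(Metric.ball (pos μ b) δ \ {pos μ b}) ∪
    (fun t : ℝ => pos μ b + t • (q - pos μ b)) '' Ioc 0 1, union_subset hsub ?_, Or.inl hx₀,
    Or.inr ⟨1, ⟨zero_lt_one, le_rfl⟩, by simp⟩, ?_⟩
  · rintro _ ⟨t, ht, rfl⟩
    exact h.ray_mem_hillRegion hq ht
  · set t := min 1 (δ / (2 * ‖q - pos μ b‖)) with ht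
    have ht0 : 0 < t := by positivity
    refine hpun.isPreconnected.union (pos μ b + t • (q - pos μ b)) ⟨?_, ?_⟩
      ⟨t, ⟨ht0, min_le_left _ _⟩, rfl⟩ hseg
    · rw [mem_ball_iff_norm, add_sub_cancel_left, norm_smul, Real.norm_of_nonneg ht0.le]
      calc t * ‖q - pos μ b‖ ≤ δ / (2 * ‖q - pos μ b‖) * ‖q - pos μ b‖ := by
            gcongr; exact min_le_right _ _
        _ = δ / 2 := by field_simp
        _ < δ := by linarith
    · rw [mem_singleton_iff, add_eq_left]
      exact smul_ne_zero ht0.ne' (sub_ne_zero.2 hqb)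

end IsLagrangePos

/-! ### Energies below the Lagrange point -/

theorem liouvilleAt_radial (a : E3) (z : E3 × E3) :
    LiouvilleAt (fun z : E3 × E3 => (z.1 - a, 0)) z := by
  have h : HasFDerivAt (fun z : E3 × E3 => ((z.1 - a, 0) : E3 × E3))
      ((ContinuousLinearMap.fst ℝ E3 E3).prod 0) z :=
    (hasFDerivAt_fst.sub_const a).prodMk (hasFDerivAt_const 0 z)
  intro v w
  rw [h.fderiv]
  simp [canonicalForm, neg_add_eq_sub]

namespace IsLagrangePos

variable {μ l : ℝ}

theorem hamDeriv_radial_pos (h : IsLagrangePos μ l) {b : Primary} {z : E3 × E3}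
    (hz : z ∈ phaseSpace μ) (hzb : z.1 ∈ Metric.ball (pos μ b) (radius μ l b))
    (hH : hamiltonian μ z ≤ critEnergy μ l) : 0 < hamDeriv μ z (z.1 - pos μ b, 0) := by
  have hne : z.1 ≠ axisPoint l := fun he => axisPoint_notMem_ball μ l b (he ▸ hzb)
  have hle := (mem_ball_iff_norm.1 hzb).le
  exact CRTBP.hamDeriv_radial_pos (h.potentialDeriv_pos (hz b) hle hne)
    (h.radialEnergy_pos (hz b) hle hne) hH

theorem isStarLevel (h : IsLagrangePos μ l) (b : Primary) {c : ℝ} (hc : c < critEnergy μ l) :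
    IsStarLevel μ b 0 c (radius μ l b) where
  lt_one := (h.radius_mem b).2
  eq_zero := Filter.Eventually.of_forall fun _ => rfl
  smooth q _ := contDiffAt_const
  deriv_pos z hz hzb hle := by
    have := h.hamDeriv_radial_pos hz hzb (by simpa [modHam] using hle.trans hc.le)
    simpa using this
  -- On the sphere of radius r the potential is at least the critical energy, hence greater than c.
  -- By continuity this holds at a slightly smaller radius too, as the definition asks for an
  -- interior point of the ray.
  le_potential θ hθ := by
    have hr := h.radius_mem b
    have hθ0 : θ ≠ 0 := fun h0 => by simp [h0] at hθ
    have hcont : ContinuousAt (fun t : ℝ => potential μ (pos μ b + t • θ)) (radius μ l b) := by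
      refine ContinuousAt.comp (f := fun t : ℝ => pos μ b + t • θ) (contDiffAt_potential
        ((offPrimaries_iff b).2 ⟨?_, ?_⟩)).continuousAt (by fun_prop)
      · rw [ne_eq, add_eq_left]; exact smul_ne_zero hr.1.ne' hθ0
      · intro he
        have := norm_pos_sub_other μ b
        rw [← he, ← norm_neg, neg_sub, add_sub_cancel_left, norm_smul, hθ,
          Real.norm_of_nonneg hr.1.le] at this
        linarith [hr.2]
    have hlt : c < potential μ (pos μ b + radius μ l b • θ) := by
      refine hc.trans_le (h.critEnergy_le_potential (b := b) ?_)
      rw [add_sub_cancel_left, norm_smul, hθ, Real.norm_of_nonneg hr.1.le, mul_one]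
    obtain ⟨ρ, hρ, hρ'⟩ := (((hcont.eventually_const_lt hlt).filter_mono
      (nhdsWithin_le_nhds (s := Iio (radius μ l b)))).and (Ioo_mem_nhdsLT hr.1)).exists
    exact ⟨ρ, hρ', by simpa using hρ.le⟩

/-- The component is cut out by the ball up to L₁; on all of it the radial field at b is the
Liouville field, and no modification of the potential is needed. -/
theorem isContactType_and_areDiffeomorphic (h : IsLagrangePos μ l) (b : Primary) {c : ℝ}
    (hc : c < critEnergy μ l) :
    IsContactType (regularizedHypersurface μ c {pos μ b}) ∧
      AreDiffeomorphic 𝓘(ℝ, E3 × E3) 𝓘(ℝ, R4 × R4) (regularizedHypersurface μ c {pos μ b})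
        unitCotangentSphere := by
  have hr := h.radius_mem b
  have hS := regularizedHypersurface_eq_surf (c := c) (Bs := {b}) h.mem
    (Metric.isOpen_ball (x := pos μ b) (ε := radius μ l b)) (fun q hq hq' => ?_)
    (h.isPreconnected_hillRegion_inter_ball c b)
    (by rintro _ rfl; exact Metric.mem_ball_self hr.1) (singleton_nonempty b)
  · rw [image_singleton] at hS
    rw [hS]
    refine ⟨?_, _, (h.isStarLevel b hc).isDiffeoOn h.mem hr.1⟩
    refine surf_isContactType (Y := fun z => (z.1 - pos μ b, 0)) h.mem Metric.isOpen_ball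
      ((contDiff_fst.sub contDiff_const).prodMk contDiff_const).contDiffOn
      (fun z _ => liouvilleAt_radial _ z) ?_ ?_
    · intro b' hb'
      obtain rfl := (h.isStarLevel b hc).eq_of_pos_mem hb'
      exact Filter.Eventually.of_forall fun _ _ => rfl
    · intro z hz hzΩ hH
      exact (h.hamDeriv_radial_pos hz hzΩ (hH.le.trans hc.le)).ne'
  · have h1 : ‖q - pos μ b‖ = radius μ l b := by
      refine le_antisymm ?_ ?_
      · have := Metric.closure_ball_subset_closedBall hq
        rwa [mem_closedBall_iff_norm] at this
      · rwa [mem_ball_iff_norm, not_lt] at hq'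
    refine ⟨(offPrimaries_iff b).2 ⟨?_, ?_⟩, hc.trans_le (h.critEnergy_le_potential h1)⟩
    · rintro rfl
      rw [sub_self, norm_zero] at h1
      linarith [hr.1]
    · rintro rfl
      rw [← norm_neg, neg_sub, norm_pos_sub_other] at h1
      linarith [hr.2]

end IsLagrangePos


/-! ### Expansion of the potential near the Lagrange point -/

/-- The coefficient of the squared distance from the axis in the effective potential. -/
def transPot (μ : ℝ) (q : E3) : ℝ :=
  mass μ .earth / (‖q - pos μ .earth‖ * radius μ (q 0) .earth *
      (‖q - pos μ .earth‖ + radius μ (q 0) .earth)) +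
    mass μ .moon / (‖q - pos μ .moon‖ * radius μ (q 0) .moon *
      (‖q - pos μ .moon‖ + radius μ (q 0) .moon))

/-- The coefficient of the transversal directions in the gradient of the potential. -/
def transCurv (μ : ℝ) (q : E3) : ℝ :=
  mass μ .earth / ‖q - pos μ .earth‖ ^ 3 + mass μ .moon / ‖q - pos μ .moon‖ ^ 3

/-- The coefficient of the squared distance from the axis in the axial derivative of the
potential. -/
def axialMix (μ : ℝ) (q : E3) : ℝ :=
  mass μ .earth * (‖q - pos μ .earth‖ ^ 2 + ‖q - pos μ .earth‖ * radius μ (q 0) .earth +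
      radius μ (q 0) .earth ^ 2) / (‖q - pos μ .earth‖ ^ 3 * radius μ (q 0) .earth ^ 2 *
        (‖q - pos μ .earth‖ + radius μ (q 0) .earth)) -
    mass μ .moon * (‖q - pos μ .moon‖ ^ 2 + ‖q - pos μ .moon‖ * radius μ (q 0) .moon +
      radius μ (q 0) .moon ^ 2) / (‖q - pos μ .moon‖ ^ 3 * radius μ (q 0) .moon ^ 2 *
        (‖q - pos μ .moon‖ + radius μ (q 0) .moon))

/-- Minus the coefficient of the squared distance from `l` in the potential on the axis. -/
def axialQuad (μ l t : ℝ) : ℝ :=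
  1 / 2 + mass μ .earth / (radius μ l .earth ^ 2 * radius μ t .earth) +
    mass μ .moon / (radius μ l .moon ^ 2 * radius μ t .moon)

/-- Minus the coefficient of the distance from `l` in the slope of the potential on the axis. -/
def axialLin (μ l t : ℝ) : ℝ :=
  1 + mass μ .earth * (radius μ l .earth + radius μ t .earth) /
      (radius μ l .earth ^ 2 * radius μ t .earth ^ 2) +
    mass μ .moon * (radius μ l .moon + radius μ t .moon) /
      (radius μ l .moon ^ 2 * radius μ t .moon ^ 2)

/-- Minus the second derivative of the potential along the axis at the Lagrange point. -/
def axialCurv (μ l : ℝ) : ℝ :=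
  1 + 2 * (mass μ .earth / radius μ l .earth ^ 3 + mass μ .moon / radius μ l .moon ^ 3)

/-- The squared distance from the axis. -/
def axisSq (q : E3) : ℝ := q 1 ^ 2 + q 2 ^ 2

theorem axisSq_nonneg (q : E3) : 0 ≤ axisSq q := by unfold axisSq; positivity

theorem norm_sub_pos_sq (μ : ℝ) (b : Primary) (q : E3) :
    ‖q - pos μ b‖ ^ 2 = radius μ (q 0) b ^ 2 + axisSq q := by
  rw [norm_sq_three, radius_eq, axisSq]
  simp only [PiLp.sub_apply, pos_one, pos_two]
  linear_combination -(q 0 - pos μ b 0) ^ 2 * sgn_mul_self b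

theorem norm_sub_axisPoint_sq (l : ℝ) (q : E3) :
    ‖q - axisPoint l‖ ^ 2 = (q 0 - l) ^ 2 + axisSq q := by
  rw [norm_sq_three, axisSq]
  simp [axisPoint]
  ring

section Expansion

variable {μ l : ℝ} {q : E3}

theorem norm_sub_pos_pos {b : Primary} (h : 0 < radius μ (q 0) b) : 0 < ‖q - pos μ b‖ := by
  rw [norm_pos_iff, sub_ne_zero]
  rintro rfl
  rw [radius_eq, sub_self, mul_zero] at h
  exact lt_irrefl _ h

theorem inv_norm_expansion {X ρ w : ℝ} (hX : 0 < X) (hρ : 0 < ρ) (h : ρ ^ 2 = X ^ 2 + w) :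
    1 / ρ = 1 / X - w / (ρ * X * (ρ + X)) := by
  have : 0 < ρ + X := by positivity
  field_simp
  linear_combination -h

/-- An exact identity in place of a Taylor expansion: 1/|q - b| differs from its value at the foot
point on the axis by an explicit multiple of the squared distance from the axis. Only continuity of
the coefficients is used later, never remainder terms. -/
theorem potential_expansion (hX : ∀ b, 0 < radius μ (q 0) b) :
    potential μ q = critEnergy μ (q 0) - q 1 ^ 2 / 2 + transPot μ q * axisSq q := by
  have hE := inv_norm_expansion (hX .earth) (norm_sub_pos_pos (hX .earth))
    (norm_sub_pos_sq μ .earth q)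
  have hM := inv_norm_expansion (hX .moon) (norm_sub_pos_pos (hX .moon))
    (norm_sub_pos_sq μ .moon q)
  have e1 : critEnergy μ (q 0) = -q 0 ^ 2 / 2 - μ * (1 / radius μ (q 0) .moon) -
      (1 - μ) * (1 / radius μ (q 0) .earth) := by
    simp only [critEnergy, axisPot, radius]
    rw [show 1 - (q 0 + 1 - μ) = μ - q 0 by ring, show q 0 + 1 - μ - (1 - μ) = q 0 by ring]
    ring
  have e2 : potential μ q = -(q 0 ^ 2 + q 1 ^ 2) / 2 - μ * (1 / ‖q - pos μ .moon‖) -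
      (1 - μ) * (1 / ‖q - pos μ .earth‖) := by
    rw [potential]; ring
  rw [e1, e2, hE, hM, transPot]
  simp only [mass]
  ring

/-- The linear term drops out by the equilibrium equation at l; what is left is exactly a square
times a function that is close to half of `axialCurv` near l. -/
theorem critEnergy_expansion (h : IsLagrangePos μ l) {t : ℝ} (hX : ∀ b, 0 < radius μ t b) :
    critEnergy μ t = critEnergy μ l - axialQuad μ l t * (t - l) ^ 2 := by
  have h1 := h.slope
  have hE := hX .earth
  have hM := hX .moon
  have hE' := (h.radius_mem .earth).1
  have hM' := (h.radius_mem .moon).1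
  simp only [radius] at hE hM hE' hM'
  simp only [critEnergy, axisPot, axisSlope, axialQuad, radius, mass] at *
  rw [show 1 - (l + 1 - μ) = μ - l by ring] at *
  rw [show 1 - (t + 1 - μ) = μ - t by ring]
  have e1 : μ / (t + 1 - μ) = μ / (l + 1 - μ) - μ / (l + 1 - μ) ^ 2 * (t - l) +
      μ / ((l + 1 - μ) ^ 2 * (t + 1 - μ)) * (t - l) ^ 2 := by
    field_simp
    ring
  have e2 : (1 - μ) / (μ - t) = (1 - μ) / (μ - l) + (1 - μ) / (μ - l) ^ 2 * (t - l) +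
      (1 - μ) / ((μ - l) ^ 2 * (μ - t)) * (t - l) ^ 2 := by
    field_simp
    ring
  rw [e1, e2]
  linear_combination (t - l) * h1

theorem axisSlope_expansion (h : IsLagrangePos μ l) {t : ℝ} (hX : ∀ b, 0 < radius μ t b) :
    axisSlope μ (t + 1 - μ) = -(axialLin μ l t * (t - l)) := by
  have h1 := h.slope
  have hE := hX .earth
  have hM := hX .moon
  have hE' := (h.radius_mem .earth).1
  have hM' := (h.radius_mem .moon).1
  simp only [radius] at hE hM hE' hM'
  simp only [axisSlope, axialLin, radius, mass] at *
  rw [show 1 - (l + 1 - μ) = μ - l by ring] at *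
  rw [show 1 - (t + 1 - μ) = μ - t by ring]
  have e1 : μ / (t + 1 - μ) ^ 2 = μ / (l + 1 - μ) ^ 2 -
      μ * (l + 1 - μ + (t + 1 - μ)) / ((l + 1 - μ) ^ 2 * (t + 1 - μ) ^ 2) * (t - l) := by
    field_simp
    ring
  have e2 : (1 - μ) / (μ - t) ^ 2 = (1 - μ) / (μ - l) ^ 2 +
      (1 - μ) * (μ - l + (μ - t)) / ((μ - l) ^ 2 * (μ - t) ^ 2) * (t - l) := by
    field_simp
    ring
  rw [e1, e2]
  linear_combination h1

theorem potentialDeriv_expansion (h : IsLagrangePos μ l) (hX : ∀ b, 0 < radius μ (q 0) b) (v : E3) :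
    potentialDeriv μ q v = (-(axialLin μ l (q 0) * (q 0 - l)) + axialMix μ q * axisSq q) * v 0 +
      (transCurv μ q - 1) * q 1 * v 1 + transCurv μ q * q 2 * v 2 := by
  rw [← axisSlope_expansion h hX]
  have key : ∀ X ρ w : ℝ, 0 < X → 0 < ρ → ρ ^ 2 = X ^ 2 + w → X / ρ ^ 3 =
      1 / X ^ 2 - (ρ ^ 2 + ρ * X + X ^ 2) / (ρ ^ 3 * X ^ 2 * (ρ + X)) * w := by
    intro X ρ w hX hρ hh
    have : 0 < ρ + X := by positivity
    field_simp
    linear_combination -(ρ ^ 2 + ρ * X + X ^ 2) * hh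
  have hE := key _ _ _ (hX .earth) (norm_sub_pos_pos (hX .earth)) (norm_sub_pos_sq μ .earth q)
  have hM := key _ _ _ (hX .moon) (norm_sub_pos_pos (hX .moon)) (norm_sub_pos_sq μ .moon q)
  have e1 : axisSlope μ (q 0 + 1 - μ) = -q 0 + μ * (1 / radius μ (q 0) .moon ^ 2) -
      (1 - μ) * (1 / radius μ (q 0) .earth ^ 2) := by
    simp only [axisSlope, radius]
    rw [show 1 - (q 0 + 1 - μ) = μ - q 0 by ring]
    ring
  have i1 : ⟪q - pos μ .moon, v⟫ = radius μ (q 0) .moon * v 0 + q 1 * v 1 + q 2 * v 2 := by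
    rw [inner_three]; simp only [radius, pos, PiLp.sub_apply, Matrix.cons_val]; ring
  have i2 : ⟪q - pos μ .earth, v⟫ = -radius μ (q 0) .earth * v 0 + q 1 * v 1 + q 2 * v 2 := by
    rw [inner_three]; simp only [radius, pos, PiLp.sub_apply, Matrix.cons_val]; ring
  rw [potentialDeriv, i1, i2, e1, axialMix, transCurv]
  simp only [mass]
  linear_combination μ * v 0 * hM - (1 - μ) * v 0 * hE

/-- Write the sum as G + 1. The equilibrium equation gives m(1 + s + s²) = Gs³ for either mass m and
its distance s from L₁. Since 1 + s + s² ≥ 3s² for s < 1, this yields 3m ≤ Gs; adding the two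
inequalities gives 3 ≤ G because both the masses and the distances sum to 1. -/
theorem four_le_curv (h : IsLagrangePos μ l) :
    4 ≤ mass μ .earth / radius μ l .earth ^ 3 + mass μ .moon / radius μ l .moon ^ 3 := by
  have hs := h.slope
  have hr := h.radius_mem .moon
  obtain ⟨d, hd⟩ : ∃ d, d = 1 - radius μ l .moon := ⟨_, rfl⟩
  have e : radius μ l .earth = d := by
    rw [hd, ← radius_other]; rfl
  have hm := h.mem
  rw [e]
  simp only [mass]
  generalize hrr : radius μ l .moon = r at *
  have hrr' : l + 1 - μ = r := hrr
  rw [hrr', axisSlope, ← hd] at hs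
  have hr0 := hr.1
  have hd0 : 0 < d := by rw [hd]; linarith [hr.2]
  obtain ⟨G, hG⟩ : ∃ G, G = (1 - μ) / d ^ 3 + μ / r ^ 3 - 1 := ⟨_, rfl⟩
  have hr1 : r = 1 - d := by linarith
  have hd1 : d < 1 := by linarith
  have g1 : μ * (1 + r + r ^ 2) = G * r ^ 3 := by
    have : -r + (1 - μ) + μ / r ^ 2 - (1 - μ) / d ^ 2 = 0 := hs
    have h2 : (1 - μ) / d ^ 3 = (-r + (1 - μ) + μ / r ^ 2) / d := by
      field_simp; field_simp at this; linear_combination -this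
    rw [hG, h2]
    field_simp
    rw [hr1]
    ring
  have g2 : (1 - μ) * (1 + d + d ^ 2) = G * d ^ 3 := by
    have : -r + (1 - μ) + μ / r ^ 2 - (1 - μ) / d ^ 2 = 0 := hs
    have h2 : μ / r ^ 3 = (r - (1 - μ) + (1 - μ) / d ^ 2) / r := by
      field_simp; field_simp at this; linear_combination this
    rw [hG, h2]
    field_simp
    rw [hr1]
    ring
  have h3 : ∀ m s : ℝ, 0 < m → 0 < s → s < 1 → m * (1 + s + s ^ 2) = G * s ^ 3 → 3 * m ≤ G * s := by
    intro m s hm hs hs1 he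
    have : 3 * m * s ^ 2 ≤ G * s * s ^ 2 := by
      have : G * s * s ^ 2 = m * (1 + s + s ^ 2) := by rw [he]; ring
      rw [this]
      nlinarith [mul_pos hm (show 0 < (2 * s + 1) * (1 - s) by nlinarith)]
    exact le_of_mul_le_mul_right this (by positivity)
  have h4 := h3 _ _ hm.1 hr0 hr.2 g1
  have h5 := h3 _ _ (sub_pos.2 hm.2) hd0 hd1 g2
  have h6 : 3 ≤ G := by nlinarith
  linarith

theorem nine_le_axialCurv (h : IsLagrangePos μ l) : 9 ≤ axialCurv μ l := by
  have := four_le_curv h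
  unfold axialCurv
  linarith

/-- The ball of radius `R` around the Lagrange point is so small that the coefficients in the
expansion of the potential are almost constant. -/
structure IsNeckRadius (μ l R C : ℝ) : Prop where
  size_pos : 0 < R
  const_pos : 0 < C
  le : ∀ b, R * axialCurv μ l ≤ radius μ l b
  radius_pos : ∀ q : E3, ‖q - axisPoint l‖ < R → ∀ b, radius μ l b / 2 < radius μ (q 0) b
  quad : ∀ q : E3, ‖q - axisPoint l‖ < R →
    |2 * axialQuad μ l (q 0) - axialCurv μ l| ≤ axialCurv μ l / 100
  lin : ∀ q : E3, ‖q - axisPoint l‖ < R →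
    |axialLin μ l (q 0) - axialCurv μ l| ≤ axialCurv μ l / 100
  trans : ∀ q : E3, ‖q - axisPoint l‖ < R → 29 / 10 ≤ 2 * transPot μ q - 1
  curv : ∀ q : E3, ‖q - axisPoint l‖ < R → transCurv μ q ≤ axialCurv μ l
  curv_sub : ∀ q : E3, ‖q - axisPoint l‖ < R → |transCurv μ q - 2 * transPot μ q| ≤ 1 / 50
  mix : ∀ q : E3, ‖q - axisPoint l‖ < R → |axialMix μ q| ≤ C

theorem IsNeckRadius.mono {R R' C : ℝ} (h : IsNeckRadius μ l R C) (hl : IsLagrangePos μ l) (h0 : 0 < R') (hR : R' ≤ R) :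
    IsNeckRadius μ l R' C where
  size_pos := h0
  const_pos := h.const_pos
  le b := (mul_le_mul_of_nonneg_right hR ((by norm_num : (0 : ℝ) ≤ 9).trans
    (nine_le_axialCurv hl))).trans (h.le b)
  radius_pos q hq := h.radius_pos q (hq.trans_le hR)
  quad q hq := h.quad q (hq.trans_le hR)
  lin q hq := h.lin q (hq.trans_le hR)
  trans q hq := h.trans q (hq.trans_le hR)
  curv q hq := h.curv q (hq.trans_le hR)
  curv_sub q hq := h.curv_sub q (hq.trans_le hR)
  mix q hq := h.mix q (hq.trans_le hR)

/-- All coefficients are continuous at L₁. There twice `axialQuad` and `axialLin` both equal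
`axialCurv`, while twice `transPot` and `transCurv` both equal the sum in `four_le_curv`, so that 2
`transPot` - 1 ≥ 3 leaves room for 29/10. -/
theorem exists_isNeckRadius (h : IsLagrangePos μ l) : ∃ R C, IsNeckRadius μ l R C := by
  have h9 := nine_le_axialCurv h
  have h4 := four_le_curv h
  have hrE := (h.radius_mem .earth).1
  have hrM := (h.radius_mem .moon).1
  have hr : ∀ b, 0 < radius μ l b := fun b => (h.radius_mem b).1
  have h00 : axisPoint l 0 = l := by simp [axisPoint]
  have hc0 : ContinuousAt (fun q : E3 => q 0) (axisPoint l) := (contDiffAt_coord 0 _).continuousAt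
  have hcr : ∀ b, ContinuousAt (fun q : E3 => radius μ (q 0) b) (axisPoint l) := by
    intro b
    simp only [radius_eq]
    exact continuousAt_const.mul (hc0.sub continuousAt_const)
  have hcn : ∀ b, ContinuousAt (fun q : E3 => ‖q - pos μ b‖) (axisPoint l) := fun b => by fun_prop
  have hn0 : ∀ b, ‖axisPoint l - pos μ b‖ = radius μ l b := by
    intro b
    have := norm_sub_pos_sq μ b (axisPoint l)
    rw [h00] at this
    simp only [axisSq, axisPoint, Matrix.cons_val] at this
    refine (pow_left_inj₀ (norm_nonneg _) (hr b).le two_ne_zero).1 ?_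
    rw [axisPoint, this]; ring
  have hnn : ∀ b, ‖axisPoint l - pos μ b‖ ≠ 0 := fun b => by rw [hn0]; exact (hr b).ne'
  have hrn : ∀ b, radius μ (axisPoint l 0) b ≠ 0 := fun b => by rw [h00]; exact (hr b).ne'
  have hsn : ∀ b, ‖axisPoint l - pos μ b‖ + radius μ (axisPoint l 0) b ≠ 0 := fun b => by
    rw [hn0, h00]; have := hr b; positivity
  have cP : ContinuousAt (transPot μ) (axisPoint l) := by
    unfold transPot
    refine (continuousAt_const.div (((hcn _).mul (hcr _)).mul ((hcn _).add (hcr _))) ?_).add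
      (continuousAt_const.div (((hcn _).mul (hcr _)).mul ((hcn _).add (hcr _))) ?_)
    · exact mul_ne_zero (mul_ne_zero (hnn _) (hrn _)) (hsn _)
    · exact mul_ne_zero (mul_ne_zero (hnn _) (hrn _)) (hsn _)
  have cC : ContinuousAt (transCurv μ) (axisPoint l) := by
    unfold transCurv
    exact (continuousAt_const.div ((hcn _).pow 3) (pow_ne_zero 3 (hnn _))).add
      (continuousAt_const.div ((hcn _).pow 3) (pow_ne_zero 3 (hnn _)))
  have cM : ContinuousAt (axialMix μ) (axisPoint l) := by
    unfold axialMix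
    have hnum : ∀ b, ContinuousAt (fun q : E3 => mass μ b * (‖q - pos μ b‖ ^ 2 +
        ‖q - pos μ b‖ * radius μ (q 0) b + radius μ (q 0) b ^ 2)) (axisPoint l) := fun b =>
      continuousAt_const.mul ((((hcn b).pow 2).add ((hcn b).mul (hcr b))).add ((hcr b).pow 2))
    have hden : ∀ b, ContinuousAt (fun q : E3 => ‖q - pos μ b‖ ^ 3 * radius μ (q 0) b ^ 2 *
        (‖q - pos μ b‖ + radius μ (q 0) b)) (axisPoint l) := fun b =>
      (((hcn b).pow 3).mul ((hcr b).pow 2)).mul ((hcn b).add (hcr b))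
    refine ((hnum _).div (hden _) ?_).sub ((hnum _).div (hden _) ?_)
    · exact mul_ne_zero (mul_ne_zero (pow_ne_zero 3 (hnn _)) (pow_ne_zero 2 (hrn _))) (hsn _)
    · exact mul_ne_zero (mul_ne_zero (pow_ne_zero 3 (hnn _)) (pow_ne_zero 2 (hrn _))) (hsn _)
  have cQ : ContinuousAt (fun q : E3 => axialQuad μ l (q 0)) (axisPoint l) := by
    unfold axialQuad
    refine (continuousAt_const.add (continuousAt_const.div (continuousAt_const.mul (hcr _)) ?_)).add
      (continuousAt_const.div (continuousAt_const.mul (hcr _)) ?_)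
    · exact mul_ne_zero (pow_ne_zero 2 hrE.ne') (hrn _)
    · exact mul_ne_zero (pow_ne_zero 2 hrM.ne') (hrn _)
  have cL : ContinuousAt (fun q : E3 => axialLin μ l (q 0)) (axisPoint l) := by
    unfold axialLin
    refine (continuousAt_const.add ((continuousAt_const.mul (continuousAt_const.add (hcr _))).div
      (continuousAt_const.mul ((hcr _).pow 2)) ?_)).add
      ((continuousAt_const.mul (continuousAt_const.add (hcr _))).div
        (continuousAt_const.mul ((hcr _).pow 2)) ?_)
    · exact mul_ne_zero (pow_ne_zero 2 hrE.ne') (pow_ne_zero 2 (hrn _))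
    · exact mul_ne_zero (pow_ne_zero 2 hrM.ne') (pow_ne_zero 2 (hrn _))
  have vP : 2 * transPot μ (axisPoint l) =
      mass μ .earth / radius μ l .earth ^ 3 + mass μ .moon / radius μ l .moon ^ 3 := by
    rw [transPot, hn0, hn0, h00]
    field_simp
    ring
  have vC : transCurv μ (axisPoint l) =
      mass μ .earth / radius μ l .earth ^ 3 + mass μ .moon / radius μ l .moon ^ 3 := by
    rw [transCurv, hn0, hn0]
  have vQ : 2 * axialQuad μ l l = axialCurv μ l := by
    rw [axialQuad, axialCurv]; field_simp; ring
  have vL : axialLin μ l l = axialCurv μ l := by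
    rw [axialLin, axialCurv]; field_simp; ring
  have ev1 : ∀ b, ∀ᶠ q : E3 in 𝓝 (axisPoint l), radius μ l b / 2 < radius μ (q 0) b := fun b =>
    (hcr b).eventually_const_lt (by simp only [h00]; linarith [hr b])
  have small : ∀ {f : E3 → ℝ} {a e : ℝ}, ContinuousAt f (axisPoint l) → f (axisPoint l) = a →
      0 < e → ∀ᶠ q : E3 in 𝓝 (axisPoint l), |f q - a| ≤ e := by
    intro f a e hf ha he
    have := (Metric.continuousAt_iff'.1 hf) e he
    filter_upwards [this] with q hq
    rw [Real.dist_eq, ha] at hq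
    exact hq.le
  have evQ := small (f := fun q : E3 => 2 * axialQuad μ l (q 0)) (a := axialCurv μ l)
    (e := axialCurv μ l / 100) (continuousAt_const.mul cQ) (by rw [h00, vQ]) (by linarith)
  have evL := small (f := fun q : E3 => axialLin μ l (q 0)) (a := axialCurv μ l)
    (e := axialCurv μ l / 100) cL (by rw [h00, vL]) (by linarith)
  have evP := small cP rfl (show (0 : ℝ) < 1 / 200 by norm_num)
  have evC := small cC rfl (show (0 : ℝ) < 1 / 200 by norm_num)
  have evM := small cM rfl zero_lt_one
  obtain ⟨R, hR, hball⟩ := Metric.eventually_nhds_iff_ball.1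
    ((ev1 .earth).and ((ev1 .moon).and (evQ.and (evL.and (evP.and (evC.and evM))))))
  have hA : 0 < axialCurv μ l := by linarith
  refine ⟨min R (min (radius μ l .earth / axialCurv μ l) (radius μ l .moon / axialCurv μ l)),
    |axialMix μ (axisPoint l)| + 1, by positivity, by positivity, ?_, ?_, ?_, ?_, ?_, ?_, ?_, ?_⟩
  · rintro (_ | _) <;> rw [← le_div_iff₀ hA]
    · exact (min_le_right _ _).trans (min_le_left _ _)
    · exact (min_le_right _ _).trans (min_le_right _ _)
  all_goals
    intro q hq
    obtain ⟨h1, h2, h3, h4, h5, h6, h7⟩ :=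
      hball q (mem_ball_iff_norm.2 (hq.trans_le (min_le_left _ _)))
  · rintro (_ | _)
    exacts [h1, h2]
  · exact h3
  · exact h4
  · rw [abs_le] at h5
    linarith [h5.1]
  · rw [abs_le, vC] at h6
    unfold axialCurv
    linarith [h6.2]
  · rw [abs_le, vC] at h6
    rw [abs_le] at h5 ⊢
    constructor <;> linarith [h5.1, h5.2, h6.1, h6.2]
  · have := abs_sub_abs_le_abs_sub (axialMix μ q) (axialMix μ (axisPoint l))
    linarith

end Expansion


/-! ### Hill's region slightly above the energy of the Lagrange point -/

/-- The signed distance along the axis from the Lagrange point, in the direction of `b`. -/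
def side (b : Primary) (l : ℝ) (q : E3) : ℝ := -(sgn b * (q 0 - l))

theorem side_other (b : Primary) (l : ℝ) (q : E3) : side b.other l q = -side b l q := by
  simp [side]

theorem sgn_sq (b : Primary) : sgn b ^ 2 = 1 := by rw [sq, sgn_mul_self]

theorem side_sq (b : Primary) (l : ℝ) (q : E3) : side b l q ^ 2 = (q 0 - l) ^ 2 := by
  rw [side, neg_sq, mul_pow, sgn_sq, one_mul]

theorem abs_side (b : Primary) (l : ℝ) (q : E3) : |side b l q| = |q 0 - l| :=
  sq_eq_sq_iff_abs_eq_abs _ _ |>.1 (side_sq b l q)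

theorem radius_side (μ l : ℝ) (b : Primary) (q : E3) :
    radius μ (q 0) b = radius μ l b - side b l q := by
  rw [radius_eq, radius_eq, side]; ring

theorem abs_side_le (b : Primary) (l : ℝ) (q : E3) : |side b l q| ≤ ‖q - axisPoint l‖ := by
  rw [abs_side]
  refine abs_le_of_sq_le_sq ?_ (norm_nonneg _)
  rw [norm_sub_axisPoint_sq]
  linarith [axisSq_nonneg q]

theorem continuous_side (b : Primary) (l : ℝ) : Continuous (side b l) := by
  have : Continuous fun q : E3 => q 0 := (EuclideanSpace.proj 0 : E3 →L[ℝ] ℝ).continuous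
  unfold side
  fun_prop

/-- With s the axial coordinate and w the squared distance from the axis, membership reads (r - s)²
+ w < r², that is s² + w < 2rs. Points of the ball with small s are therefore close to L₁. -/
theorem side_pos_of_mem_ball {μ l : ℝ} {b : Primary} {q : E3} (hr : 0 < radius μ l b)
    (hq : q ∈ Metric.ball (pos μ b) (radius μ l b)) : 0 < side b l q ∧
      ‖q - axisPoint l‖ ^ 2 < 2 * radius μ l b * side b l q := by
  have h1 : ‖q - pos μ b‖ ^ 2 < radius μ l b ^ 2 :=
    pow_lt_pow_left₀ (mem_ball_iff_norm.1 hq) (norm_nonneg _) two_ne_zero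
  rw [norm_sub_pos_sq, radius_side μ l] at h1
  have h2 : ‖q - axisPoint l‖ ^ 2 < 2 * radius μ l b * side b l q := by
    rw [norm_sub_axisPoint_sq, ← side_sq b]
    nlinarith
  exact ⟨by nlinarith [sq_nonneg ‖q - axisPoint l‖], h2⟩

/-- The union of the balls around the primaries up to the Lagrange point and a small ball around
the Lagrange point. -/
def neckDomain (μ l δ : ℝ) : Set E3 :=
  {q | (∃ b, q ∈ Metric.ball (pos μ b) (radius μ l b)) ∨ q ∈ Metric.ball (axisPoint l) δ}

theorem isOpen_neckDomain (μ l δ : ℝ) : IsOpen (neckDomain μ l δ) := by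
  have : neckDomain μ l δ = (⋃ b, Metric.ball (pos μ b) (radius μ l b)) ∪
      Metric.ball (axisPoint l) δ := by
    ext q; simp [neckDomain]
  rw [this]
  exact (isOpen_iUnion fun b => Metric.isOpen_ball).union Metric.isOpen_ball

theorem closure_neckDomain {μ l δ : ℝ} {q : E3} (hq : q ∈ closure (neckDomain μ l δ)) :
    (∃ b, ‖q - pos μ b‖ ≤ radius μ l b) ∨ ‖q - axisPoint l‖ ≤ δ := by
  have hcl : IsClosed ((Metric.closedBall (pos μ .earth) (radius μ l .earth) ∪
      Metric.closedBall (pos μ .moon) (radius μ l .moon)) ∪ Metric.closedBall (axisPoint l) δ) :=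
    (Metric.isClosed_closedBall.union Metric.isClosed_closedBall).union Metric.isClosed_closedBall
  have hsub : neckDomain μ l δ ⊆ (Metric.closedBall (pos μ .earth) (radius μ l .earth) ∪
      Metric.closedBall (pos μ .moon) (radius μ l .moon)) ∪ Metric.closedBall (axisPoint l) δ := by
    rintro q (⟨_ | _, h⟩ | h)
    · exact Or.inl (Or.inl (Metric.ball_subset_closedBall h))
    · exact Or.inl (Or.inr (Metric.ball_subset_closedBall h))
    · exact Or.inr (Metric.ball_subset_closedBall h)
  rcases closure_minimal hsub hcl hq with (h | h) | h
  · exact Or.inl ⟨_, mem_closedBall_iff_norm.1 h⟩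
  · exact Or.inl ⟨_, mem_closedBall_iff_norm.1 h⟩
  · exact Or.inr (mem_closedBall_iff_norm.1 h)

theorem norm_lt_of_mem_neckDomain {μ l δ R : ℝ} {q : E3} (h : IsLagrangePos μ l)
    (hq : q ∈ neckDomain μ l δ) (hR : 0 < R) (hδ : δ ≤ R) (hx : 2 * |q 0 - l| ≤ R ^ 2) :
    ‖q - axisPoint l‖ < R := by
  rcases hq with ⟨b, hb⟩ | hb
  · obtain ⟨h1, h2⟩ := side_pos_of_mem_ball (h.radius_mem b).1 hb
    rw [← abs_side b, abs_of_pos h1] at hx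
    refine lt_of_pow_lt_pow_left₀ 2 hR.le (h2.trans_le ?_)
    nlinarith [(h.radius_mem b).2]
  · exact (mem_ball_iff_norm.1 hb).trans_le hδ

theorem mem_ball_of_side {μ l δ : ℝ} {q : E3} (h : IsLagrangePos μ l) {b : Primary}
    (hq : q ∈ neckDomain μ l δ) (hs : δ ≤ side b l q) (h0 : 0 ≤ side b l q) :
    q ∈ Metric.ball (pos μ b) (radius μ l b) := by
  rcases hq with ⟨b', hb'⟩ | hb'
  · obtain ⟨h1, -⟩ := side_pos_of_mem_ball (h.radius_mem b').1 hb'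
    rcases b.eq_or_eq_other b' with rfl | rfl
    · exact hb'
    · rw [side_other] at h1
      linarith
  · have := (abs_side_le b l q).trans_lt (mem_ball_iff_norm.1 hb')
    linarith [le_abs_self (side b l q)]

section Neck

variable {μ l R C : ℝ} {q : E3}

namespace IsNeckRadius

theorem radius_pos' (hN : IsNeckRadius μ l R C) (h : IsLagrangePos μ l)
    (hq : ‖q - axisPoint l‖ < R) (b : Primary) : 0 < radius μ (q 0) b :=
  (half_pos (h.radius_mem b).1).trans (hN.radius_pos q hq b)

theorem mem_offPrimaries (hN : IsNeckRadius μ l R C) (h : IsLagrangePos μ l)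
    (hq : ‖q - axisPoint l‖ < R) : q ∈ offPrimaries μ := fun b =>
  sub_ne_zero.1 (norm_pos_iff.1 (norm_sub_pos_pos (hN.radius_pos' h hq b)))

theorem critEnergy_le (hN : IsNeckRadius μ l R C) (h : IsLagrangePos μ l)
    (hq : ‖q - axisPoint l‖ < R) : critEnergy μ (q 0) ≤ critEnergy μ l := by
  rw [critEnergy_expansion h (hN.radius_pos' h hq)]
  have h1 := (abs_le.1 (hN.quad q hq)).1
  have h2 := nine_le_axialCurv h
  have : 0 ≤ axialQuad μ l (q 0) := by linarith
  nlinarith [mul_nonneg this (sq_nonneg (q 0 - l))]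

theorem potential_ge (hN : IsNeckRadius μ l R C) (h : IsLagrangePos μ l)
    (hq : ‖q - axisPoint l‖ < R) :
    critEnergy μ (q 0) + 29 / 20 * axisSq q ≤ potential μ q := by
  rw [potential_expansion (hN.radius_pos' h hq)]
  have h1 := hN.trans q hq
  have h2 : q 1 ^ 2 ≤ axisSq q := by unfold axisSq; nlinarith [sq_nonneg (q 2)]
  nlinarith [axisSq_nonneg q]

/-- Outside of the two balls, the potential has a strict minimum at the Lagrange point. -/
theorem potential_ge_of_notMem (hN : IsNeckRadius μ l R C) (h : IsLagrangePos μ l)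
    (hq : ‖q - axisPoint l‖ < R)
    (hout : ∀ b, q ∉ Metric.ball (pos μ b) (radius μ l b)) :
    critEnergy μ l + ‖q - axisPoint l‖ ^ 2 / 2 ≤ potential μ q := by
  obtain ⟨b, hb⟩ : ∃ b, 0 ≤ side b l q := by
    rcases le_total 0 (side .earth l q) with h1 | h1
    · exact ⟨_, h1⟩
    · refine ⟨Primary.earth.other, ?_⟩
      rw [side_other]; linarith
  have h1 : radius μ l b ^ 2 ≤ ‖q - pos μ b‖ ^ 2 := by
    have := hout b
    rw [mem_ball_iff_norm, not_lt] at this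
    exact pow_le_pow_left₀ (h.radius_mem b).1.le this 2
  rw [norm_sub_pos_sq, radius_side μ l] at h1
  have h2 := hN.radius_pos q hq b
  rw [radius_side μ l] at h2
  have h3 := hN.potential_ge h hq
  rw [critEnergy_expansion h (hN.radius_pos' h hq), ← side_sq b] at h3
  have h4 := (abs_le.1 (hN.quad q hq)).2
  have h9 := nine_le_axialCurv h
  have h5 := (le_abs_self _).trans_lt ((abs_side_le b l q).trans_lt hq)
  have h6 := hN.le b
  rw [norm_sub_axisPoint_sq, ← side_sq b]
  generalize side b l q = s at *
  generalize radius μ l b = r at *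
  generalize axialQuad μ l (q 0) = a at *
  generalize axialCurv μ l = A at *
  have hw := axisSq_nonneg q
  generalize axisSq q = w at *
  -- `A s ≤ r`, `3 r s ≤ 2 w`
  have h7 : 3 / 2 * r * s ≤ w := by nlinarith
  have h8 : A * s ≤ r := by nlinarith
  have h10 : 3 / 2 * A * s ^ 2 ≤ w := by nlinarith
  nlinarith [mul_nonneg (show 0 ≤ A * (101 / 200) - a by linarith) (sq_nonneg s), sq_nonneg s]

theorem mem_neckDomain_of_le (hN : IsNeckRadius μ l R C) (h : IsLagrangePos μ l) {δ c : ℝ}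
    (hδ : 0 < δ) (hq : ‖q - axisPoint l‖ < R) (hV : potential μ q ≤ c)
    (hc : c < critEnergy μ l + δ ^ 2 / 2) : q ∈ neckDomain μ l δ := by
  by_contra hcon
  simp only [neckDomain, mem_ofPred_eq, not_or, not_exists] at hcon
  have h1 := hN.potential_ge_of_notMem h hq hcon.1
  have h2 : δ ≤ ‖q - axisPoint l‖ := not_lt.1 fun h' => hcon.2 (mem_ball_iff_norm.2 h')
  nlinarith

end IsNeckRadius

theorem sphere_mem_offPrimaries (h : IsLagrangePos μ l) {b : Primary}
    (hq : ‖q - pos μ b‖ = radius μ l b) : q ∈ offPrimaries μ := by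
  have hr := h.radius_mem b
  refine (offPrimaries_iff b).2 ⟨?_, ?_⟩
  · rintro rfl
    rw [sub_self, norm_zero] at hq
    linarith [hr.1]
  · rintro rfl
    rw [← norm_neg, neg_sub, norm_pos_sub_other] at hq
    linarith [hr.2]

/-- On the spheres, the potential exceeds the critical energy away from the Lagrange point. -/
theorem exists_potential_gap (h : IsLagrangePos μ l) {η : ℝ} (hη : 0 < η) :
    ∃ ε > 0, ∀ b q, ‖q - pos μ b‖ = radius μ l b → η ≤ ‖q - axisPoint l‖ →
      critEnergy μ l + ε ≤ potential μ q := by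
  have key : ∀ b, ∃ ε > 0, ∀ q, ‖q - pos μ b‖ = radius μ l b → η ≤ ‖q - axisPoint l‖ →
      critEnergy μ l + ε ≤ potential μ q := by
    intro b
    have hcomp : IsCompact (Metric.sphere (pos μ b) (radius μ l b) ∩
        {q | η ≤ ‖q - axisPoint l‖}) :=
      (isCompact_sphere _ _).inter_right (isClosed_le continuous_const (by fun_prop))
    have hcont : ContinuousOn (potential μ) (Metric.sphere (pos μ b) (radius μ l b) ∩
        {q | η ≤ ‖q - axisPoint l‖}) := fun q hq =>
      (contDiffAt_potential (sphere_mem_offPrimaries h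
        (mem_sphere_iff_norm.1 hq.1))).continuousAt.continuousWithinAt
    obtain ⟨m, hm, hle⟩ := hcomp.exists_forall_le' hcont (a := critEnergy μ l) (by
      rintro q ⟨hq, hq'⟩
      refine h.critEnergy_lt_potential (mem_sphere_iff_norm.1 hq) ?_
      rintro rfl
      simp only [mem_ofPred_eq, sub_self, norm_zero] at hq'
      linarith)
    refine ⟨m - critEnergy μ l, by linarith, fun q h1 h2 => ?_⟩
    have := hle q ⟨mem_sphere_iff_norm.2 h1, h2⟩
    linarith
  obtain ⟨ε₁, h1, h1'⟩ := key .earth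
  obtain ⟨ε₂, h2, h2'⟩ := key .moon
  refine ⟨min ε₁ ε₂, lt_min h1 h2, ?_⟩
  rintro (_ | _) q hq hq'
  · linarith [h1' q hq hq', min_le_left ε₁ ε₂]
  · linarith [h2' q hq hq', min_le_right ε₁ ε₂]

/-- The radial field is transverse to energy levels slightly above the critical one, away from the
Lagrange point. -/
theorem exists_radial_gap (h : IsLagrangePos μ l) {η : ℝ} (hη : 0 < η) :
    ∃ ε > 0, ∀ b, ∀ z ∈ phaseSpace μ, z.1 ∈ Metric.ball (pos μ b) (radius μ l b) →
      η ≤ ‖z.1 - axisPoint l‖ → hamiltonian μ z < critEnergy μ l + ε →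
      0 < hamDeriv μ z (z.1 - pos μ b, 0) := by
  have key : ∀ b, ∃ ε > 0, ∀ q, q ≠ pos μ b → q ∈ Metric.ball (pos μ b) (radius μ l b) →
      η ≤ ‖q - axisPoint l‖ → ∀ c < critEnergy μ l + ε, 0 < radialEnergy μ b c q := by
    intro b
    have hr := h.radius_mem b
    set r := radius μ l b with hrdef
    -- The cap r/2 guarantees that the whole sphere of radius r/2 belongs to the compact set T,
    -- which is needed to reach the points nearer to b.
    set η' := min η (r / 2) with hη'
    set T : Set E3 := (Metric.closedBall (pos μ b) r ∩ {q | r / 2 ≤ ‖q - pos μ b‖}) ∩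
      {q | η' ≤ ‖q - axisPoint l‖} with hT
    have hTo : ∀ q ∈ T, q ∈ offPrimaries μ := by
      rintro q ⟨⟨h1, h2⟩, -⟩
      rw [mem_closedBall_iff_norm] at h1
      refine (offPrimaries_iff b).2 ⟨?_, ?_⟩
      · rintro rfl
        simp only [mem_ofPred_eq, sub_self, norm_zero] at h2
        linarith [hr.1]
      · rintro rfl
        rw [← norm_neg, neg_sub, norm_pos_sub_other] at h1
        linarith [hr.2]
    have hcomp : IsCompact T :=
      ((isCompact_closedBall _ _).inter_right (isClosed_le continuous_const (by fun_prop))).inter_right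
        (isClosed_le continuous_const (by fun_prop))
    have hcont : ContinuousOn (radialEnergy μ b (critEnergy μ l)) T := by
      intro q hq
      have hc : ∀ i : Fin 3, ContinuousAt (fun q : E3 => (q - pos μ b) i) q := fun i =>
        ContinuousAt.comp (f := fun q : E3 => q - pos μ b) (contDiffAt_coord i _).continuousAt
          (by fun_prop)
      have hc' : ∀ i : Fin 3, ContinuousAt (fun q : E3 => q i) q := fun i =>
        (contDiffAt_coord i _).continuousAt
      have hd : ∀ b', ‖q - pos μ b'‖ ^ 3 ≠ 0 := fun b' =>
        pow_ne_zero 3 (norm_ne_zero_iff.2 (sub_ne_zero.2 (hTo q hq b')))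
      unfold radialEnergy potentialDeriv
      refine ContinuousAt.continuousWithinAt ?_
      refine ((((((hc' 0).mul (hc 0)).add ((hc' 1).mul (hc 1))).neg.add
        (ContinuousAt.div (by fun_prop) (by fun_prop) (hd _))).add
        (ContinuousAt.div (by fun_prop) (by fun_prop) (hd _))).pow 2).add
        ((continuousAt_const.mul (((hc 0).pow 2).add ((hc 1).pow 2))).mul
          ((contDiffAt_potential (hTo q hq)).continuousAt.sub continuousAt_const))
    obtain ⟨m, hm, hle⟩ := hcomp.exists_forall_le' hcont (a := 0) (by
      rintro q ⟨⟨h1, h2⟩, h3⟩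
      refine h.radialEnergy_pos ?_ (mem_closedBall_iff_norm.1 h1) ?_
      · rintro rfl
        simp only [mem_ofPred_eq, sub_self, norm_zero] at h2
        linarith [hr.1]
      · rintro rfl
        simp only [mem_ofPred_eq, sub_self, norm_zero] at h3
        have : 0 < η' := lt_min hη (half_pos hr.1)
        linarith)
    -- The horizontal part of q - b has length less than 1, so raising the energy by less than m/2
    -- lowers the radial energy by less than m, its lower bound on T.
    refine ⟨m / 2, by linarith, ?_⟩
    have hT' : ∀ q ∈ T, ∀ c < critEnergy μ l + m / 2, 0 < radialEnergy μ b c q := by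
      intro q hq c hc
      have h1 := hle q hq
      have h2 : ‖q - pos μ b‖ ^ 2 < 1 := by
        have := mem_closedBall_iff_norm.1 hq.1.1
        have h3 := norm_nonneg (q - pos μ b)
        nlinarith [hr.2]
      rw [norm_sq_three] at h2
      unfold radialEnergy at h1 ⊢
      have h3 : (q - pos μ b) 0 ^ 2 + (q - pos μ b) 1 ^ 2 < 1 := by
        nlinarith [sq_nonneg ((q - pos μ b) 2)]
      have h4 : 0 ≤ (q - pos μ b) 0 ^ 2 + (q - pos μ b) 1 ^ 2 := by positivity
      nlinarith
    intro q hqb hq hηq c hc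
    have hn : 0 < ‖q - pos μ b‖ := norm_pos_iff.2 (sub_ne_zero.2 hqb)
    have hnr := mem_ball_iff_norm.1 hq
    -- Compactness fails at b itself. Closer than r/2 the estimate is transported inwards along the
    -- ray from the sphere of radius r/2, since `rayEnergy` decreases with the radius for every c.
    by_cases hh : r / 2 ≤ ‖q - pos μ b‖
    · exact hT' q ⟨⟨Metric.ball_subset_closedBall hq, hh⟩, (min_le_left _ _).trans hηq⟩ c hc
    · rw [not_le] at hh
      set t := r / 2 / ‖q - pos μ b‖ with ht
      have ht0 : 0 < t := div_pos (half_pos hr.1) hn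
      have htn : t * ‖q - pos μ b‖ = r / 2 := by rw [ht]; field_simp
      have hy : q - pos μ b ≠ 0 := sub_ne_zero.2 hqb
      have hn' : ‖t • (q - pos μ b)‖ = r / 2 := by
        rw [norm_smul, Real.norm_of_nonneg ht0.le, htn]
      have hqb' : pos μ b + t • (q - pos μ b) ≠ pos μ b := by
        rw [ne_eq, add_eq_left]; exact smul_ne_zero ht0.ne' hy
      have hmem : pos μ b + t • (q - pos μ b) ∈ T := by
        refine ⟨⟨?_, ?_⟩, ?_⟩
        · rw [mem_closedBall_iff_norm, add_sub_cancel_left, hn']; linarith [hr.1]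
        · rw [mem_ofPred_eq, add_sub_cancel_left, hn']
        · have h1 : r ≤ ‖axisPoint l - pos μ b‖ := by
            have := IsLagrangePos.axisPoint_notMem_ball μ l b
            rwa [mem_ball_iff_norm, not_lt] at this
          have h2 := norm_sub_norm_le (axisPoint l - pos μ b) (t • (q - pos μ b))
          rw [mem_ofPred_eq, ← norm_neg, neg_sub, ← sub_sub]
          linarith [min_le_right η (r / 2)]
      have h1 := hT' _ hmem c hc
      rw [radialEnergy_eq hqb', add_sub_cancel_left, horiz_smul ht0.ne', cosOther_smul ht0, hn'] at h1
      have h2 := pos_of_mul_pos_right h1 (by positivity)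
      rw [radialEnergy_eq hqb]
      have hc := cosOther_mem b (q - pos μ b)
      have h3 := rayEnergy_strictAntiOn (c := c) (mass_mem h.mem b) (h.axisSlope_radius b) hr.2 hc.1
        hc.2 (horiz_le_one (q - pos μ b)) ⟨hn, hnr.le⟩
        ⟨half_pos hr.1, half_le_self hr.1.le⟩ hh
      exact mul_pos (by positivity) (h2.trans h3)
  obtain ⟨ε₁, h1, h1'⟩ := key .earth
  obtain ⟨ε₂, h2, h2'⟩ := key .moon
  refine ⟨min ε₁ ε₂, lt_min h1 h2, ?_⟩
  intro b z hz hzb hηz hH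
  have hne : z.1 ≠ axisPoint l := fun he => IsLagrangePos.axisPoint_notMem_ball μ l b (he ▸ hzb)
  refine hamDeriv_radial_pos (c := hamiltonian μ z)
    (h.potentialDeriv_pos (hz b) (mem_ball_iff_norm.1 hzb).le hne) ?_ le_rfl
  cases b
  · exact h1' _ (hz _) hzb hηz _ (by linarith [min_le_left ε₁ ε₂])
  · exact h2' _ (hz _) hzb hηz _ (by linarith [min_le_right ε₁ ε₂])

/-! ### The component that contains both primaries -/

/-- Shrinking the transversal coordinates lowers the potential, as its transversal derivatives point
outwards; so every point moves within Hill's region to the axis. On the axis the potential is at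
most the critical energy, and one can walk to L₁. -/
theorem isPreconnected_hillRegion_neck (hN : IsNeckRadius μ l R C) (h : IsLagrangePos μ l) {δ c : ℝ}
    (hδ : 0 < δ) (hδR : δ ≤ R) (hc : critEnergy μ l ≤ c) :
    IsPreconnected (hillRegion μ c ∩ Metric.ball (axisPoint l) δ) := by
  have haxis : ∀ t : ℝ, |t - l| < δ → axisPoint t ∈ hillRegion μ c ∩ Metric.ball (axisPoint l) δ := by
    intro t ht
    have h2 : ‖axisPoint t - axisPoint l‖ ^ 2 = (t - l) ^ 2 := by
      rw [norm_sub_axisPoint_sq]; simp [axisPoint, axisSq]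
    have h1 : ‖axisPoint t - axisPoint l‖ < δ := by
      refine lt_of_pow_lt_pow_left₀ 2 hδ.le ?_
      rw [h2, ← sq_abs]
      exact pow_lt_pow_left₀ ht (abs_nonneg _) two_ne_zero
    refine ⟨?_, mem_ball_iff_norm.2 h1⟩
    have h3 := h1.trans_le hδR
    rw [hillRegion_eq]
    refine ⟨hN.mem_offPrimaries h h3, ?_⟩
    rw [potential_expansion (hN.radius_pos' h h3)]
    have h4 := hN.critEnergy_le h h3
    simp only [axisPoint, axisSq, Matrix.cons_val] at h4 ⊢
    linarith
  refine isPreconnected_of_forall (axisPoint l) fun q hq => ?_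
  rw [hillRegion_eq] at hq
  obtain ⟨⟨hqo, hV⟩, hqb⟩ := hq
  rw [mem_ball_iff_norm] at hqb
  have hq0 : |q 0 - l| < δ := by
    rw [← abs_side .earth]; exact (abs_side_le _ l q).trans_lt hqb
  set f : ℝ → E3 := fun t => !₂[q 0, t * q 1, t * q 2] with hf
  set g : ℝ → E3 := fun t => axisPoint (l + t * (q 0 - l)) with hg
  have hfd : ∀ t, HasDerivAt f !₂[0, q 1, q 2] t := by
    intro t
    have e : f = fun t => !₂[q 0, 0, 0] + t • !₂[0, q 1, q 2] := by
      funext t; ext i; fin_cases i <;> simp [hf]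
    rw [e]
    simpa using ((hasDerivAt_id t).smul_const (!₂[0, q 1, q 2] : E3)).const_add
      (!₂[q 0, 0, 0] : E3)
  have hfc : Continuous f := continuous_iff_continuousAt.2 fun t => (hfd t).continuousAt
  have hgc : Continuous g := by
    have e : g = fun t => axisPoint l + t • !₂[q 0 - l, 0, 0] := by
      funext t; ext i; fin_cases i <;> simp [hg, axisPoint]
    rw [e]; fun_prop
  have hfn : ∀ t ∈ Icc (0 : ℝ) 1, ‖f t - axisPoint l‖ < δ := by
    intro t ht
    refine lt_of_pow_lt_pow_left₀ 2 hδ.le (lt_of_le_of_lt ?_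
      (pow_lt_pow_left₀ hqb (norm_nonneg _) two_ne_zero))
    rw [norm_sub_axisPoint_sq, norm_sub_axisPoint_sq]
    simp only [hf, axisSq, Matrix.cons_val]
    have : t ^ 2 ≤ 1 := pow_le_one₀ ht.1 ht.2
    nlinarith [sq_nonneg (q 1), sq_nonneg (q 2)]
  have hmono : MonotoneOn (fun t => potential μ (f t)) (Icc 0 1) := by
    have hd : ∀ t ∈ Icc (0 : ℝ) 1, HasDerivAt (fun t => potential μ (f t))
        (potentialDeriv μ (f t) !₂[0, q 1, q 2]) t := by
      intro t ht
      obtain ⟨L, hL, hL'⟩ := hasFDerivAt_potential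
        (hN.mem_offPrimaries h ((hfn t ht).trans_le hδR))
      rw [← hL']
      exact hL.comp_hasDerivAt t (hfd t)
    refine monotoneOn_of_hasDerivWithinAt_nonneg (f' := fun t =>
      potentialDeriv μ (f t) !₂[0, q 1, q 2]) (convex_Icc 0 1)
      (fun t ht => (hd t ht).continuousAt.continuousWithinAt)
      (fun t ht => (hd t (interior_subset ht)).hasDerivWithinAt) ?_
    intro t ht
    have ht := interior_subset ht
    have hR := (hfn t ht).trans_le hδR
    rw [potentialDeriv_expansion h (hN.radius_pos' h hR)]
    have h1 := hN.trans _ hR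
    have h2 := (abs_le.1 (hN.curv_sub _ hR)).1
    have h3 : 0 ≤ transCurv μ (f t) - 1 := by linarith
    have h4 : 0 ≤ transCurv μ (f t) := by linarith
    simp only [hf, Matrix.cons_val] at h3 h4 ⊢
    have := ht.1
    have e1 := mul_nonneg h3 (mul_nonneg this (sq_nonneg (q 1)))
    have e2 := mul_nonneg h4 (mul_nonneg this (sq_nonneg (q 2)))
    nlinarith
  have hf1 : f 1 = q := by ext i; fin_cases i <;> simp [hf]
  refine ⟨f '' Icc 0 1 ∪ g '' Icc 0 1, ?_, Or.inr ⟨0, by simp, by simp [hg]⟩,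
    Or.inl ⟨1, by simp, hf1⟩, ?_⟩
  · rintro _ (⟨t, ht, rfl⟩ | ⟨t, ht, rfl⟩)
    · refine ⟨?_, mem_ball_iff_norm.2 (hfn t ht)⟩
      rw [hillRegion_eq]
      refine ⟨hN.mem_offPrimaries h ((hfn t ht).trans_le hδR), ?_⟩
      have := hmono ht (right_mem_Icc.2 zero_le_one) ht.2
      simp only [hf1] at this
      exact this.trans hV
    · refine haxis _ ?_
      rw [add_sub_cancel_left, abs_mul, abs_of_nonneg ht.1]
      nlinarith [abs_nonneg (q 0 - l), ht.2]
  · refine IsPreconnected.union (f 0) ⟨0, by simp, rfl⟩ ⟨1, by simp, ?_⟩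
      (isPreconnected_Icc.image _ hfc.continuousOn) (isPreconnected_Icc.image _ hgc.continuousOn)
    ext i; fin_cases i <;> simp [hf, hg, axisPoint]

/-- The three connected pieces are linked by axis points slightly on either side of L₁, which lie
both in the neck ball and in one of the large balls. -/
theorem isPreconnected_hillRegion_neckDomain (hN : IsNeckRadius μ l R C) (h : IsLagrangePos μ l)
    {δ c : ℝ} (hδ : 0 < δ) (hδR : δ ≤ R) (hc : critEnergy μ l ≤ c) :
    IsPreconnected (hillRegion μ c ∩ neckDomain μ l δ) := by
  have hpt : ∀ b, ∃ q, q ∈ hillRegion μ c ∩ Metric.ball (pos μ b) (radius μ l b) ∧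
      q ∈ hillRegion μ c ∩ Metric.ball (axisPoint l) δ := by
    intro b
    have hr := h.radius_mem b
    set t := min δ (radius μ l b) / 2 with ht
    have ht0 : 0 < t := half_pos (lt_min hδ hr.1)
    have htδ : t < δ := (half_lt_self (lt_min hδ hr.1)).trans_le (min_le_left _ _)
    have htr : t < radius μ l b := (half_lt_self (lt_min hδ hr.1)).trans_le (min_le_right _ _)
    set q := axisPoint (l - sgn b * t) with hq
    have hs : side b l q = t := by
      simp only [side, hq, axisPoint, Matrix.cons_val]
      linear_combination t * sgn_mul_self b
    have hw : axisSq q = 0 := by simp [axisSq, hq, axisPoint]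
    have h1 : ‖q - axisPoint l‖ < δ := by
      refine lt_of_pow_lt_pow_left₀ 2 hδ.le ?_
      rw [norm_sub_axisPoint_sq, ← side_sq b, hs, hw, add_zero]
      exact pow_lt_pow_left₀ htδ ht0.le two_ne_zero
    have h2 : q ∈ hillRegion μ c := by
      have h3 := h1.trans_le hδR
      rw [hillRegion_eq]
      refine ⟨hN.mem_offPrimaries h h3, ?_⟩
      rw [potential_expansion (hN.radius_pos' h h3), hw]
      have h4 := hN.critEnergy_le h h3
      have h5 : q 1 = 0 := by simp [hq, axisPoint]
      rw [h5]
      linarith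
    refine ⟨q, ⟨h2, mem_ball_iff_norm.2 ?_⟩, h2, mem_ball_iff_norm.2 h1⟩
    refine lt_of_pow_lt_pow_left₀ 2 hr.1.le ?_
    rw [norm_sub_pos_sq, radius_side μ l, hs, hw, add_zero]
    exact pow_lt_pow_left₀ (by linarith) (by linarith) two_ne_zero
  have e : hillRegion μ c ∩ neckDomain μ l δ =
      (hillRegion μ c ∩ Metric.ball (pos μ .earth) (radius μ l .earth) ∪
        hillRegion μ c ∩ Metric.ball (axisPoint l) δ) ∪
        hillRegion μ c ∩ Metric.ball (pos μ .moon) (radius μ l .moon) := by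
    ext q
    constructor
    · rintro ⟨h1, (⟨_ | _, h2⟩ | h2)⟩
      exacts [Or.inl (Or.inl ⟨h1, h2⟩), Or.inr ⟨h1, h2⟩, Or.inl (Or.inr ⟨h1, h2⟩)]
    · rintro ((h1 | h1) | h1)
      exacts [⟨h1.1, Or.inl ⟨_, h1.2⟩⟩, ⟨h1.1, Or.inr h1.2⟩, ⟨h1.1, Or.inl ⟨_, h1.2⟩⟩]
  rw [e]
  obtain ⟨q, hq, hq'⟩ := hpt .earth
  obtain ⟨p, hp, hp'⟩ := hpt .moon
  exact ((h.isPreconnected_hillRegion_inter_ball c .earth).union q hq hq'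
    (isPreconnected_hillRegion_neck hN h hδ hδR hc)).union p (Or.inr hp') hp
    (h.isPreconnected_hillRegion_inter_ball c .moon)

/-- Slightly above the critical energy, the regularized hypersurface of the component at both
primaries is the regularized level over `neckDomain μ l δ`. -/
theorem exists_regularizedHypersurface_eq (hN : IsNeckRadius μ l R C) (h : IsLagrangePos μ l)
    {δ : ℝ} (hδ : 0 < δ) (hδR : δ < R) :
    ∃ ε > 0, ∀ c, critEnergy μ l < c → c < critEnergy μ l + ε →
      regularizedHypersurface μ c {pos μ .earth, pos μ .moon} = surf μ 0 c (neckDomain μ l δ) := by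
  obtain ⟨ε, hε, hgap⟩ := exists_potential_gap h hN.size_pos
  -- Frontier points within R of L₁ are excluded from Hill's region by the quadratic growth outside
  -- the two balls, whence δ²/2. The others lie on one of the spheres, where ε bounds the potential.
  refine ⟨min ε (δ ^ 2 / 2), by positivity, fun c hc hc' => ?_⟩
  have h1 := min_le_left ε (δ ^ 2 / 2)
  have h2 := min_le_right ε (δ ^ 2 / 2)
  have hS := regularizedHypersurface_eq_surf (c := c) (Bs := {.earth, .moon}) h.mem
    (isOpen_neckDomain μ l δ) ?_ (isPreconnected_hillRegion_neckDomain hN h hδ hδR.le hc.le)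
    (fun b _ => Or.inl ⟨b, Metric.mem_ball_self (h.radius_mem b).1⟩) ⟨.earth, by simp⟩
  · rwa [image_pair] at hS
  · intro q hq hq'
    by_cases hn : ‖q - axisPoint l‖ < R
    · refine ⟨hN.mem_offPrimaries h hn, not_le.1 fun hV => hq' ?_⟩
      exact hN.mem_neckDomain_of_le h hδ hn hV (by linarith)
    · rw [not_lt] at hn
      rcases closure_neckDomain hq with ⟨b, hb⟩ | hb
      · have hb' : ‖q - pos μ b‖ = radius μ l b := by
          refine le_antisymm hb (not_lt.1 fun hlt => hq' (Or.inl ⟨b, mem_ball_iff_norm.2 hlt⟩))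
        exact ⟨sphere_mem_offPrimaries h hb', by linarith [hgap b q hb' hn]⟩
      · linarith

end Neck


/-! ### Profile functions -/


/-- A concave function that is the identity up to `1` and constant from `2` on. -/
def satur (u : ℝ) : ℝ := ∫ v in (0 : ℝ)..u, (1 - Real.smoothTransition (v - 1))

theorem contDiff_saturDeriv : ContDiff ℝ ∞ fun v : ℝ => 1 - Real.smoothTransition (v - 1) :=
  contDiff_const.sub (Real.smoothTransition.contDiff.comp (contDiff_id.sub contDiff_const))

theorem hasDerivAt_satur (u : ℝ) : HasDerivAt satur (1 - Real.smoothTransition (u - 1)) u :=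
  (contDiff_saturDeriv.continuous.integral_hasStrictDerivAt 0 u).hasDerivAt

theorem contDiff_satur : ContDiff ℝ ∞ satur := by
  rw [contDiff_infty_iff_deriv]
  refine ⟨fun u => (hasDerivAt_satur u).differentiableAt, ?_⟩
  have : deriv satur = fun u => 1 - Real.smoothTransition (u - 1) := by
    funext u; exact (hasDerivAt_satur u).deriv
  rw [this]
  exact contDiff_saturDeriv

theorem satur_mono : Monotone satur :=
  monotone_of_hasDerivAt_nonneg hasDerivAt_satur fun _ =>
    sub_nonneg.2 (Real.smoothTransition.le_one _)

theorem satur_of_le_one {u : ℝ} (hu : u ≤ 1) : satur u = u := by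
  have : ∀ v ∈ Set.uIcc 0 u, 1 - Real.smoothTransition (v - 1) = 1 := by
    intro v hv
    have hv1 : v ≤ 1 := by
      rcases Set.mem_uIcc.1 hv with h | h <;> linarith [h.2]
    rw [Real.smoothTransition.zero_of_nonpos (by linarith), sub_zero]
  rw [satur, intervalIntegral.integral_congr this]
  simp

theorem satur_of_two_le {u : ℝ} (hu : 2 ≤ u) : satur u = satur 2 := by
  have h := intervalIntegral.integral_add_adjacent_intervals (μ := MeasureTheory.volume)
    (f := fun v : ℝ => 1 - Real.smoothTransition (v - 1))
    (contDiff_saturDeriv.continuous.intervalIntegrable 0 2)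
    (contDiff_saturDeriv.continuous.intervalIntegrable 2 u)
  have : ∀ v ∈ Set.uIcc 2 u, 1 - Real.smoothTransition (v - 1) = 0 := by
    intro v hv
    rw [Set.uIcc_of_le hu] at hv
    rw [Real.smoothTransition.one_of_one_le (by linarith [hv.1]), sub_self]
  rw [intervalIntegral.integral_congr (a := 2) this] at h
  simp only [intervalIntegral.integral_zero, add_zero] at h
  exact h.symm

theorem satur_two_mem : satur 2 ∈ Icc (1 : ℝ) 2 := by
  constructor
  · rw [← satur_of_le_one le_rfl]
    exact (satur_of_le_one le_rfl).ge.trans (satur_mono (by norm_num)) |>.trans' (by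
      rw [satur_of_le_one le_rfl])
  · have h := intervalIntegral.integral_mono_on (μ := MeasureTheory.volume) (a := 0) (b := 2)
      (by norm_num) (contDiff_saturDeriv.continuous.intervalIntegrable 0 2)
      (continuous_const.intervalIntegrable (u := fun _ => (1 : ℝ)) 0 2)
      (fun v _ => sub_le_self _ (Real.smoothTransition.nonneg _))
    simpa [satur] using h

/-- Concavity together with the value 0 at 0: the derivative at u is at most its average over [0,
u]. -/
theorem mul_saturDeriv_le {u : ℝ} (hu : 0 ≤ u) :
    u * (1 - Real.smoothTransition (u - 1)) ≤ satur u := by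
  have h := intervalIntegral.integral_mono_on (μ := MeasureTheory.volume) (a := 0) (b := u)
    hu (continuous_const.intervalIntegrable (u := fun _ => 1 - Real.smoothTransition (u - 1)) 0 u)
    (contDiff_saturDeriv.continuous.intervalIntegrable 0 u)
    (fun v hv => sub_le_sub_left (Real.smoothTransition.monotone (by linarith [hv.2])) _)
  rw [intervalIntegral.integral_const, sub_zero, smul_eq_mul] at h
  exact h

/-- A concave function that is the identity up to `d / 2` and equal to `d` from `2 * d` on. -/
def saturAt (d u : ℝ) : ℝ := d / satur 2 * satur (satur 2 / d * u)

section SaturAt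

variable {d : ℝ}

theorem contDiff_saturAt (d : ℝ) : ContDiff ℝ ∞ (saturAt d) :=
  contDiff_const.mul (contDiff_satur.comp (contDiff_const.mul contDiff_id))

theorem hasDerivAt_saturAt (hd : 0 < d) (u : ℝ) :
    HasDerivAt (saturAt d) (1 - Real.smoothTransition (satur 2 / d * u - 1)) u := by
  have hJ : 0 < satur 2 := zero_lt_one.trans_le satur_two_mem.1
  have h := ((hasDerivAt_satur (satur 2 / d * u)).comp u
    ((hasDerivAt_id u).const_mul (satur 2 / d))).const_mul (d / satur 2)
  refine h.congr_deriv ?_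
  field_simp

theorem saturAt_of_le (hd : 0 < d) {u : ℝ} (hu : u ≤ d / 2) : saturAt d u = u := by
  have hJ : 0 < satur 2 := zero_lt_one.trans_le satur_two_mem.1
  rw [saturAt, satur_of_le_one (u := satur 2 / d * u)]
  · field_simp
  · rw [div_mul_eq_mul_div, div_le_one hd]
    rcases le_total 0 u with h | h
    · nlinarith [satur_two_mem.2]
    · nlinarith

theorem saturAt_of_ge (hd : 0 < d) {u : ℝ} (hu : 2 * d ≤ u) : saturAt d u = d := by
  have hJ : 0 < satur 2 := zero_lt_one.trans_le satur_two_mem.1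
  rw [saturAt, satur_of_two_le (u := satur 2 / d * u)]
  · field_simp
  · rw [div_mul_eq_mul_div, le_div_iff₀ hd]
    nlinarith [satur_two_mem.1]

theorem saturAt_deriv_of_ge (hd : 0 < d) {u : ℝ} (hu : 2 * d ≤ u) :
    1 - Real.smoothTransition (satur 2 / d * u - 1) = 0 := by
  rw [Real.smoothTransition.one_of_one_le, sub_self]
  have : 2 ≤ satur 2 / d * u := by
    rw [div_mul_eq_mul_div, le_div_iff₀ hd]
    nlinarith [satur_two_mem.1]
  linarith

theorem saturAt_mono (hd : 0 < d) : Monotone (saturAt d) :=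
  monotone_of_hasDerivAt_nonneg (hasDerivAt_saturAt hd) fun _ =>
    sub_nonneg.2 (Real.smoothTransition.le_one _)

theorem mul_saturAt_deriv_le (hd : 0 < d) {u : ℝ} (hu : 0 ≤ u) :
    u * (1 - Real.smoothTransition (satur 2 / d * u - 1)) ≤ saturAt d u := by
  have hJ : 0 < satur 2 := zero_lt_one.trans_le satur_two_mem.1
  have h := mul_saturDeriv_le (u := satur 2 / d * u) (by positivity)
  rw [saturAt]
  have h2 := mul_le_mul_of_nonneg_left h (show 0 ≤ d / satur 2 by positivity)
  refine le_trans (le_of_eq ?_) h2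
  field_simp

end SaturAt

/-- The transition between the radial fields at the two primaries. -/
structure IsNeckProfile (dE dM δ δ₁ : ℝ) (g : ℝ → ℝ) : Prop where
  smooth : ContDiff ℝ ∞ g
  small_pos : 0 < δ₁
  deriv_nonneg : ∀ x, 0 ≤ deriv g x
  right : ∀ x, δ ≤ x → g x = dE ∧ deriv g x = 0
  left : ∀ x, x ≤ -δ → g x = -dM ∧ deriv g x = 0
  mul_nonneg : ∀ x, 0 ≤ x * g x
  abs_le : ∀ x, |x| ≤ δ → |x| ≤ |g x|
  deriv_le : ∀ x, x ^ 2 * deriv g x ≤ 3 * (x * g x)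
  small : ∀ x, |x| ≤ δ₁ → |g x| ≤ 11 / 10 * |x| ∧ deriv g x ≤ 13 / 10

/-- A steep odd cubic u(x) is fed into a saturation on each side. Concavity of the saturation and
the bound x u' ≤ 3u for the cubic give `deriv_le`, with the factor 3 coming from the exponent. -/
theorem exists_isNeckProfile {dE dM δ : ℝ} (hE : dE ∈ Ioo (0 : ℝ) 1) (hM : dM ∈ Ioo (0 : ℝ) 1)
    (hδ : 0 < δ) (hδE : δ ≤ dE / 2) (hδM : δ ≤ dM / 2) :
    ∃ g δ₁, IsNeckProfile dE dM δ δ₁ g := by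
  -- Then u(δ) ≥ 2, which exceeds 2dE and 2dM, so both saturations are complete from δ on.
  set M : ℝ := 2 / δ ^ 3 with hMdef
  have hM0 : 0 < M := by positivity
  set u : ℝ → ℝ := fun x => x + M * x ^ 3 with hu
  have hud : ∀ x, HasDerivAt u (1 + 3 * M * x ^ 2) x := by
    intro x
    refine ((hasDerivAt_id x).add ((hasDerivAt_pow 3 x).const_mul M)).congr_deriv ?_
    norm_num
    ring
  -- On either half-line one of the saturations is still in its linear range and cancels -u, which
  -- leaves the other one. The formula is smooth at 0 without gluing.
  set g : ℝ → ℝ := fun x => saturAt dE (u x) - saturAt dM (-u x) - u x with hg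
  have huc : ContDiff ℝ ∞ u := contDiff_id.add (contDiff_const.mul (contDiff_id.pow 3))
  have hgc : ContDiff ℝ ∞ g := (((contDiff_saturAt dE).comp huc).sub
    ((contDiff_saturAt dM).comp huc.neg)).sub huc
  have hgd : ∀ x, HasDerivAt g (((1 - Real.smoothTransition (satur 2 / dE * u x - 1)) +
      (1 - Real.smoothTransition (satur 2 / dM * (-u x) - 1)) - 1) * (1 + 3 * M * x ^ 2)) x := by
    intro x
    have h1 := (hasDerivAt_saturAt hE.1 (u x)).comp x (hud x)
    have h2 := (hasDerivAt_saturAt hM.1 (-u x)).comp x (hud x).neg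
    refine ((h1.sub h2).sub (hud x)).congr_deriv ?_
    ring
  have hupos : ∀ x, 0 ≤ x → 0 ≤ u x := fun x hx => by simp only [hu]; positivity
  have huneg : ∀ x, u (-x) = -u x := fun x => by simp only [hu]; ring
  have hST : ∀ d v : ℝ, 0 < d → v ≤ 0 → Real.smoothTransition (satur 2 / d * v - 1) = 0 := by
    intro d v hd hv
    have hJ : 0 < satur 2 := zero_lt_one.trans_le satur_two_mem.1
    refine Real.smoothTransition.zero_of_nonpos ?_
    have : satur 2 / d * v ≤ 0 := mul_nonpos_of_nonneg_of_nonpos (by positivity) hv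
    linarith
  have hgR : ∀ x, 0 ≤ x → g x = saturAt dE (u x) := by
    intro x hx
    simp only [hg]
    rw [saturAt_of_le hM.1 (u := -u x) (by linarith [hupos x hx, hM.1])]
    ring
  have hgL : ∀ x, 0 ≤ x → g (-x) = -saturAt dM (u x) := by
    intro x hx
    simp only [hg]
    rw [huneg, neg_neg, saturAt_of_le hE.1 (u := -u x) (by linarith [hupos x hx, hE.1])]
    ring
  have hdR : ∀ x, 0 ≤ x → deriv g x =
      (1 - Real.smoothTransition (satur 2 / dE * u x - 1)) * (1 + 3 * M * x ^ 2) := by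
    intro x hx
    rw [(hgd x).deriv, hST dM _ hM.1 (by linarith [hupos x hx])]
    ring
  have hdL : ∀ x, 0 ≤ x → deriv g (-x) =
      (1 - Real.smoothTransition (satur 2 / dM * u x - 1)) * (1 + 3 * M * x ^ 2) := by
    intro x hx
    rw [(hgd (-x)).deriv, huneg, neg_neg, hST dE _ hE.1 (by linarith [hupos x hx])]
    ring
  have hbig : ∀ x, δ ≤ x → 2 ≤ u x := by
    intro x hx
    have h3 : δ ^ 3 ≤ x ^ 3 := pow_le_pow_left₀ hδ.le hx 3
    have : M * δ ^ 3 = 2 := by rw [hMdef]; field_simp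
    simp only [hu]
    nlinarith
  have hxu : ∀ x, 0 ≤ x → x ≤ u x := fun x hx => by
    simp only [hu]; linarith [mul_nonneg hM0.le (pow_nonneg hx 3)]
  -- the properties on a half-line
  have hsat0 : ∀ d x : ℝ, 0 < d → 0 ≤ x → 0 ≤ saturAt d (u x) := by
    intro d x hd hx
    have := saturAt_mono hd (hupos x hx)
    rwa [saturAt_of_le hd (by linarith)] at this
  have hsat1 : ∀ d x : ℝ, 0 < d → δ ≤ d / 2 → 0 ≤ x → x ≤ δ → x ≤ saturAt d (u x) := by
    intro d x hd hdδ hx hxδ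
    have := saturAt_mono hd (hxu x hx)
    rwa [saturAt_of_le hd (by linarith)] at this
  have hsat2 : ∀ d x : ℝ, 0 < d → 0 ≤ x →
      x ^ 2 * ((1 - Real.smoothTransition (satur 2 / d * u x - 1)) * (1 + 3 * M * x ^ 2)) ≤
        3 * (x * saturAt d (u x)) := by
    intro d x hd hx
    have h1 := mul_saturAt_deriv_le hd (hupos x hx)
    have h2 : x * (1 + 3 * M * x ^ 2) ≤ 3 * u x := by simp only [hu]; nlinarith
    have h3 : 0 ≤ 1 - Real.smoothTransition (satur 2 / d * u x - 1) :=
      sub_nonneg.2 (Real.smoothTransition.le_one _)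
    generalize 1 - Real.smoothTransition (satur 2 / d * u x - 1) = s at *
    calc x ^ 2 * (s * (1 + 3 * M * x ^ 2)) = x * s * (x * (1 + 3 * M * x ^ 2)) := by ring
      _ ≤ x * s * (3 * u x) := by gcongr
      _ = 3 * (x * (u x * s)) := by ring
      _ ≤ 3 * (x * saturAt d (u x)) := by gcongr
  have hδ1 : δ < 1 / 2 := by linarith [hE.2]
  -- For x ≤ δ²/5 one has Mx² ≤ 2δ/25, so u is within ten percent of x and the saturation acts as
  -- the identity. This accounts for the constants 11/10 and 13/10.
  have hsmall : ∀ x, 0 ≤ x → x ≤ δ ^ 2 / 5 → M * x ^ 2 ≤ 1 / 10 ∧ u x ≤ δ := by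
    intro x hx hxs
    have h1 : x ^ 2 ≤ (δ ^ 2 / 5) ^ 2 := pow_le_pow_left₀ hx hxs 2
    have h2 : M * x ^ 2 ≤ 1 / 10 := by
      calc M * x ^ 2 ≤ M * (δ ^ 2 / 5) ^ 2 := by gcongr
        _ = 2 * δ / 25 := by rw [hMdef]; field_simp; norm_num
        _ ≤ 1 / 10 := by linarith
    refine ⟨h2, ?_⟩
    have : u x = x * (1 + M * x ^ 2) := by simp only [hu]; ring
    rw [this]
    nlinarith
  have hsm : ∀ d x : ℝ, 0 < d → δ ≤ d / 2 → 0 ≤ x → x ≤ δ ^ 2 / 5 →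
      saturAt d (u x) ≤ 11 / 10 * x ∧
        (1 - Real.smoothTransition (satur 2 / d * u x - 1)) * (1 + 3 * M * x ^ 2) ≤ 13 / 10 := by
    intro d x hd hdδ hx hxs
    obtain ⟨h1, h2⟩ := hsmall x hx hxs
    constructor
    · rw [saturAt_of_le hd (by linarith)]
      have : u x = x * (1 + M * x ^ 2) := by simp only [hu]; ring
      rw [this]
      nlinarith
    · have h3 : 0 ≤ Real.smoothTransition (satur 2 / d * u x - 1) :=
        Real.smoothTransition.nonneg _
      nlinarith [mul_nonneg hM0.le (sq_nonneg x)]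
  have sym : ∀ P : ℝ → Prop, (∀ x, 0 ≤ x → P x) → (∀ x, 0 ≤ x → P (-x)) → ∀ x, P x := by
    intro P h1 h2 x
    rcases le_total 0 x with h | h
    · exact h1 x h
    · have := h2 (-x) (by linarith)
      rwa [neg_neg] at this
  refine ⟨g, δ ^ 2 / 5, hgc, by positivity, ?_, ?_, ?_, ?_, ?_, ?_, ?_⟩
  · refine sym _ (fun x hx => ?_) fun x hx => ?_
    · rw [hdR x hx]
      exact mul_nonneg (sub_nonneg.2 (Real.smoothTransition.le_one _)) (by positivity)
    · rw [hdL x hx]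
      exact mul_nonneg (sub_nonneg.2 (Real.smoothTransition.le_one _)) (by positivity)
  · intro x hx
    have hx0 : 0 ≤ x := hδ.le.trans hx
    have h2 : 2 * dE ≤ u x := by linarith [hbig x hx, hE.2]
    rw [hgR x hx0, hdR x hx0, saturAt_of_ge hE.1 h2, saturAt_deriv_of_ge hE.1 h2]
    simp
  · intro x hx
    have hx0 : 0 ≤ -x := by linarith
    have h2 : 2 * dM ≤ u (-x) := by linarith [hbig (-x) (by linarith), hM.2]
    have h3 := hgL (-x) hx0
    have h4 := hdL (-x) hx0
    rw [neg_neg] at h3 h4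
    rw [h3, h4, saturAt_of_ge hM.1 h2, saturAt_deriv_of_ge hM.1 h2]
    simp
  · refine sym _ (fun x hx => ?_) fun x hx => ?_
    · rw [hgR x hx]; exact mul_nonneg hx (hsat0 _ _ hE.1 hx)
    · rw [hgL x hx, neg_mul_neg]; exact mul_nonneg hx (hsat0 _ _ hM.1 hx)
  · refine sym _ (fun x hx hxδ => ?_) fun x hx hxδ => ?_
    · rw [abs_of_nonneg hx] at hxδ ⊢
      rw [hgR x hx]
      exact (hsat1 _ _ hE.1 hδE hx hxδ).trans (le_abs_self _)
    · rw [abs_neg, abs_of_nonneg hx] at hxδ ⊢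
      rw [hgL x hx, abs_neg]
      exact (hsat1 _ _ hM.1 hδM hx hxδ).trans (le_abs_self _)
  · refine sym _ (fun x hx => ?_) fun x hx => ?_
    · rw [hgR x hx, hdR x hx]; exact hsat2 _ _ hE.1 hx
    · rw [hgL x hx, hdL x hx, neg_mul_neg, neg_sq]; exact hsat2 _ _ hM.1 hx
  · refine sym _ (fun x hx hxδ => ?_) fun x hx hxδ => ?_
    · rw [abs_of_nonneg hx] at hxδ ⊢
      rw [hgR x hx, hdR x hx, abs_of_nonneg (hsat0 _ _ hE.1 hx)]
      exact hsm _ _ hE.1 hδE hx hxδ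
    · rw [abs_neg, abs_of_nonneg hx] at hxδ ⊢
      rw [hgL x hx, hdL x hx, abs_neg, abs_of_nonneg (hsat0 _ _ hM.1 hx)]
      exact hsm _ _ hM.1 hδM hx hxδ

/-- A cutoff function around `0`. -/
def cutoff (t : ℝ) : ℝ := Real.smoothTransition ((4 - t ^ 2) / 3)

theorem contDiff_cutoff : ContDiff ℝ ∞ cutoff :=
  Real.smoothTransition.contDiff.comp ((contDiff_const.sub (contDiff_id.pow 2)).div_const 3)

theorem cutoff_of_le {t : ℝ} (h : |t| ≤ 1) : cutoff t = 1 := by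
  have : t ^ 2 ≤ 1 := by rw [← sq_abs]; exact pow_le_one₀ (abs_nonneg t) h
  exact Real.smoothTransition.one_of_one_le (by linarith)

theorem cutoff_of_ge {t : ℝ} (h : 2 ≤ |t|) : cutoff t = 0 := by
  have : 4 ≤ t ^ 2 := by rw [← sq_abs]; nlinarith
  exact Real.smoothTransition.zero_of_nonpos (by linarith)

theorem exists_deriv_cutoff_le : ∃ C₀ > 0, ∀ t, |deriv cutoff t| ≤ C₀ := by
  have hc : Continuous (deriv cutoff) := contDiff_cutoff.continuous_deriv (by simp)
  obtain ⟨C₀, hC⟩ := (isCompact_Icc (a := (-3 : ℝ)) (b := 3)).exists_bound_of_continuousOn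
    hc.continuousOn
  refine ⟨max C₀ 1, by positivity, fun t => ?_⟩
  by_cases ht : t ∈ Icc (-3 : ℝ) 3
  · exact (hC t ht).trans (le_max_left _ _)
  · have h2 : 2 < |t| := by
      by_contra hcon
      rw [not_lt, abs_le] at hcon
      exact ht ⟨by linarith [hcon.1], by linarith [hcon.2]⟩
    have : cutoff =ᶠ[𝓝 t] fun _ => 0 := by
      filter_upwards [continuous_abs.continuousAt.eventually_const_lt h2] with s hs
      exact cutoff_of_ge hs.le
    rw [this.deriv_eq]
    simp


/-! ### A Liouville field across the neck -/

section Estimates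

variable {A a a₁ k K m e x y z al be ga G g' : ℝ}

/-- In these estimates x, y, z are the position relative to L₁, al, be, ga the velocity, e the
excess energy, A the axial curvature; a and k are the coefficients in the potential, a₁, K and m
those in its gradient, and `hlev` is the energy equation. The inequality says that velocity and
transversal displacement are controlled by e and Ax². -/
theorem neck_level_le (ha : |2 * a - A| ≤ A / 100) (hk : 29 / 10 ≤ 2 * k - 1)
    (hlev : (al ^ 2 + be ^ 2 + ga ^ 2) / 2 = e + a * x ^ 2 - k * (y ^ 2 + z ^ 2) + y ^ 2 / 2) :
    al ^ 2 + be ^ 2 + ga ^ 2 + 29 / 10 * (y ^ 2 + z ^ 2) ≤ 2 * e + 101 / 100 * (A * x ^ 2) := by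
  have h1 := mul_le_mul_of_nonneg_right (abs_le.1 ha).2 (sq_nonneg x)
  have h2 := mul_le_mul_of_nonneg_right hk (add_nonneg (sq_nonneg y) (sq_nonneg z))
  nlinarith [sq_nonneg z]

/-- Half of the sum of the kinetic energy and of the virial of the potential is almost the excess
energy. -/
theorem neck_virial_ge (ha : |2 * a - A| ≤ A / 100) (ha₁ : |a₁ - A| ≤ A / 100)
    (hKk : |K - 2 * k| ≤ 1 / 50) (hm : |m| ≤ 1 / 100)
    (hlev : (al ^ 2 + be ^ 2 + ga ^ 2) / 2 = e + a * x ^ 2 - k * (y ^ 2 + z ^ 2) + y ^ 2 / 2) :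
    e - 1 / 100 * (A * x ^ 2) - 3 / 200 * (y ^ 2 + z ^ 2) ≤ (al ^ 2 + be ^ 2 + ga ^ 2) / 2 +
      (-a₁ * x ^ 2 + m * (y ^ 2 + z ^ 2) + (K - 1) * y ^ 2 + K * z ^ 2) / 2 := by
  -- For an exactly quadratic Hamiltonian, 2a = a₁ = A, K = 2k and m = 0, and by Euler's identity
  -- the right-hand side is e. The small terms come from the permitted deviations.
  have hw := add_nonneg (sq_nonneg y) (sq_nonneg z)
  have h1 := mul_le_mul_of_nonneg_right (abs_le.1 ha).1 (sq_nonneg x)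
  have h2 := mul_le_mul_of_nonneg_right (abs_le.1 ha₁).2 (sq_nonneg x)
  have h3 := mul_le_mul_of_nonneg_right (abs_le.1 hKk).1 hw
  have h4 := mul_le_mul_of_nonneg_right (abs_le.1 hm).1 hw
  nlinarith

/-- Close to L₁ nothing is small relative to e, so positivity starts from the virial term e. The
axial term adds Ax², which with A ≥ 9 pays for the cross term in x and be; the negative part of the
g' term is paid by the transversal share of the energy equation. -/
theorem neck_center_pos (hA : 9 ≤ A) (ha : |2 * a - A| ≤ A / 100) (ha₁ : |a₁ - A| ≤ A / 100)
    (hk : 29 / 10 ≤ 2 * k - 1) (hKk : |K - 2 * k| ≤ 1 / 50) (hm : |m| ≤ 1 / 100)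
    (hlev : (al ^ 2 + be ^ 2 + ga ^ 2) / 2 = e + a * x ^ 2 - k * (y ^ 2 + z ^ 2) + y ^ 2 / 2)
    (he : 0 < e) (hG : G ∈ Icc 1 (11 / 10)) (hg' : g' ∈ Icc 0 (13 / 10)) :
    0 < (al ^ 2 + be ^ 2 + ga ^ 2) / 2 +
      (-a₁ * x ^ 2 + m * (y ^ 2 + z ^ 2) + (K - 1) * y ^ 2 + K * z ^ 2) / 2 +
      G * (a₁ * x ^ 2 - m * (y ^ 2 + z ^ 2) + x * be) + g' * (al ^ 2 - al * y) := by
  have hw := add_nonneg (sq_nonneg y) (sq_nonneg z)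
  have h0 := neck_virial_ge ha ha₁ hKk hm hlev
  have h1 := neck_level_le ha hk hlev
  have h2 := mul_le_mul_of_nonneg_right (abs_le.1 ha₁).1 (sq_nonneg x)
  have h3 := mul_le_mul_of_nonneg_right (abs_le.1 hm).2 hw
  have h4 : 9 * x ^ 2 ≤ A * x ^ 2 := mul_le_mul_of_nonneg_right hA (sq_nonneg x)
  have h5 : -(13 / 40) * y ^ 2 ≤ g' * (al ^ 2 - al * y) := by
    have : -(y ^ 2 / 4) ≤ al ^ 2 - al * y := by nlinarith [sq_nonneg (al - y / 2)]
    nlinarith [hg'.1, hg'.2, sq_nonneg y]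
  have h6 : 99 / 100 * (A * x ^ 2) - 11 / 1000 * (y ^ 2 + z ^ 2) - 12 / 100 * be ^ 2 -
      253 / 100 * x ^ 2 ≤ G * (a₁ * x ^ 2 - m * (y ^ 2 + z ^ 2) + x * be) := by
    have i1 : 99 / 100 * (A * x ^ 2) ≤ G * (a₁ * x ^ 2) := by nlinarith [hG.1, hG.2]
    have i2 : G * (m * (y ^ 2 + z ^ 2)) ≤ 11 / 1000 * (y ^ 2 + z ^ 2) := by
      nlinarith [hG.1, hG.2]
    have i3 : -(12 / 100 * be ^ 2 + 253 / 100 * x ^ 2) ≤ G * (x * be) := by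
      have hG2 : G ^ 2 ≤ 121 / 100 := by nlinarith [hG.1, hG.2]
      nlinarith [sq_nonneg (12 / 100 * be + G * x / 2), sq_nonneg x]
    linarith
  nlinarith [sq_nonneg al, sq_nonneg ga, sq_nonneg be, sq_nonneg x]

/-- Complete the square in x·be and bound be² by the energy equation. Since e is at most x²/100,
this costs only part of Ax² and returns a positive multiple of y² + z². -/
theorem neck_axial_ge (hA : 9 ≤ A) (ha : |2 * a - A| ≤ A / 100) (ha₁ : |a₁ - A| ≤ A / 100)
    (hk : 29 / 10 ≤ 2 * k - 1) (hm : |m| ≤ 1 / 100)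
    (hlev : (al ^ 2 + be ^ 2 + ga ^ 2) / 2 = e + a * x ^ 2 - k * (y ^ 2 + z ^ 2) + y ^ 2 / 2)
    (he : e ≤ 1 / 100 * x ^ 2) :
    61 / 100 * (A * x ^ 2) + 3 / 4 * (y ^ 2 + z ^ 2) ≤
      a₁ * x ^ 2 - m * (y ^ 2 + z ^ 2) + x * be := by
  have hw := add_nonneg (sq_nonneg y) (sq_nonneg z)
  have h1 := neck_level_le ha hk hlev
  have h2 := mul_le_mul_of_nonneg_right (abs_le.1 ha₁).1 (sq_nonneg x)
  have h3 := mul_le_mul_of_nonneg_right (abs_le.1 hm).2 hw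
  have h4 : 9 * x ^ 2 ≤ A * x ^ 2 := mul_le_mul_of_nonneg_right hA (sq_nonneg x)
  nlinarith [sq_nonneg (267 / 1000 * be + x / 2), sq_nonneg al, sq_nonneg ga, sq_nonneg x]

theorem neck_inner_ge (hA : 9 ≤ A) (ha : |2 * a - A| ≤ A / 100) (ha₁ : |a₁ - A| ≤ A / 100)
    (hk : 29 / 10 ≤ 2 * k - 1) (hKk : |K - 2 * k| ≤ 1 / 50) (hm : |m| ≤ 1 / 100)
    (hlev : (al ^ 2 + be ^ 2 + ga ^ 2) / 2 = e + a * x ^ 2 - k * (y ^ 2 + z ^ 2) + y ^ 2 / 2)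
    (he0 : 0 ≤ e) (he : e ≤ 1 / 100 * x ^ 2) (hG : 1 ≤ G) (hg0 : 0 ≤ g') (hg' : g' ≤ 3 * G) :
    G * (59 / 100 * (A * x ^ 2)) ≤ (al ^ 2 + be ^ 2 + ga ^ 2) / 2 +
      (-a₁ * x ^ 2 + m * (y ^ 2 + z ^ 2) + (K - 1) * y ^ 2 + K * z ^ 2) / 2 +
      G * (a₁ * x ^ 2 - m * (y ^ 2 + z ^ 2) + x * be) + g' * (al ^ 2 - al * y) := by
  have hw := add_nonneg (sq_nonneg y) (sq_nonneg z)
  have h0 := neck_virial_ge ha ha₁ hKk hm hlev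
  have h1 := neck_level_le ha hk hlev
  have h2 := neck_axial_ge hA ha ha₁ hk hm hlev he
  have h4 : 9 * x ^ 2 ≤ A * x ^ 2 := mul_le_mul_of_nonneg_right hA (sq_nonneg x)
  -- The worst value of al² - al·y is -y²/4. With g' ≤ 3G the loss is exactly the 3/4 y² provided by
  -- `neck_axial_ge`.
  have h5 : -(G * (3 / 4 * y ^ 2)) ≤ g' * (al ^ 2 - al * y) := by
    have : -(y ^ 2 / 4) ≤ al ^ 2 - al * y := by nlinarith [sq_nonneg (al - y / 2)]
    nlinarith [sq_nonneg y]
  have h6 := mul_le_mul_of_nonneg_left h2 (zero_le_one.trans hG)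
  have h7 : 1 / 100 * (A * x ^ 2) + 3 / 200 * (y ^ 2 + z ^ 2) ≤
      G * (2 / 100 * (A * x ^ 2) + 3 / 4 * z ^ 2) := by
    have hy : 3 / 200 * y ^ 2 ≤ 1 / 100 * (A * x ^ 2) := by
      nlinarith [sq_nonneg al, sq_nonneg ga, sq_nonneg be, sq_nonneg z]
    have : 0 ≤ 2 / 100 * (A * x ^ 2) + 3 / 4 * z ^ 2 := by nlinarith [sq_nonneg x, sq_nonneg z]
    nlinarith [sq_nonneg z]
  nlinarith

/-- For the pure radial field the terms without G have no sign, but by the energy equation they are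
at least a fixed negative multiple of Ax²; G ≥ 90 absorbs this into two percent of the axial term.
-/
theorem neck_outer_ge (hA : 9 ≤ A) (ha : |2 * a - A| ≤ A / 100) (ha₁ : |a₁ - A| ≤ A / 100)
    (hk : 29 / 10 ≤ 2 * k - 1) (hKk : |K - 2 * k| ≤ 1 / 50) (hm : |m| ≤ 1 / 100)
    (hlev : (al ^ 2 + be ^ 2 + ga ^ 2) / 2 = e + a * x ^ 2 - k * (y ^ 2 + z ^ 2) + y ^ 2 / 2)
    (he : e ≤ 1 / 100 * x ^ 2) (hG : 90 ≤ G) :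
    G * (59 / 100 * (A * x ^ 2)) ≤
      (-a₁ * x ^ 2 + m * (y ^ 2 + z ^ 2) + (K - 1) * y ^ 2 + K * z ^ 2) + al * y - be * x +
      G * (a₁ * x ^ 2 - m * (y ^ 2 + z ^ 2) + x * be) := by
  have hw := add_nonneg (sq_nonneg y) (sq_nonneg z)
  have h1 := neck_level_le ha hk hlev
  have h2 := neck_axial_ge hA ha ha₁ hk hm hlev he
  have h4 : 9 * x ^ 2 ≤ A * x ^ 2 := mul_le_mul_of_nonneg_right hA (sq_nonneg x)
  have h6 := mul_le_mul_of_nonneg_left h2 (show 0 ≤ G by linarith)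
  have h7 := mul_le_mul_of_nonneg_right (abs_le.1 ha₁).2 (sq_nonneg x)
  have h8 := mul_le_mul_of_nonneg_right (abs_le.1 hm).1 hw
  have hK : 1 ≤ K - 1 := by linarith [(abs_le.1 hKk).1]
  have h9 : y ^ 2 + z ^ 2 ≤ (K - 1) * y ^ 2 + K * z ^ 2 := by nlinarith [sq_nonneg y, sq_nonneg z]
  have h10 : -(al ^ 2 + y ^ 2) / 2 ≤ al * y := by nlinarith [sq_nonneg (al + y)]
  have h11 : be * x ≤ (be ^ 2 + x ^ 2) / 2 := by nlinarith [sq_nonneg (be - x)]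
  have h12 : 90 * (1 / 50 * (A * x ^ 2)) ≤ G * (1 / 50 * (A * x ^ 2)) :=
    mul_le_mul_of_nonneg_right hG (by nlinarith [sq_nonneg x])
  have h13 : 0 ≤ G * (y ^ 2 + z ^ 2) := mul_nonneg (by linarith) hw
  nlinarith [sq_nonneg ga, sq_nonneg x]

/-- With e negligible, the energy equation bounds all velocities and transversal displacements by
multiples of √A|x|. The product to be estimated is therefore cubic in x and becomes quadratic after
division by the cutoff length. -/
theorem neck_cutoff_le (hA : 9 ≤ A) (ha : |2 * a - A| ≤ A / 100) (hk : 29 / 10 ≤ 2 * k - 1)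
    (hlev : (al ^ 2 + be ^ 2 + ga ^ 2) / 2 = e + a * x ^ 2 - k * (y ^ 2 + z ^ 2) + y ^ 2 / 2)
    (he : e ≤ 1 / 100 * x ^ 2) :
    |(x * al + y * be + z * ga) * al| ≤ 7 / 10 * A ^ 2 * |x| ^ 3 := by
  have hw := add_nonneg (sq_nonneg y) (sq_nonneg z)
  have h1 := neck_level_le ha hk hlev
  have h4 : 9 * x ^ 2 ≤ A * x ^ 2 := mul_le_mul_of_nonneg_right hA (sq_nonneg x)
  have h5 : al ^ 2 + be ^ 2 + ga ^ 2 + 29 / 10 * (y ^ 2 + z ^ 2) ≤ 102 / 100 * (A * x ^ 2) := by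
    nlinarith [sq_nonneg x]
  have hal : al ^ 2 ≤ 102 / 100 * (A * x ^ 2) := by
    nlinarith [sq_nonneg be, sq_nonneg ga]
  have hal' : |al| ≤ 102 / 100 * A * |x| := by
    refine abs_le_of_sq_le_sq ?_ (by positivity)
    rw [mul_pow, sq_abs]
    nlinarith [mul_nonneg (show 0 ≤ A * x ^ 2 by nlinarith [sq_nonneg x]) (show 0 ≤ A - 1 by linarith)]
  have h6 : |y * be + z * ga| ≤ 51 / 100 * (A * x ^ 2) := by
    rw [abs_le]
    constructor <;> nlinarith [sq_nonneg (y + be), sq_nonneg (y - be), sq_nonneg (z + ga),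
      sq_nonneg (z - ga), sq_nonneg al]
  have e1 : (x * al + y * be + z * ga) * al = x * al ^ 2 + (y * be + z * ga) * al := by ring
  rw [e1]
  refine (abs_add_le _ _).trans ?_
  rw [abs_mul, abs_mul, abs_of_nonneg (sq_nonneg al)]
  have h7 : |x| * al ^ 2 ≤ |x| * (102 / 100 * (A * |x| ^ 2)) := by
    rw [sq_abs]; exact mul_le_mul_of_nonneg_left hal (abs_nonneg x)
  have h8 : |y * be + z * ga| * |al| ≤ 51 / 100 * (A * |x| ^ 2) * (102 / 100 * A * |x|) := by
    rw [sq_abs]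
    exact mul_le_mul h6 hal' (abs_nonneg _) (by nlinarith [sq_nonneg x])
  have h9 : 0 ≤ A * |x| ^ 3 := by positivity
  nlinarith

end Estimates

/-- The Hamiltonian modification of the radial field at the Lagrange point `l` that is a translate
of the radial field where `χ = 0` and `g` is constant, and that expands all the unstable directions
where `χ = 1`. -/
def neckField (l : ℝ) (χ g : ℝ → ℝ) (z : E3 × E3) : E3 × E3 :=
  (!₂[(1 - χ (z.1 0 - l) / 2) * (z.1 0 - l) - g (z.1 0 - l), (1 - χ (z.1 0 - l) / 2) * z.1 1,
      (1 - χ (z.1 0 - l) / 2) * z.1 2],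
    !₂[χ (z.1 0 - l) * z.2 0 / 2 + deriv g (z.1 0 - l) * z.2 0 + deriv χ (z.1 0 - l) *
        ((z.1 0 - l) * z.2 0 + z.1 1 * (z.2 1 - l) + z.1 2 * z.2 2) / 2,
      χ (z.1 0 - l) * (z.2 1 - l) / 2, χ (z.1 0 - l) * z.2 2 / 2])

section NeckField

variable {l : ℝ} {χ g : ℝ → ℝ}

theorem contDiff_euclidean_three {f₀ f₁ f₂ : E3 × E3 → ℝ} (h0 : ContDiff ℝ ∞ f₀)
    (h1 : ContDiff ℝ ∞ f₁) (h2 : ContDiff ℝ ∞ f₂) :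
    ContDiff ℝ ∞ fun z => (!₂[f₀ z, f₁ z, f₂ z] : E3) := by
  rw [contDiff_piLp]
  intro i
  fin_cases i
  exacts [h0, h1, h2]

theorem contDiff_neckField (hχ : ContDiff ℝ ∞ χ) (hg : ContDiff ℝ ∞ g) :
    ContDiff ℝ ∞ (neckField l χ g) := by
  have hq : ∀ i : Fin 3, ContDiff ℝ ∞ (fun z : E3 × E3 => z.1 i) := fun i =>
    (EuclideanSpace.proj i : E3 →L[ℝ] ℝ).contDiff.comp contDiff_fst
  have hp : ∀ i : Fin 3, ContDiff ℝ ∞ (fun z : E3 × E3 => z.2 i) := fun i =>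
    (EuclideanSpace.proj i : E3 →L[ℝ] ℝ).contDiff.comp contDiff_snd
  have hx : ContDiff ℝ ∞ fun z : E3 × E3 => z.1 0 - l := (hq 0).sub contDiff_const
  have hχ' : ContDiff ℝ ∞ (deriv χ) := (contDiff_infty_iff_deriv.1 hχ).2
  have hg' : ContDiff ℝ ∞ (deriv g) := (contDiff_infty_iff_deriv.1 hg).2
  have c1 := hχ.comp hx
  have c2 := hχ'.comp hx
  have c3 := hg.comp hx
  have c4 := hg'.comp hx
  have c5 : ContDiff ℝ ∞ fun z : E3 × E3 => 1 - χ (z.1 0 - l) / 2 :=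
    contDiff_const.sub (c1.div_const 2)
  unfold neckField
  refine (contDiff_euclidean_three ((c5.mul hx).sub c3) (c5.mul (hq 1)) (c5.mul (hq 2))).prodMk
    (contDiff_euclidean_three ((((c1.mul (hp 0)).div_const 2).add (c4.mul (hp 0))).add
      ((c2.mul (((hx.mul (hp 0)).add ((hq 1).mul ((hp 1).sub contDiff_const))).add
        ((hq 2).mul (hp 2)))).div_const 2)) ((c1.mul ((hp 1).sub contDiff_const)).div_const 2)
      ((c1.mul (hp 2)).div_const 2))

theorem fderiv_coord_eq {Y : E3 × E3 → E3 × E3} {z a : E3 × E3} (hY : DifferentiableAt ℝ Y z)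
    (P : E3 × E3 →L[ℝ] ℝ) {d : ℝ} (h : HasDerivAt (fun t : ℝ => P (Y (z + t • a))) d 0) :
    P (fderiv ℝ Y z a) = d := by
  have h1 : HasDerivAt (fun t : ℝ => z + t • a) a 0 := by
    simpa using ((hasDerivAt_id (0 : ℝ)).smul_const a).const_add z
  have h2 : HasFDerivAt Y (fderiv ℝ Y z) (z + (0 : ℝ) • a) := by simpa using hY.hasFDerivAt
  exact (P.hasFDerivAt.comp_hasDerivAt (0 : ℝ) (h2.comp_hasDerivAt (0 : ℝ) h1)).unique h

/-- The field is the radial field centred at (l, 0, 0) plus the Hamiltonian field of -(g p₀ + χ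
S/2), with S = x p₀ + q₁(p₁ - l) + q₂p₂ and χ, g evaluated at x = q₀ - l. A Hamiltonian field leaves
the Liouville condition intact; here this is verified by explicit differentiation. -/
theorem liouvilleAt_neckField (hχ : ContDiff ℝ ∞ χ) (hg : ContDiff ℝ ∞ g) (z : E3 × E3) :
    LiouvilleAt (neckField l χ g) z := by
  have hY : DifferentiableAt ℝ (neckField l χ g) z :=
    (contDiff_neckField hχ hg).contDiffAt.differentiableAt (by simp)
  have hχ' : ContDiff ℝ ∞ (deriv χ) := (contDiff_infty_iff_deriv.1 hχ).2
  have hg' : ContDiff ℝ ∞ (deriv g) := (contDiff_infty_iff_deriv.1 hg).2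
  obtain ⟨q, p⟩ := z
  set X := q 0 - l with hX
  obtain ⟨χ0, hχ0⟩ : ∃ r, r = χ X := ⟨_, rfl⟩
  obtain ⟨χ1, hχ1⟩ : ∃ r, r = deriv χ X := ⟨_, rfl⟩
  obtain ⟨χ2, hχ2⟩ : ∃ r, r = deriv (deriv χ) X := ⟨_, rfl⟩
  obtain ⟨g1, hg1⟩ : ∃ r, r = deriv g X := ⟨_, rfl⟩
  obtain ⟨g2, hg2⟩ : ∃ r, r = deriv (deriv g) X := ⟨_, rfl⟩
  have key : ∀ a : E3 × E3, ∀ D, D = fderiv ℝ (neckField l χ g) (q, p) a →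
      D.1 0 = (1 - χ0 / 2) * a.1 0 - χ1 * a.1 0 / 2 * X - g1 * a.1 0 ∧
      D.1 1 = (1 - χ0 / 2) * a.1 1 - χ1 * a.1 0 / 2 * q 1 ∧
      D.1 2 = (1 - χ0 / 2) * a.1 2 - χ1 * a.1 0 / 2 * q 2 ∧
      D.2 0 = (χ0 * a.2 0 + χ1 * a.1 0 * p 0) / 2 + (g1 * a.2 0 + g2 * a.1 0 * p 0) +
        (χ2 * a.1 0 * (X * p 0 + q 1 * (p 1 - l) + q 2 * p 2) +
          χ1 * (a.1 0 * p 0 + X * a.2 0 + a.1 1 * (p 1 - l) + q 1 * a.2 1 + a.1 2 * p 2 +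
            q 2 * a.2 2)) / 2 ∧
      D.2 1 = (χ0 * a.2 1 + χ1 * a.1 0 * (p 1 - l)) / 2 ∧
      D.2 2 = (χ0 * a.2 2 + χ1 * a.1 0 * p 2) / 2 := by
    rintro ⟨u, v⟩ D rfl
    have hl : ∀ r s : ℝ, HasDerivAt (fun t : ℝ => r + t * s) s 0 := fun r s => by
      simpa using ((hasDerivAt_id (0 : ℝ)).mul_const s).const_add r
    have hx : HasDerivAt (fun t : ℝ => q 0 + t * u 0 - l) (u 0) 0 := (hl _ _).sub_const l
    have hp1 : HasDerivAt (fun t : ℝ => p 1 + t * v 1 - l) (v 1) 0 := (hl _ _).sub_const l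
    have comp : ∀ f : ℝ → ℝ, ContDiff ℝ ∞ f →
        HasDerivAt (fun t : ℝ => f (q 0 + t * u 0 - l)) (deriv f X * u 0) 0 := by
      intro f hf
      have h1 : HasDerivAt f (deriv f X) (q 0 + 0 * u 0 - l) := by
        rw [zero_mul, add_zero]
        exact (hf.differentiable (by simp) X).hasDerivAt
      exact h1.comp (0 : ℝ) hx
    have c0 := comp χ hχ
    have c1 := comp _ hχ'
    have d0 := comp g hg
    have d1 := comp _ hg'
    have cc : HasDerivAt (fun t : ℝ => 1 - χ (q 0 + t * u 0 - l) / 2) (-(deriv χ X * u 0 / 2)) 0 :=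
      (c0.div_const 2).const_sub 1
    set π₁ : Fin 3 → E3 × E3 →L[ℝ] ℝ := fun i =>
      (EuclideanSpace.proj i : E3 →L[ℝ] ℝ).comp (ContinuousLinearMap.fst ℝ E3 E3)
    set π₂ : Fin 3 → E3 × E3 →L[ℝ] ℝ := fun i =>
      (EuclideanSpace.proj i : E3 →L[ℝ] ℝ).comp (ContinuousLinearMap.snd ℝ E3 E3)
    refine ⟨fderiv_coord_eq hY (π₁ 0) (((cc.mul hx).sub d0).congr_deriv ?_),
      fderiv_coord_eq hY (π₁ 1) ((cc.mul (hl (q 1) (u 1))).congr_deriv ?_),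
      fderiv_coord_eq hY (π₁ 2) ((cc.mul (hl (q 2) (u 2))).congr_deriv ?_),
      fderiv_coord_eq hY (π₂ 0) ((((c0.mul (hl (p 0) (v 0))).div_const 2).add
        (d1.mul (hl (p 0) (v 0)))).add ((c1.mul (((hx.mul (hl (p 0) (v 0))).add
        ((hl (q 1) (u 1)).mul hp1)).add ((hl (q 2) (u 2)).mul (hl (p 2) (v 2))))).div_const 2)
        |>.congr_deriv ?_),
      fderiv_coord_eq hY (π₂ 1) (((c0.mul hp1).div_const 2).congr_deriv ?_),
      fderiv_coord_eq hY (π₂ 2) (((c0.mul (hl (p 2) (v 2))).div_const 2).congr_deriv ?_)⟩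
    all_goals
      simp only [zero_mul, add_zero, Pi.add_apply, Pi.mul_apply, ← hX, ← hχ0, ← hχ1, ← hχ2, ← hg1, ← hg2]
      ring
  intro a b
  obtain ⟨a0, a1, a2, a3, a4, a5⟩ := key a _ rfl
  obtain ⟨b0, b1, b2, b3, b4, b5⟩ := key b _ rfl
  simp only [canonicalForm, inner_three, a0, a1, a2, a3, a4, a5, b0, b1, b2, b3, b4, b5]
  ring

end NeckField


/-! ### The hypersurface around both primaries is of contact type -/

theorem eventually_mul_le (a : ℝ) {K : ℝ} (hK : 0 < K) : ∀ᶠ δ : ℝ in 𝓝[>] 0, a * δ ≤ K := by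
  have : ContinuousAt (fun δ : ℝ => a * δ) 0 := by fun_prop
  exact nhdsWithin_le_nhds ((this.eventually_lt_const (by simpa using hK)).mono fun _ h => h.le)

section Transverse

variable {μ l : ℝ} {χ g : ℝ → ℝ}

/-- The derivative is a convex combination, with weight χ, of the Euler-type and the radial
expression, plus the error from χ'. Writing g(x) = Gx makes the contribution of the profile
proportional to the coercive axial expression D. -/
theorem hamDeriv_neckField (h : IsLagrangePos μ l) {z : E3 × E3}
    (hX : ∀ b, 0 < radius μ (z.1 0) b) {x w al be ga S G m T B D g' : ℝ} (hx : x = z.1 0 - l)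
    (hw : w = z.1 1 ^ 2 + z.1 2 ^ 2) (hal : al = z.2 0 + z.1 1) (hbe : be = z.2 1 - z.1 0)
    (hga : ga = z.2 2) (hS : S = x * al + z.1 1 * be + z.1 2 * ga) (hG : g x = G * x)
    (hm : m = axialMix μ z.1 * x) (hT : T = al ^ 2 + be ^ 2 + ga ^ 2)
    (hB : B = -axialLin μ l (z.1 0) * x ^ 2 + m * w + (transCurv μ z.1 - 1) * z.1 1 ^ 2 +
      transCurv μ z.1 * z.1 2 ^ 2) (hD : D = axialLin μ l (z.1 0) * x ^ 2 - m * w + x * be)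
    (hg' : g' = deriv g x) :
    hamDeriv μ z (neckField l χ g z) =
      χ x * (T / 2 + B / 2 + G * D + g' * (al ^ 2 - al * z.1 1)) +
        (1 - χ x) * (B + al * z.1 1 - be * x + G * D + g' * (al ^ 2 - al * z.1 1)) +
        deriv χ x * (S * al) / 2 := by
  rw [hamDeriv, potentialDeriv_expansion h hX, axisSq]
  simp only [neckField, ← hx, Matrix.cons_val, hG, ← hg']
  have e0 : z.2 0 = al - z.1 1 := by rw [hal]; ring
  have e1 : z.2 1 = be + x + l := by rw [hbe, hx]; ring
  have e2 : z.1 0 = x + l := by rw [hx]; ring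
  rw [hS, hT, hB, hD, hm, hw, ← hga, e0, e1, e2]
  ring

theorem neckField_of_far {δ dE dM δ₁ : ℝ} (hg : IsNeckProfile dE dM δ δ₁ g)
    (hδ : 0 < δ) {z : E3 × E3} (hx : 2 * δ < |z.1 0 - l|) (b : Primary)
    (hd : dE = radius μ l .earth) (hd' : dM = radius μ l .moon) (hb : 0 < side b l z.1) :
    neckField l (fun x => cutoff (x / δ)) g z = (z.1 - pos μ b, 0) := by
  have h1 : ∀ x : ℝ, 2 * δ < |x| → cutoff (x / δ) = 0 := fun x hx => cutoff_of_ge (by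
    rw [abs_div, abs_of_pos hδ, le_div_iff₀ hδ]; exact hx.le)
  have h2 : deriv (fun x => cutoff (x / δ)) (z.1 0 - l) = 0 := by
    have : (fun x => cutoff (x / δ)) =ᶠ[𝓝 (z.1 0 - l)] fun _ => 0 := by
      filter_upwards [continuous_abs.continuousAt.eventually_const_lt hx] with s hs
      exact h1 s hs
    rw [this.deriv_eq]; simp
  have h3 : g (z.1 0 - l) = -(sgn b * radius μ l b) ∧ deriv g (z.1 0 - l) = 0 := by
    cases b
    · have : side .earth l z.1 = z.1 0 - l := by simp [side, sgn]
      rw [this] at hb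
      rw [abs_of_pos hb] at hx
      simpa [sgn, hd] using hg.right _ (by linarith)
    · have : side .moon l z.1 = -(z.1 0 - l) := by simp [side, sgn]
      rw [this] at hb
      rw [abs_of_neg (by linarith)] at hx
      simpa [sgn, hd'] using hg.left _ (by linarith)
  have h4 : pos μ b 0 = l - sgn b * radius μ l b := by
    rw [radius_eq]; linear_combination (l - pos μ b 0) * sgn_mul_self b
  refine Prod.ext ?_ ?_
  · ext i
    fin_cases i
    · simp [neckField, h1 _ hx, h3, h4]; ring
    · simp [neckField, h1 _ hx, pos_one]
    · simp [neckField, h1 _ hx, pos_two]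
  · ext i
    fin_cases i <;> simp [neckField, h1 _ hx, h2, h3]

theorem IsNeckProfile.exists_slope {dE dM δ δ₁ : ℝ} (hg : IsNeckProfile dE dM δ δ₁ g) {x : ℝ}
    (hx : |x| ≤ δ) : ∃ G, g x = G * x ∧ 1 ≤ G ∧ (x ≠ 0 → deriv g x ≤ 3 * G) ∧
      (|x| ≤ δ₁ → G ≤ 11 / 10 ∧ deriv g x ≤ 13 / 10) := by
  by_cases h0 : x = 0
  · subst h0
    -- At x = 0 the quotient g/x is undefined; since g(0) = 0, any G works and 1 satisfies the
    -- bounds.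
    refine ⟨1, ?_, le_rfl, fun h => absurd rfl h, fun h => ⟨by norm_num, (hg.small 0 h).2⟩⟩
    have := (hg.small 0 (by simpa using hg.small_pos.le)).1
    rw [abs_zero, mul_zero] at this
    rw [abs_nonpos_iff.1 this, mul_zero]
  · have hx0 : 0 < |x| := abs_pos.2 h0
    have hG : g x = g x / x * x := by field_simp
    have hG0 : 0 ≤ g x / x := by
      rw [show g x / x = x * g x / x ^ 2 by field_simp]
      exact div_nonneg (hg.mul_nonneg x) (sq_nonneg x)
    have hGa : g x / x = |g x| / |x| := by rw [← abs_div, abs_of_nonneg hG0]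
    refine ⟨g x / x, hG, ?_, fun _ => ?_, fun h => ⟨?_, (hg.small x h).2⟩⟩
    · rw [hGa, le_div_iff₀ hx0, one_mul]
      exact hg.abs_le x hx
    · have := hg.deriv_le x
      have hx2 : 0 < x ^ 2 := by positivity
      refine le_of_mul_le_mul_left (this.trans (le_of_eq ?_)) hx2
      field_simp
    · rw [hGa, div_le_iff₀ hx0]
      exact (hg.small x h).1

theorem IsNeckProfile.exists_slope_far {dE dM δ δ₁ d : ℝ} (hg : IsNeckProfile dE dM δ δ₁ g)
    (hδ : 0 < δ) (hE : d ≤ dE) (hM : d ≤ dM) {x : ℝ} (hx : δ ≤ |x|) :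
    ∃ G, g x = G * x ∧ d ≤ G * |x| ∧ deriv g x = 0 := by
  rcases le_total 0 x with h | h
  · rw [abs_of_nonneg h] at hx ⊢
    have hx0 : x ≠ 0 := by linarith [hδ]
    obtain ⟨h1, h2⟩ := hg.right x hx
    refine ⟨dE / x, ?_, ?_, h2⟩
    · rw [h1]; field_simp
    · rwa [div_mul_cancel₀ _ hx0]
  · rw [abs_of_nonpos h] at hx ⊢
    have hx0 : x ≠ 0 := by linarith [hδ]
    obtain ⟨h1, h2⟩ := hg.left x (by linarith)
    refine ⟨-dM / x, ?_, ?_, h2⟩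
    · rw [h1]; field_simp
    · rwa [show -dM / x * -x = dM by field_simp]

set_option maxHeartbeats 1000000 in
/-- Slightly above the critical energy, the regularized hypersurface around both primaries is of
contact type. -/
theorem exists_isContactType_neck (h : IsLagrangePos μ l) : ∃ ε > 0, ∀ c, critEnergy μ l < c →
    c < critEnergy μ l + ε →
      IsContactType (regularizedHypersurface μ c {pos μ .earth, pos μ .moon}) := by
  obtain ⟨R, C, hN⟩ := exists_isNeckRadius h
  obtain ⟨C₀, hC₀, hcut⟩ := exists_deriv_cutoff_le
  have hA := nine_le_axialCurv h
  set A := axialCurv μ l with hAdef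
  set d := min (radius μ l .earth) (radius μ l .moon) with hd
  have hd0 : 0 < d := lt_min (h.radius_mem .earth).1 (h.radius_mem .moon).1
  have hdb : ∀ b, d ≤ radius μ l b := by
    rintro (_ | _)
    exacts [min_le_left _ _, min_le_right _ _]
  have hR0 := hN.size_pos
  have hC0 := hN.const_pos
  -- The first two conditions keep the zone |x| ≤ 2δ inside the ball of radius R. The third makes
  -- the mixed coefficient at most 1/100, the fourth gives G ≥ 90 in the transition zone, and the
  -- last makes G outweigh the derivative of the cutoff.
  obtain ⟨δ, ⟨⟨⟨⟨c1, c2⟩, c3⟩, c4⟩, c5⟩, hδ⟩ : ∃ δ : ℝ, ((((2 * δ ≤ R ∧ 4 * δ ≤ R ^ 2) ∧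
      200 * C * δ ≤ 1) ∧ 20 * A * δ ≤ d) ∧ 4 * C₀ * A * δ ≤ d) ∧ 0 < δ :=
    ((((((eventually_mul_le _ hR0).and (eventually_mul_le _ (pow_pos hR0 2))).and
      (eventually_mul_le _ one_pos)).and (eventually_mul_le _ hd0)).and
      (eventually_mul_le _ hd0)).and self_mem_nhdsWithin).exists
  have hδd : 180 * δ ≤ d := by nlinarith
  obtain ⟨g, δ₁, hg⟩ := exists_isNeckProfile (δ := δ) (h.radius_mem .earth) (h.radius_mem .moon) hδ
    (by linarith [hdb .earth]) (by linarith [hdb .moon])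
  set χ : ℝ → ℝ := fun x => cutoff (x / δ) with hχ
  have hχs : ContDiff ℝ ∞ χ := contDiff_cutoff.comp (contDiff_id.div_const δ)
  have hχd : ∀ x, |deriv χ x| ≤ C₀ / δ := by
    intro x
    have h1 : HasDerivAt χ (deriv cutoff (x / δ) * (1 / δ)) x :=
      HasDerivAt.comp (h₂ := cutoff) (h := fun x => x / δ) x
        (contDiff_cutoff.differentiable (by simp) (x / δ)).hasDerivAt
        ((hasDerivAt_id x).div_const δ)
    rw [h1.deriv, abs_mul, abs_of_pos (one_div_pos.2 hδ), div_eq_mul_one_div C₀]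
    exact mul_le_mul_of_nonneg_right (hcut _) (by positivity)
  obtain ⟨ε₁, hε₁, hS⟩ := exists_regularizedHypersurface_eq hN h hδ (by linarith)
  obtain ⟨ε₂, hε₂, hgap⟩ := exists_radial_gap h (η := 2 * δ) (by positivity)
  have hδ₁ := hg.small_pos
  -- The last term makes the excess energy at most x²/100 once |x| ≥ min δ δ₁, the hypothesis of the
  -- estimates away from the centre.
  refine ⟨min (min ε₁ ε₂) (1 / 100 * min δ δ₁ ^ 2), by positivity, fun c hc hc' => ?_⟩
  have hm1 := min_le_left (min ε₁ ε₂) (1 / 100 * min δ δ₁ ^ 2)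
  have hm2 := min_le_right (min ε₁ ε₂) (1 / 100 * min δ δ₁ ^ 2)
  have hm3 := min_le_left ε₁ ε₂
  have hm4 := min_le_right ε₁ ε₂
  rw [hS c hc (by linarith)]
  have hfar : ∀ z : E3 × E3, ∀ b, 2 * δ < |z.1 0 - l| → 0 < side b l z.1 →
      neckField l χ g z = (z.1 - pos μ b, 0) := fun z b hz hb =>
    neckField_of_far hg hδ hz b rfl rfl hb
  refine surf_isContactType (Y := neckField l χ g) h.mem (isOpen_neckDomain μ l δ)
    (contDiff_neckField hχs hg.smooth).contDiffOn
    (fun z _ => liouvilleAt_neckField hχs hg.smooth z) (fun b _ => ?_) fun z hz hzΩ hH => ?_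
  · have h1 : 2 * δ < side b l (pos μ b) := by
      have := radius_side μ l b (pos μ b)
      rw [radius_eq, sub_self, mul_zero] at this
      linarith [hdb b]
    filter_upwards [(continuous_side b l).continuousAt.eventually_const_lt h1] with q hq p
    refine hfar (q, p) b ?_ (by change 0 < side b l q; linarith)
    change 2 * δ < |q 0 - l|
    rw [← abs_side b]
    exact hq.trans_le (le_abs_self _)
  · refine ne_of_gt ?_
    -- Beyond 2δ the field is exactly the radial field of the nearer primary.
    rcases lt_or_ge (2 * δ) |z.1 0 - l| with hx | hx
    · obtain ⟨b, hb⟩ : ∃ b, 2 * δ < side b l z.1 := by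
        rw [← abs_side .earth] at hx
        rcases lt_abs.1 hx with h1 | h1
        · exact ⟨_, h1⟩
        · rw [← side_other] at h1
          exact ⟨_, h1⟩
      rw [hfar z b hx (by linarith)]
      refine hgap b z hz (mem_ball_of_side h hzΩ (by linarith) (by linarith)) ?_ (by linarith)
      exact hb.le.trans ((le_abs_self _).trans (abs_side_le b l z.1))
    have hzR : ‖z.1 - axisPoint l‖ < R :=
      norm_lt_of_mem_neckDomain h hzΩ hR0 (by linarith) (by linarith)
    have hX := hN.radius_pos' h hzR
    set e := c - critEnergy μ l with he
    have he0 : 0 < e := by linarith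
    obtain ⟨x, hxdef⟩ : ∃ x, x = z.1 0 - l := ⟨_, rfl⟩
    obtain ⟨al, hal⟩ : ∃ x, x = z.2 0 + z.1 1 := ⟨_, rfl⟩
    obtain ⟨be, hbe⟩ : ∃ x, x = z.2 1 - z.1 0 := ⟨_, rfl⟩
    obtain ⟨ga, hga⟩ : ∃ x, x = z.2 2 := ⟨_, rfl⟩
    obtain ⟨m, hmdef⟩ : ∃ x', x' = axialMix μ z.1 * x := ⟨_, rfl⟩
    have hlev : (al ^ 2 + be ^ 2 + ga ^ 2) / 2 = e + axialQuad μ l (z.1 0) * x ^ 2 -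
        transPot μ z.1 * (z.1 1 ^ 2 + z.1 2 ^ 2) + z.1 1 ^ 2 / 2 := by
      rw [hamiltonian_eq, potential_expansion hX, critEnergy_expansion h hX, ← hal, ← hbe, ← hga,
        ← hxdef, axisSq] at hH
      rw [he]; linarith
    rw [← hxdef] at hx
    have hm : |m| ≤ 1 / 100 := by
      rw [hmdef, abs_mul]
      calc |axialMix μ z.1| * |x| ≤ C * (2 * δ) :=
            mul_le_mul (hN.mix _ hzR) hx (abs_nonneg _) hC0.le
        _ ≤ 1 / 100 := by linarith
    have ha := hN.quad _ hzR
    have ha₁ := hN.lin _ hzR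
    have hk := hN.trans _ hzR
    have hKk := hN.curv_sub _ hzR
    have hsmall : ∀ r, min δ δ₁ ≤ r → r ≤ |x| → e ≤ 1 / 100 * x ^ 2 := by
      intro r hr hr'
      have : min δ δ₁ ^ 2 ≤ |x| ^ 2 := pow_le_pow_left₀ (by positivity) (hr.trans hr') 2
      rw [sq_abs] at this
      linarith
    -- For |x| < δ the cutoff is 1 and only the profile varies; between δ and 2δ the profile is
    -- constant and only the cutoff varies. The two transitions never interact.
    rcases lt_or_ge |x| δ with hxδ | hxδ
    · obtain ⟨G, hG, hG1, hG2, hG3⟩ := hg.exists_slope hxδ.le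
      rw [hamDeriv_neckField h hX hxdef rfl hal hbe hga rfl hG hmdef rfl rfl rfl rfl]
      have hχ1 : ∀ y : ℝ, |y| ≤ δ → χ y = 1 := fun y hy => cutoff_of_le (by
        rwa [abs_div, abs_of_pos hδ, div_le_one hδ])
      have hχ2 : deriv χ x = 0 := by
        have : χ =ᶠ[𝓝 x] fun _ => 1 := by
          filter_upwards [continuous_abs.continuousAt.eventually_lt_const hxδ] with s hs
          exact hχ1 s hs.le
        rw [this.deriv_eq]; simp
      rw [hχ1 x hxδ.le, hχ2, sub_self, zero_mul, zero_mul, zero_div, add_zero, add_zero, one_mul]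
      rcases le_or_gt |x| δ₁ with hx1 | hx1
      · obtain ⟨h1, h2⟩ := hG3 hx1
        exact neck_center_pos hA ha ha₁ hk hKk hm hlev he0 ⟨hG1, h1⟩ ⟨hg.deriv_nonneg x, h2⟩
      · have hx0 : x ≠ 0 := abs_pos.1 (hδ₁.trans hx1)
        refine lt_of_lt_of_le ?_ (neck_inner_ge hA ha ha₁ hk hKk hm hlev he0.le
          (hsmall δ₁ (min_le_right _ _) hx1.le) hG1 (hg.deriv_nonneg x) (hG2 hx0))
        positivity
    · obtain ⟨G, hG, hG1, hG2⟩ := hg.exists_slope_far hδ (hdb .earth) (hdb .moon) hxδ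
      have hx0 : 0 < |x| := hδ.trans_le hxδ
      have hes := hsmall δ (min_le_left _ _) hxδ
      rw [hamDeriv_neckField h hX hxdef rfl hal hbe hga rfl hG hmdef rfl rfl rfl rfl, hG2]
      have hG90 : 90 ≤ G := by
        by_contra hcon
        rw [not_le] at hcon
        nlinarith
      have hGC : 2 * C₀ * A ≤ G := by
        by_contra hcon
        rw [not_le] at hcon
        have : G * |x| < 2 * C₀ * A * |x| := mul_lt_mul_of_pos_right hcon hx0
        have h2 : 2 * C₀ * A * |x| ≤ 2 * C₀ * A * (2 * δ) :=
          mul_le_mul_of_nonneg_left hx (by positivity)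
        linarith
      have hQ := neck_inner_ge (g' := 0) hA ha ha₁ hk hKk hm hlev he0.le hes (by linarith : 1 ≤ G)
        le_rfl (by linarith)
      have hP := neck_outer_ge hA ha ha₁ hk hKk hm hlev hes hG90
      have hF := neck_cutoff_le hA ha hk hlev hes
      have hχ0 : 0 ≤ χ x := Real.smoothTransition.nonneg _
      have hχ1 : χ x ≤ 1 := Real.smoothTransition.le_one _
      have hF' : |deriv χ x * ((x * al + z.1 1 * be + z.1 2 * ga) * al)| ≤
          G * (7 / 10 * (A * x ^ 2)) := by
        rw [abs_mul]
        calc _ ≤ C₀ / δ * (7 / 10 * A ^ 2 * |x| ^ 3) :=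
              mul_le_mul (hχd x) hF (abs_nonneg _) (by positivity)
          _ = C₀ * (7 / 10 * A ^ 2 * x ^ 2) * (|x| / δ) := by
              rw [← sq_abs x]; field_simp
          _ ≤ C₀ * (7 / 10 * A ^ 2 * x ^ 2) * 2 := by
              gcongr
              rwa [div_le_iff₀ hδ]
          _ = 2 * C₀ * A * (7 / 10 * (A * x ^ 2)) := by ring
          _ ≤ G * (7 / 10 * (A * x ^ 2)) := by gcongr
      have hF2 := (abs_le.1 hF').1
      have hx2 : 0 < x ^ 2 := by rw [← sq_abs]; positivity
      have hpos : 0 < G * (A * x ^ 2) := by positivity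
      have e1 := mul_le_mul_of_nonneg_left hQ hχ0
      have e2 := mul_le_mul_of_nonneg_left hP (sub_nonneg.2 hχ1)
      rw [zero_mul, add_zero] at e1 ⊢
      rw [add_zero]
      linarith

end Transverse


/-! ### Coordinates on the neck -/

/-- Five-dimensional Euclidean space. -/
abbrev E5 := EuclideanSpace ℝ (Fin 5)

theorem norm_sq_five (x : E5) :
    ‖x‖ ^ 2 = x 0 ^ 2 + x 1 ^ 2 + x 2 ^ 2 + x 3 ^ 2 + x 4 ^ 2 := by
  simp [EuclideanSpace.real_norm_sq_eq, Fin.sum_univ_five]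

/-- Rescaling of the transversal directions that makes the potential quadratic in them. -/
def neckScale (μ : ℝ) (q : E3) : E3 :=
  !₂[q 0, q 1 * √(2 * transPot μ q - 1), q 2 * √(2 * transPot μ q)]

/-- The transversal coordinates around the neck. -/
def neckTrans (μ : ℝ) (z : E3 × E3) : E5 :=
  !₂[z.2 0 + z.1 1, z.2 1 - z.1 0, z.2 2, neckScale μ z.1 1, neckScale μ z.1 2]

/-- The point with given axial and transversal coordinates, for a right inverse `f` of
`neckScale μ`. -/
def neckPoint (f : E3 → E3) (t : ℝ) (W : E5) : E3 × E3 :=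
  (f !₂[t, W 3, W 4],
    !₂[W 0 - f !₂[t, W 3, W 4] 1, W 1 + f !₂[t, W 3, W 4] 0, W 2])

section NeckCoord

variable {μ l R C : ℝ} {q : E3}

theorem contDiffAt_transPot (hX : ∀ b, 0 < radius μ (q 0) b) : ContDiffAt ℝ ∞ (transPot μ) q := by
  have hn : ∀ b, ContDiffAt ℝ ∞ (fun q : E3 => ‖q - pos μ b‖) q := fun b =>
    (contDiffAt_id.sub contDiffAt_const).norm ℝ (norm_pos_iff.1 (norm_sub_pos_pos (hX b)))
  have hr : ∀ b, ContDiffAt ℝ ∞ (fun q : E3 => radius μ (q 0) b) q := fun b => by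
    simp only [radius_eq]
    exact contDiffAt_const.mul ((contDiffAt_coord 0 q).sub contDiffAt_const)
  have h0 : ∀ b, ‖q - pos μ b‖ * radius μ (q 0) b * (‖q - pos μ b‖ + radius μ (q 0) b) ≠ 0 := by
    intro b
    have h1 := norm_sub_pos_pos (hX b)
    have h2 := hX b
    positivity
  unfold transPot
  exact (contDiffAt_const.div (((hn _).mul (hr _)).mul ((hn _).add (hr _))) (h0 _)).add
    (contDiffAt_const.div (((hn _).mul (hr _)).mul ((hn _).add (hr _))) (h0 _))

theorem contDiffAt_neckScale (hX : ∀ b, 0 < radius μ (q 0) b) (hk : 0 < 2 * transPot μ q - 1) :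
    ContDiffAt ℝ ∞ (neckScale μ) q := by
  have h1 := contDiffAt_transPot hX
  have h2 : ContDiffAt ℝ ∞ (fun q => 2 * transPot μ q) q := contDiffAt_const.mul h1
  unfold neckScale
  rw [contDiffAt_piLp]
  intro i
  fin_cases i
  · exact contDiffAt_coord 0 q
  · exact (contDiffAt_coord 1 q).mul ((h2.sub contDiffAt_const).sqrt hk.ne')
  · exact (contDiffAt_coord 2 q).mul (h2.sqrt (by linarith))

theorem contDiffAt_neckTrans {z : E3 × E3} (hX : ∀ b, 0 < radius μ (z.1 0) b)
    (hk : 0 < 2 * transPot μ z.1 - 1) : ContDiffAt ℝ ∞ (neckTrans μ) z := by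
  have hq : ∀ i : Fin 3, ContDiffAt ℝ ∞ (fun z : E3 × E3 => z.1 i) z :=
    fun i => (contDiffAt_coord i z.1).comp z contDiffAt_fst
  have hp : ∀ i : Fin 3, ContDiffAt ℝ ∞ (fun z : E3 × E3 => z.2 i) z :=
    fun i => (contDiffAt_coord i z.2).comp z contDiffAt_snd
  have hs : ∀ i : Fin 3, ContDiffAt ℝ ∞ (fun z : E3 × E3 => neckScale μ z.1 i) z := fun i =>
    (contDiffAt_coord i _).comp z ((contDiffAt_neckScale hX hk).comp z contDiffAt_fst)
  unfold neckTrans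
  rw [contDiffAt_piLp]
  intro i
  fin_cases i
  exacts [(hp 0).add (hq 1), (hp 1).sub (hq 0), hp 2, hs 1, hs 2]

theorem contDiffAt_neckPoint {f : E3 → E3} {t : ℝ} {W : E5}
    (hf : ContDiffAt ℝ ∞ f !₂[t, W 3, W 4]) :
    ContDiffAt ℝ ∞ (fun v : ℝ × E5 => neckPoint f v.1 v.2) (t, W) := by
  have hW : ∀ i : Fin 5, ContDiffAt ℝ ∞ (fun v : ℝ × E5 => v.2 i) (t, W) := fun i =>
    (EuclideanSpace.proj i : E5 →L[ℝ] ℝ).contDiff.contDiffAt.comp _ contDiffAt_snd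
  have hu : ContDiffAt ℝ ∞ (fun v : ℝ × E5 => (!₂[v.1, v.2 3, v.2 4] : E3)) (t, W) := by
    rw [contDiffAt_piLp]
    intro i
    fin_cases i
    exacts [contDiffAt_fst, hW 3, hW 4]
  have hfu : ContDiffAt ℝ ∞ (fun v : ℝ × E5 => f !₂[v.1, v.2 3, v.2 4]) (t, W) :=
    ContDiffAt.comp (t, W) (g := f) hf hu
  have hfi : ∀ i : Fin 3, ContDiffAt ℝ ∞ (fun v : ℝ × E5 => f !₂[v.1, v.2 3, v.2 4] i) (t, W) :=
    fun i => (contDiffAt_coord i _).comp _ hfu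
  unfold neckPoint
  refine hfu.prodMk ?_
  rw [contDiffAt_piLp]
  intro i
  fin_cases i
  exacts [(hW 0).sub (hfi 1), (hW 1).add (hfi 0), hW 2]

/-- The exact expansion of the potential lets the transversal variables absorb their variable
coefficients under the square root. No Morse lemma is needed, and the axial coordinate stays q₀. -/
theorem hamiltonian_neckTrans {z : E3 × E3} (hX : ∀ b, 0 < radius μ (z.1 0) b)
    (hk : 0 < 2 * transPot μ z.1 - 1) :
    hamiltonian μ z = ‖neckTrans μ z‖ ^ 2 / 2 + critEnergy μ (z.1 0) := by
  rw [hamiltonian_eq, potential_expansion hX, norm_sq_five, axisSq]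
  simp only [neckTrans, neckScale, Matrix.cons_val]
  rw [mul_pow, mul_pow, Real.sq_sqrt hk.le, Real.sq_sqrt (by linarith)]
  ring

theorem axisSq_le_neckTrans {z : E3 × E3} (hk : 29 / 10 ≤ 2 * transPot μ z.1 - 1) :
    (z.2 0 + z.1 1) ^ 2 + (z.2 1 - z.1 0) ^ 2 + 29 / 10 * axisSq z.1 ≤ ‖neckTrans μ z‖ ^ 2 := by
  rw [norm_sq_five, axisSq]
  simp only [neckTrans, neckScale, Matrix.cons_val]
  rw [mul_pow, mul_pow, Real.sq_sqrt (by linarith), Real.sq_sqrt (by linarith)]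
  nlinarith [sq_nonneg (z.1 1), sq_nonneg (z.1 2), sq_nonneg (z.2 2)]

/-- `f` inverts `neckScale μ` on balls around the Lagrange point. -/
structure IsNeckChart (μ l R C r₀ : ℝ) (f : E3 → E3) : Prop extends IsNeckRadius μ l R C where
  chart_pos : 0 < r₀
  left_inv : ∀ q : E3, ‖q - axisPoint l‖ < R → f (neckScale μ q) = q
  mem : ∀ u : E3, ‖u - axisPoint l‖ < r₀ → ‖f u - axisPoint l‖ < R
  right_inv : ∀ u : E3, ‖u - axisPoint l‖ < r₀ → neckScale μ (f u) = u
  smooth : ∀ u : E3, ‖u - axisPoint l‖ < r₀ → ContDiffAt ℝ ∞ f u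

/-- At L₁ the derivative of the rescaling is diagonal with positive entries, so the inverse function
theorem applies. -/
theorem exists_isNeckChart (h : IsLagrangePos μ l) : ∃ R C r₀ f, IsNeckChart μ l R C r₀ f := by
  obtain ⟨R₀, C, hN⟩ := exists_isNeckRadius h
  have hsm : ∀ q : E3, ‖q - axisPoint l‖ < R₀ → ContDiffAt ℝ ∞ (neckScale μ) q := fun q hq =>
    contDiffAt_neckScale (hN.radius_pos' h hq) (by linarith [hN.trans q hq])
  have hL : ‖axisPoint l - axisPoint l‖ < R₀ := by simpa using hN.size_pos
  have hkL := hN.trans _ hL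
  have h0 : neckScale μ (axisPoint l) = axisPoint l := by
    ext i; fin_cases i <;> simp [neckScale, axisPoint]
  set D := fderiv ℝ (neckScale μ) (axisPoint l) with hD
  have hDd : HasFDerivAt (neckScale μ) D (axisPoint l) :=
    ((hsm _ hL).differentiableAt (by simp)).hasFDerivAt
  have hDv : ∀ v : E3, D v 0 = v 0 ∧ D v 1 = v 1 * √(2 * transPot μ (axisPoint l) - 1) ∧
      D v 2 = v 2 * √(2 * transPot μ (axisPoint l)) := by
    intro v
    have h1 : HasDerivAt (fun t : ℝ => axisPoint l + t • v) v 0 := by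
      simpa using ((hasDerivAt_id (0 : ℝ)).smul_const v).const_add (axisPoint l)
    have hDd' : HasFDerivAt (neckScale μ) D (axisPoint l + (0 : ℝ) • v) := by simpa using hDd
    have h2' : HasDerivAt (fun t : ℝ => neckScale μ (axisPoint l + t • v)) (D v) 0 :=
      HasFDerivAt.comp_hasDerivAt (l := neckScale μ) (f := fun t : ℝ => axisPoint l + t • v)
        (0 : ℝ) hDd' h1
    have h2 : ∀ i : Fin 3, HasDerivAt (fun t : ℝ => neckScale μ (axisPoint l + t • v) i) (D v i) 0 :=
      fun i => HasFDerivAt.comp_hasDerivAt (l := (EuclideanSpace.proj i : E3 →L[ℝ] ℝ))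
        (f := fun t : ℝ => neckScale μ (axisPoint l + t • v)) (0 : ℝ)
        (EuclideanSpace.proj i : E3 →L[ℝ] ℝ).hasFDerivAt h2'
    have hk : ContinuousAt (fun t : ℝ => transPot μ (axisPoint l + t • v)) 0 := by
      have : ContinuousAt (transPot μ) (axisPoint l + (0 : ℝ) • v) := by
        simpa using (contDiffAt_transPot (hN.radius_pos' h hL)).continuousAt
      exact ContinuousAt.comp (f := fun t : ℝ => axisPoint l + t • v) this h1.continuousAt
    -- The factor t vanishes at 0, so continuity of the scaling factor suffices and its derivative
    -- is not needed.
    have key : ∀ (r : ℝ) (F : ℝ → ℝ), ContinuousAt F 0 →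
        HasDerivAt (fun t : ℝ => t * r * F t) (r * F 0) 0 := by
      intro r F hF
      rw [hasDerivAt_iff_tendsto_slope]
      have : Filter.Tendsto (fun t => r * F t) (𝓝[≠] 0) (𝓝 (r * F 0)) :=
        ((continuousAt_const.mul hF).tendsto).mono_left nhdsWithin_le_nhds
      refine this.congr' ?_
      filter_upwards [self_mem_nhdsWithin] with t ht
      have : t ≠ 0 := ht
      simp only [slope_def_field]
      field_simp
      simp only [zero_mul, sub_zero]
      ring
    refine ⟨(h2 0).unique ?_, (h2 1).unique ?_, (h2 2).unique ?_⟩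
    · have : HasDerivAt (fun t : ℝ => l + t * v 0) (v 0) 0 := by
        simpa using ((hasDerivAt_id (0 : ℝ)).mul_const (v 0)).const_add l
      simpa [neckScale, axisPoint] using this
    · have := key (v 1) (fun t => √(2 * transPot μ (axisPoint l + t • v) - 1))
        ((continuousAt_const.mul hk).sub continuousAt_const).sqrt
      simpa [neckScale, axisPoint] using this
    · have := key (v 2) (fun t => √(2 * transPot μ (axisPoint l + t • v)))
        (continuousAt_const.mul hk).sqrt
      simpa [neckScale, axisPoint] using this
  have hinj : Function.Injective D := by
    rw [injective_iff_map_eq_zero]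
    intro v hv
    obtain ⟨h1, h2, h3⟩ := hDv v
    rw [hv] at h1 h2 h3
    have s1 : √(2 * transPot μ (axisPoint l) - 1) ≠ 0 := (Real.sqrt_pos.2 (by linarith)).ne'
    have s2 : √(2 * transPot μ (axisPoint l)) ≠ 0 := (Real.sqrt_pos.2 (by linarith)).ne'
    simp only [PiLp.zero_apply] at h1 h2 h3
    ext i
    fin_cases i
    · exact h1.symm
    · exact (mul_eq_zero.1 h2.symm).resolve_right s1
    · exact (mul_eq_zero.1 h3.symm).resolve_right s2
  set D' : E3 ≃L[ℝ] E3 := (LinearEquiv.ofInjectiveEndo D.toLinearMap hinj).toContinuousLinearEquiv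
    with hD'
  have hDD : (D' : E3 →L[ℝ] E3) = D := by ext v; rfl
  set e := (hsm _ hL).toOpenPartialHomeomorph (neckScale μ) (f' := D') (hDD ▸ hDd) (by simp) with he
  have hec : ∀ q, e q = neckScale μ q := fun q => rfl
  have hLs : axisPoint l ∈ e.source :=
    (hsm _ hL).mem_toOpenPartialHomeomorph_source (hDD ▸ hDd) (by simp)
  -- Invertibility on a neighbourhood, and not only at L₁, makes the inverse smooth at every point
  -- of the chart.
  have hinv : ∀ᶠ q in 𝓝 (axisPoint l), fderiv ℝ (neckScale μ) q ∈
      range ((↑) : (E3 ≃L[ℝ] E3) → E3 →L[ℝ] E3) := by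
    have h1 : ContinuousAt (fderiv ℝ (neckScale μ)) (axisPoint l) :=
      ((hsm _ hL).fderiv_right (m := 1) (by norm_cast)).continuousAt
    refine h1.eventually ?_
    change _ ∈ 𝓝 D
    rw [← hDD]
    exact D'.nhds
  obtain ⟨R', hR', hball⟩ := Metric.eventually_nhds_iff_ball.1
    (hinv.and (e.open_source.mem_nhds hLs))
  set R := min R₀ R' with hR
  have hR0 : 0 < R := lt_min hN.size_pos hR'
  have hLt : axisPoint l ∈ e.target := by
    have := e.map_source hLs
    rwa [hec, h0] at this
  have hsymm : e.symm (axisPoint l) = axisPoint l := by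
    conv_lhs => rw [← h0, ← hec, e.left_inv hLs]
  have hev : ∀ᶠ u in 𝓝 (axisPoint l), u ∈ e.target ∧ ‖e.symm u - axisPoint l‖ < R := by
    refine Filter.Eventually.and (e.open_target.mem_nhds hLt) ?_
    have := (e.continuousAt_symm hLt).eventually (Metric.ball_mem_nhds (e.symm (axisPoint l)) hR0)
    rw [hsymm] at this
    exact this.mono fun u hu => mem_ball_iff_norm.1 hu
  obtain ⟨r₀, hr₀, hball'⟩ := Metric.eventually_nhds_iff_ball.1 hev
  refine ⟨R, C, r₀, e.symm, hN.mono h hR0 (min_le_left _ _), hr₀, fun q hq => ?_, fun u hu => ?_,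
    fun u hu => ?_, fun u hu => ?_⟩
  · rw [← hec]
    exact e.left_inv (hball q (mem_ball_iff_norm.2 (hq.trans_le (min_le_right _ _)))).2
  · exact (hball' u (mem_ball_iff_norm.2 hu)).2
  · rw [← hec]
    exact e.right_inv (hball' u (mem_ball_iff_norm.2 hu)).1
  · obtain ⟨h1, h2⟩ := hball' u (mem_ball_iff_norm.2 hu)
    have h3 := h2.trans_le (min_le_left _ _)
    obtain ⟨T, hT⟩ := (hball _ (mem_ball_iff_norm.2 (h2.trans_le (min_le_right _ _)))).1
    refine e.contDiffAt_symm (f₀' := T) h1 ?_ (hsm _ h3)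
    rw [hT]
    exact ((hsm _ h3).differentiableAt (by simp)).hasFDerivAt

namespace IsNeckChart

variable {r₀ t : ℝ} {f : E3 → E3} {W : E5} {z : E3 × E3}

theorem radius_pos_of_mem (hf : IsNeckChart μ l R C r₀ f) (h : IsLagrangePos μ l)
    (hz : ‖z.1 - axisPoint l‖ < R) (b : Primary) : 0 < radius μ (z.1 0) b :=
  hf.toIsNeckRadius.radius_pos' h hz b

theorem neckPoint_neckTrans (hf : IsNeckChart μ l R C r₀ f) (hz : ‖z.1 - axisPoint l‖ < R) :
    neckPoint f (z.1 0) (neckTrans μ z) = z := by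
  have h1 : (!₂[z.1 0, neckTrans μ z 3, neckTrans μ z 4] : E3) = neckScale μ z.1 := by
    ext i; fin_cases i <;> simp [neckTrans, neckScale]
  rw [neckPoint, h1, hf.left_inv _ hz]
  refine Prod.ext rfl ?_
  ext i
  fin_cases i <;> simp [neckTrans]

theorem norm_lt_chart (hf : IsNeckChart μ l R C r₀ f) (ht : (t - l) ^ 2 + ‖W‖ ^ 2 < r₀ ^ 2) :
    ‖(!₂[t, W 3, W 4] : E3) - axisPoint l‖ < r₀ := by
  refine lt_of_pow_lt_pow_left₀ 2 hf.chart_pos.le (lt_of_le_of_lt ?_ ht)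
  rw [norm_sub_axisPoint_sq, norm_sq_five, axisSq]
  simp only [Matrix.cons_val]
  nlinarith [sq_nonneg (W 0), sq_nonneg (W 1), sq_nonneg (W 2)]

theorem neckPoint_spec (hf : IsNeckChart μ l R C r₀ f) (ht : (t - l) ^ 2 + ‖W‖ ^ 2 < r₀ ^ 2) :
    ‖(neckPoint f t W).1 - axisPoint l‖ < R ∧ (neckPoint f t W).1 0 = t ∧
      neckTrans μ (neckPoint f t W) = W := by
  have h1 := hf.norm_lt_chart ht
  have h2 := hf.right_inv _ h1
  have h3 : f !₂[t, W 3, W 4] 0 = t := by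
    have := congrArg (fun v : E3 => v 0) h2
    simpa [neckScale] using this
  refine ⟨hf.mem _ h1, h3, ?_⟩
  ext i
  fin_cases i
  · simp [neckTrans, neckPoint]
  · simp [neckTrans, neckPoint]
  · simp [neckTrans, neckPoint]
  · have := congrArg (fun v : E3 => v 1) h2
    simpa [neckTrans, neckPoint] using this
  · have := congrArg (fun v : E3 => v 2) h2
    simpa [neckTrans, neckPoint] using this

theorem contDiffAt_neckPoint (hf : IsNeckChart μ l R C r₀ f)
    (ht : (t - l) ^ 2 + ‖W‖ ^ 2 < r₀ ^ 2) :
    ContDiffAt ℝ ∞ (fun v : ℝ × E5 => neckPoint f v.1 v.2) (t, W) :=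
  CRTBP.contDiffAt_neckPoint (hf.smooth _ (hf.norm_lt_chart ht))

theorem contDiffAt_neckTrans (hf : IsNeckChart μ l R C r₀ f) (h : IsLagrangePos μ l)
    (hz : ‖z.1 - axisPoint l‖ < R) : ContDiffAt ℝ ∞ (neckTrans μ) z :=
  CRTBP.contDiffAt_neckTrans (hf.radius_pos_of_mem h hz) (by linarith [hf.trans _ hz])

theorem mem_phaseSpace (hf : IsNeckChart μ l R C r₀ f) (h : IsLagrangePos μ l)
    (hz : ‖z.1 - axisPoint l‖ < R) : z ∈ phaseSpace μ :=
  hf.toIsNeckRadius.mem_offPrimaries h hz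

theorem hamiltonian_eq (hf : IsNeckChart μ l R C r₀ f) (h : IsLagrangePos μ l)
    (hz : ‖z.1 - axisPoint l‖ < R) :
    hamiltonian μ z = ‖neckTrans μ z‖ ^ 2 / 2 + critEnergy μ (z.1 0) :=
  hamiltonian_neckTrans (hf.radius_pos_of_mem h hz) (by linarith [hf.trans _ hz])

end IsNeckChart

end NeckCoord


/-! ### Closing the neck by a cap -/

/-- A smooth step between `3 * δ / 4` and `δ`. -/
def capStep (δ s : ℝ) : ℝ := Real.smoothTransition (4 * s / δ - 3)

/-- The energy that is available for the transversal motion at the signed distance `s` from the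
Lagrange point in the direction of `b`. -/
def sideEnergy (μ l : ℝ) (b : Primary) (c s : ℝ) : ℝ := c - critEnergy μ (l - sgn b * s)

/-- The available energy after capping. -/
def capEnergy (μ l : ℝ) (b : Primary) (c δ s : ℝ) : ℝ :=
  (1 - capStep δ s) * (4 * δ * s - δ ^ 2) + capStep δ s * sideEnergy μ l b c s

/-- The additional potential that produces the cap. -/
def capPot (μ l : ℝ) (b : Primary) (c δ : ℝ) (q : E3) : ℝ :=
  (1 - capStep δ (side b l q)) *
    (sideEnergy μ l b c (side b l q) - (4 * δ * side b l q - δ ^ 2))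

section CapStep

variable {δ s : ℝ}

theorem contDiff_capStep (δ : ℝ) : ContDiff ℝ ∞ (capStep δ) :=
  Real.smoothTransition.contDiff.comp
    (((contDiff_const.mul contDiff_id).div_const δ).sub contDiff_const)

theorem capStep_mem (δ s : ℝ) : capStep δ s ∈ Icc (0 : ℝ) 1 :=
  ⟨Real.smoothTransition.nonneg _, Real.smoothTransition.le_one _⟩

theorem capStep_of_le (hδ : 0 < δ) (hs : 4 * s ≤ 3 * δ) : capStep δ s = 0 :=
  Real.smoothTransition.zero_of_nonpos (by rw [sub_nonpos, div_le_iff₀ hδ]; exact hs)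

theorem capStep_of_ge (hδ : 0 < δ) (hs : δ ≤ s) : capStep δ s = 1 :=
  Real.smoothTransition.one_of_one_le (by
    have : 4 ≤ 4 * s / δ := by rw [le_div_iff₀ hδ]; linarith
    linarith)

theorem monotone_capStep (hδ : 0 < δ) : Monotone (capStep δ) := fun s t h =>
  Real.smoothTransition.monotone (by gcongr)

theorem hasDerivAt_capStep (hδ : 0 < δ) (s : ℝ) : ∃ D ≥ 0, HasDerivAt (capStep δ) D s :=
  ⟨_, (monotone_capStep hδ).deriv_nonneg, ((contDiff_capStep δ).differentiable (by simp) s).hasDerivAt⟩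

end CapStep

theorem capPot_eq (μ l : ℝ) (b : Primary) (c δ : ℝ) (q : E3) : capPot μ l b c δ q =
    sideEnergy μ l b c (side b l q) - capEnergy μ l b c δ (side b l q) := by
  rw [capPot, capEnergy]; ring

theorem sideEnergy_side (μ l : ℝ) (b : Primary) (c : ℝ) (q : E3) :
    sideEnergy μ l b c (side b l q) = c - critEnergy μ (q 0) := by
  rw [sideEnergy, side, show l - sgn b * -(sgn b * (q 0 - l)) = q 0 by
    linear_combination (q 0 - l) * sgn_mul_self b]

/-- The smallness assumptions for capping the energy level `c` at the distance `δ` from the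
Lagrange point. -/
structure IsCapData (μ l R C r₀ : ℝ) (f : E3 → E3) (δ c : ℝ) : Prop
    extends IsNeckChart μ l R C r₀ f where
  lagrange : IsLagrangePos μ l
  width_pos : 0 < δ
  three_lt : 3 * δ < R
  six_le : 6 * δ ≤ R ^ 2
  width_le : ∀ b, 20 * axialCurv μ l * δ ≤ radius μ l b
  mix_le : 100 * C * δ ≤ 1
  chart_le : 8 * axialCurv μ l * δ ≤ r₀
  lt_energy : critEnergy μ l < c
  energy_le : c - critEnergy μ l < δ ^ 2 / 100
  radial : ∀ b, ∀ z ∈ phaseSpace μ, z.1 ∈ Metric.ball (pos μ b) (radius μ l b) →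
    δ ≤ ‖z.1 - axisPoint l‖ → hamiltonian μ z ≤ c → 0 < hamDeriv μ z (z.1 - pos μ b, 0)
  lt_potential : ∀ b q, ‖q - pos μ b‖ = radius μ l b → δ / 4 ≤ ‖q - axisPoint l‖ →
    c < potential μ q

theorem exists_isCapData {μ l : ℝ} (h : IsLagrangePos μ l) : ∃ R C r₀ f δ, ∃ ε > 0,
    ∀ c, critEnergy μ l < c → c < critEnergy μ l + ε → IsCapData μ l R C r₀ f δ c := by
  obtain ⟨R, C, r₀, f, hf⟩ := exists_isNeckChart h
  have hR := hf.size_pos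
  have hr : ∀ b, 0 < radius μ l b := fun b => (h.radius_mem b).1
  obtain ⟨δ, ⟨⟨⟨⟨⟨c1, c2⟩, c3⟩, c4⟩, c5⟩, c6⟩, hδ⟩ : ∃ δ : ℝ, (((((4 * δ ≤ R ∧ 6 * δ ≤ R ^ 2) ∧
      20 * axialCurv μ l * δ ≤ radius μ l .earth) ∧ 20 * axialCurv μ l * δ ≤ radius μ l .moon) ∧
      100 * C * δ ≤ 1) ∧ 8 * axialCurv μ l * δ ≤ r₀) ∧ 0 < δ :=
    (((((((eventually_mul_le _ hR).and (eventually_mul_le _ (pow_pos hR 2))).and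
      (eventually_mul_le _ (hr _))).and (eventually_mul_le _ (hr _))).and
      (eventually_mul_le _ one_pos)).and (eventually_mul_le _ hf.chart_pos)).and
      self_mem_nhdsWithin).exists
  obtain ⟨ε₁, h1, hrad⟩ := exists_radial_gap h hδ
  obtain ⟨ε₂, h2, hpot⟩ := exists_potential_gap h (η := δ / 4) (by positivity)
  refine ⟨R, C, r₀, f, δ, min (min ε₁ ε₂) (δ ^ 2 / 100), by positivity, fun c hc hc' => ?_⟩
  have m1 := min_le_left (min ε₁ ε₂) (δ ^ 2 / 100)
  have m2 := min_le_right (min ε₁ ε₂) (δ ^ 2 / 100)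
  have m3 := min_le_left ε₁ ε₂
  have m4 := min_le_right ε₁ ε₂
  exact
    { hf with
      lagrange := h
      width_pos := hδ
      three_lt := by linarith
      six_le := c2
      width_le := by rintro (_ | _); exacts [c3, c4]
      mix_le := c5
      chart_le := c6
      lt_energy := hc
      energy_le := by linarith
      radial := fun b z hz hzb hη hH => hrad b z hz hzb hη (by linarith)
      lt_potential := fun b q hq hη => by linarith [hpot b q hq hη] }

namespace IsCapData

variable {μ l R C r₀ δ c s : ℝ} {f : E3 → E3} {q : E3} {b : Primary} {z : E3 × E3}

theorem curv_ge (H : IsCapData μ l R C r₀ f δ c) : 9 ≤ axialCurv μ l := nine_le_axialCurv H.lagrange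

theorem width_lt (H : IsCapData μ l R C r₀ f δ c) (b : Primary) : 180 * δ ≤ radius μ l b := by
  have h1 := H.width_le b
  have h2 := H.curv_ge
  nlinarith [H.width_pos]

theorem axis_mem (b : Primary) (l : ℝ) (hs : |s| < R) :
    ‖axisPoint (l - sgn b * s) - axisPoint l‖ < R := by
  have hR : 0 ≤ R := (abs_nonneg s).trans hs.le
  refine lt_of_pow_lt_pow_left₀ 2 hR ?_
  rw [norm_sub_axisPoint_sq]
  have e : (axisPoint (l - sgn b * s) 0 - l) ^ 2 + axisSq (axisPoint (l - sgn b * s)) = |s| ^ 2 := by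
    simp only [axisPoint, axisSq, Matrix.cons_val, sq_abs]
    linear_combination s ^ 2 * sgn_mul_self b
  rw [e]
  exact pow_lt_pow_left₀ hs (abs_nonneg _) two_ne_zero

theorem sideEnergy_mem (H : IsCapData μ l R C r₀ f δ c) (b : Primary) (hs : |s| < R) :
    sideEnergy μ l b c s ∈ Icc (c - critEnergy μ l + 99 / 200 * (axialCurv μ l * s ^ 2))
      (c - critEnergy μ l + 101 / 200 * (axialCurv μ l * s ^ 2)) := by
  have h1 := axis_mem b l hs
  have h2 := abs_le.1 (H.quad _ h1)
  have h3 := critEnergy_expansion H.lagrange (H.toIsNeckRadius.radius_pos' H.lagrange h1)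
  have e : axisPoint (l - sgn b * s) 0 = l - sgn b * s := by simp [axisPoint]
  have e2 : (l - sgn b * s - l) ^ 2 = s ^ 2 := by linear_combination s ^ 2 * sgn_mul_self b
  rw [e] at h2 h3
  rw [e2] at h3
  rw [sideEnergy, h3]
  have h4 := sq_nonneg s
  have h5 := mul_le_mul_of_nonneg_right h2.1 h4
  have h6 := mul_le_mul_of_nonneg_right h2.2 h4
  constructor <;> linarith

theorem hasDerivAt_sideEnergy (H : IsCapData μ l R C r₀ f δ c) (b : Primary) (hs : |s| < R) :
    HasDerivAt (sideEnergy μ l b c) (axialLin μ l (l - sgn b * s) * s) s := by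
  have h1 := axis_mem b l hs
  have hX := H.toIsNeckRadius.radius_pos' H.lagrange h1
  have e : axisPoint (l - sgn b * s) 0 = l - sgn b * s := by simp [axisPoint]
  rw [e] at hX
  have hE := hX .earth
  have hM := hX .moon
  simp only [radius] at hE hM
  have h2 := hasDerivAt_axisPot (m := μ) (ρ := l - sgn b * s + 1 - μ) hM.ne' (by linarith)
  rw [axisSlope_expansion H.lagrange hX] at h2
  have h3 : HasDerivAt (fun s => l - sgn b * s + 1 - μ) (-(sgn b * 1)) s :=
    ((((hasDerivAt_id s).const_mul (sgn b)).const_sub l).add_const 1).sub_const μ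
  refine ((HasDerivAt.comp s h2 h3).const_sub c).congr_deriv ?_
  linear_combination axialLin μ l (l - sgn b * s) * s * sgn_mul_self b

theorem contDiffAt_sideEnergy (H : IsCapData μ l R C r₀ f δ c) (b : Primary) (hs : |s| < R) :
    ContDiffAt ℝ ∞ (sideEnergy μ l b c) s := by
  have hX := H.toIsNeckRadius.radius_pos' H.lagrange (axis_mem b l hs)
  have e : axisPoint (l - sgn b * s) 0 = l - sgn b * s := by simp [axisPoint]
  rw [e] at hX
  have hE := hX .earth
  have hM := hX .moon
  simp only [radius] at hE hM
  have h1 : ContDiffAt ℝ ∞ (fun s => l - sgn b * s + 1 - μ) s :=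
    ((contDiffAt_const.sub (contDiffAt_const.mul contDiffAt_id)).add contDiffAt_const).sub
      contDiffAt_const
  unfold sideEnergy critEnergy axisPot
  exact contDiffAt_const.sub (((((h1.sub contDiffAt_const).pow 2).neg.div_const 2).sub
    (contDiffAt_const.div h1 hM.ne')).sub
      (contDiffAt_const.div (contDiffAt_const.sub h1) (by linarith)))

theorem contDiffAt_capEnergy (H : IsCapData μ l R C r₀ f δ c) (b : Primary) (hs : |s| < R) :
    ContDiffAt ℝ ∞ (capEnergy μ l b c δ) s := by
  have h1 : ContDiffAt ℝ ∞ (capStep δ) s := (contDiff_capStep δ).contDiffAt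
  unfold capEnergy
  exact ((contDiffAt_const.sub h1).mul ((contDiffAt_const.mul contDiffAt_id).sub
    contDiffAt_const)).add (h1.mul (H.contDiffAt_sideEnergy b hs))

/-- The line is tangent to 4s² at s = δ/2, and 4s² lies below the available energy because A ≥ 9.
Hence the additional potential of the cap is nonnegative. -/
theorem le_sideEnergy (H : IsCapData μ l R C r₀ f δ c) (b : Primary) (hs : |s| < R) :
    4 * δ * s - δ ^ 2 ≤ sideEnergy μ l b c s := by
  have h1 := (H.sideEnergy_mem b hs).1
  have h2 := H.curv_ge
  have h3 := H.lt_energy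
  nlinarith [sq_nonneg (2 * s - δ), sq_nonneg s, mul_le_mul_of_nonneg_right h2 (sq_nonneg s)]

theorem sideEnergy_pos (H : IsCapData μ l R C r₀ f δ c) (b : Primary) (hs : |s| < R) :
    0 < sideEnergy μ l b c s := by
  have h1 := (H.sideEnergy_mem b hs).1
  have h2 := H.curv_ge
  have h3 := H.lt_energy
  nlinarith [sq_nonneg s]

theorem capEnergy_of_le (H : IsCapData μ l R C r₀ f δ c) (hs : 4 * s ≤ 3 * δ) :
    capEnergy μ l b c δ s = 4 * δ * s - δ ^ 2 := by
  rw [capEnergy, capStep_of_le H.width_pos hs]; ring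

theorem capEnergy_of_ge (H : IsCapData μ l R C r₀ f δ c) (hs : δ ≤ s) :
    capEnergy μ l b c δ s = sideEnergy μ l b c s := by
  rw [capEnergy, capStep_of_ge H.width_pos hs]; ring

theorem capEnergy_pos (H : IsCapData μ l R C r₀ f δ c) (b : Primary) (hs : |s| < R)
    (hsa : δ / 4 < s) : 0 < capEnergy μ l b c δ s := by
  have h1 := H.sideEnergy_pos b hs
  have h2 : 0 < 4 * δ * s - δ ^ 2 := by nlinarith [H.width_pos]
  have h3 := capStep_mem δ s
  rcases h3.1.eq_or_lt with h4 | h4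
  · rw [capEnergy, ← h4]; linarith
  · rw [capEnergy]
    have := mul_nonneg (sub_nonneg.2 h3.2) h2.le
    have := mul_pos h4 h1
    linarith

/-- The available energy is small on the neck. -/
theorem energy_bound (H : IsCapData μ l R C r₀ f δ c) (b : Primary) (hs : |s| < 3 * δ) :
    sideEnergy μ l b c s ≤ 5 * axialCurv μ l * δ ^ 2 ∧
      capEnergy μ l b c δ s ≤ 5 * axialCurv μ l * δ ^ 2 := by
  have h1 := (H.sideEnergy_mem b (hs.trans H.three_lt)).2
  have h2 := H.curv_ge
  have h3 := H.energy_le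
  have hδ := H.width_pos
  have h4 : s ^ 2 ≤ 9 * δ ^ 2 := by
    rw [← sq_abs]
    nlinarith [abs_nonneg s]
  have h5 : axialCurv μ l * s ^ 2 ≤ axialCurv μ l * (9 * δ ^ 2) :=
    mul_le_mul_of_nonneg_left h4 (by linarith)
  have h6 : 9 * δ ^ 2 ≤ axialCurv μ l * δ ^ 2 := mul_le_mul_of_nonneg_right h2 (sq_nonneg δ)
  have h7 : sideEnergy μ l b c s ≤ 5 * axialCurv μ l * δ ^ 2 := by linarith [sq_nonneg δ]
  refine ⟨h7, ?_⟩
  have h8 := capStep_mem δ s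
  have h9 : 4 * δ * s - δ ^ 2 ≤ 5 * axialCurv μ l * δ ^ 2 := by nlinarith [(abs_lt.1 hs).2]
  rw [capEnergy]
  nlinarith [h8.1, h8.2]

/-- A bound linear in s is what membership in the ball around b requires near its boundary: the
squared distance from the axis must stay below 2rs - s². -/
theorem capEnergy_le (H : IsCapData μ l R C r₀ f δ c) (b : Primary) (hs0 : 0 ≤ s)
    (hs : s < 3 * δ) : capEnergy μ l b c δ s ≤ 4 * axialCurv μ l * δ * s := by
  have hs' : |s| < 3 * δ := by rwa [abs_of_nonneg hs0]
  have h1 := (H.sideEnergy_mem b (hs'.trans H.three_lt)).2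
  have h2 := H.curv_ge
  have h3 := H.energy_le
  have hδ := H.width_pos
  have h8 := capStep_mem δ s
  have h9 : 4 * δ * s - δ ^ 2 ≤ 4 * axialCurv μ l * δ * s := by
    nlinarith [mul_nonneg hδ.le hs0, mul_le_mul_of_nonneg_right h2 (mul_nonneg hδ.le hs0)]
  rw [capEnergy]
  rcases h8.1.eq_or_lt with h | h
  · rw [← h]; linarith
  · have h10 : 3 * δ < 4 * s := by
      by_contra hcon
      rw [capStep_of_le hδ (not_lt.1 hcon)] at h
      exact lt_irrefl _ h
    have h11 : axialCurv μ l * s ^ 2 ≤ axialCurv μ l * (3 * δ * s) :=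
      mul_le_mul_of_nonneg_left (by nlinarith) (by linarith)
    have h12 : δ ^ 2 ≤ axialCurv μ l * δ * s := by
      have := mul_le_mul_of_nonneg_right h2 (mul_nonneg hδ.le hs0)
      nlinarith
    have h13 : sideEnergy μ l b c s ≤ 4 * axialCurv μ l * δ * s := by linarith [sq_nonneg δ]
    nlinarith [h8.1, h8.2]

/-- Both bounds feed the star-shapedness of the cap: the first keeps the axial force D away from
zero, and the second says that the available energy, hence every squared velocity, is small compared
with D². They hold for the line and for the true energy where the step is active, and pass to the
convex combination. -/
theorem hasDerivAt_capEnergy (H : IsCapData μ l R C r₀ f δ c) (b : Primary)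
    (hs : s ∈ Icc (δ / 4) δ) : ∃ D, HasDerivAt (capEnergy μ l b c δ) D s ∧ 4 * δ ≤ D ∧
      5 * capEnergy μ l b c δ s ≤ 4 * δ * D := by
  have hδ := H.width_pos
  have hs0 : 0 < s := by linarith [hs.1]
  have hsR : |s| < R := by rw [abs_of_pos hs0]; linarith [hs.2, H.three_lt]
  obtain ⟨d, hd, hd'⟩ := hasDerivAt_capStep hδ s
  have h1 := ((hasDerivAt_const s (1 : ℝ)).sub hd').mul
    (((hasDerivAt_id s).const_mul (4 * δ)).sub_const (δ ^ 2))
  have h2 := h1.add (hd'.mul (H.hasDerivAt_sideEnergy b hsR))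
  have h3 := axis_mem b l hsR
  have e : axisPoint (l - sgn b * s) 0 = l - sgn b * s := by simp [axisPoint]
  have h4 := (abs_le.1 (H.lin _ h3)).1
  rw [e] at h4
  have h5 := H.le_sideEnergy b hsR
  have h6 := H.sideEnergy_mem b hsR
  have hA := H.curv_ge
  have hS := capStep_mem δ s
  have he := H.energy_le
  obtain ⟨E', hE'⟩ : ∃ E', E' = axialLin μ l (l - sgn b * s) * s := ⟨_, rfl⟩
  have h7 : 99 / 100 * (axialCurv μ l * s) ≤ E' := by
    rw [hE']; nlinarith
  rw [← hE'] at h2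
  obtain ⟨D, hD⟩ : ∃ D, D = d * (sideEnergy μ l b c s - (4 * δ * s - δ ^ 2)) +
    ((1 - capStep δ s) * (4 * δ) + capStep δ s * E') := ⟨_, rfl⟩
  -- The derivative of the step contributes with the right sign, because the step increases and the
  -- true energy lies above the line.
  have hDge : (1 - capStep δ s) * (4 * δ) + capStep δ s * E' ≤ D := by
    rw [hD]
    linarith [mul_nonneg hd (sub_nonneg.2 h5)]
  refine ⟨D, ?_, ?_⟩
  · refine h2.congr_deriv ?_
    rw [hD]
    simp only [Pi.sub_apply, id]
    ring
  rcases hS.1.eq_or_lt with h | h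
  · rw [← h] at hDge
    rw [capEnergy, ← h]
    constructor
    · linarith
    · nlinarith [hs.2]
  · have h10 : 3 * δ < 4 * s := by
      by_contra hcon
      rw [capStep_of_le hδ (not_lt.1 hcon)] at h
      exact lt_irrefl _ h
    have h11 : 9 * s ≤ axialCurv μ l * s := mul_le_mul_of_nonneg_right hA hs0.le
    constructor
    · have : 4 * δ ≤ E' := by linarith
      nlinarith [hS.1, hS.2]
    · have h12 : axialCurv μ l * s ^ 2 ≤ δ * (axialCurv μ l * s) := by
        have : 0 ≤ axialCurv μ l * s := by linarith
        nlinarith [hs.2]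
      have h13 : 5 * sideEnergy μ l b c s ≤ 4 * δ * E' := by
        have : δ * (99 / 100 * (axialCurv μ l * s)) ≤ δ * E' := mul_le_mul_of_nonneg_left h7 hδ.le
        nlinarith [h6.2]
      have h14 : 5 * (4 * δ * s - δ ^ 2) ≤ 4 * δ * (4 * δ) := by nlinarith [hs.2]
      have h15 := mul_le_mul_of_nonneg_left h13 hS.1
      have h16 := mul_le_mul_of_nonneg_left h14 (sub_nonneg.2 hS.2)
      have h17 := mul_le_mul_of_nonneg_left hDge (show 0 ≤ 4 * δ by linarith)
      rw [capEnergy]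
      linarith

end IsCapData


/-! ### The capped levels are star-shaped -/

namespace IsCapData

variable {μ l R C r₀ δ c s : ℝ} {f : E3 → E3} {q : E3} {b : Primary} {z : E3 × E3}

theorem norm_lt_of_mem_ball (H : IsCapData μ l R C r₀ f δ c)
    (hq : q ∈ Metric.ball (pos μ b) (radius μ l b)) (hs : side b l q < 3 * δ) :
    ‖q - axisPoint l‖ < R := by
  obtain ⟨h1, h2⟩ := side_pos_of_mem_ball (H.lagrange.radius_mem b).1 hq
  refine lt_of_pow_lt_pow_left₀ 2 H.size_pos.le (h2.trans_le ?_)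
  nlinarith [H.six_le, (H.lagrange.radius_mem b).2, (H.lagrange.radius_mem b).1]

theorem capPot_of_ge (H : IsCapData μ l R C r₀ f δ c) (hs : δ ≤ side b l q) :
    capPot μ l b c δ q = 0 := by
  rw [capPot, capStep_of_ge H.width_pos hs]; ring

theorem capPot_eventually (H : IsCapData μ l R C r₀ f δ c) (hs : δ < side b l q) :
    capPot μ l b c δ =ᶠ[𝓝 q] fun _ => 0 := by
  filter_upwards [(continuous_side b l).continuousAt.eventually_const_lt hs] with q' hq'
  exact H.capPot_of_ge hq'.le

theorem capPot_nonneg (H : IsCapData μ l R C r₀ f δ c) (hs : 0 ≤ side b l q) :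
    0 ≤ capPot μ l b c δ q := by
  rcases le_or_gt δ (side b l q) with h | h
  · rw [H.capPot_of_ge h]
  · rw [capPot]
    refine mul_nonneg (sub_nonneg.2 (capStep_mem _ _).2) (sub_nonneg.2 (H.le_sideEnergy b ?_))
    rw [abs_of_nonneg hs]
    linarith [H.three_lt, H.width_pos]

theorem hasFDerivAt_side (b : Primary) (l : ℝ) (q : E3) :
    HasFDerivAt (side b l) (-(sgn b • (EuclideanSpace.proj 0 : E3 →L[ℝ] ℝ))) q := by
  have h := ((EuclideanSpace.proj 0 : E3 →L[ℝ] ℝ).hasFDerivAt (x := q)).sub_const l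
  exact (h.const_mul (sgn b)).neg

theorem contDiff_side (b : Primary) (l : ℝ) : ContDiff ℝ ∞ (side b l) := by
  have h : ContDiff ℝ ∞ fun q : E3 => q 0 := (EuclideanSpace.proj 0 : E3 →L[ℝ] ℝ).contDiff
  exact (contDiff_const.mul (h.sub contDiff_const)).neg

theorem contDiffAt_capPot (H : IsCapData μ l R C r₀ f δ c) (hs : 0 < side b l q) :
    ContDiffAt ℝ ∞ (capPot μ l b c δ) q := by
  rcases lt_or_ge δ (side b l q) with h | h
  · exact contDiffAt_const.congr_of_eventuallyEq (H.capPot_eventually h)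
  · have hsR : |side b l q| < R := by
      rw [abs_of_pos hs]; linarith [H.three_lt, H.width_pos]
    have h1 := ((H.contDiffAt_sideEnergy b hsR).sub (H.contDiffAt_capEnergy b hsR)).comp q
      (contDiff_side b l).contDiffAt
    refine h1.congr_of_eventuallyEq (Filter.Eventually.of_forall fun q' => ?_)
    exact capPot_eq μ l b c δ q'

/-- In the neck, the capped Hamiltonian is the sum of the square of the transversal coordinates and
a function of the axial coordinate. -/
theorem modHam_capPot (H : IsCapData μ l R C r₀ f δ c) (hz : ‖z.1 - axisPoint l‖ < R) :
    modHam μ (capPot μ l b c δ) z =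
      ‖neckTrans μ z‖ ^ 2 / 2 + (c - capEnergy μ l b c δ (side b l z.1)) := by
  rw [modHam, H.toIsNeckChart.hamiltonian_eq H.lagrange hz, capPot_eq, sideEnergy_side]
  ring

theorem modHam_zero (H : IsCapData μ l R C r₀ f δ c) (b : Primary) (hz : ‖z.1 - axisPoint l‖ < R) :
    modHam μ 0 z = ‖neckTrans μ z‖ ^ 2 / 2 + (c - sideEnergy μ l b c (side b l z.1)) := by
  rw [modHam, H.toIsNeckChart.hamiltonian_eq H.lagrange hz, sideEnergy_side]
  simp

/-- On the cap the radial field is nearly axial and of length about r, so the axial force D is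
multiplied by at least 90δ. The velocity and the mixed term take at most 65 percent of D, and the
transversal terms cost at most δD. -/
theorem cap_deriv_pos (H : IsCapData μ l R C r₀ f δ c)
    (hzb : z.1 ∈ Metric.ball (pos μ b) (radius μ l b)) (hs : side b l z.1 ≤ δ)
    (hle : modHam μ (capPot μ l b c δ) z ≤ c) :
    0 < hamDeriv μ z (z.1 - pos μ b, 0) + fderiv ℝ (capPot μ l b c δ) z.1 (z.1 - pos μ b) := by
  have hδ := H.width_pos
  have hr := H.width_lt b
  have hs0 := (side_pos_of_mem_ball (H.lagrange.radius_mem b).1 hzb).1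
  have hzR := H.norm_lt_of_mem_ball hzb (by linarith)
  have hX := H.toIsNeckRadius.radius_pos' H.lagrange hzR
  rw [H.modHam_capPot hzR] at hle
  have hW := axisSq_le_neckTrans (H.trans _ hzR)
  have hw0 := axisSq_nonneg z.1
  obtain ⟨s, hsdef⟩ : ∃ s, s = side b l z.1 := ⟨_, rfl⟩
  rw [← hsdef] at hs hs0 hle
  have hsa : δ / 4 ≤ s := by
    by_contra hcon
    rw [not_le] at hcon
    rw [H.capEnergy_of_le (by linarith)] at hle
    nlinarith [sq_nonneg ‖neckTrans μ z‖]
  have hsR : |s| < R := by rw [abs_of_pos hs0]; linarith [H.three_lt]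
  obtain ⟨D, hD, hD1, hD2⟩ := H.hasDerivAt_capEnergy b ⟨hsa, hs⟩
  have hE := H.hasDerivAt_sideEnergy b hsR
  have hfd : HasFDerivAt (capPot μ l b c δ) ((axialLin μ l (l - sgn b * s) * s - D) •
      (-(sgn b • (EuclideanSpace.proj 0 : E3 →L[ℝ] ℝ)))) z.1 := by
    have h1 := hE.sub hD
    rw [hsdef] at h1
    have h2 := h1.comp_hasFDerivAt z.1 (hasFDerivAt_side b l z.1)
    rw [← hsdef] at h2
    refine h2.congr_of_eventuallyEq (Filter.Eventually.of_forall fun q' => ?_)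
    exact capPot_eq μ l b c δ q'
  have hq0 : z.1 0 = l - sgn b * s := by
    rw [hsdef, side]; linear_combination -(z.1 0 - l) * sgn_mul_self b
  have hX0 : z.1 0 - pos μ b 0 = sgn b * (radius μ l b - s) := by
    rw [hsdef, ← radius_side, radius_eq]
    linear_combination -(z.1 0 - pos μ b 0) * sgn_mul_self b
  -- The derivative of the true available energy inside the added potential cancels the axial slope
  -- of the effective potential and leaves D.
  have e : hamDeriv μ z (z.1 - pos μ b, 0) + fderiv ℝ (capPot μ l b c δ) z.1 (z.1 - pos μ b) =
      (radius μ l b - s) * (D - sgn b * (z.2 1 - z.1 0) + sgn b * (axialMix μ z.1 * axisSq z.1)) +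
      ((z.2 0 + z.1 1) * z.1 1 + (transCurv μ z.1 - 1) * z.1 1 ^ 2 +
        transCurv μ z.1 * z.1 2 ^ 2) := by
    rw [hfd.fderiv, hamDeriv, potentialDeriv_expansion H.lagrange hX]
    simp only [PiLp.sub_apply, pos_one, pos_two, PiLp.zero_apply, sub_zero, zero_add, mul_zero,
      smul_apply, neg_apply, PiLp.proj_apply, smul_eq_mul,
      hX0]
    rw [hq0]
    linear_combination (radius μ l b - s) * D * sgn_mul_self b
  rw [e]
  have hwφ : (z.2 0 + z.1 1) ^ 2 + (z.2 1 - z.1 0) ^ 2 + 29 / 10 * axisSq z.1 ≤ 8 / 5 * (δ * D) := by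
    linarith
  have hD0 : 0 < D := by linarith
  have hsg : |sgn b| = 1 := by cases b <;> simp [sgn]
  -- From δ ≤ D/4 the square of the velocity is at most 2D²/5, and 2/5 < (16/25)².
  have hbe : sgn b * (z.2 1 - z.1 0) ≤ 16 / 25 * D := by
    have : |z.2 1 - z.1 0| ≤ 16 / 25 * D := by
      refine abs_le_of_sq_le_sq ?_ (by positivity)
      nlinarith [sq_nonneg (z.2 0 + z.1 1)]
    refine (le_abs_self _).trans ?_
    rwa [abs_mul, hsg, one_mul]
  have hmix : -(1 / 100 * D) ≤ sgn b * (axialMix μ z.1 * axisSq z.1) := by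
    refine (neg_le_neg ?_).trans (neg_abs_le _)
    rw [abs_mul, hsg, one_mul, abs_mul, abs_of_nonneg hw0]
    have h1 : axisSq z.1 ≤ δ * D := by
      nlinarith [sq_nonneg (z.2 0 + z.1 1), sq_nonneg (z.2 1 - z.1 0), mul_pos hδ hD0]
    calc |axialMix μ z.1| * axisSq z.1 ≤ C * (δ * D) :=
          mul_le_mul (H.mix _ hzR) h1 hw0 H.const_pos.le
      _ = C * δ * D := by ring
      _ ≤ 1 / 100 * D := mul_le_mul_of_nonneg_right (by linarith [H.mix_le]) hD0.le
  have hK : 1 ≤ transCurv μ z.1 - 1 := by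
    linarith [(abs_le.1 (H.curv_sub _ hzR)).1, H.trans _ hzR]
  have hlast : -(δ * D) ≤ (z.2 0 + z.1 1) * z.1 1 + (transCurv μ z.1 - 1) * z.1 1 ^ 2 +
      transCurv μ z.1 * z.1 2 ^ 2 := by
    have i1 := mul_le_mul_of_nonneg_right hK (sq_nonneg (z.1 1))
    have i2 : 0 ≤ transCurv μ z.1 * z.1 2 ^ 2 := mul_nonneg (by linarith) (sq_nonneg _)
    have i3 : -((z.2 0 + z.1 1) ^ 2 / 4) ≤ (z.2 0 + z.1 1) * z.1 1 + 1 * z.1 1 ^ 2 := by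
      nlinarith only [sq_nonneg ((z.2 0 + z.1 1) + 2 * z.1 1)]
    linarith [sq_nonneg (z.2 1 - z.1 0), mul_pos hδ hD0]
  have hrs : 90 * δ ≤ radius μ l b - s := by linarith
  have h1 : 3 / 10 * D ≤ D - sgn b * (z.2 1 - z.1 0) + sgn b * (axialMix μ z.1 * axisSq z.1) := by
    linarith
  have h2 : 90 * δ * (3 / 10 * D) ≤ (radius μ l b - s) *
      (D - sgn b * (z.2 1 - z.1 0) + sgn b * (axialMix μ z.1 * axisSq z.1)) :=
    mul_le_mul hrs h1 (by positivity) (by linarith)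
  linarith [mul_pos hδ hD0]

theorem isStarLevel (H : IsCapData μ l R C r₀ f δ c) (b : Primary) :
    IsStarLevel μ b (capPot μ l b c δ) c (radius μ l b) := by
  have hδ := H.width_pos
  have hr := H.lagrange.radius_mem b
  have hrδ := H.width_lt b
  refine ⟨hr.2, ?_, fun q hq => H.contDiffAt_capPot (side_pos_of_mem_ball hr.1 hq).1, ?_, ?_⟩
  · refine H.capPot_eventually ?_
    have := radius_side μ l b (pos μ b)
    rw [radius_eq, sub_self, mul_zero] at this
    linarith
  · intro z hz hzb hle
    rcases le_or_gt (side b l z.1) δ with h | h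
    · exact H.cap_deriv_pos hzb h hle
    · have e := (H.capPot_eventually h).fderiv_eq (𝕜 := ℝ)
      rw [modHam, H.capPot_of_ge h.le, add_zero] at hle
      rw [e]
      have := H.radial b z hz hzb ((h.le.trans (le_abs_self _)).trans (abs_side_le b l z.1)) hle
      simpa using this
  · intro θ hθ
    have hs : ∀ ρ : ℝ, side b l (pos μ b + ρ • θ) = radius μ l b - ρ * (sgn b * θ 0) := by
      intro ρ
      have := radius_side μ l b (pos μ b + ρ • θ)
      rw [radius_eq] at this
      simp only [PiLp.add_apply, PiLp.smul_apply, smul_eq_mul] at this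
      linarith
    -- The left-hand side is the axial coordinate of the end of the ray on the sphere of radius r.
    -- If it is below δ/4, the ray crosses the plane of the tip, where the cap leaves no energy.
    -- Otherwise the end is far enough from L₁ for the true potential to exceed c.
    rcases lt_or_ge (radius μ l b - radius μ l b * (sgn b * θ 0)) (δ / 4) with hend | hend
    · set t := sgn b * θ 0 with ht
      have ht0 : 0 < t := by
        by_contra hcon
        rw [not_lt] at hcon
        nlinarith [hr.1]
      have ht1 : t ≤ 1 := by
        have h1 : t ^ 2 ≤ 1 := by
          have := norm_sq_three θ
          rw [hθ] at this
          have e : t ^ 2 = θ 0 ^ 2 := by rw [ht, mul_pow, sgn_sq, one_mul]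
          rw [e]
          nlinarith [sq_nonneg (θ 1), sq_nonneg (θ 2)]
        nlinarith
      set ρ := (radius μ l b - δ / 4) / t with hρ
      have hρt : ρ * t = radius μ l b - δ / 4 := by rw [hρ]; field_simp
      have hρ0 : 0 < ρ := div_pos (by linarith) ht0
      have hρr : ρ < radius μ l b := by rw [hρ, div_lt_iff₀ ht0]; linarith
      refine ⟨ρ, ⟨hρ0, hρr⟩, ?_⟩
      have hside : side b l (pos μ b + ρ • θ) = δ / 4 := by rw [hs, hρt]; ring
      have hball : pos μ b + ρ • θ ∈ Metric.ball (pos μ b) (radius μ l b) := by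
        rw [mem_ball_iff_norm, add_sub_cancel_left, norm_smul, hθ, mul_one,
          Real.norm_of_nonneg hρ0.le]
        exact hρr
      have hR := H.norm_lt_of_mem_ball hball (by rw [hside]; linarith)
      have h1 := H.toIsNeckRadius.potential_ge H.lagrange hR
      have h2 := axisSq_nonneg (pos μ b + ρ • θ)
      rw [capPot_eq, sideEnergy_side, hside, H.capEnergy_of_le (by linarith)]
      nlinarith
    · set q₁ := pos μ b + radius μ l b • θ with hq₁
      have hn : ‖q₁ - pos μ b‖ = radius μ l b := by
        rw [hq₁, add_sub_cancel_left, norm_smul, hθ, mul_one, Real.norm_of_nonneg hr.1.le]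
      have hV := H.lt_potential b q₁ hn (by
        refine le_trans ?_ (abs_side_le b l q₁)
        rw [hq₁, hs]
        exact hend.trans (le_abs_self _))
      have hcont : ContinuousAt (fun ρ : ℝ => potential μ (pos μ b + ρ • θ)) (radius μ l b) := by
        have h1 : ContinuousAt (potential μ) q₁ :=
          (contDiffAt_potential (sphere_mem_offPrimaries H.lagrange hn)).continuousAt
        exact ContinuousAt.comp (f := fun ρ : ℝ => pos μ b + ρ • θ) h1 (by fun_prop)
      have hev : ∀ᶠ ρ in 𝓝[<] radius μ l b, c < potential μ (pos μ b + ρ • θ) :=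
        nhdsWithin_le_nhds (hcont.eventually_const_lt hV)
      obtain ⟨ρ, hρ1, hρ2⟩ := (hev.and (Ioo_mem_nhdsLT hr.1)).exists
      refine ⟨ρ, hρ2, ?_⟩
      have hball : pos μ b + ρ • θ ∈ Metric.ball (pos μ b) (radius μ l b) := by
        rw [mem_ball_iff_norm, add_sub_cancel_left, norm_smul, hθ, mul_one,
          Real.norm_of_nonneg hρ2.1.le]
        exact hρ2.2
      have h1 := H.capPot_nonneg (side_pos_of_mem_ball hr.1 hball).1.le
      have h2 : c < potential μ (pos μ b + ρ • θ) := hρ1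
      linarith

end IsCapData


/-! ### Maps of the regularized phase space that are given on the phase space -/

open Classical in
/-- The map of the regularized phase space that is given by `F` on the phase space and fixes the
collisions. -/
def phaseMap (μ : ℝ) (F : E3 × E3 → E3 × E3) : RegPhase μ → RegPhase μ
  | .phase z hz => if h : F z ∈ phaseSpace μ then .phase (F z) h else .phase z hz
  | .collision b η hη => .collision b η hη

section PhaseMap

variable {μ : ℝ} {F G : E3 × E3 → E3 × E3} {z : E3 × E3}

theorem phaseMap_phase (hz : z ∈ phaseSpace μ) (h : F z ∈ phaseSpace μ) :
    phaseMap μ F (.phase z hz) = .phase (F z) h := dif_pos h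

theorem phaseMap_of_eq (hz : z ∈ phaseSpace μ) (h : F z = z) :
    phaseMap μ F (.phase z hz) = .phase z hz := by
  rw [phaseMap_phase hz (by rwa [h])]
  congr 1

theorem phaseMap_congr (hz : z ∈ phaseSpace μ) (h : F z = G z) :
    phaseMap μ F (.phase z hz) = phaseMap μ G (.phase z hz) := by
  simp only [phaseMap]
  split_ifs with h1 h2 h2
  · congr 1
  · exact absurd (h ▸ h1) h2
  · exact absurd (h.symm ▸ h2) h1
  · rfl

theorem overPos_mono {N N' : Set E3} (h : N ⊆ N') : overPos μ N ⊆ overPos μ N' := by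
  rintro x (⟨z, hz, rfl, hx⟩ | ⟨b, η, hη, rfl, hx⟩)
  exacts [phase_mem_over.2 (h hx), collision_mem_over.2 (h hx)]

theorem eventually_phase (hz : z ∈ phaseSpace μ) {P : E3 × E3 → Prop} (hP : ∀ᶠ z' in 𝓝 z, P z') :
    ∀ᶠ x in 𝓝 (RegPhase.phase z hz), ∃ z' hz', x = .phase z' hz' ∧ P z' := by
  obtain ⟨U, hU, hUo, hzU⟩ := eventually_nhds_iff.1 hP
  filter_upwards [(isOpen_setOf_qp (μ := μ) hUo).mem_nhds ⟨z, hz, rfl, hzU⟩]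
  rintro x ⟨z', hz', rfl, h⟩
  exact ⟨z', hz', rfl, hU z' h⟩

theorem contMDiffAt_phase_mk {E : Type*} [NormedAddCommGroup E] [NormedSpace ℝ E] {g : E → E3 × E3}
    {a : E} (hg : ContDiffAt ℝ ∞ g a) (hga : g a ∈ phaseSpace μ) :
    ContMDiffAt 𝓘(ℝ, E) 𝓘(ℝ, E3 × E3) ∞ (fun v => (chart μ none).symm (g v)) a :=
  ((contMDiffOn_chart_symm' (μ := μ) none).contMDiffAt
    ((chart μ none).open_target.mem_nhds hga)).comp a hg.contMDiffAt

theorem contMDiffAt_comp_chart {E : Type*} [NormedAddCommGroup E] [NormedSpace ℝ E]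
    {g : E3 × E3 → E} (hz : z ∈ phaseSpace μ) (hg : ContDiffAt ℝ ∞ g z) :
    ContMDiffAt 𝓘(ℝ, E3 × E3) 𝓘(ℝ, E) ∞ (fun x => g (chart μ none x)) (.phase z hz) :=
  contMDiffAt_of_chart (i := none) (phase_mem hz) hg (Filter.Eventually.of_forall fun _ => rfl)

theorem contMDiffAt_phaseMap (hz : z ∈ phaseSpace μ) (hF : ContDiffAt ℝ ∞ F z)
    (h : F z ∈ phaseSpace μ) :
    ContMDiffAt 𝓘(ℝ, E3 × E3) 𝓘(ℝ, E3 × E3) ∞ (phaseMap μ F) (.phase z hz) := by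
  have h1 : ContMDiffAt 𝓘(ℝ, E3 × E3) 𝓘(ℝ, E3 × E3) ∞
      (fun x => (chart μ none).symm (F (chart μ none x))) (.phase z hz) :=
    ContMDiffAt.comp (I' := 𝓘(ℝ, E3 × E3)) (RegPhase.phase z hz)
      (g := (chart μ none).symm) (f := fun x => F (chart μ none x))
      ((contMDiffOn_chart_symm' (μ := μ) none).contMDiffAt
        ((chart μ none).open_target.mem_nhds h)) (contMDiffAt_comp_chart hz hF)
  refine h1.congr_of_eventuallyEq ?_
  filter_upwards [eventually_phase hz (hF.continuousAt.eventually
    ((isOpen_phaseSpace μ).mem_nhds h))]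
  rintro x ⟨z', hz', rfl, h'⟩
  rw [phaseMap_phase hz' h', chart_none_phase, chart_none_symm h']

end PhaseMap

/-! ### Reparametrizing levels along the neck -/

/-- `S` is on the part of the neck with axial coordinate larger than `a` given by the transversal
energy `E`. -/
structure IsNeckLevel (μ l R δ : ℝ) (b : Primary) (S : Set (RegPhase μ)) (E : ℝ → ℝ) (a : ℝ) :
    Prop where
  le : -δ ≤ a
  lt : a < 2 * δ
  mem_iff : ∀ z hz, a < side b l z.1 → side b l z.1 < 3 * δ →
    (RegPhase.phase z hz ∈ S ↔
      ‖z.1 - axisPoint l‖ < R ∧ ‖neckTrans μ z‖ ^ 2 = 2 * E (side b l z.1))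
  energy_pos : ∀ s, a < s → s < 3 * δ → 0 < E s
  energy_le : ∀ s, a < s → s < 3 * δ → E s ≤ 5 * axialCurv μ l * δ ^ 2
  smooth : ∀ s, a < s → s < 3 * δ → ContDiffAt ℝ ∞ E s

/-- `ρ` maps the axial coordinates larger than `a₁` to those larger than `a₂`, and it is the
identity from `2 * δ` on. -/
structure IsNeckShift (δ a₁ a₂ : ℝ) (ρ : ℝ → ℝ) : Prop where
  maps : ∀ s, a₁ < s → a₂ < ρ s
  eq_self : ∀ s, 2 * δ ≤ s → ρ s = s
  lt : ∀ s, a₁ < s → s < 2 * δ → ρ s < 2 * δ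
  smooth : ∀ s, a₁ < s → ContDiffAt ℝ ∞ ρ s

/-- The map that changes the axial coordinate by `ρ` and rescales the transversal coordinates
accordingly. -/
def shiftPoint (μ l : ℝ) (f : E3 → E3) (b : Primary) (E₁ E₂ ρ : ℝ → ℝ) (z : E3 × E3) : E3 × E3 :=
  neckPoint f (l - sgn b * ρ (side b l z.1))
    (√(E₂ (ρ (side b l z.1)) / E₁ (side b l z.1)) • neckTrans μ z)

open Classical in
/-- The map `shiftPoint`, extended by the identity beyond the neck. -/
def shiftMap (μ l δ : ℝ) (f : E3 → E3) (b : Primary) (E₁ E₂ ρ : ℝ → ℝ) (z : E3 × E3) : E3 × E3 :=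
  if side b l z.1 < 2 * δ then shiftPoint μ l f b E₁ E₂ ρ z else z

section Shift

variable {μ l R C r₀ δ c a₁ a₂ : ℝ} {f : E3 → E3} {b : Primary} {S₁ S₂ : Set (RegPhase μ)}
  {E₁ E₂ ρ ρ' : ℝ → ℝ} {z : E3 × E3}

theorem side_of_eq (b : Primary) {l s : ℝ} {q : E3} (h : q 0 = l - sgn b * s) :
    side b l q = s := by
  rw [side, h]; linear_combination s * sgn_mul_self b

theorem eq_of_side (b : Primary) (l : ℝ) (q : E3) : q 0 = l - sgn b * side b l q := by
  rw [side]; linear_combination -(q 0 - l) * sgn_mul_self b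

/-- Points with small axial coordinate and transversal energy lie in the chart. -/
theorem IsCapData.chart_bound (H : IsCapData μ l R C r₀ f δ c) (b : Primary) {s e : ℝ} {W : E5}
    (hs : |s| ≤ 3 * δ) (hW : ‖W‖ ^ 2 = 2 * e) (he : e ≤ 5 * axialCurv μ l * δ ^ 2) :
    (l - sgn b * s - l) ^ 2 + ‖W‖ ^ 2 < r₀ ^ 2 := by
  have hA := H.curv_ge
  have hδ := H.width_pos
  have h1 : (l - sgn b * s - l) ^ 2 = s ^ 2 := by linear_combination s ^ 2 * sgn_mul_self b
  have h2 : s ^ 2 ≤ 9 * δ ^ 2 := by rw [← sq_abs]; nlinarith [abs_nonneg s]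
  have h3 : (8 * axialCurv μ l * δ) ^ 2 ≤ r₀ ^ 2 :=
    pow_le_pow_left₀ (by positivity) H.chart_le 2
  have h4 : 9 * (axialCurv μ l * δ ^ 2) ≤ axialCurv μ l * (axialCurv μ l * δ ^ 2) :=
    mul_le_mul_of_nonneg_right hA (by positivity)
  have h5 : 9 * δ ^ 2 ≤ axialCurv μ l * δ ^ 2 := mul_le_mul_of_nonneg_right hA (by positivity)
  have h6 : 0 < δ ^ 2 := by positivity
  rw [h1, hW]
  nlinarith

theorem IsNeckShift.lt_three (hρ : IsNeckShift δ a₁ a₂ ρ) {s : ℝ} (h : a₁ < s)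
    (hs : s < 3 * δ) (hδ : 0 < δ) : ρ s < 3 * δ := by
  rcases lt_or_ge s (2 * δ) with h1 | h1
  · linarith [hρ.lt s h h1]
  · rwa [hρ.eq_self s h1]

/-- The factor √(E₂/E₁) carries the sphere |W|² = 2E₁ onto |W|² = 2E₂. The energy bounds in
`IsNeckLevel` keep the image inside the chart. -/
theorem shiftPoint_spec (H : IsCapData μ l R C r₀ f δ c) (h₁ : IsNeckLevel μ l R δ b S₁ E₁ a₁)
    (h₂ : IsNeckLevel μ l R δ b S₂ E₂ a₂) (hρ : IsNeckShift δ a₁ a₂ ρ) {hz : z ∈ phaseSpace μ}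
    (hzS : RegPhase.phase z hz ∈ S₁) (hs : a₁ < side b l z.1) (hs3 : side b l z.1 < 3 * δ) :
    ‖(shiftPoint μ l f b E₁ E₂ ρ z).1 - axisPoint l‖ < R ∧
      side b l (shiftPoint μ l f b E₁ E₂ ρ z).1 = ρ (side b l z.1) ∧
      neckTrans μ (shiftPoint μ l f b E₁ E₂ ρ z) =
        √(E₂ (ρ (side b l z.1)) / E₁ (side b l z.1)) • neckTrans μ z ∧
      ‖neckTrans μ (shiftPoint μ l f b E₁ E₂ ρ z)‖ ^ 2 = 2 * E₂ (ρ (side b l z.1)) ∧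
      (l - sgn b * ρ (side b l z.1) - l) ^ 2 +
        ‖√(E₂ (ρ (side b l z.1)) / E₁ (side b l z.1)) • neckTrans μ z‖ ^ 2 < r₀ ^ 2 := by
  have hδ := H.width_pos
  have hρ2 := hρ.maps _ hs
  have hρ3 := hρ.lt_three hs hs3 hδ
  have hE1 := h₁.energy_pos _ hs hs3
  have hE2 := h₂.energy_pos _ hρ2 hρ3
  obtain ⟨hzR, hW⟩ := (h₁.mem_iff z hz hs hs3).1 hzS
  have hn : ‖√(E₂ (ρ (side b l z.1)) / E₁ (side b l z.1)) • neckTrans μ z‖ ^ 2 =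
      2 * E₂ (ρ (side b l z.1)) := by
    rw [norm_smul, mul_pow, hW, Real.norm_of_nonneg (Real.sqrt_nonneg _),
      Real.sq_sqrt (div_pos hE2 hE1).le]
    field_simp
  have hb := H.chart_bound b (s := ρ (side b l z.1))
    (abs_le.2 ⟨by linarith [h₂.le], hρ3.le⟩) hn (h₂.energy_le _ hρ2 hρ3)
  obtain ⟨s1, s2, s3⟩ := H.toIsNeckChart.neckPoint_spec hb
  refine ⟨s1, side_of_eq b s2, s3, ?_, hb⟩
  rw [shiftPoint, s3, hn]

theorem shiftPoint_eq_self (H : IsCapData μ l R C r₀ f δ c)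
    (h₁ : IsNeckLevel μ l R δ b S₁ E₁ a₁) (hρ : IsNeckShift δ a₁ a₂ ρ)
    (hE : ∀ s, 2 * δ ≤ s → s < 3 * δ → E₁ s = E₂ s) (hzR : ‖z.1 - axisPoint l‖ < R)
    (hs : 2 * δ ≤ side b l z.1) (hs3 : side b l z.1 < 3 * δ) :
    shiftPoint μ l f b E₁ E₂ ρ z = z := by
  have hE1 := h₁.energy_pos _ (h₁.lt.trans_le hs) hs3
  rw [shiftPoint, hρ.eq_self _ hs, ← hE _ hs hs3, div_self hE1.ne', Real.sqrt_one, one_smul,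
    ← eq_of_side, H.toIsNeckChart.neckPoint_neckTrans hzR]

theorem contDiffAt_shiftPoint (H : IsCapData μ l R C r₀ f δ c)
    (h₁ : IsNeckLevel μ l R δ b S₁ E₁ a₁) (h₂ : IsNeckLevel μ l R δ b S₂ E₂ a₂)
    (hρ : IsNeckShift δ a₁ a₂ ρ) {hz : z ∈ phaseSpace μ} (hzS : RegPhase.phase z hz ∈ S₁)
    (hs : a₁ < side b l z.1) (hs3 : side b l z.1 < 3 * δ) :
    ∀ᶠ z' in 𝓝 z, ContDiffAt ℝ ∞ (shiftPoint μ l f b E₁ E₂ ρ) z' ∧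
      shiftPoint μ l f b E₁ E₂ ρ z' ∈ phaseSpace μ := by
  have hδ := H.width_pos
  obtain ⟨hzR, -⟩ := (h₁.mem_iff z hz hs hs3).1 hzS
  set J : E3 × E3 → ℝ × E5 := fun z => (l - sgn b * ρ (side b l z.1),
    √(E₂ (ρ (side b l z.1)) / E₁ (side b l z.1)) • neckTrans μ z) with hJ
  have hJs : ∀ z' : E3 × E3, a₁ < side b l z'.1 → side b l z'.1 < 3 * δ →
      ‖z'.1 - axisPoint l‖ < R → ContDiffAt ℝ ∞ J z' := by
    intro z' h1 h2 h3
    have c1 : ContDiffAt ℝ ∞ (fun z : E3 × E3 => side b l z.1) z' :=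
      (IsCapData.contDiff_side b l).contDiffAt.comp z' contDiffAt_fst
    have c2 : ContDiffAt ℝ ∞ (fun z : E3 × E3 => ρ (side b l z.1)) z' :=
      ContDiffAt.comp z' (g := ρ) (hρ.smooth _ h1) c1
    have k1 := hρ.maps _ h1
    have k2 := hρ.lt_three h1 h2 hδ
    have c3 : ContDiffAt ℝ ∞ (fun z : E3 × E3 => E₂ (ρ (side b l z.1))) z' :=
      ContDiffAt.comp z' (g := E₂) (h₂.smooth _ k1 k2) c2
    have c4 : ContDiffAt ℝ ∞ (fun z : E3 × E3 => E₁ (side b l z.1)) z' :=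
      ContDiffAt.comp z' (g := E₁) (h₁.smooth _ h1 h2) c1
    have p1 := h₁.energy_pos _ h1 h2
    have p2 := h₂.energy_pos _ k1 k2
    exact (contDiffAt_const.sub (contDiffAt_const.mul c2)).prodMk
      (((c3.div c4 p1.ne').sqrt (div_pos p2 p1).ne').smul
        (H.toIsNeckChart.contDiffAt_neckTrans H.lagrange h3))
  have hcs : Continuous fun z : E3 × E3 => side b l z.1 := (continuous_side b l).comp continuous_fst
  have hcn : Continuous fun z : E3 × E3 => ‖z.1 - axisPoint l‖ := by fun_prop
  have hV : IsOpen {v : ℝ × E5 | (v.1 - l) ^ 2 + ‖v.2‖ ^ 2 < r₀ ^ 2} :=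
    isOpen_lt (by fun_prop) continuous_const
  have hJz := (shiftPoint_spec H h₁ h₂ hρ hzS hs hs3).2.2.2.2
  filter_upwards [hcs.continuousAt.eventually_const_lt hs, hcs.continuousAt.eventually_lt_const hs3,
    hcn.continuousAt.eventually_lt_const hzR,
    (hJs z hs hs3 hzR).continuousAt.eventually (hV.mem_nhds hJz)] with z' h1 h2 h3 h4
  refine ⟨ContDiffAt.comp z' (g := fun v : ℝ × E5 => neckPoint f v.1 v.2)
    (H.toIsNeckChart.contDiffAt_neckPoint h4) (hJs z' h1 h2 h3), ?_⟩
  exact H.toIsNeckChart.mem_phaseSpace H.lagrange (H.toIsNeckChart.neckPoint_spec h4).1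

theorem side_pos (μ l : ℝ) (b : Primary) : side b l (pos μ b) = radius μ l b := by
  have := radius_side μ l b (pos μ b)
  rw [radius_eq, sub_self, mul_zero] at this
  linarith

theorem IsCapData.eq_of_lt_side (H : IsCapData μ l R C r₀ f δ c) {b' : Primary}
    (h : -δ < side b l (pos μ b')) : b' = b := by
  rcases b.eq_or_eq_other b' with h1 | h1
  · exact h1
  · have h2 : side b l (pos μ b') = -radius μ l b' := by
      rw [← side_pos μ l b', ← side_other, h1, Primary.other_other]
    rw [h2] at h
    linarith [H.width_lt b', H.width_pos]

theorem over_lt_subset_over_le {a : ℝ} :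
    overPos μ {q | a < side b l q} ⊆ overPos μ {q | a ≤ side b l q} :=
  overPos_mono fun q (hq : a < side b l q) => show a ≤ side b l q from hq.le

theorem phaseMap_shiftMap_of_far {x : RegPhase μ} (hx : x ∈ overPos μ {q | 2 * δ ≤ side b l q}) :
    phaseMap μ (shiftMap μ l δ f b E₁ E₂ ρ) x = x := by
  rcases hx with ⟨z, hz, rfl, h⟩ | ⟨b', η, hη, rfl, -⟩
  · exact phaseMap_of_eq hz (if_neg (not_lt.2 h))
  · rfl

/-- The part of a level beyond the axial coordinate `a`. -/
def beyond (S : Set (RegPhase μ)) (l : ℝ) (b : Primary) (a : ℝ) : Set (RegPhase μ) :=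
  S ∩ overPos μ {q | a < side b l q}

/-- The two alternatives are relatively open and overlap for axial coordinates between 2δ and 3δ.
Smoothness can thus be checked in the neck coordinates on the first and for the identity on the
second. -/
theorem beyond_cases (H : IsCapData μ l R C r₀ f δ c) (h₁ : IsNeckLevel μ l R δ b S₁ E₁ a₁)
    {x : RegPhase μ} (hx : x ∈ beyond S₁ l b a₁) :
    (∃ z hz, x = .phase z hz ∧ a₁ < side b l z.1 ∧ side b l z.1 < 3 * δ) ∨
      x ∈ overPos μ {q | 2 * δ < side b l q} := by
  have hδ := H.width_pos
  obtain ⟨hxS, ⟨z, hz, rfl, h⟩ | ⟨b', η, hη, rfl, h⟩⟩ := hx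
  · rcases lt_or_ge (side b l z.1) (3 * δ) with h3 | h3
    · exact Or.inl ⟨z, hz, rfl, h, h3⟩
    · refine Or.inr (phase_mem_over.2 ?_)
      change 2 * δ < side b l z.1
      linarith
  · refine Or.inr (collision_mem_over.2 ?_)
    have h' : a₁ < side b l (pos μ b') := h
    obtain rfl := H.eq_of_lt_side (h₁.le.trans_lt h')
    change 2 * δ < side b' l (pos μ b')
    rw [side_pos]
    linarith [H.width_lt b']

theorem mapsTo_shiftMap (H : IsCapData μ l R C r₀ f δ c) (h₁ : IsNeckLevel μ l R δ b S₁ E₁ a₁)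
    (h₂ : IsNeckLevel μ l R δ b S₂ E₂ a₂) (hρ : IsNeckShift δ a₁ a₂ ρ)
    (hfar : ∀ x ∈ overPos μ {q | 2 * δ ≤ side b l q}, x ∈ S₁ → x ∈ S₂) :
    MapsTo (phaseMap μ (shiftMap μ l δ f b E₁ E₂ ρ)) (beyond S₁ l b a₁) (beyond S₂ l b a₂) := by
  have hfar' : ∀ x ∈ beyond S₁ l b a₁, x ∈ overPos μ {q | 2 * δ ≤ side b l q} →
      phaseMap μ (shiftMap μ l δ f b E₁ E₂ ρ) x ∈ beyond S₂ l b a₂ := by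
    intro x hx h
    rw [phaseMap_shiftMap_of_far h]
    refine ⟨hfar x h hx.1, ?_⟩
    rcases h with ⟨z, hz, rfl, h⟩ | ⟨b', η, hη, rfl, h⟩
    · exact phase_mem_over.2 (h₂.lt.trans_le h)
    · exact collision_mem_over.2 (h₂.lt.trans_le h)
  intro x hx
  rcases beyond_cases H h₁ hx with ⟨z, hz, rfl, hs, hs3⟩ | h
  · rcases lt_or_ge (side b l z.1) (2 * δ) with h2 | h2
    · obtain ⟨s1, s2, -, s4, -⟩ := shiftPoint_spec H h₁ h₂ hρ hx.1 hs hs3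
      have hmem := H.toIsNeckChart.mem_phaseSpace H.lagrange s1
      have e : shiftMap μ l δ f b E₁ E₂ ρ z = shiftPoint μ l f b E₁ E₂ ρ z := if_pos h2
      rw [phaseMap_congr (G := shiftPoint μ l f b E₁ E₂ ρ) hz e, phaseMap_phase hz hmem]
      have h3 := hρ.maps _ hs
      have h4 := hρ.lt_three hs hs3 H.width_pos
      refine ⟨(h₂.mem_iff _ hmem (by rwa [s2]) (by rwa [s2])).2 ⟨s1, by rw [s4, s2]⟩,
        phase_mem_over.2 ?_⟩
      change a₂ < side b l _
      rwa [s2]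
    · exact hfar' _ hx (phase_mem_over.2 h2)
  · exact hfar' x hx (over_lt_subset_over_le h)

/-- The definition by cases at 2δ is harmless: from 2δ to 3δ the energies agree and ρ is the
identity, so on the level the shifted point equals the original one. -/
theorem smoothOnSubset_shiftMap (H : IsCapData μ l R C r₀ f δ c)
    (h₁ : IsNeckLevel μ l R δ b S₁ E₁ a₁) (h₂ : IsNeckLevel μ l R δ b S₂ E₂ a₂)
    (hρ : IsNeckShift δ a₁ a₂ ρ) (hE : ∀ s, 2 * δ ≤ s → s < 3 * δ → E₁ s = E₂ s) :
    SmoothOnSubset 𝓘(ℝ, E3 × E3) 𝓘(ℝ, E3 × E3) (phaseMap μ (shiftMap μ l δ f b E₁ E₂ ρ))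
      (beyond S₁ l b a₁) := by
  refine SmoothOnSubset.of_eventually fun x hx => ?_
  rcases beyond_cases H h₁ hx with ⟨z, hz, rfl, hs, hs3⟩ | h
  · refine ⟨phaseMap μ (shiftPoint μ l f b E₁ E₂ ρ), ?_, ?_⟩
    · filter_upwards [eventually_phase hz (contDiffAt_shiftPoint H h₁ h₂ hρ hx.1 hs hs3)]
      rintro x' ⟨z', hz', rfl, h1, h2⟩
      exact contMDiffAt_phaseMap hz' h1 h2
    · have hcs : Continuous fun z : E3 × E3 => side b l z.1 :=
        (continuous_side b l).comp continuous_fst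
      filter_upwards [eventually_phase hz ((hcs.continuousAt.eventually_const_lt hs).and
        (hcs.continuousAt.eventually_lt_const hs3))]
      rintro x' ⟨z', hz', rfl, h1, h2⟩ hx'
      refine phaseMap_congr hz' ?_
      rw [shiftMap]
      split_ifs with h3
      · rfl
      · exact (shiftPoint_eq_self H h₁ hρ hE ((h₁.mem_iff z' hz' h1 h2).1 hx'.1).1
          (not_lt.1 h3) h2).symm
  · refine ⟨id, Filter.Eventually.of_forall fun y => contMDiffAt_id, ?_⟩
    filter_upwards [(isOpen_over (isOpen_lt continuous_const (continuous_side b l))).mem_nhds h]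
      with y hy _
    exact phaseMap_shiftMap_of_far (over_lt_subset_over_le hy)

theorem leftInvOn_shiftMap (H : IsCapData μ l R C r₀ f δ c) (h₁ : IsNeckLevel μ l R δ b S₁ E₁ a₁)
    (h₂ : IsNeckLevel μ l R δ b S₂ E₂ a₂) (hρ : IsNeckShift δ a₁ a₂ ρ)
    (hinv : ∀ s, a₁ < s → ρ' (ρ s) = s) :
    LeftInvOn (phaseMap μ (shiftMap μ l δ f b E₂ E₁ ρ')) (phaseMap μ (shiftMap μ l δ f b E₁ E₂ ρ))
      (beyond S₁ l b a₁) := by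
  have hfar : ∀ x ∈ overPos μ {q | 2 * δ ≤ side b l q},
      phaseMap μ (shiftMap μ l δ f b E₂ E₁ ρ') (phaseMap μ (shiftMap μ l δ f b E₁ E₂ ρ) x) = x := by
    intro x hx
    rw [phaseMap_shiftMap_of_far hx, phaseMap_shiftMap_of_far hx]
  intro x hx
  rcases beyond_cases H h₁ hx with ⟨z, hz, rfl, hs, hs3⟩ | h
  · rcases lt_or_ge (side b l z.1) (2 * δ) with h2 | h2
    · obtain ⟨s1, s2, s3, -, -⟩ := shiftPoint_spec H h₁ h₂ hρ hx.1 hs hs3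
      have hmem := H.toIsNeckChart.mem_phaseSpace H.lagrange s1
      have e : shiftMap μ l δ f b E₁ E₂ ρ z = shiftPoint μ l f b E₁ E₂ ρ z := if_pos h2
      have hE1 := h₁.energy_pos _ hs hs3
      have hE2 := h₂.energy_pos _ (hρ.maps _ hs) (hρ.lt_three hs hs3 H.width_pos)
      have hzR := ((h₁.mem_iff z hz hs hs3).1 hx.1).1
      have e' : shiftMap μ l δ f b E₂ E₁ ρ' (shiftPoint μ l f b E₁ E₂ ρ z) = z := by
        have h3 := hρ.lt _ hs h2
        rw [← s2] at h3
        rw [shiftMap, if_pos h3, shiftPoint, s3, s2, hinv _ hs, smul_smul,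
          ← Real.sqrt_mul (div_pos hE1 hE2).le]
        have e1 : E₁ (side b l z.1) / E₂ (ρ (side b l z.1)) *
            (E₂ (ρ (side b l z.1)) / E₁ (side b l z.1)) = 1 := by field_simp
        rw [e1, Real.sqrt_one, one_smul, ← eq_of_side, H.toIsNeckChart.neckPoint_neckTrans hzR]
      rw [phaseMap_congr (G := shiftPoint μ l f b E₁ E₂ ρ) hz e, phaseMap_phase hz hmem,
        phaseMap_phase hmem (by rwa [e'])]
      congr 1
    · exact hfar _ (phase_mem_over.2 h2)
  · exact hfar x (over_lt_subset_over_le h)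

theorem isDiffeoOn_shiftMap (H : IsCapData μ l R C r₀ f δ c)
    (h₁ : IsNeckLevel μ l R δ b S₁ E₁ a₁) (h₂ : IsNeckLevel μ l R δ b S₂ E₂ a₂)
    (hρ : IsNeckShift δ a₁ a₂ ρ) (hρ' : IsNeckShift δ a₂ a₁ ρ')
    (hinv : ∀ s, a₁ < s → ρ' (ρ s) = s) (hinv' : ∀ s, a₂ < s → ρ (ρ' s) = s)
    (hE : ∀ s, 2 * δ ≤ s → s < 3 * δ → E₁ s = E₂ s)
    (hfar : ∀ x ∈ overPos μ {q | 2 * δ ≤ side b l q}, x ∈ S₁ ↔ x ∈ S₂) :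
    IsDiffeoOn 𝓘(ℝ, E3 × E3) 𝓘(ℝ, E3 × E3) (phaseMap μ (shiftMap μ l δ f b E₁ E₂ ρ))
      (beyond S₁ l b a₁) (beyond S₂ l b a₂) :=
  IsDiffeoOn.of_leftInvOn (smoothOnSubset_shiftMap H h₁ h₂ hρ hE)
    (smoothOnSubset_shiftMap H h₂ h₁ hρ' fun s h h' => (hE s h h').symm)
    (mapsTo_shiftMap H h₁ h₂ hρ fun x hx => (hfar x hx).1)
    (mapsTo_shiftMap H h₂ h₁ hρ' fun x hx => (hfar x hx).2)
    (leftInvOn_shiftMap H h₁ h₂ hρ hinv) (leftInvOn_shiftMap H h₂ h₁ hρ' hinv')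

end Shift


/-! ### The reparametrization of the axial coordinate -/

/-- A function with positive derivative has a smooth inverse. -/
theorem exists_smooth_inverse {σ : ℝ → ℝ} {a a' : ℝ} (hσ : ContDiff ℝ ∞ σ)
    (hpos : ∀ x, a < x → 0 < deriv σ x) (ha : σ a = a')
    (hbig : ∀ y, ∃ x, a ≤ x ∧ y ≤ σ x) :
    ∃ τ : ℝ → ℝ, (∀ y, a' < y → a < τ y ∧ σ (τ y) = y ∧ ContDiffAt ℝ ∞ τ y) ∧
      ∀ x, a < x → τ (σ x) = x := by
  have hmono : StrictMonoOn σ (Ici a) := strictMonoOn_of_deriv_pos (convex_Ici a)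
    hσ.continuous.continuousOn fun x hx => hpos x (by simpa using hx)
  have hex : ∀ y, a' < y → ∃ x, a < x ∧ σ x = y := by
    intro y hy
    obtain ⟨X, hX, hX'⟩ := hbig y
    obtain ⟨x, hx, rfl⟩ := intermediate_value_Icc hX hσ.continuous.continuousOn
      (⟨by rw [ha]; exact hy.le, hX'⟩ : y ∈ Icc (σ a) (σ X))
    refine ⟨x, lt_of_le_of_ne hx.1 ?_, rfl⟩
    rintro rfl
    rw [ha] at hy
    exact lt_irrefl _ hy
  choose! τ hτ using hex
  refine ⟨τ, fun y hy => ⟨(hτ y hy).1, (hτ y hy).2, ?_⟩, fun x hx => ?_⟩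
  · obtain ⟨h1, h2⟩ := hτ y hy
    obtain ⟨τ', h3, h4⟩ := exists_smooth_root (F := fun v : ℝ × ℝ => σ v.2 - v.1) (a := y)
      (t₀ := τ y) (D := deriv σ (τ y))
      (Filter.Eventually.of_forall fun v =>
        ((hσ.comp contDiff_snd).sub contDiff_fst).contDiffAt) (by simp [h2])
      ((hσ.differentiable (by simp) (τ y)).hasDerivAt.sub_const y) (hpos _ h1).ne'
    have h5 := h4.self_of_nhds.1
    refine h5.congr_of_eventuallyEq ?_
    have h6 : ∀ᶠ y' in 𝓝 y, a < τ' y' := h5.continuousAt.eventually_const_lt (by rwa [h3])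
    filter_upwards [h4, h6, eventually_gt_nhds hy] with y' h7 h8 h9
    obtain ⟨k1, k2⟩ := hτ y' h9
    exact hmono.injOn k1.le h8.le (by rw [k2]; linarith [h7.2])
  · have h1 : a' < σ x := by
      rw [← ha]; exact hmono (mem_Ici.2 le_rfl) hx.le hx
    obtain ⟨k1, k2⟩ := hτ _ h1
    exact hmono.injOn k1.le hx.le k2

/-- The axial coordinate on the capped level, as a function of the axial coordinate on the neck. -/
def capShift (δ x : ℝ) : ℝ :=
  (1 - Real.smoothTransition (x / δ - 1)) * (δ / 4 + (x + δ) ^ 2 / (12 * δ)) +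
    Real.smoothTransition (x / δ - 1) * x

section CapShift

variable {δ x : ℝ}

/-- The quadratic is chosen so that x = δ(2t - 1) goes to δ/4 + δt²/3, the axial coordinate at
radius t of the disk `capPoint`. -/
theorem capShift_of_le (hδ : 0 < δ) (hx : x ≤ δ) :
    capShift δ x = δ / 4 + (x + δ) ^ 2 / (12 * δ) := by
  rw [capShift, Real.smoothTransition.zero_of_nonpos (by rwa [sub_nonpos, div_le_one hδ])]
  ring

theorem capShift_of_ge (hδ : 0 < δ) (hx : 2 * δ ≤ x) : capShift δ x = x := by
  rw [capShift, Real.smoothTransition.one_of_one_le (by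
    have : 2 ≤ x / δ := by rwa [le_div_iff₀ hδ]
    linarith)]
  ring

theorem contDiff_capShift (δ : ℝ) : ContDiff ℝ ∞ (capShift δ) := by
  have h1 : ContDiff ℝ ∞ fun x : ℝ => Real.smoothTransition (x / δ - 1) :=
    Real.smoothTransition.contDiff.comp ((contDiff_id.div_const δ).sub contDiff_const)
  exact ((contDiff_const.sub h1).mul (contDiff_const.add
    (((contDiff_id.add contDiff_const).pow 2).div_const _))).add (h1.mul contDiff_id)

theorem capShift_deriv_pos (hδ : 0 < δ) (hx : -δ < x) : 0 < deriv (capShift δ) x := by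
  set S : ℝ → ℝ := fun x => Real.smoothTransition (x / δ - 1) with hS
  have hSs : ContDiff ℝ ∞ S :=
    Real.smoothTransition.contDiff.comp ((contDiff_id.div_const δ).sub contDiff_const)
  have hSm : Monotone S := fun x y h => Real.smoothTransition.monotone (by gcongr)
  have hSd : HasDerivAt S (deriv S x) x := (hSs.differentiable (by simp) x).hasDerivAt
  have hd0 : 0 ≤ deriv S x := hSm.deriv_nonneg
  have hS0 : 0 ≤ S x := Real.smoothTransition.nonneg _
  have hS1 : S x ≤ 1 := Real.smoothTransition.le_one _
  have hB : HasDerivAt (fun x : ℝ => δ / 4 + (x + δ) ^ 2 / (12 * δ)) ((x + δ) / (6 * δ)) x := by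
    refine (((((hasDerivAt_id x).add_const δ).pow 2).div_const (12 * δ)).const_add
      (δ / 4)).congr_deriv ?_
    simp only [id, Nat.cast_ofNat, Nat.add_one_sub_one, pow_one, mul_one]
    field_simp
    ring
  have h := ((hSd.const_sub 1).mul hB).add (hSd.mul (hasDerivAt_id x))
  have e : deriv (capShift δ) x = deriv S x * (x - (δ / 4 + (x + δ) ^ 2 / (12 * δ))) +
      ((1 - S x) * ((x + δ) / (6 * δ)) + S x) := by
    refine HasDerivAt.deriv (h.congr_deriv ?_)
    simp only [id]
    ring
  rw [e]
  have h1 : 0 < (x + δ) / (6 * δ) := div_pos (by linarith) (by linarith)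
  -- The step varies only on [δ, 2δ], where the identity lies above the quadratic; passing from the
  -- latter to the former only helps monotonicity.
  have h2 : 0 ≤ deriv S x * (x - (δ / 4 + (x + δ) ^ 2 / (12 * δ))) := by
    rcases lt_or_ge x δ with hx1 | hx1
    · have : S =ᶠ[𝓝 x] fun _ => 0 := by
        filter_upwards [eventually_lt_nhds hx1] with y hy
        exact Real.smoothTransition.zero_of_nonpos (by
          rw [sub_nonpos, div_le_one hδ]; exact hy.le)
      rw [this.deriv_eq]; simp
    rcases lt_or_ge (2 * δ) x with hx2 | hx2
    · have : S =ᶠ[𝓝 x] fun _ => 1 := by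
        filter_upwards [eventually_gt_nhds hx2] with y hy
        refine Real.smoothTransition.one_of_one_le ?_
        have : 2 ≤ y / δ := by rw [le_div_iff₀ hδ]; exact hy.le
        linarith
      rw [this.deriv_eq]; simp
    · refine mul_nonneg hd0 ?_
      have : (x + δ) ^ 2 / (12 * δ) ≤ 3 / 4 * δ := by
        rw [div_le_iff₀ (by positivity)]
        nlinarith
      have h3 : (x + δ) ^ 2 / (12 * δ) ≤ x - δ / 4 := by
        rw [div_le_iff₀ (by positivity)]
        nlinarith
      linarith
  rcases hS0.eq_or_lt with h3 | h3
  · rw [← h3] at *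
    linarith
  · have := mul_nonneg (sub_nonneg.2 hS1) h1.le
    linarith

theorem exists_capShift_inverse (hδ : 0 < δ) : ∃ τ, IsNeckShift δ (-δ) (δ / 4) (capShift δ) ∧
    IsNeckShift δ (δ / 4) (-δ) τ ∧ (∀ s, -δ < s → τ (capShift δ s) = s) ∧
      ∀ s, δ / 4 < s → capShift δ (τ s) = s := by
  have h0 : capShift δ (-δ) = δ / 4 := by rw [capShift_of_le hδ (by linarith)]; simp
  obtain ⟨τ, h1, h2⟩ := exists_smooth_inverse (contDiff_capShift δ)
    (fun x hx => capShift_deriv_pos hδ hx) h0 (fun y => ⟨max y (2 * δ), by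
      refine le_trans ?_ (le_max_right _ _); linarith, by
      rw [capShift_of_ge hδ (le_max_right _ _)]; exact le_max_left _ _⟩)
  have hmono : StrictMonoOn (capShift δ) (Ici (-δ)) := strictMonoOn_of_deriv_pos (convex_Ici _)
    (contDiff_capShift δ).continuous.continuousOn fun x hx =>
      capShift_deriv_pos hδ (by simpa using hx)
  have h3 : capShift δ (2 * δ) = 2 * δ := capShift_of_ge hδ le_rfl
  refine ⟨τ, ⟨fun s hs => ?_, fun s hs => capShift_of_ge hδ hs, fun s hs hs2 => ?_,
    fun s _ => (contDiff_capShift δ).contDiffAt⟩, ⟨fun s hs => (h1 s hs).1, fun s hs => ?_,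
    fun s hs hs2 => ?_, fun s hs => (h1 s hs).2.2⟩, h2, fun s hs => (h1 s hs).2.1⟩
  · rw [← h0]; exact hmono (mem_Ici.2 le_rfl) hs.le hs
  · rw [← h3]; exact hmono hs.le (by rw [mem_Ici]; linarith) hs2
  · have := h2 s (by linarith)
    rwa [capShift_of_ge hδ hs] at this
  · by_contra hcon
    rw [not_lt] at hcon
    have := (h1 s hs).2.1
    rw [capShift_of_ge hδ hcon] at this
    linarith

end CapShift

/-! ### The neck and the caps as levels -/

namespace IsCapData

variable {μ l R C r₀ δ c s : ℝ} {f : E3 → E3} {q : E3} {b : Primary} {z : E3 × E3}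

/-- The content is that a point satisfying the energy equation with s > 0 automatically lies in the
ball around b. By the linear bound `capEnergy_le`, its squared distance from the axis is at most
3Aδs, well below 2rs - s². -/
theorem mem_capLevel_iff (H : IsCapData μ l R C r₀ f δ c) (hz : z ∈ phaseSpace μ)
    (hs : side b l z.1 < 3 * δ) : RegPhase.phase z hz ∈
      surf μ (capPot μ l b c δ) c (Metric.ball (pos μ b) (radius μ l b)) ↔
      0 < side b l z.1 ∧ ‖z.1 - axisPoint l‖ < R ∧
        ‖neckTrans μ z‖ ^ 2 = 2 * capEnergy μ l b c δ (side b l z.1) := by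
  have hr := H.lagrange.radius_mem b
  rw [phase_mem_surf]
  constructor
  · rintro ⟨h1, h2⟩
    have h3 := H.norm_lt_of_mem_ball h1 hs
    rw [H.modHam_capPot h3] at h2
    exact ⟨(side_pos_of_mem_ball hr.1 h1).1, h3, by linarith⟩
  · rintro ⟨h1, h2, h3⟩
    refine ⟨?_, by rw [H.modHam_capPot h2, h3]; ring⟩
    have h4 := axisSq_le_neckTrans (H.trans _ h2)
    have h5 := H.capEnergy_le b h1.le hs
    have h6 := H.width_le b
    have hA := H.curv_ge
    have hδ := H.width_pos
    rw [mem_ball_iff_norm]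
    refine lt_of_pow_lt_pow_left₀ 2 hr.1.le ?_
    rw [norm_sub_pos_sq, radius_side μ l]
    have h7 : axisSq z.1 ≤ 3 * axialCurv μ l * δ * side b l z.1 := by
      have : 0 ≤ axialCurv μ l * δ * side b l z.1 := by positivity
      nlinarith [sq_nonneg (z.2 0 + z.1 1), sq_nonneg (z.2 1 - z.1 0)]
    have h8 : 9 * δ ≤ axialCurv μ l * δ := mul_le_mul_of_nonneg_right hA hδ.le
    have h9 : 0 < side b l z.1 * (2 * radius μ l b - 3 * axialCurv μ l * δ - side b l z.1) :=
      mul_pos h1 (by linarith)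
    nlinarith

theorem mem_neckLevel_iff (H : IsCapData μ l R C r₀ f δ c) (hz : z ∈ phaseSpace μ)
    (hs : |side b l z.1| < 3 * δ) : RegPhase.phase z hz ∈ surf μ 0 c (neckDomain μ l δ) ↔
      ‖z.1 - axisPoint l‖ < R ∧
        ‖neckTrans μ z‖ ^ 2 = 2 * sideEnergy μ l b c (side b l z.1) := by
  have hδ := H.width_pos
  rw [phase_mem_surf]
  constructor
  · rintro ⟨h1, h2⟩
    rw [abs_side] at hs
    have h3 := norm_lt_of_mem_neckDomain H.lagrange h1 H.size_pos (by linarith [H.three_lt])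
      (by linarith [H.six_le])
    rw [H.modHam_zero b h3] at h2
    exact ⟨h3, by linarith⟩
  · rintro ⟨h1, h2⟩
    have h3 : modHam μ 0 z = c := by rw [H.modHam_zero b h1, h2]; ring
    refine ⟨H.toIsNeckRadius.mem_neckDomain_of_le H.lagrange hδ h1 (c := c) ?_ ?_, h3⟩
    · have := potential_le_hamiltonian μ z
      simp only [modHam, Pi.zero_apply, add_zero] at h3
      linarith
    · nlinarith [H.energy_le]

theorem isNeckLevel_cap (H : IsCapData μ l R C r₀ f δ c) (b : Primary) :
    IsNeckLevel μ l R δ b (surf μ (capPot μ l b c δ) c (Metric.ball (pos μ b) (radius μ l b)))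
      (capEnergy μ l b c δ) (δ / 4) := by
  have hδ := H.width_pos
  have habs : ∀ s, δ / 4 < s → s < 3 * δ → |s| < 3 * δ := fun s h1 h2 => by
    rwa [abs_of_pos (by linarith)]
  refine ⟨by linarith, by linarith, fun z hz h1 h2 => ?_, fun s h1 h2 => ?_, fun s h1 h2 => ?_,
    fun s h1 h2 => ?_⟩
  · rw [H.mem_capLevel_iff hz h2]
    exact and_iff_right (by linarith)
  · exact H.capEnergy_pos b ((habs s h1 h2).trans H.three_lt) h1
  · exact (H.energy_bound b (habs s h1 h2)).2
  · exact H.contDiffAt_capEnergy b ((habs s h1 h2).trans H.three_lt)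

theorem isNeckLevel_neck (H : IsCapData μ l R C r₀ f δ c) (b : Primary) :
    IsNeckLevel μ l R δ b (surf μ 0 c (neckDomain μ l δ)) (sideEnergy μ l b c) (-δ) := by
  have hδ := H.width_pos
  have habs : ∀ s, -δ < s → s < 3 * δ → |s| < 3 * δ := fun s h1 h2 =>
    abs_lt.2 ⟨by linarith, h2⟩
  refine ⟨le_rfl, by linarith, fun z hz h1 h2 => ?_, fun s h1 h2 => ?_, fun s h1 h2 => ?_,
    fun s h1 h2 => ?_⟩
  · exact H.mem_neckLevel_iff hz (habs _ h1 h2)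
  · exact H.sideEnergy_pos b ((habs s h1 h2).trans H.three_lt)
  · exact (H.energy_bound b (habs s h1 h2)).1
  · exact H.contDiffAt_sideEnergy b ((habs s h1 h2).trans H.three_lt)

theorem mem_cap_iff_mem_neck (H : IsCapData μ l R C r₀ f δ c) {x : RegPhase μ}
    (hx : x ∈ overPos μ {q | 2 * δ ≤ side b l q}) :
    x ∈ surf μ (capPot μ l b c δ) c (Metric.ball (pos μ b) (radius μ l b)) ↔
      x ∈ surf μ 0 c (neckDomain μ l δ) := by
  have hδ := H.width_pos
  rcases hx with ⟨z, hz, rfl, h⟩ | ⟨b', η, hη, rfl, h⟩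
  · have h : 2 * δ ≤ side b l z.1 := h
    rw [phase_mem_surf, phase_mem_surf, modHam, modHam, H.capPot_of_ge (by linarith)]
    refine and_congr_left fun _ => ⟨fun h' => Or.inl ⟨b, h'⟩, fun h' => ?_⟩
    exact mem_ball_of_side H.lagrange h' (by linarith) (by linarith)
  · have h : 2 * δ ≤ side b l (pos μ b') := h
    obtain rfl := H.eq_of_lt_side (by linarith : -δ < side b l (pos μ b'))
    rw [collision_mem_surf, collision_mem_surf]
    have hb : pos μ b' ∈ Metric.ball (pos μ b') (radius μ l b') :=
      Metric.mem_ball_self (H.lagrange.radius_mem b').1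
    exact and_congr_left fun _ => ⟨fun h' => Or.inl ⟨b', h'⟩, fun _ => hb⟩

/-- The embedding of the capped level without the tip of the cap into the hypersurface around both
primaries. -/
theorem isDiffeoOn_uncap (H : IsCapData μ l R C r₀ f δ c) (b : Primary) {τ : ℝ → ℝ}
    (hσ : IsNeckShift δ (-δ) (δ / 4) (capShift δ)) (hτ : IsNeckShift δ (δ / 4) (-δ) τ)
    (h1 : ∀ s, -δ < s → τ (capShift δ s) = s) (h2 : ∀ s, δ / 4 < s → capShift δ (τ s) = s) :
    IsDiffeoOn 𝓘(ℝ, E3 × E3) 𝓘(ℝ, E3 × E3)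
      (phaseMap μ (shiftMap μ l δ f b (capEnergy μ l b c δ) (sideEnergy μ l b c) τ))
      (beyond (surf μ (capPot μ l b c δ) c (Metric.ball (pos μ b) (radius μ l b))) l b (δ / 4))
      (beyond (surf μ 0 c (neckDomain μ l δ)) l b (-δ)) :=
  isDiffeoOn_shiftMap H (H.isNeckLevel_cap b) (H.isNeckLevel_neck b) hτ hσ h2 h1
    (fun _ hs _ => H.capEnergy_of_ge (by linarith [H.width_pos]))
    (fun _ hx => H.mem_cap_iff_mem_neck hx)

end IsCapData


/-! ### Connected sums are invariant under diffeomorphisms -/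

section Transport

variable {E H M : Type*} [NormedAddCommGroup E] [NormedSpace ℝ E] [TopologicalSpace H]
  {I : ModelWithCorners ℝ E H} [TopologicalSpace M] [ChartedSpace H M]
  {E' H' M' : Type*} [NormedAddCommGroup E'] [NormedSpace ℝ E'] [TopologicalSpace H']
  {I' : ModelWithCorners ℝ E' H'} [TopologicalSpace M'] [ChartedSpace H' M']
  {E'' H'' M'' : Type*} [NormedAddCommGroup E''] [NormedSpace ℝ E''] [TopologicalSpace H'']
  {I'' : ModelWithCorners ℝ E'' H''} [TopologicalSpace M''] [ChartedSpace H'' M'']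
  {E₁ H₁ M₁ : Type*} [NormedAddCommGroup E₁] [NormedSpace ℝ E₁] [TopologicalSpace H₁]
  {I₁ : ModelWithCorners ℝ E₁ H₁} [TopologicalSpace M₁] [ChartedSpace H₁ M₁]
  {E₂ H₂ M₂ : Type*} [NormedAddCommGroup E₂] [NormedSpace ℝ E₂] [TopologicalSpace H₂]
  {I₂ : ModelWithCorners ℝ E₂ H₂} [TopologicalSpace M₂] [ChartedSpace H₂ M₂]

theorem IsOpenDiffeoInto.mapsTo {f : M → M'} {S : Set M} {T : Set M'}
    (h : IsOpenDiffeoInto I I' f S T) : MapsTo f S T := by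
  obtain ⟨O, -, h⟩ := h
  exact fun x hx => (h.1.mapsTo hx).1

theorem IsDiffeoOn.diff_singleton {f : M → M'} {S : Set M} {T : Set M'} {x : M}
    (h : IsDiffeoOn I I' f S T) (hx : x ∈ S) :
    IsDiffeoOn I I' f (S \ {x}) (T \ {f x}) := by
  have := h.restrict (S' := S \ {x}) sdiff_subset
  rwa [h.1.injOn.image_sdiff_subset (by simpa using hx), image_singleton, h.1.image_eq] at this

theorem IsConnectedSum.of_isDiffeoOn {n : ℕ} {A : Set M} {B : Set M'} {N : Set M''} {A' : Set M₁}
    {B' : Set M₂} {F : M → M₁} {G : M' → M₂} (h : IsConnectedSum I I' I'' n A B N)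
    (hF : IsDiffeoOn I I₁ F A A') (hG : IsDiffeoOn I' I₂ G B B') :
    IsConnectedSum I₁ I₂ I'' n A' B' N := by
  obtain ⟨φ, ψ, i, j, hφ, hψ, hi, hj, h1, h2, h3⟩ := h
  obtain ⟨F', hF', hFl, hFr⟩ := hF.exists_inverse
  obtain ⟨G', hG', hGl, hGr⟩ := hG.exists_inverse
  have h0 : (0 : EuclideanSpace ℝ (Fin n)) ∈ Metric.ball (0 : EuclideanSpace ℝ (Fin n)) 1 := by simp
  have hφ0 : φ 0 ∈ A := hφ.mapsTo h0
  have hψ0 : ψ 0 ∈ B := hψ.mapsTo h0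
  have hFd := hF'.diff_singleton (hF.1.mapsTo hφ0)
  have hGd := hG'.diff_singleton (hG.1.mapsTo hψ0)
  rw [hFl hφ0] at hFd
  rw [hGl hψ0] at hGd
  have eF : (i ∘ F') '' (A' \ {F (φ 0)}) = i '' (A \ {φ 0}) := by
    rw [image_comp, hFd.1.image_eq]
  have eG : (j ∘ G') '' (B' \ {G (ψ 0)}) = j '' (B \ {ψ 0}) := by
    rw [image_comp, hGd.1.image_eq]
  refine ⟨F ∘ φ, G ∘ ψ, i ∘ F', j ∘ G', IsOpenDiffeoInto.comp hF hφ, IsOpenDiffeoInto.comp hG hψ,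
    ?_, ?_, ?_, ?_, ?_⟩
  · obtain ⟨O, hO, hi⟩ := hi
    exact ⟨O, hO, hi.comp hFd⟩
  · obtain ⟨O, hO, hj⟩ := hj
    exact ⟨O, hO, hj.comp hGd⟩
  · rw [Function.comp_apply, Function.comp_apply, eF, eG, h1]
  · rw [Function.comp_apply, Function.comp_apply, eF, eG, h2, image_comp, image_comp F φ]
    congr 1
    rw [← image_comp]
    refine ((image_congr ?_).trans (image_id _)).symm
    rintro _ ⟨w, hw, rfl⟩
    exact hFl (hφ.mapsTo hw.1)
  · intro v hv t ht
    have m1 : t • v ∈ Metric.ball (0 : EuclideanSpace ℝ (Fin n)) 1 := by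
      rw [mem_ball_zero_iff, norm_smul, hv, mul_one, Real.norm_of_nonneg ht.1.le]
      exact ht.2
    have m2 : (1 - t) • v ∈ Metric.ball (0 : EuclideanSpace ℝ (Fin n)) 1 := by
      rw [mem_ball_zero_iff, norm_smul, hv, mul_one, Real.norm_of_nonneg (by linarith [ht.2])]
      linarith [ht.1]
    simp only [Function.comp_apply]
    rw [hFl (hφ.mapsTo m1), hGl (hψ.mapsTo m2), h3 v hv t ht]

end Transport

/-! ### The connected sum decomposition -/

/-- The coordinate ball around the tip of the cap. -/
def capPoint (l δ : ℝ) (f : E3 → E3) (b : Primary) (w : E5) : E3 × E3 :=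
  neckPoint f (l - sgn b * (δ / 4 + δ / 3 * ‖w‖ ^ 2)) ((δ * √(8 / 3)) • w)

/-- The coordinate ball around the tip of the cap, in the regularized phase space. -/
def capDisk (μ l δ : ℝ) (f : E3 → E3) (b : Primary) (w : E5) : RegPhase μ :=
  (chart μ none).symm (capPoint l δ f b w)

namespace IsCapData

variable {μ l R C r₀ δ c s : ℝ} {f : E3 → E3} {q : E3} {b : Primary} {z : E3 × E3} {w : E5}

theorem capPoint_bound (H : IsCapData μ l R C r₀ f δ c) (b : Primary) (hw : ‖w‖ < 1) :
    (l - sgn b * (δ / 4 + δ / 3 * ‖w‖ ^ 2) - l) ^ 2 + ‖(δ * √(8 / 3)) • w‖ ^ 2 < r₀ ^ 2 := by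
  have hδ := H.width_pos
  have h1 : ‖w‖ ^ 2 ≤ 1 := pow_le_one₀ (norm_nonneg _) hw.le
  have h2 : 0 ≤ δ / 3 * ‖w‖ ^ 2 := by positivity
  have h3 : δ / 3 * ‖w‖ ^ 2 ≤ δ / 3 := mul_le_of_le_one_right (by positivity) h1
  refine H.chart_bound b (e := 4 / 3 * δ ^ 2 * ‖w‖ ^ 2) (by rw [abs_of_nonneg] <;> linarith) ?_ ?_
  · rw [norm_smul, mul_pow, Real.norm_of_nonneg (by positivity), mul_pow,
      Real.sq_sqrt (by norm_num)]
    ring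
  · have h4 : 9 * δ ^ 2 ≤ axialCurv μ l * δ ^ 2 :=
      mul_le_mul_of_nonneg_right H.curv_ge (sq_nonneg δ)
    nlinarith [sq_nonneg δ]

theorem contDiffAt_capPoint (H : IsCapData μ l R C r₀ f δ c) (b : Primary) (hw : ‖w‖ < 1) :
    ContDiffAt ℝ ∞ (capPoint l δ f b) w := by
  have h1 : ContDiffAt ℝ ∞ (fun w : E5 => l - sgn b * (δ / 4 + δ / 3 * ‖w‖ ^ 2)) w :=
    contDiffAt_const.sub (contDiffAt_const.mul (contDiffAt_const.add
      (contDiffAt_const.mul (contDiff_id.norm_sq ℝ).contDiffAt)))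
  have h2 : ContDiffAt ℝ ∞ (fun w : E5 => (δ * √(8 / 3)) • w) w :=
    contDiffAt_id.const_smul _
  have h3 : ContDiffAt ℝ ∞ (fun w : E5 =>
      (l - sgn b * (δ / 4 + δ / 3 * ‖w‖ ^ 2), (δ * √(8 / 3)) • w)) w := h1.prodMk h2
  have h4 := H.toIsNeckChart.contDiffAt_neckPoint (H.capPoint_bound b hw)
  exact ContDiffAt.comp w h4 h3

/-- The constants fit the cap: at s = δ/4 + δ|w|²/3 twice the available energy 4δs - δ² equals
8δ²|w|²/3, the squared norm of the transversal coordinates. So the point lies on the capped level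
and w is a coordinate even at the tip. -/
theorem capPoint_spec (H : IsCapData μ l R C r₀ f δ c) (b : Primary) (hw : ‖w‖ < 1) :
    capPoint l δ f b w ∈ phaseSpace μ ∧ ‖(capPoint l δ f b w).1 - axisPoint l‖ < R ∧
      side b l (capPoint l δ f b w).1 = δ / 4 + δ / 3 * ‖w‖ ^ 2 ∧
      neckTrans μ (capPoint l δ f b w) = (δ * √(8 / 3)) • w := by
  obtain ⟨h1, h2, h3⟩ := H.toIsNeckChart.neckPoint_spec (H.capPoint_bound b hw)
  exact ⟨H.toIsNeckChart.mem_phaseSpace H.lagrange h1, h1, side_of_eq b h2, h3⟩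

theorem capDisk_eq (H : IsCapData μ l R C r₀ f δ c) (b : Primary) (hw : ‖w‖ < 1) :
    capDisk μ l δ f b w = .phase (capPoint l δ f b w) (H.capPoint_spec b hw).1 :=
  chart_none_symm (H.capPoint_spec b hw).1

theorem side_lt_of_mem_cap (H : IsCapData μ l R C r₀ f δ c) {x : RegPhase μ} {a : ℝ}
    (ha : a ≤ 3 * δ)
    (hx : x ∈ surf μ (capPot μ l b c δ) c (Metric.ball (pos μ b) (radius μ l b)))
    (hxa : x ∈ overPos μ {q | side b l q < a}) : ∃ z hz, x = .phase z hz ∧ side b l z.1 < a := by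
  rcases hxa with ⟨z, hz, rfl, h⟩ | ⟨b', η, hη, rfl, h⟩
  · exact ⟨z, hz, rfl, h⟩
  · have h : side b l (pos μ b') < a := h
    rw [collision_mem_surf] at hx
    obtain rfl := (H.isStarLevel b).eq_of_pos_mem hx.1
    rw [side_pos] at h
    linarith [H.width_lt b', H.width_pos]

theorem isOpenDiffeoInto_capDisk (H : IsCapData μ l R C r₀ f δ c) (b : Primary) :
    IsOpenDiffeoInto 𝓘(ℝ, E5) 𝓘(ℝ, E3 × E3) (capDisk μ l δ f b) (Metric.ball 0 1)
      (surf μ (capPot μ l b c δ) c (Metric.ball (pos μ b) (radius μ l b))) := by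
  have hδ := H.width_pos
  have hκ : 0 < δ * √(8 / 3) := by positivity
  have hκ2 : (δ * √(8 / 3)) ^ 2 = 8 / 3 * δ ^ 2 := by
    rw [mul_pow, Real.sq_sqrt (by norm_num)]; ring
  -- 7/12 = 1/4 + 1/3 is the axial coordinate at |w| = 1, in units of δ; it lies below 3/4, where
  -- the step of the cap begins.
  refine ⟨overPos μ {q | side b l q < 7 * δ / 12},
    isOpen_over (isOpen_lt (continuous_side b l) continuous_const), ?_⟩
  refine IsDiffeoOn.of_leftInvOn
    (g := fun x => (δ * √(8 / 3))⁻¹ • neckTrans μ (chart μ none x)) ?_ ?_ ?_ ?_ ?_ ?_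
  · refine SmoothOnSubset.of_eventually fun w hw => ⟨capDisk μ l δ f b, ?_, ?_⟩
    · filter_upwards [Metric.isOpen_ball.mem_nhds hw] with w' hw'
      rw [mem_ball_zero_iff] at hw'
      exact contMDiffAt_phase_mk (H.contDiffAt_capPoint b hw') (H.capPoint_spec b hw').1
    · exact Filter.Eventually.of_forall fun _ _ => rfl
  · refine SmoothOnSubset.of_eventually fun x hx =>
      ⟨fun x => (δ * √(8 / 3))⁻¹ • neckTrans μ (chart μ none x), ?_,
        Filter.Eventually.of_forall fun _ _ => rfl⟩
    obtain ⟨z, hz, rfl, hs⟩ := H.side_lt_of_mem_cap (by linarith) hx.1 hx.2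
    have hzR := ((H.mem_capLevel_iff hz (by linarith)).1 hx.1).2.1
    have hcn : Continuous fun z : E3 × E3 => ‖z.1 - axisPoint l‖ := by fun_prop
    filter_upwards [eventually_phase hz (hcn.continuousAt.eventually_lt_const hzR)]
    rintro x' ⟨z', hz', rfl, h'⟩
    exact contMDiffAt_comp_chart (g := fun z => (δ * √(8 / 3))⁻¹ • neckTrans μ z) hz'
      ((H.toIsNeckChart.contDiffAt_neckTrans H.lagrange h').const_smul _)
  · intro w hw
    rw [mem_ball_zero_iff] at hw
    obtain ⟨h1, h2, h3, h4⟩ := H.capPoint_spec b hw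
    have hw2 : ‖w‖ ^ 2 < 1 := pow_lt_one₀ (norm_nonneg _) hw two_ne_zero
    rw [H.capDisk_eq b hw]
    have h5 : δ / 3 * ‖w‖ ^ 2 < δ / 3 := mul_lt_of_lt_one_right (by positivity) hw2
    have h6 : 0 ≤ δ / 3 * ‖w‖ ^ 2 := by positivity
    refine ⟨(H.mem_capLevel_iff h1 (by rw [h3]; linarith)).2 ⟨by rw [h3]; positivity, h2, ?_⟩,
      phase_mem_over.2 ?_⟩
    · rw [h4, h3, norm_smul, mul_pow, Real.norm_of_nonneg hκ.le, hκ2,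
        H.capEnergy_of_le (by linarith)]
      ring
    · change side b l _ < _
      rw [h3]; linarith
  · intro x hx
    obtain ⟨z, hz, rfl, hs⟩ := H.side_lt_of_mem_cap (by linarith) hx.1 hx.2
    obtain ⟨h1, h2, h3⟩ := (H.mem_capLevel_iff hz (by linarith)).1 hx.1
    rw [H.capEnergy_of_le (by linarith)] at h3
    simp only [mem_ball_zero_iff, chart_none_phase]
    refine lt_of_pow_lt_pow_left₀ 2 zero_le_one ?_
    rw [norm_smul, mul_pow, h3, Real.norm_of_nonneg (by positivity), inv_pow, hκ2, one_pow,
      inv_mul_lt_iff₀ (by positivity)]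
    nlinarith
  · intro w hw
    rw [mem_ball_zero_iff] at hw
    simp only
    rw [H.capDisk_eq b hw, chart_none_phase, (H.capPoint_spec b hw).2.2.2, smul_smul,
      inv_mul_cancel₀ hκ.ne', one_smul]
  · intro x hx
    obtain ⟨z, hz, rfl, hs⟩ := H.side_lt_of_mem_cap (by linarith) hx.1 hx.2
    obtain ⟨h1, h2, h3⟩ := (H.mem_capLevel_iff hz (by linarith)).1 hx.1
    rw [H.capEnergy_of_le (by linarith)] at h3
    have e : capPoint l δ f b ((δ * √(8 / 3))⁻¹ • neckTrans μ z) = z := by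
      have e1 : δ / 4 + δ / 3 * ‖(δ * √(8 / 3))⁻¹ • neckTrans μ z‖ ^ 2 = side b l z.1 := by
        rw [norm_smul, mul_pow, h3, Real.norm_of_nonneg (by positivity), inv_pow, hκ2]
        field_simp
        ring
      rw [capPoint, e1, smul_smul, mul_inv_cancel₀ hκ.ne', one_smul, ← eq_of_side,
        H.toIsNeckChart.neckPoint_neckTrans h2]
    simp only [chart_none_phase]
    rw [capDisk, e, chart_none_symm hz]

/-- For s < δ/4 the available energy is negative and the level is empty; at s = δ/4 it is zero,
which forces vanishing transversal coordinates and leaves only the tip. -/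
theorem cap_diff_tip (H : IsCapData μ l R C r₀ f δ c) (b : Primary) :
    surf μ (capPot μ l b c δ) c (Metric.ball (pos μ b) (radius μ l b)) \ {capDisk μ l δ f b 0} =
      beyond (surf μ (capPot μ l b c δ) c (Metric.ball (pos μ b) (radius μ l b))) l b (δ / 4) := by
  have hδ := H.width_pos
  have h0 : ‖(0 : E5)‖ < 1 := by simp
  obtain ⟨t1, t2, t3, t4⟩ := H.capPoint_spec b h0
  ext x
  refine and_congr_right fun hx => ?_
  rw [mem_singleton_iff, H.capDisk_eq b h0]
  constructor
  · intro hne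
    by_contra hcon
    rcases hx with ⟨z, hz, rfl, h⟩ | ⟨b', η, hη, rfl, h, -⟩
    · rw [phase_mem_over] at hcon
      have hs : side b l z.1 ≤ δ / 4 := not_lt.1 hcon
      obtain ⟨h1, h2, h3⟩ := (H.mem_capLevel_iff hz (by linarith)).1 (phase_mem_surf.2 h)
      rw [H.capEnergy_of_le (by linarith)] at h3
      have hs' : side b l z.1 = δ / 4 := by
        refine le_antisymm hs (not_lt.1 fun hlt => ?_)
        nlinarith [sq_nonneg ‖neckTrans μ z‖]
      have hW : neckTrans μ z = 0 := by
        rw [← norm_eq_zero, ← pow_eq_zero_iff two_ne_zero, h3, hs']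
        ring
      have e : capPoint l δ f b 0 = z := by
        rw [capPoint, norm_zero, smul_zero, ← hW]
        rw [show δ / 4 + δ / 3 * 0 ^ 2 = side b l z.1 by rw [hs']; ring, ← eq_of_side,
          H.toIsNeckChart.neckPoint_neckTrans h2]
      refine hne ?_
      congr 1
      exact e.symm
    · obtain rfl := (H.isStarLevel b).eq_of_pos_mem h
      refine hcon (collision_mem_over.2 ?_)
      change δ / 4 < side b' l (pos μ b')
      rw [side_pos]
      linarith [H.width_lt b']
  · rintro hb rfl
    rw [phase_mem_over] at hb
    have hb : δ / 4 < side b l (capPoint l δ f b 0).1 := hb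
    rw [t3, norm_zero] at hb
    norm_num at hb

/-- Radius t goes to axial coordinate δ(2t - 1) and the direction v is kept. The result depends on b
only through sgn b·(2t - 1), so it is the same for the other primary with 1 - t in place of t; this
is the gluing rule of the connected sum. -/
theorem uncap_capDisk (H : IsCapData μ l R C r₀ f δ c) (b : Primary) {τ : ℝ → ℝ}
    (h1 : ∀ s, -δ < s → τ (capShift δ s) = s) {v : E5} (hv : ‖v‖ = 1) {t : ℝ}
    (ht : t ∈ Ioo (0 : ℝ) 1) :
    phaseMap μ (shiftMap μ l δ f b (capEnergy μ l b c δ) (sideEnergy μ l b c) τ)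
      (capDisk μ l δ f b (t • v)) = (chart μ none).symm
        (neckPoint f (l - sgn b * (δ * (2 * t - 1)))
          (√(2 * (c - critEnergy μ (l - sgn b * (δ * (2 * t - 1))))) • v)) := by
  have hδ := H.width_pos
  have hn : ‖t • v‖ = t := by rw [norm_smul, hv, mul_one, Real.norm_of_nonneg ht.1.le]
  have hw : ‖t • v‖ < 1 := by rw [hn]; exact ht.2
  obtain ⟨k1, k2, k3, k4⟩ := H.capPoint_spec b hw
  rw [hn] at k3
  have hs : capShift δ (δ * (2 * t - 1)) = δ / 4 + δ / 3 * t ^ 2 := by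
    rw [capShift_of_le hδ (by nlinarith [ht.2])]
    field_simp
    ring
  have hτ : τ (δ / 4 + δ / 3 * t ^ 2) = δ * (2 * t - 1) := by
    rw [← hs, h1 _ (by nlinarith [ht.1])]
  have ht2 : t ^ 2 < 1 := pow_lt_one₀ ht.1.le ht.2 two_ne_zero
  have hlt : δ / 3 * t ^ 2 < δ / 3 := mul_lt_of_lt_one_right (by positivity) ht2
  have habs : |δ * (2 * t - 1)| < R := by
    refine lt_trans ?_ H.three_lt
    rw [abs_lt]
    constructor <;> nlinarith [ht.1, ht.2]
  have hE := H.sideEnergy_pos b habs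
  have e : shiftPoint μ l f b (capEnergy μ l b c δ) (sideEnergy μ l b c) τ
      (capPoint l δ f b (t • v)) = neckPoint f (l - sgn b * (δ * (2 * t - 1)))
          (√(2 * (c - critEnergy μ (l - sgn b * (δ * (2 * t - 1))))) • v) := by
    rw [shiftPoint, k3, k4, hτ, smul_smul, smul_smul, H.capEnergy_of_le (by linarith)]
    congr 2
    have hE' : c - critEnergy μ (l - sgn b * (δ * (2 * t - 1))) =
        sideEnergy μ l b c (δ * (2 * t - 1)) := rfl
    rw [hE']
    have hden : 4 * δ * (δ / 4 + δ / 3 * t ^ 2) - δ ^ 2 = 4 / 3 * δ ^ 2 * t ^ 2 := by ring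
    rw [hden]
    have ht0 := ht.1
    refine (pow_left_inj₀ (by positivity) (by positivity) two_ne_zero).1 ?_
    rw [mul_pow, mul_pow, mul_pow, Real.sq_sqrt (by positivity), Real.sq_sqrt (by positivity),
      Real.sq_sqrt (by positivity)]
    field_simp
    ring
  rw [H.capDisk_eq b hw]
  have hlt2 : side b l (capPoint l δ f b (t • v)).1 < 2 * δ := by rw [k3]; linarith
  have e2 : shiftMap μ l δ f b (capEnergy μ l b c δ) (sideEnergy μ l b c) τ
      (capPoint l δ f b (t • v)) = neckPoint f (l - sgn b * (δ * (2 * t - 1)))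
          (√(2 * (c - critEnergy μ (l - sgn b * (δ * (2 * t - 1))))) • v) := by
    rw [shiftMap, if_pos hlt2, e]
  have hmem : neckPoint f (l - sgn b * (δ * (2 * t - 1)))
      (√(2 * (c - critEnergy μ (l - sgn b * (δ * (2 * t - 1))))) • v) ∈ phaseSpace μ := by
    have hb := H.chart_bound b (s := δ * (2 * t - 1))
      (e := sideEnergy μ l b c (δ * (2 * t - 1)))
      (W := √(2 * (c - critEnergy μ (l - sgn b * (δ * (2 * t - 1))))) • v)
      (by rw [abs_le]; constructor <;> nlinarith [ht.1, ht.2]) (by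
        rw [norm_smul, hv, mul_one, Real.norm_of_nonneg (Real.sqrt_nonneg _)]
        exact Real.sq_sqrt (by
          have : 0 < c - critEnergy μ (l - sgn b * (δ * (2 * t - 1))) := hE
          linarith)) (H.energy_bound b (by
        rw [abs_lt]; constructor <;> nlinarith [ht.1, ht.2])).1
    exact H.toIsNeckChart.mem_phaseSpace H.lagrange (H.toIsNeckChart.neckPoint_spec hb).1
  rw [chart_none_symm hmem, phaseMap_phase _ (by rwa [e2])]
  congr 1

/-- The two uncapping maps have as images the parts of the hypersurface with axial coordinate
greater than -δ as seen from either primary. These cover it, and they intersect in the neck of axial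
width δ on both sides of L₁, which is the image of the punctured disk. -/
theorem isConnectedSum (H : IsCapData μ l R C r₀ f δ c) :
    IsConnectedSum 𝓘(ℝ, E3 × E3) 𝓘(ℝ, E3 × E3) 𝓘(ℝ, E3 × E3) 5
      (surf μ (capPot μ l .earth c δ) c (Metric.ball (pos μ .earth) (radius μ l .earth)))
      (surf μ (capPot μ l .moon c δ) c (Metric.ball (pos μ .moon) (radius μ l .moon)))
      (surf μ 0 c (neckDomain μ l δ)) := by
  have hδ := H.width_pos
  obtain ⟨τ, hσ, hτ, h1, h2⟩ := exists_capShift_inverse hδ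
  have hd := fun b => H.isDiffeoOn_uncap b hσ hτ h1 h2
  have himg : ∀ b, phaseMap μ (shiftMap μ l δ f b (capEnergy μ l b c δ) (sideEnergy μ l b c) τ) ''
      (surf μ (capPot μ l b c δ) c (Metric.ball (pos μ b) (radius μ l b)) \ {capDisk μ l δ f b 0}) =
      beyond (surf μ 0 c (neckDomain μ l δ)) l b (-δ) := by
    intro b
    rw [H.cap_diff_tip b, (hd b).1.image_eq]
  have hopen : ∀ b, IsOpenDiffeoInto 𝓘(ℝ, E3 × E3) 𝓘(ℝ, E3 × E3)
      (phaseMap μ (shiftMap μ l δ f b (capEnergy μ l b c δ) (sideEnergy μ l b c) τ))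
      (surf μ (capPot μ l b c δ) c (Metric.ball (pos μ b) (radius μ l b)) \ {capDisk μ l δ f b 0})
      (surf μ 0 c (neckDomain μ l δ)) := by
    intro b
    rw [H.cap_diff_tip b]
    exact ⟨_, isOpen_over (isOpen_lt continuous_const (continuous_side b l)), hd b⟩
  have hmoon : ∀ q, side .moon l q = -side .earth l q := fun q => side_other .earth l q
  refine ⟨capDisk μ l δ f .earth, capDisk μ l δ f .moon, _, _, H.isOpenDiffeoInto_capDisk .earth,
    H.isOpenDiffeoInto_capDisk .moon, hopen .earth, hopen .moon, ?_, ?_, ?_⟩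
  · rw [himg, himg]
    refine subset_antisymm (union_subset inter_subset_left inter_subset_left) ?_
    -- The two signed coordinates are opposite, so one of them is nonnegative.
    have key : ∀ q, q ∈ {q | -δ < side .earth l q} ∨ q ∈ {q | -δ < side .moon l q} := by
      intro q
      simp only [mem_ofPred_eq, hmoon]
      by_contra hcon
      rw [not_or, not_lt, not_lt] at hcon
      linarith [hcon.1, hcon.2]
    intro x hx
    rcases hx with ⟨z, hz, rfl, h⟩ | ⟨b', η, hη, rfl, h⟩
    · rcases key z.1 with hk | hk
      · exact Or.inl ⟨phase_mem_surf.2 h, phase_mem_over.2 hk⟩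
      · exact Or.inr ⟨phase_mem_surf.2 h, phase_mem_over.2 hk⟩
    · rcases key (pos μ b') with hk | hk
      · exact Or.inl ⟨collision_mem_surf.2 h, collision_mem_over.2 hk⟩
      · exact Or.inr ⟨collision_mem_surf.2 h, collision_mem_over.2 hk⟩
  · rw [himg, himg]
    set i := phaseMap μ (shiftMap μ l δ f .earth (capEnergy μ l .earth c δ)
      (sideEnergy μ l .earth c) τ) with hi
    have h0 : (0 : E5) ∈ Metric.ball (0 : E5) 1 := by simp
    apply subset_antisymm
    · rintro x ⟨⟨hxN, hxE⟩, -, hxM⟩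
      -- No collision lies in the overlap: a primary with coordinate greater than -δ as seen from
      -- both sides would have to be both of them.
      obtain ⟨z, hz, rfl, hsE, hsM⟩ : ∃ z hz, x = .phase z hz ∧ -δ < side .earth l z.1 ∧
          side .earth l z.1 < δ := by
        rcases hxE with ⟨z, hz, rfl, hsE⟩ | ⟨b', η, hη, rfl, hsE⟩
        · rw [phase_mem_over] at hxM
          have hxM : -δ < side .moon l z.1 := hxM
          rw [hmoon] at hxM
          exact ⟨z, hz, rfl, hsE, by linarith⟩
        · rw [collision_mem_over] at hxM
          have e1 := H.eq_of_lt_side (b := .earth) hsE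
          have e2 := H.eq_of_lt_side (b := .moon) hxM
          rw [e1] at e2
          cases e2
      obtain ⟨hzR, hW⟩ := (H.mem_neckLevel_iff (b := .earth) hz
        (by rw [abs_lt]; constructor <;> linarith)).1 hxN
      -- The inverse of t ↦ δ(2t - 1); the direction v below is the normalized transversal vector,
      -- which is nonzero because the available energy on the neck is positive.
      set t := (side .earth l z.1 / δ + 1) / 2 with ht
      have hst : δ * (2 * t - 1) = side .earth l z.1 := by rw [ht]; field_simp; ring
      have ht0 : 0 < t := by
        have : -1 < side .earth l z.1 / δ := by rw [lt_div_iff₀ hδ]; linarith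
        rw [ht]; linarith
      have ht1 : t < 1 := by
        have : side .earth l z.1 / δ < 1 := by rw [div_lt_one hδ]; linarith
        rw [ht]; linarith
      have hE := H.sideEnergy_pos .earth (s := side .earth l z.1)
        (by rw [abs_lt]; constructor <;> linarith [H.three_lt])
      have hn : 0 < ‖neckTrans μ z‖ := by
        refine lt_of_le_of_ne (norm_nonneg _) fun h => ?_
        rw [← h] at hW
        norm_num at hW
        linarith
      set v := ‖neckTrans μ z‖⁻¹ • neckTrans μ z with hv
      have hv1 : ‖v‖ = 1 := by
        rw [hv, norm_smul, norm_inv, norm_norm, inv_mul_cancel₀ hn.ne']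
      refine ⟨capDisk μ l δ f .earth (t • v), ⟨t • v, ⟨?_, ?_⟩, rfl⟩, ?_⟩
      · rw [mem_ball_zero_iff, norm_smul, hv1, mul_one, Real.norm_of_nonneg ht0.le]
        exact ht1
      · rw [mem_singleton_iff, smul_eq_zero, not_or]
        refine ⟨ht0.ne', fun h => ?_⟩
        rw [h, norm_zero] at hv1
        exact zero_ne_one hv1
      · rw [hi, H.uncap_capDisk .earth h1 hv1 ⟨ht0, ht1⟩, hst]
        have e1 : 2 * (c - critEnergy μ (l - sgn .earth * side .earth l z.1)) =
            ‖neckTrans μ z‖ ^ 2 := hW.symm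
        rw [e1, Real.sqrt_sq hn.le, hv, smul_smul, mul_inv_cancel₀ hn.ne', one_smul, ← eq_of_side,
          H.toIsNeckChart.neckPoint_neckTrans hzR, chart_none_symm hz]
    · rintro _ ⟨_, ⟨w, ⟨hw, hw0⟩, rfl⟩, rfl⟩
      have hwn : 0 < ‖w‖ := norm_pos_iff.2 hw0
      have hw1 : ‖w‖ < 1 := mem_ball_zero_iff.1 hw
      have hmem : i (capDisk μ l δ f .earth w) = phaseMap μ (shiftMap μ l δ f .moon
          (capEnergy μ l .moon c δ) (sideEnergy μ l .moon c) τ) (capDisk μ l δ f .moon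
            ((1 - ‖w‖) • ‖w‖⁻¹ • w)) := by
        have hv1 : ‖‖w‖⁻¹ • w‖ = 1 := by
          rw [norm_smul, norm_inv, norm_norm, inv_mul_cancel₀ hwn.ne']
        have hww : w = ‖w‖ • ‖w‖⁻¹ • w := by
          rw [smul_smul, mul_inv_cancel₀ hwn.ne', one_smul]
        have e := H.uncap_capDisk .earth h1 hv1 ⟨hwn, hw1⟩
        rw [← hww] at e
        rw [H.uncap_capDisk .moon h1 hv1 ⟨by linarith, by linarith⟩, hi, e]
        rw [show l - sgn .moon * (δ * (2 * (1 - ‖w‖) - 1)) =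
          l - sgn .earth * (δ * (2 * ‖w‖ - 1)) by simp [sgn]; ring]
      have hin : ∀ b, ∀ u : E5, u ∈ Metric.ball (0 : E5) 1 → u ≠ 0 →
          phaseMap μ (shiftMap μ l δ f b (capEnergy μ l b c δ) (sideEnergy μ l b c) τ)
            (capDisk μ l δ f b u) ∈ beyond (surf μ 0 c (neckDomain μ l δ)) l b (-δ) := by
        intro b u hu hu0
        rw [← himg b]
        obtain ⟨O, -, hD⟩ := H.isOpenDiffeoInto_capDisk b
        refine mem_image_of_mem _ ⟨(hD.1.mapsTo hu).1, fun h => hu0 (hD.1.injOn hu h0 h)⟩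
      refine ⟨?_, ?_⟩
      · exact hin .earth w hw hw0
      · rw [hmem]
        have hc : ‖(1 - ‖w‖) • ‖w‖⁻¹ • w‖ = 1 - ‖w‖ := by
          rw [norm_smul, norm_smul, norm_inv, norm_norm, inv_mul_cancel₀ hwn.ne', mul_one,
            Real.norm_of_nonneg (by linarith)]
        refine hin .moon _ ?_ ?_
        · rw [mem_ball_zero_iff, hc]; linarith
        · rw [← norm_pos_iff, hc]; linarith
  · intro v hv t ht
    rw [H.uncap_capDisk .earth h1 hv ht,
      H.uncap_capDisk .moon h1 hv ⟨by linarith [ht.2], by linarith [ht.1]⟩]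
    rw [show l - sgn .moon * (δ * (2 * (1 - t) - 1)) =
      l - sgn .earth * (δ * (2 * t - 1)) by simp [sgn]; ring]

end IsCapData

/-- Slightly above the critical energy, the regularized hypersurface around both primaries is a
connected sum of two unit cotangent bundles. -/
theorem exists_isConnectedSum {μ l : ℝ} (h : IsLagrangePos μ l) : ∃ ε > 0, ∀ c,
    critEnergy μ l < c → c < critEnergy μ l + ε →
      IsConnectedSum 𝓘(ℝ, R4 × R4) 𝓘(ℝ, R4 × R4) 𝓘(ℝ, E3 × E3) 5 unitCotangentSphere
        unitCotangentSphere (regularizedHypersurface μ c {pos μ .earth, pos μ .moon}) := by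
  obtain ⟨R, C, r₀, f, δ, ε₁, hε₁, hcap⟩ := exists_isCapData h
  -- The parameters R, C, δ do not depend on c, but their properties are packaged with a level; an
  -- auxiliary level in the window gives access to them.
  have H₀ := hcap (critEnergy μ l + ε₁ / 2) (by linarith) (by linarith)
  obtain ⟨ε₂, hε₂, hS⟩ := exists_regularizedHypersurface_eq H₀.toIsNeckRadius h H₀.width_pos
    (by linarith [H₀.three_lt, H₀.width_pos])
  refine ⟨min ε₁ ε₂, lt_min hε₁ hε₂, fun c hc hc' => ?_⟩
  have H := hcap c hc (hc'.trans_le (by gcongr; exact min_le_left _ _))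
  rw [hS c hc (hc'.trans_le (by gcongr; exact min_le_right _ _))]
  exact H.isConnectedSum.of_isDiffeoOn
    ((H.isStarLevel .earth).isDiffeoOn h.mem (h.radius_mem .earth).1)
    ((H.isStarLevel .moon).isDiffeoOn h.mem (h.radius_mem .moon).1)

end CRTBP

end

theorem theorem1p1 (μ : ℝ) (hμ : μ ∈ Set.Ioo (0 : ℝ) 1) (L₁ : CRTBP.E3 × CRTBP.E3)
    (hL₁ : CRTBP.IsFirstLagrangePoint μ L₁) :
    (∀ c < CRTBP.hamiltonian μ L₁,
      (CRTBP.IsContactType (CRTBP.regularizedHypersurface μ c {CRTBP.pos μ .earth}) ∧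
        CRTBP.AreDiffeomorphic 𝓘(ℝ, CRTBP.E3 × CRTBP.E3) 𝓘(ℝ, CRTBP.R4 × CRTBP.R4)
          (CRTBP.regularizedHypersurface μ c {CRTBP.pos μ .earth}) CRTBP.unitCotangentSphere) ∧
      (CRTBP.IsContactType (CRTBP.regularizedHypersurface μ c {CRTBP.pos μ .moon}) ∧
        CRTBP.AreDiffeomorphic 𝓘(ℝ, CRTBP.E3 × CRTBP.E3) 𝓘(ℝ, CRTBP.R4 × CRTBP.R4)
          (CRTBP.regularizedHypersurface μ c {CRTBP.pos μ .moon}) CRTBP.unitCotangentSphere)) ∧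
    ∃ ε > 0, ∀ c, CRTBP.hamiltonian μ L₁ < c → c < CRTBP.hamiltonian μ L₁ + ε →
      CRTBP.IsContactType
        (CRTBP.regularizedHypersurface μ c {CRTBP.pos μ .earth, CRTBP.pos μ .moon}) ∧
      CRTBP.IsConnectedSum 𝓘(ℝ, CRTBP.R4 × CRTBP.R4) 𝓘(ℝ, CRTBP.R4 × CRTBP.R4)
        𝓘(ℝ, CRTBP.E3 × CRTBP.E3) 5 CRTBP.unitCotangentSphere CRTBP.unitCotangentSphere
        (CRTBP.regularizedHypersurface μ c {CRTBP.pos μ .earth, CRTBP.pos μ .moon}) := by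
  obtain ⟨h, he⟩ := hL₁.isLagrangePos hμ
  rw [he]
  refine ⟨fun c hc => ⟨h.isContactType_and_areDiffeomorphic .earth hc,
    h.isContactType_and_areDiffeomorphic .moon hc⟩, ?_⟩
  obtain ⟨ε₁, hε₁, hcontact⟩ := CRTBP.exists_isContactType_neck h
  obtain ⟨ε₂, hε₂, hsum⟩ := CRTBP.exists_isConnectedSum h
  exact ⟨min ε₁ ε₂, lt_min hε₁ hε₂, fun c hc hc' =>
    ⟨hcontact c hc (hc'.trans_le (by gcongr; exact min_le_left _ _)),
      hsum c hc (hc'.trans_le (by gcongr; exact min_le_right _ _))⟩⟩
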